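/- **Setting.** Let $\Bbbk$ be a field, $q\in\Bbbk\setminus\{0,1\}$, $d(h)\in 1+h\Bbbk[[h]]$, $\mathsf q=q\,d(h)\in\Bbbk[[h]]$. Let $m,n\ge 0$ be integers, and let $\kappa,\epsilon,s$ be real numbers with $\kappa\ne 0$, $\epsilon>0$, $m\epsilon<|\kappa|$ and $|\kappa|+m\epsilon<s$. A composition $\mu=(\mu_1,\dots,\mu_n)$ of $m$ has $n$ parts, which may be $0$; $S_\mu\subset S_m$ is its Young subgroup. *Hecke side.* $\mathcal H_h$ is the affine Hecke algebra over $\Bbbk[[h]]$ with generators $X_1^{\pm1},\dots,X_m^{\pm1},T_1,\dots,T_{m-1}$ and relations: the $X_i^{\pm1}$ commute, $T_r^2=(\mathsf q-1)T_r+\mathsf q$, $T_rX_rT_r=\mathsf qX_{r+1}$, $T_rX_i=X_iT_r$ for $i\ne r,r+1$, $T_rT_{r+1}T_r=T_{r+1}T_rT_{r+1}$, $T_rT_t=T_tT_r$ for $|r-t|>1$. Put $\epsilon_\mu=\sum_{w\in S_\mu}T_w$ and $\epsilon_\mu^-=\sum_{w\in S_\mu}(-\mathsf q)^{-\ell(w)}T_w$.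 The affine $q$-Schur algebra is $\mathcal S_h(n,m)=\operatorname{End}_{\mathcal H_h}\big(\bigoplus_\mu\mathcal H_h\epsilon_\mu\big)$ and the signed one is $\mathcal S^-_h(n,m)=\operatorname{End}_{\mathcal H_h}\big(\bigoplus_\mu\mathcal H_h\epsilon^-_\mu\big)$, the sums being over all $n$-part compositions of $m$; endomorphisms of left modules are written on the right, so that $\phi$ is identified with the matrix $(\phi_{\mu\nu})$, where $\phi_{\mu\nu}\in \mathcal H_h\epsilon_\nu$ is the component of the image of $\epsilon_\mu$. Let $\mathcal P$ be the left $\mathcal H_h$-module generated by an element $\mathbb 1$ subject to the relations $T_r\mathbb 1=-\mathbb 1$. The polynomial representation of $\mathcal S_h(n,m)$ is $\mathcal P_{\mathcal S}=\bigoplus_\mu\epsilon_\mu\mathcal P$, on which $\phi$ acts by $(\epsilon_\nu p_\nu)_\nu\mapsto\big(\sum_\nu\phi_{\mu\nu}p_\nu\big)_\mu$. *Diagram side.* A type W diagram has $m$ strands in $\mathbb R\times[0,1]$, each projecting diffeomorphically to $[0,1]$ and carrying squares and inverse squares, and each accompanied by a dashed ghost $\kappa$ units to its right, without tangencies or triple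 points among strands and ghosts; diagrams are considered up to isotopies preserving these conditions, $ab$ is $a$ stacked on top of $b$ (and $0$ if the ends do not match), squares slide freely along strands except through crossings of two strands. For a collection $\mathscr B$ of configurations of $m$ points, $\mathscr W_{\mathscr B}$ is the $\Bbbk[[h]]$-span of the diagrams with both ends in $\mathscr B$ modulo the local relations: * if $D$ is the crossing of the $r$th and $(r+1)$st strands from the left and $X_i$ is a square on the $i$th strand, then $X_rD-DX_{r+1}=1=DX_r-X_{r+1}D$; a bigon of two strands is $0$; the two resolutions of a triple point of strands are equal; * a bigon between the strand $r$ and the ghost of the strand $t$ equals $X_r-\mathsf q X_t$; * for a strand $r$ lying between two ghosts which cross, (the diagram with $r$ passing to the left of the crossing) $=$ (the diagram with $r$ passing to the right) $-\,\mathsf q\,\cdot$(vertical strands); * for a ghost lying between two strands which cross, (the diagram with the ghost passing to the left of the crossing) $=$ (the diagram with the ghost passing to the right) $+$ (vertical strands). It acts on $P_{\mathscr B}=\bigoplus_{B\in\mathscr B}\Bbbk[[h]][Y_1^{\pm1},\dots,Y_m^{\pm1}]$: a crossing of the strands $r,r+1$ acts by $\partial_r F=\frac{F^{s_r}-F}{Y_{r+1}-Y_r}$,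 a square on the $r$th strand by $Y_r$, and a crossing of the strand $r$ with the ghost of the strand $t$ by $1$ if $\kappa<0$ and the strand is NE/SW or $\kappa>0$ and the strand is NW/SE, and by $Y_r-\mathsf q Y_t$ otherwise. Let $\mathscr C$ be the collection of the sets $C_\mu=\{i\epsilon+js\mid 1\le j\le n,\ 0\le i<\mu_j\}$. Let $e'_\mu\in\mathscr W_{\mathscr C}$ be the element with both ends at $C_\mu$ which on the $j$th cluster of strands is the nilHecke element $y_1^{k-1}y_2^{k-2}\cdots y_{k-1}\partial_{w_0}$ with $k=\mu_j$ ($y_i$ the square on the $i$th strand of the cluster, $\partial_{w_0}$ the product of crossings along a reduced expression of the longest element), and put $e'=\sum_\mu e'_\mu$. **Theorem.** The element $e'$ is an idempotent. 1. If $\kappa<0$, there is an isomorphism of $\Bbbk[[h]]$-algebras $\Phi: e'\mathscr W_{\mathscr C}e'\cong\mathcal S_h(n,m)$ and an isomorphism of $\Bbbk[[h]]$-modules $\Psi: e'P_{\mathscr C}\cong\mathcal P_{\mathcal S}$ with $\Psi(uv)=\Phi(u)\Psi(v)$ for all $u\in e'\mathscr W_{\mathscr C}e'$ and $v\in e'P_{\mathscr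 C}$. 2. If $\kappa>0$, there is an isomorphism of $\Bbbk[[h]]$-algebras $e'\mathscr W_{\mathscr C}e'\cong\mathcal S^-_h(n,m)$. -/

import Mathlib

open scoped PowerSeries

set_option linter.unusedSectionVars false
set_option linter.unusedSimpArgs false
set_option linter.unusedVariables false

noncomputable section

namespace WAHA

/-! ### Laurent polynomials and Demazure operators -/

/-- Positions `r` such that both the `r`-th and the `(r+1)`-st of `m` strands exist
(counted from `0`); these index the simple reflections of `S_m`. -/
abbrev Adj (m : ℕ) : Type := {r : ℕ // r + 1 < m}

/-- The left one of the two strands of an adjacent pair. -/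
def Adj.lo {m : ℕ} (a : Adj m) : Fin m := ⟨a.1, Nat.lt_of_succ_lt a.2⟩

/-- The right one of the two strands of an adjacent pair. -/
def Adj.hi {m : ℕ} (a : Adj m) : Fin m := ⟨a.1 + 1, a.2⟩

/-- The simple reflection exchanging the two strands of an adjacent pair. -/
def Adj.refl {m : ℕ} (a : Adj m) : Equiv.Perm (Fin m) := Equiv.swap a.lo a.hi

/-- The Laurent polynomial ring `R[Y₁^{±1}, …, Y_m^{±1}]`. -/
abbrev Laurent (R : Type*) [CommRing R] (m : ℕ) : Type _ := AddMonoidAlgebra R (Fin m → ℤ)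

section Laurent

variable {R : Type*} [CommRing R] {m : ℕ}

/-- The variable `Y_i`. -/
def Y (R : Type*) [CommRing R] {m : ℕ} (i : Fin m) : Laurent R m :=
  AddMonoidAlgebra.single (Pi.single i 1) 1

/-- The inverse variable `Y_i⁻¹`. -/
def Yinv (R : Type*) [CommRing R] {m : ℕ} (i : Fin m) : Laurent R m :=
  AddMonoidAlgebra.single (Pi.single i (-1)) 1

/-- The algebra automorphism `F ↦ F^w` with `Y_i ↦ Y_{w i}`. -/
def permVars (w : Equiv.Perm (Fin m)) : Laurent R m →ₐ[R] Laurent R m :=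
  AddMonoidAlgebra.mapDomainAlgHom R R
    (LinearMap.funLeft ℤ ℤ (w.symm : Fin m → Fin m)).toAddMonoidHom

theorem permVars_single (w : Equiv.Perm (Fin m)) (a : Fin m → ℤ) (c : R) :
    permVars w (AddMonoidAlgebra.single a c : Laurent R m) =
      AddMonoidAlgebra.single (a ∘ w.symm) c := by
  simp [permVars, AddMonoidAlgebra.mapDomainAlgHom]
  rfl

theorem permVars_Y (w : Equiv.Perm (Fin m)) (i : Fin m) :
    permVars w (Y R i) = Y R (w i) := by
  rw [Y, permVars_single, Y]
  congr 1
  funext j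
  simp [Pi.single_apply, Equiv.symm_apply_eq]

theorem permVars_comp (v w : Equiv.Perm (Fin m)) (F : Laurent R m) :
    permVars v (permVars w F) = permVars (v * w) F := by
  have : (permVars v).comp (permVars w) = (permVars (v * w) : Laurent R m →ₐ[R] Laurent R m) := by
    refine AddMonoidAlgebra.algHom_ext (fun a => ?_) (by ext)
    simp [permVars_single, Function.comp_assoc]
    rfl
  exact DFunLike.congr_fun this F

theorem Y_mul_Yinv (i : Fin m) : Y R i * Yinv R i = 1 := by
  rw [Y, Yinv, AddMonoidAlgebra.single_mul_single, ← Pi.single_add]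
  simp [AddMonoidAlgebra.one_def]

theorem Yinv_mul_Y (i : Fin m) : Yinv R i * Y R i = 1 := by
  rw [mul_comm, Y_mul_Yinv]

theorem Y_sub_Y_ne_zero [Nontrivial R] {i j : Fin m} (h : i ≠ j) : Y R i - Y R j ≠ 0 := by
  rw [sub_ne_zero, Y, Y]
  intro e
  have := AddMonoidAlgebra.single_left_injective (one_ne_zero (α := R)) e
  have h1 := congrFun this i
  simp [h] at h1

theorem dvd_mul_of {δ F F' G G' : Laurent R m} (hF : δ ∣ F' - F) (hG : δ ∣ G' - G) :
    δ ∣ F' * G' - F * G := by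
  have : F' * G' - F * G = F' * (G' - G) + (F' - F) * G := by ring
  rw [this]
  exact dvd_add (hG.mul_left _) (hF.mul_right _)

theorem demazure_dvd (a : Adj m) (F : Laurent R m) :
    (Y R a.hi - Y R a.lo) ∣ permVars a.refl F - F := by
  have hY (i : Fin m) : (Y R a.hi - Y R a.lo) ∣ permVars a.refl (Y R i) - Y R i := by
    rw [permVars_Y]
    by_cases h1 : i = a.lo
    · subst h1; simp [Adj.refl]
    by_cases h2 : i = a.hi
    · subst h2
      rw [Adj.refl, Equiv.swap_apply_right]
      exact ⟨-1, by ring⟩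
    · rw [Adj.refl, Equiv.swap_apply_of_ne_of_ne h1 h2, sub_self]; exact dvd_zero _
  have hYi (i : Fin m) : (Y R a.hi - Y R a.lo) ∣ permVars a.refl (Yinv R i) - Yinv R i := by
    have e : permVars a.refl (Yinv R i) - Yinv R i =
        -(permVars a.refl (Yinv R i) * Yinv R i) * (permVars a.refl (Y R i) - Y R i) := by
      have h1 : permVars a.refl (Yinv R i) * permVars a.refl (Y R i) = 1 := by
        rw [← map_mul, Yinv_mul_Y, map_one]
      have h2 := Yinv_mul_Y (R := R) i
      linear_combination (Yinv R i) * h1 - permVars a.refl (Yinv R i) * h2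
    rw [e]
    exact (hY i).mul_left _
  have hpow {G : Laurent R m} (hG : (Y R a.hi - Y R a.lo) ∣ permVars a.refl G - G) (k : ℕ) :
      (Y R a.hi - Y R a.lo) ∣ permVars a.refl (G ^ k) - G ^ k := by
    induction k with
    | zero => simp
    | succ k ih => rw [pow_succ, map_mul]; exact dvd_mul_of ih hG
  have hz (i : Fin m) (z : ℤ) : (Y R a.hi - Y R a.lo) ∣
      permVars a.refl (AddMonoidAlgebra.single (Pi.single i z) 1 : Laurent R m) -
        AddMonoidAlgebra.single (Pi.single i z) 1 := by
    obtain ⟨k, rfl | rfl⟩ := z.eq_nat_or_neg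
    · have : (AddMonoidAlgebra.single (Pi.single i (k : ℤ)) 1 : Laurent R m) = Y R i ^ k := by
        rw [Y, AddMonoidAlgebra.single_pow, ← Pi.single_smul]; simp
      rw [this]; exact hpow (hY i) k
    · have : (AddMonoidAlgebra.single (Pi.single i (-(k : ℤ))) 1 : Laurent R m) =
          Yinv R i ^ k := by
        rw [Yinv, AddMonoidAlgebra.single_pow, ← Pi.single_smul]; simp
      rw [this]; exact hpow (hYi i) k
  have hprod (b : Fin m → ℤ) (s : Finset (Fin m)) : (Y R a.hi - Y R a.lo) ∣
      permVars a.refl (∏ i ∈ s, AddMonoidAlgebra.single (Pi.single i (b i)) 1 : Laurent R m) -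
        ∏ i ∈ s, AddMonoidAlgebra.single (Pi.single i (b i)) 1 := by
    classical
    induction s using Finset.induction_on with
    | empty => simp
    | insert i s hi ih =>
      rw [Finset.prod_insert hi, map_mul]
      exact dvd_mul_of (hz i (b i)) ih
  refine AddMonoidAlgebra.induction_on
    (motive := fun F => (Y R a.hi - Y R a.lo) ∣ permVars a.refl F - F) F (fun b => ?_) (fun F G hF hG => ?_) (fun c F hF => ?_)
  · have e : (AddMonoidAlgebra.of R (Fin m → ℤ)) (Multiplicative.ofAdd b) =
        ∏ i, AddMonoidAlgebra.single (Pi.single i (b i)) 1 := by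
      rw [AddMonoidAlgebra.prod_single, Finset.univ_sum_single]
      simp
    rw [e]; exact hprod b _
  · rw [map_add, add_sub_add_comm]; exact dvd_add hF hG
  · rw [map_smul, ← smul_sub]
    exact hF.trans ⟨algebraMap R _ c, by rw [Algebra.smul_def, mul_comm]⟩

variable [IsDomain R]

theorem Adj.hi_ne_lo (a : Adj m) : a.hi ≠ a.lo := by
  simp [Adj.hi, Adj.lo]

/-- The Demazure operator `∂_r F = (F^{s_r} - F) / (Y_{r+1} - Y_r)`. -/
def demazure (R : Type*) [CommRing R] [IsDomain R] {m : ℕ} (a : Adj m) :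
    Laurent R m →ₗ[R] Laurent R m where
  toFun F := (demazure_dvd a F).choose
  map_add' F G := by
    apply mul_left_cancel₀ (Y_sub_Y_ne_zero (R := R) a.hi_ne_lo)
    rw [mul_add, ← (demazure_dvd a _).choose_spec, ← (demazure_dvd a _).choose_spec,
      ← (demazure_dvd a _).choose_spec, map_add]
    ring
  map_smul' c F := by
    apply mul_left_cancel₀ (Y_sub_Y_ne_zero (R := R) a.hi_ne_lo)
    rw [RingHom.id_apply, mul_smul_comm, ← (demazure_dvd a _).choose_spec,
      ← (demazure_dvd a _).choose_spec, map_smul, smul_sub]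

theorem demazure_spec (a : Adj m) (F : Laurent R m) :
    (Y R a.hi - Y R a.lo) * demazure R a F = permVars a.refl F - F :=
  (demazure_dvd a F).choose_spec.symm

theorem lo_ne_hi (a : Adj m) : a.lo ≠ a.hi := a.hi_ne_lo.symm

theorem demazure_mul (a : Adj m) (G F : Laurent R m) :
    demazure R a (G * F) = permVars a.refl G * demazure R a F + demazure R a G * F := by
  apply mul_left_cancel₀ (Y_sub_Y_ne_zero (R := R) a.hi_ne_lo)
  have h1 := demazure_spec a (G * F)
  have h2 := demazure_spec a F
  have h3 := demazure_spec a G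
  rw [map_mul (permVars a.refl)] at h1
  linear_combination h1 - permVars a.refl G * h2 - F * h3

theorem demazure_Y_lo (a : Adj m) : demazure R a (Y R a.lo) = 1 := by
  apply mul_left_cancel₀ (Y_sub_Y_ne_zero (R := R) a.hi_ne_lo)
  rw [demazure_spec, permVars_Y]
  simp [Adj.refl]

theorem demazure_Y_hi (a : Adj m) : demazure R a (Y R a.hi) = -1 := by
  apply mul_left_cancel₀ (Y_sub_Y_ne_zero (R := R) a.hi_ne_lo)
  rw [demazure_spec, permVars_Y, Adj.refl, Equiv.swap_apply_right]
  ring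

theorem demazure_Y_of_ne (a : Adj m) {i : Fin m} (h1 : i ≠ a.lo) (h2 : i ≠ a.hi) :
    demazure R a (Y R i) = 0 := by
  apply mul_left_cancel₀ (Y_sub_Y_ne_zero (R := R) a.hi_ne_lo)
  rw [demazure_spec, permVars_Y, Adj.refl, Equiv.swap_apply_of_ne_of_ne h1 h2]
  ring

theorem permVars_demazure (a : Adj m) (F : Laurent R m) :
    permVars a.refl (demazure R a F) = demazure R a F := by
  apply mul_left_cancel₀ (Y_sub_Y_ne_zero (R := R) a.hi_ne_lo)
  have h1 := demazure_spec a F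
  have h2 := congrArg (permVars a.refl) h1
  rw [map_mul, map_sub, permVars_Y, permVars_Y, map_sub, permVars_comp] at h2
  simp only [Adj.refl, Equiv.swap_apply_left, Equiv.swap_apply_right, Equiv.swap_mul_self] at h2 h1 ⊢
  have h3 : permVars (1 : Equiv.Perm (Fin m)) F = F := by
    have : (permVars 1 : Laurent R m →ₐ[R] Laurent R m) = AlgHom.id R _ := by
      refine AddMonoidAlgebra.algHom_ext (fun b => ?_) (by ext)
      rw [permVars_single]; rfl
    rw [this]; rfl
  rw [h3] at h2
  linear_combination -h1 - h2

theorem demazure_demazure (a : Adj m) (F : Laurent R m) :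
    demazure R a (demazure R a F) = 0 := by
  apply mul_left_cancel₀ (Y_sub_Y_ne_zero (R := R) a.hi_ne_lo)
  rw [demazure_spec, permVars_demazure]
  ring

theorem refl_lo (a : Adj m) : a.refl a.lo = a.hi := Equiv.swap_apply_left _ _

theorem refl_hi (a : Adj m) : a.refl a.hi = a.lo := Equiv.swap_apply_right _ _

theorem refl_of_ne (a : Adj m) {i : Fin m} (h1 : i ≠ a.lo) (h2 : i ≠ a.hi) : a.refl i = i :=
  Equiv.swap_apply_of_ne_of_ne h1 h2

theorem demazure_comm (a b : Adj m) (h : a.1 + 1 < b.1) (F : Laurent R m) :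
    demazure R a (demazure R b F) = demazure R b (demazure R a F) := by
  have n1 : b.hi ≠ a.lo := by simp only [Adj.hi, Adj.lo, ne_eq, Fin.mk.injEq]; omega
  have n2 : b.hi ≠ a.hi := by simp only [Adj.hi, ne_eq, Fin.mk.injEq]; omega
  have n3 : b.lo ≠ a.lo := by simp only [Adj.lo, ne_eq, Fin.mk.injEq]; omega
  have n4 : b.lo ≠ a.hi := by simp only [Adj.hi, Adj.lo, ne_eq, Fin.mk.injEq]; omega
  apply mul_left_cancel₀ (Y_sub_Y_ne_zero (R := R) a.hi_ne_lo)
  apply mul_left_cancel₀ (Y_sub_Y_ne_zero (R := R) b.hi_ne_lo)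
  have hab : permVars a.refl (permVars b.refl F) = permVars b.refl (permVars a.refl F) := by
    rw [permVars_comp, permVars_comp]
    have : a.refl * b.refl = b.refl * a.refl := by
      refine (Equiv.Perm.Disjoint.commute ?_).eq
      intro i
      by_cases h1 : i = a.lo
      · right; subst h1; exact refl_of_ne b n3.symm n1.symm
      by_cases h2 : i = a.hi
      · right; subst h2; exact refl_of_ne b n4.symm n2.symm
      · left; exact refl_of_ne a h1 h2
    rw [this]
  have e1 := demazure_spec a (demazure R b F)
  have e2 := demazure_spec b F
  have e3 := demazure_spec b (demazure R a F)
  have e4 := demazure_spec a F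
  have e5 := congrArg (permVars a.refl) e2
  have e6 := congrArg (permVars b.refl) e4
  simp only [map_mul (permVars _), map_sub, permVars_Y, refl_of_ne a n1 n2, refl_of_ne a n3 n4,
    refl_of_ne b n3.symm n1.symm, refl_of_ne b n4.symm n2.symm]
    at e5 e6
  linear_combination (Y R b.hi - Y R b.lo) * e1 + e5 - e2 - (Y R a.hi - Y R a.lo) * e3
    - e6 + e4 + hab

theorem demazure_braid (a b : Adj m) (h : b.1 = a.1 + 1) (F : Laurent R m) :
    demazure R a (demazure R b (demazure R a F)) =
      demazure R b (demazure R a (demazure R b F)) := by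
  have hm : b.lo = a.hi := by simp only [Adj.hi, Adj.lo, Fin.mk.injEq]; omega
  have n1 : b.hi ≠ a.lo := by simp only [Adj.hi, Adj.lo, ne_eq, Fin.mk.injEq]; omega
  have n2 : b.hi ≠ a.hi := by simp only [Adj.hi, ne_eq, Fin.mk.injEq]; omega
  have n3 := a.hi_ne_lo
  have r1 : a.refl a.hi = a.lo := refl_hi a
  have r2 : a.refl a.lo = a.hi := refl_lo a
  have r3 : a.refl b.hi = b.hi := refl_of_ne a n1 n2
  have r4 : b.refl a.hi = b.hi := by rw [← hm]; exact refl_lo b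
  have r5 : b.refl b.hi = a.hi := by rw [← hm]; exact refl_hi b
  have r6 : b.refl a.lo = a.lo := refl_of_ne b (by rw [hm]; exact n3.symm) n1.symm
  have perm : a.refl * (b.refl * a.refl) = b.refl * (a.refl * b.refl) := by
    ext i
    by_cases h1 : i = a.lo
    · subst h1; simp [r1, r2, r3, r4, r5, r6]
    by_cases h2 : i = a.hi
    · subst h2; simp [r1, r2, r3, r4, r5, r6]
    by_cases h3 : i = b.hi
    · subst h3; simp [r1, r2, r3, r4, r5, r6]
    have q1 := refl_of_ne a h1 h2
    have q2 := refl_of_ne b (by rw [hm]; exact h2) h3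
    simp [q1, q2]
  have sss : permVars a.refl (permVars b.refl (permVars a.refl F)) =
      permVars b.refl (permVars a.refl (permVars b.refl F)) := by
    simp only [permVars_comp]
    rw [perm]
  have invol (c : Adj m) (G : Laurent R m) : permVars c.refl (permVars c.refl G) = G := by
    have h1 := demazure_spec c G
    have h2 := demazure_spec c (permVars c.refl G)
    have h3 := congrArg (permVars c.refl) h1
    rw [map_mul, map_sub, map_sub, permVars_Y, permVars_Y, refl_hi, refl_lo,
      permVars_demazure] at h3
    linear_combination -h1 - h3
  have spec (c : Adj m) (G : Laurent R m) := demazure_spec (R := R) c G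
  have z1 : Y R a.hi - Y R a.lo ≠ 0 := Y_sub_Y_ne_zero n3
  have z2 : Y R b.hi - Y R a.hi ≠ 0 := Y_sub_Y_ne_zero n2
  have z3 : Y R b.hi - Y R a.lo ≠ 0 := Y_sub_Y_ne_zero n1
  have a1 := spec a F
  have a2 := spec b (demazure R a F)
  have a3 := spec a (demazure R b (demazure R a F))
  have a4 := congrArg (permVars b.refl) a1
  simp only [map_mul (permVars _), map_sub, permVars_Y, hm, r1, r2, r3, r4, r5, r6] at a1 a2 a3 a4
  have K : (Y R b.hi - Y R a.hi) * (Y R b.hi - Y R a.lo) * (Y R a.hi - Y R a.lo) *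
      demazure R b (demazure R a F) =
      (Y R a.hi - Y R a.lo) * (permVars b.refl (permVars a.refl F) - permVars b.refl F) -
      (Y R b.hi - Y R a.lo) * (permVars a.refl F - F) := by
    linear_combination (Y R b.hi - Y R a.lo) * (Y R a.hi - Y R a.lo) * a2 +
      (Y R a.hi - Y R a.lo) * a4 - (Y R b.hi - Y R a.lo) * a1
  have sK := congrArg (permVars a.refl) K
  have b1 := spec b F
  have b2 := spec a (demazure R b F)
  have b3 := spec b (demazure R a (demazure R b F))
  have b4 := congrArg (permVars a.refl) b1
  simp only [map_mul (permVars _), map_sub, permVars_Y, hm, r1, r2, r3, r4, r5, r6] at b1 b2 b3 b4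
  have K' : (Y R b.hi - Y R a.hi) * (Y R b.hi - Y R a.lo) * (Y R a.hi - Y R a.lo) *
      demazure R a (demazure R b F) =
      (Y R b.hi - Y R a.hi) * (permVars a.refl (permVars b.refl F) - permVars a.refl F) -
      (Y R b.hi - Y R a.lo) * (permVars b.refl F - F) := by
    linear_combination (Y R b.hi - Y R a.lo) * (Y R b.hi - Y R a.hi) * b2 +
      (Y R b.hi - Y R a.hi) * b4 - (Y R b.hi - Y R a.lo) * b1
  have tK := congrArg (permVars b.refl) K'
  simp only [map_mul (permVars _), map_sub, permVars_Y, r1, r2, r3, r4, r5, r6, invol] at sK tK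
  apply mul_left_cancel₀ z1
  apply mul_left_cancel₀ z1
  apply mul_left_cancel₀ z2
  apply mul_left_cancel₀ z2
  apply mul_left_cancel₀ z3
  linear_combination
    (Y R b.hi - Y R a.hi) * ((Y R b.hi - Y R a.hi) * (Y R b.hi - Y R a.lo) *
      (Y R a.hi - Y R a.lo) * a3 - sK - K) -
    (Y R a.hi - Y R a.lo) * ((Y R b.hi - Y R a.hi) * (Y R b.hi - Y R a.lo) *
      (Y R a.hi - Y R a.lo) * b3 - tK - K') +
    (Y R b.hi - Y R a.hi) * (Y R a.hi - Y R a.lo) * sss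

end Laurent

/-! ### Type W diagrams

A generic diagram is cut by horizontal lines into thin slices.  At each cut the strands sit at a
generic configuration of `m` real points, each strand being accompanied by its ghost `κ` units to
the right.  A slice is a straight-line motion of strands (and hence ghosts) from one generic
configuration to another during which at most one crossing occurs, or it carries one square. -/

/-- A generic configuration of `m` strands on a horizontal line: the strands are at distinct
positions, listed from left to right, and no strand meets a ghost. -/
@[ext] structure Config (κ : ℝ) (m : ℕ) where
  /-- The position of the `i`-th strand from the left. -/
  pos : Fin m → ℝ
  strictMono : StrictMono pos
  generic : ∀ i j, pos i ≠ pos j + κ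

section Diagrams

variable {κ : ℝ} {m : ℕ}

/-- The `i`-th strand is to the left of the ghost of the `j`-th strand. -/
def Side (x : Config κ m) (i j : Fin m) : Prop := x.pos i < x.pos j + κ

/-- The straight-line motion from `x` to `y` keeping the order of the strands has no crossings of
strands or of strands with ghosts. -/
def IsMove (x y : Config κ m) : Prop := ∀ i j, Side x i j ↔ Side y i j

/-- The straight-line motion from `x` to `y` exchanging the adjacent strands `a` (and keeping
the order of all other strands) has no crossing of a strand with a ghost. -/
def IsCross (a : Adj m) (x y : Config κ m) : Prop :=
  ∀ i j, Side x i j ↔ Side y (a.refl i) (a.refl j)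

/-- In the straight-line motion from `x` to `y` keeping the order of the strands, the strand `r`
crosses the ghost of the strand `t`, and there are no other crossings of strands with ghosts. -/
def IsGhost (r t : Fin m) (x y : Config κ m) : Prop :=
  ∀ i j, (Side x i j ↔ Side y i j) ↔ ¬ (i = r ∧ j = t)

variable (κ m) in
/-- Elementary slices of type W diagrams, with bottom `x` and top `y`. -/
inductive Slice : Type
  /-- a slice without crossings and squares -/
  | move (x y : Config κ m) (h : IsMove x y)
  /-- vertical strands, with a square on the `i`-th strand -/
  | sq (x : Config κ m) (i : Fin m)
  /-- vertical strands, with an inverse square on the `i`-th strand -/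
  | sqInv (x : Config κ m) (i : Fin m)
  /-- a crossing of two adjacent strands -/
  | cross (a : Adj m) (x y : Config κ m) (h : IsCross a x y)
  /-- a crossing of the strand `r` with the ghost of the strand `t` -/
  | ghost (r t : Fin m) (x y : Config κ m) (h : IsGhost r t x y)

/-- The configuration at the bottom of a slice. -/
def Slice.bot : Slice κ m → Config κ m
  | move x _ _ => x
  | sq x _ => x
  | sqInv x _ => x
  | cross _ x _ _ => x
  | ghost _ _ x _ _ => x

/-- The configuration at the top of a slice. -/
def Slice.top : Slice κ m → Config κ m
  | move _ y _ => y
  | sq x _ => x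
  | sqInv x _ => x
  | cross _ _ y _ => y
  | ghost _ _ _ y _ => y

end Diagrams

section Relations

variable (R : Type*) [CommRing R] {κ : ℝ} {m : ℕ}

/-- The free algebra on slices; the product `a * b` is `a` placed on top of `b`. -/
abbrev FreeDiag (κ : ℝ) (m : ℕ) : Type _ := FreeAlgebra R (Slice κ m)

/-- The slice without crossings and squares, in the free algebra. -/
abbrev fMove (x y : Config κ m) (h : IsMove x y) : FreeDiag R κ m :=
  FreeAlgebra.ι R (Slice.move x y h)

/-- The diagram of vertical strands at `x`. -/
abbrev fId (x : Config κ m) : FreeDiag R κ m := fMove R x x fun _ _ => Iff.rfl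

/-- A square, in the free algebra. -/
abbrev fSq (x : Config κ m) (i : Fin m) : FreeDiag R κ m := FreeAlgebra.ι R (Slice.sq x i)

/-- An inverse square, in the free algebra. -/
abbrev fSqInv (x : Config κ m) (i : Fin m) : FreeDiag R κ m := FreeAlgebra.ι R (Slice.sqInv x i)

/-- A crossing of strands, in the free algebra. -/
abbrev fCross (a : Adj m) (x y : Config κ m) (h : IsCross a x y) : FreeDiag R κ m :=
  FreeAlgebra.ι R (Slice.cross a x y h)

/-- A crossing of a strand and a ghost, in the free algebra. -/
abbrev fGhost (r t : Fin m) (x y : Config κ m) (h : IsGhost r t x y) : FreeDiag R κ m :=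
  FreeAlgebra.ι R (Slice.ghost r t x y h)

/-- The relations among diagrams: first those expressing stacking and isotopy, then the
local relations of the type W affine Hecke algebra. -/
inductive Rel (q : R) : FreeDiag R κ m → FreeDiag R κ m → Prop
  /- stacking: slices with non-matching ends multiply to zero -/
  | id_id (x y : Config κ m) (h : x ≠ y) : Rel q (fId R x * fId R y) 0
  | id_slice (g : Slice κ m) : Rel q (fId R g.top * FreeAlgebra.ι R g) (FreeAlgebra.ι R g)
  | slice_id (g : Slice κ m) : Rel q (FreeAlgebra.ι R g * fId R g.bot) (FreeAlgebra.ι R g)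
  /- isotopy: motions without crossings can be absorbed -/
  | move_move (x y z : Config κ m) (h₁ : IsMove x y) (h₂ : IsMove y z) (h : IsMove x z) :
      Rel q (fMove R y z h₂ * fMove R x y h₁) (fMove R x z h)
  | move_cross (a : Adj m) (x y z : Config κ m) (h₁ : IsCross a x y) (h₂ : IsMove y z)
      (h : IsCross a x z) : Rel q (fMove R y z h₂ * fCross R a x y h₁) (fCross R a x z h)
  | cross_move (a : Adj m) (x y z : Config κ m) (h₁ : IsMove x y) (h₂ : IsCross a y z)
      (h : IsCross a x z) : Rel q (fCross R a y z h₂ * fMove R x y h₁) (fCross R a x z h)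
  | move_ghost (r t : Fin m) (x y z : Config κ m) (h₁ : IsGhost r t x y) (h₂ : IsMove y z)
      (h : IsGhost r t x z) : Rel q (fMove R y z h₂ * fGhost R r t x y h₁) (fGhost R r t x z h)
  | ghost_move (r t : Fin m) (x y z : Config κ m) (h₁ : IsMove x y) (h₂ : IsGhost r t y z)
      (h : IsGhost r t x z) : Rel q (fGhost R r t y z h₂ * fMove R x y h₁) (fGhost R r t x z h)
  /- isotopy: crossings which do not form a triple point can be passed by each other -/
  | cross_cross (a b : Adj m) (hab : a.1 + 1 < b.1) (x y y' z : Config κ m)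
      (h₁ : IsCross b x y) (h₂ : IsCross a y z) (h₁' : IsCross a x y') (h₂' : IsCross b y' z) :
      Rel q (fCross R a y z h₂ * fCross R b x y h₁) (fCross R b y' z h₂' * fCross R a x y' h₁')
  | cross_ghost (a : Adj m) (r t : Fin m) (x y y' z : Config κ m)
      (h₁ : IsCross a x y) (h₂ : IsGhost r t y z)
      (h₁' : IsGhost (a.refl r) (a.refl t) x y') (h₂' : IsCross a y' z) :
      Rel q (fGhost R r t y z h₂ * fCross R a x y h₁)
        (fCross R a y' z h₂' * fGhost R (a.refl r) (a.refl t) x y' h₁')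
  | ghost_ghost (r t r' t' : Fin m) (hne : ¬ (r = r' ∧ t = t')) (x y y' z : Config κ m)
      (h₁ : IsGhost r t x y) (h₂ : IsGhost r' t' y z)
      (h₁' : IsGhost r' t' x y') (h₂' : IsGhost r t y' z) :
      Rel q (fGhost R r' t' y z h₂ * fGhost R r t x y h₁)
        (fGhost R r t y' z h₂' * fGhost R r' t' x y' h₁')
  /- squares: they are invertible, and slide freely along strands and through ghosts -/
  | sq_sqInv (x : Config κ m) (i : Fin m) : Rel q (fSq R x i * fSqInv R x i) (fId R x)
  | sqInv_sq (x : Config κ m) (i : Fin m) : Rel q (fSqInv R x i * fSq R x i) (fId R x)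
  | sq_sq (x : Config κ m) (i j : Fin m) :
      Rel q (fSq R x i * fSq R x j) (fSq R x j * fSq R x i)
  | move_sq (x y : Config κ m) (h : IsMove x y) (i : Fin m) :
      Rel q (fMove R x y h * fSq R x i) (fSq R y i * fMove R x y h)
  | ghost_sq (r t : Fin m) (x y : Config κ m) (h : IsGhost r t x y) (i : Fin m) :
      Rel q (fGhost R r t x y h * fSq R x i) (fSq R y i * fGhost R r t x y h)
  | cross_sq (a : Adj m) (x y : Config κ m) (h : IsCross a x y) (i : Fin m)
      (hlo : i ≠ a.lo) (hhi : i ≠ a.hi) :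
      Rel q (fCross R a x y h * fSq R x i) (fSq R y i * fCross R a x y h)
  /- squares and crossings of strands -/
  | nil_lo (a : Adj m) (x y : Config κ m) (h : IsCross a x y) (h' : IsMove x y) :
      Rel q (fSq R y a.lo * fCross R a x y h - fCross R a x y h * fSq R x a.hi) (fMove R x y h')
  | nil_hi (a : Adj m) (x y : Config κ m) (h : IsCross a x y) (h' : IsMove x y) :
      Rel q (fCross R a x y h * fSq R x a.lo - fSq R y a.hi * fCross R a x y h) (fMove R x y h')
  /- bigons and triple points of strands -/
  | bigon (a : Adj m) (x y z : Config κ m) (h₁ : IsCross a x y) (h₂ : IsCross a y z) :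
      Rel q (fCross R a y z h₂ * fCross R a x y h₁) 0
  | braid (a b : Adj m) (hab : b.1 = a.1 + 1) (x y₁ y₂ z y₁' y₂' : Config κ m)
      (h₁ : IsCross a x y₁) (h₂ : IsCross b y₁ y₂) (h₃ : IsCross a y₂ z)
      (h₁' : IsCross b x y₁') (h₂' : IsCross a y₁' y₂') (h₃' : IsCross b y₂' z) :
      Rel q (fCross R a y₂ z h₃ * fCross R b y₁ y₂ h₂ * fCross R a x y₁ h₁)
        (fCross R b y₂' z h₃' * fCross R a y₁' y₂' h₂' * fCross R b x y₁' h₁')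
  /- a bigon of a strand and a ghost -/
  | ghost_bigon (r t : Fin m) (x y z : Config κ m) (h₁ : IsGhost r t x y) (h₂ : IsGhost r t y z)
      (h : IsMove x z) :
      Rel q (fGhost R r t y z h₂ * fGhost R r t x y h₁)
        ((fSq R z r - q • fSq R z t) * fMove R x z h)
  /- a strand `r` and the crossing of the ghosts of two adjacent strands -/
  | triple_ghosts (r : Fin m) (a : Adj m) (x y₁ y₂ z y₁' y₂' : Config κ m)
      (h₁ : IsGhost r a.lo x y₁) (h₂ : IsCross a y₁ y₂) (h₃ : IsGhost r a.lo y₂ z)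
      (h₁' : IsGhost r a.hi x y₁') (h₂' : IsCross a y₁' y₂') (h₃' : IsGhost r a.hi y₂' z)
      (h : IsMove x z) :
      Rel q (fGhost R r a.lo y₂ z h₃ * fCross R a y₁ y₂ h₂ * fGhost R r a.lo x y₁ h₁)
        (fGhost R r a.hi y₂' z h₃' * fCross R a y₁' y₂' h₂' * fGhost R r a.hi x y₁' h₁' -
          q • fMove R x z h)
  /- the ghost of a strand `t` and the crossing of two adjacent strands -/
  | triple_strands (a : Adj m) (t : Fin m) (x y₁ y₂ z y₁' y₂' : Config κ m)
      (h₁ : IsGhost a.lo t x y₁) (h₂ : IsCross a y₁ y₂) (h₃ : IsGhost a.lo t y₂ z)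
      (h₁' : IsGhost a.hi t x y₁') (h₂' : IsCross a y₁' y₂') (h₃' : IsGhost a.hi t y₂' z)
      (h : IsMove x z) :
      Rel q (fGhost R a.lo t y₂ z h₃ * fCross R a y₁ y₂ h₂ * fGhost R a.lo t x y₁ h₁)
        (fGhost R a.hi t y₂' z h₃' * fCross R a y₁' y₂' h₂' * fGhost R a.hi t x y₁' h₁' +
          fMove R x z h)

/-- The algebra of all type W diagrams with `m` strands and arbitrary generic ends, modulo
isotopy and the local relations, with a unit adjoined. -/
abbrev Diag (κ : ℝ) (m : ℕ) (q : R) : Type _ := RingQuot (Rel R (κ := κ) (m := m) q)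

end Relations

/-! ### The polynomial representation -/

section Poly

variable {R : Type*} [CommRing R] [IsDomain R] {κ : ℝ} {m : ℕ}

open Classical in
/-- The operator of a crossing of the strand `r` with the ghost of `t`, starting at `x`: the
identity if the strand goes from SW to NE and `κ < 0` or from SE to NW and `κ > 0`,
and the multiplication by `Y_r - q Y_t` otherwise. -/
def ghostFactor (q : R) (r t : Fin m) (x : Config κ m) : Laurent R m :=
  if (Side x r t ↔ κ < 0) then 1 else Y R r - q • Y R t

/-- The operator on Laurent polynomials by which a slice acts. -/
def Slice.op (q : R) : Slice κ m → (Laurent R m →ₗ[R] Laurent R m)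
  | move _ _ _ => LinearMap.id
  | sq _ i => LinearMap.mulLeft R (Y R i)
  | sqInv _ i => LinearMap.mulLeft R (Yinv R i)
  | cross a _ _ _ => demazure R a
  | ghost r t x _ _ => LinearMap.mulLeft R (ghostFactor q r t x)

/-- The direct sum of copies of the Laurent polynomials, one for each configuration. -/
abbrev PolyRep (R : Type*) [CommRing R] (κ : ℝ) (m : ℕ) : Type _ := Config κ m →₀ Laurent R m

/-- An operator from the summand of `x` to the summand of `y`. -/
def block (x y : Config κ m) (A : Laurent R m →ₗ[R] Laurent R m) :
    Module.End R (PolyRep R κ m) :=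
  Finsupp.lsingle y ∘ₗ A ∘ₗ Finsupp.lapply x

theorem block_mul (x y z : Config κ m) (A B : Laurent R m →ₗ[R] Laurent R m) :
    (block y z B * block x y A : Module.End R (PolyRep R κ m)) = block x z (B ∘ₗ A) := by
  refine LinearMap.ext fun v => ?_
  simp [block]

theorem block_mul_ne {x y y' z : Config κ m} (h : y ≠ y') (A B : Laurent R m →ₗ[R] Laurent R m) :
    (block y' z B * block x y A : Module.End R (PolyRep R κ m)) = 0 := by
  refine LinearMap.ext fun v => ?_
  simp [block, h]

theorem block_sub (x y : Config κ m) (A B : Laurent R m →ₗ[R] Laurent R m) :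
    (block x y A - block x y B : Module.End R (PolyRep R κ m)) = block x y (A - B) := by
  simp [block, LinearMap.sub_comp, LinearMap.comp_sub]

theorem block_add (x y : Config κ m) (A B : Laurent R m →ₗ[R] Laurent R m) :
    (block x y A + block x y B : Module.End R (PolyRep R κ m)) = block x y (A + B) := by
  simp [block, LinearMap.add_comp, LinearMap.comp_add]

theorem block_smul (x y : Config κ m) (c : R) (A : Laurent R m →ₗ[R] Laurent R m) :
    (c • block x y A : Module.End R (PolyRep R κ m)) = block x y (c • A) := by
  simp [block, LinearMap.smul_comp, LinearMap.comp_smul]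

/-- The action of the free algebra on slices. -/
def polyFree (q : R) : FreeDiag R κ m →ₐ[R] Module.End R (PolyRep R κ m) :=
  FreeAlgebra.lift R fun g => block g.bot g.top (g.op q)

theorem polyFree_ι (q : R) (g : Slice κ m) :
    polyFree q (FreeAlgebra.ι R g) = block g.bot g.top (g.op q) :=
  FreeAlgebra.lift_ι_apply _ _

theorem Side.lo_of_hi {x : Config κ m} {a : Adj m} {j : Fin m} (h : Side x a.hi j) :
    Side x a.lo j :=
  (x.strictMono (show a.lo < a.hi from Nat.lt_succ_self _)).trans h

theorem Side.hi_of_lo {x : Config κ m} {a : Adj m} {i : Fin m} (h : Side x i a.lo) :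
    Side x i a.hi :=
  lt_trans h (by simpa using x.strictMono (show a.lo < a.hi from Nat.lt_succ_self _))

theorem refl_refl (a : Adj m) (i : Fin m) : a.refl (a.refl i) = i := Equiv.swap_apply_self _ _ _

theorem IsCross.symm {a : Adj m} {x y : Config κ m} (h : IsCross a x y) : IsCross a y x := by
  intro i j
  rw [h, refl_refl, refl_refl]

theorem IsCross.row {a : Adj m} {x y : Config κ m} (h : IsCross a x y) (j : Fin m) :
    Side x a.lo j ↔ Side x a.hi j := by
  refine ⟨fun h1 => ?_, Side.lo_of_hi⟩
  rw [h, refl_lo] at h1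
  rw [h, refl_hi]
  exact h1.lo_of_hi

theorem IsCross.col {a : Adj m} {x y : Config κ m} (h : IsCross a x y) (i : Fin m) :
    Side x i a.lo ↔ Side x i a.hi := by
  refine ⟨Side.hi_of_lo, fun h1 => ?_⟩
  rw [h, refl_hi] at h1
  rw [h, refl_lo]
  exact h1.hi_of_lo

theorem IsGhost.ne {r t : Fin m} {x y : Config κ m} (h : IsGhost r t x y) : r ≠ t := by
  rintro rfl
  have h1 := h r r
  simp [Side] at h1

theorem IsGhost.flip {r t : Fin m} {x y : Config κ m} (h : IsGhost r t x y) :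
    Side x r t ↔ ¬ Side y r t := by
  have h1 := h r t
  tauto

theorem IsGhost.same {r t i j : Fin m} {x y : Config κ m} (h : IsGhost r t x y)
    (hij : ¬ (i = r ∧ j = t)) : Side x i j ↔ Side y i j := (h i j).2 hij

theorem cross_ghost_ne {a : Adj m} {r t : Fin m} {x y y' z : Config κ m}
    (h₁ : IsCross a x y) (h₁' : IsGhost r t x y') (h₂' : IsCross a y' z) :
    (r ≠ a.lo ∧ r ≠ a.hi) ∧ (t ≠ a.lo ∧ t ≠ a.hi) := by
  have n := a.hi_ne_lo
  refine ⟨⟨?_, ?_⟩, ⟨?_, ?_⟩⟩ <;> rintro rfl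
  · have := h₁'.flip
    have := h₁'.same (i := a.hi) (j := t) (by tauto)
    have := h₁.row t
    have := h₂'.row t
    tauto
  · have := h₁'.flip
    have := h₁'.same (i := a.lo) (j := t) (by simp [n.symm])
    have := h₁.row t
    have := h₂'.row t
    tauto
  · have := h₁'.flip
    have := h₁'.same (i := r) (j := a.hi) (by tauto)
    have := h₁.col r
    have := h₂'.col r
    tauto
  · have := h₁'.flip
    have := h₁'.same (i := r) (j := a.lo) (by simp [n.symm])
    have := h₁.col r
    have := h₂'.col r
    tauto

theorem ghostFactor_congr (q : R) {r t : Fin m} {x y : Config κ m} (h : Side x r t ↔ Side y r t) :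
    ghostFactor q r t x = ghostFactor q r t y := by
  unfold ghostFactor
  by_cases h1 : Side x r t
  · simp [h1, h.1 h1]
  · simp [h1, mt h.2 h1]

theorem ghostFactor_of_side {q : R} {r t : Fin m} {x : Config κ m} (h : Side x r t) :
    ghostFactor q r t x = if κ < 0 then 1 else Y R r - q • Y R t := by
  simp [ghostFactor, h]

theorem ghostFactor_of_not_side {q : R} {r t : Fin m} {x : Config κ m} (h : ¬ Side x r t) :
    ghostFactor q r t x = if κ < 0 then Y R r - q • Y R t else 1 := by
  by_cases hκ : κ < 0 <;> simp [ghostFactor, h, hκ]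

theorem ghostFactor_mul (q : R) {r t : Fin m} {x y : Config κ m} (h : Side x r t ↔ ¬ Side y r t) :
    ghostFactor q r t y * ghostFactor q r t x = Y R r - q • Y R t := by
  by_cases h1 : Side x r t
  · rw [ghostFactor_of_side h1, ghostFactor_of_not_side (h.1 h1)]
    by_cases hκ : κ < 0 <;> simp [hκ]
  · rw [ghostFactor_of_not_side h1, ghostFactor_of_side (not_not.1 (mt h.2 h1))]
    by_cases hκ : κ < 0 <;> simp [hκ]

theorem triple_ghosts_side {r : Fin m} {a : Adj m} {x y₁ y₂ z y₁' y₂' : Config κ m}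
    (h₁ : IsGhost r a.lo x y₁) (h₂ : IsCross a y₁ y₂) (h₃ : IsGhost r a.lo y₂ z)
    (h₁' : IsGhost r a.hi x y₁') (h₂' : IsCross a y₁' y₂') (h₃' : IsGhost r a.hi y₂' z) :
    (r ≠ a.lo ∧ r ≠ a.hi) ∧ ¬ Side x r a.lo ∧ Side y₂ r a.lo ∧ Side x r a.hi ∧
      ¬ Side y₂' r a.hi := by
  have n := a.hi_ne_lo
  have hr := refl_of_ne a h₁.ne h₁'.ne
  have e1 := h₁.flip
  have e2 := h₁.same (i := r) (j := a.hi) (by tauto)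
  have e3 := h₂.col r
  have e4 : Side x r a.lo → Side x r a.hi := Side.hi_of_lo
  have e5 := h₂ r a.hi
  have e6 := h₁'.flip
  have e7 := h₁'.same (i := r) (j := a.lo) (by simp [n.symm])
  have e8 := h₂' r a.lo
  rw [hr, refl_hi] at e5
  rw [hr, refl_lo] at e8
  have := h₁.ne
  have := h₁'.ne
  tauto

theorem triple_strands_side {a : Adj m} {t : Fin m} {x y₁ y₂ z y₁' y₂' : Config κ m}
    (h₁ : IsGhost a.lo t x y₁) (h₂ : IsCross a y₁ y₂) (h₃ : IsGhost a.lo t y₂ z)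
    (h₁' : IsGhost a.hi t x y₁') (h₂' : IsCross a y₁' y₂') (h₃' : IsGhost a.hi t y₂' z) :
    (t ≠ a.lo ∧ t ≠ a.hi) ∧ Side x a.lo t ∧ ¬ Side y₂ a.lo t ∧ ¬ Side x a.hi t ∧
      Side y₂' a.hi t := by
  have n := a.hi_ne_lo
  have ht := refl_of_ne a h₁.ne.symm h₁'.ne.symm
  have e1 := h₁.flip
  have e2 := h₁.same (i := a.hi) (j := t) (by tauto)
  have e3 := h₂.row t
  have e4 : Side x a.hi t → Side x a.lo t := Side.lo_of_hi
  have e5 := h₂ a.hi t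
  have e6 := h₁'.flip
  have e7 := h₁'.same (i := a.lo) (j := t) (by simp [n.symm])
  have e8 := h₂' a.lo t
  rw [ht, refl_hi] at e5
  rw [ht, refl_lo] at e8
  have := h₁.ne.symm
  have := h₁'.ne.symm
  tauto

/-- Every relation among diagrams holds for the operators on Laurent polynomials. -/
theorem polyFree_rel (q : R) {u v : FreeDiag R κ m} (h : Rel R q u v) :
    polyFree q u = polyFree q v := by
  induction h <;>
    simp only [map_mul, map_sub, map_add, map_smul, map_zero, polyFree_ι, Slice.bot, Slice.top,
      Slice.op, block_mul, block_sub, block_add, block_smul]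
  case id_id x y h => exact block_mul_ne h.symm _ _
  case id_slice g => rfl
  case slice_id g => rfl
  case move_move => rfl
  case move_cross => rfl
  case cross_move => rfl
  case move_ghost => rfl
  case ghost_move r t x y z h₁ h₂ h => rw [ghostFactor_congr q (h₁ r t)]; rfl
  case cross_cross a b hab x y y' z h₁ h₂ h₁' h₂' =>
    congr 1; refine LinearMap.ext fun F => ?_
    exact demazure_comm a b hab F
  case cross_ghost a r t x y y' z h₁ h₂ h₁' h₂' =>
    obtain ⟨⟨h1, h2⟩, ⟨h3, h4⟩⟩ := cross_ghost_ne h₁ h₁' h₂'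
    have hr : a.refl r = r := by
      conv_rhs => rw [← refl_refl a r]
      exact (refl_of_ne a h1 h2).symm
    have ht : a.refl t = t := by
      conv_rhs => rw [← refl_refl a t]
      exact (refl_of_ne a h3 h4).symm
    have hs := h₁ r t
    rw [hr] at h1 h2 hs ⊢
    rw [ht] at h3 h4 hs ⊢
    rw [ghostFactor_congr q hs]
    congr 1; refine LinearMap.ext fun F => ?_
    simp only [LinearMap.comp_apply, LinearMap.mulLeft_apply]
    rw [demazure_mul]
    unfold ghostFactor
    split_ifs
    · have : demazure R a 1 = 0 := by
        have := demazure_mul (R := R) a 1 1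
        simpa using this
      simp [this]
    · simp [permVars_Y, hr, ht, demazure_Y_of_ne a h1 h2, demazure_Y_of_ne a h3 h4]
  case ghost_ghost r t r' t' hne x y y' z h₁ h₂ h₁' h₂' =>
    rw [ghostFactor_congr q (h₁'.same hne), ← ghostFactor_congr q (h₁.same
      (fun h => hne ⟨h.1.symm, h.2.symm⟩))]
    congr 1; refine LinearMap.ext fun F => ?_
    simp only [LinearMap.comp_apply, LinearMap.mulLeft_apply]
    ring
  case sq_sqInv x i =>
    congr 1; refine LinearMap.ext fun F => ?_
    simp [← mul_assoc, Y_mul_Yinv]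
  case sqInv_sq x i =>
    congr 1; refine LinearMap.ext fun F => ?_
    simp [← mul_assoc, Yinv_mul_Y]
  case sq_sq x i j =>
    congr 1; refine LinearMap.ext fun F => ?_
    simp only [LinearMap.comp_apply, LinearMap.mulLeft_apply]
    ring
  case move_sq => rfl
  case ghost_sq r t x y h i =>
    congr 1; refine LinearMap.ext fun F => ?_
    simp only [LinearMap.comp_apply, LinearMap.mulLeft_apply]
    ring
  case cross_sq a x y h i hlo hhi =>
    congr 1; refine LinearMap.ext fun F => ?_
    simp only [LinearMap.comp_apply, LinearMap.mulLeft_apply]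
    rw [demazure_mul, demazure_Y_of_ne a hlo hhi, permVars_Y, refl_of_ne a hlo hhi]
    ring
  case nil_lo a x y h h' =>
    congr 1; refine LinearMap.ext fun F => ?_
    simp only [LinearMap.sub_apply, LinearMap.comp_apply, LinearMap.mulLeft_apply,
      LinearMap.id_apply]
    rw [demazure_mul, demazure_Y_hi, permVars_Y, refl_hi]
    ring
  case nil_hi a x y h h' =>
    congr 1; refine LinearMap.ext fun F => ?_
    simp only [LinearMap.sub_apply, LinearMap.comp_apply, LinearMap.mulLeft_apply,
      LinearMap.id_apply]
    rw [demazure_mul, demazure_Y_lo, permVars_Y, refl_lo]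
    ring
  case bigon a x y z h₁ h₂ =>
    have : demazure R a ∘ₗ demazure R a = 0 := LinearMap.ext fun F => demazure_demazure a F
    simp [this, block]
  case braid a b hab x y₁ y₂ z y₁' y₂' h₁ h₂ h₃ h₁' h₂' h₃' =>
    congr 1; refine LinearMap.ext fun F => ?_
    exact demazure_braid a b hab F
  case ghost_bigon r t x y z h₁ h₂ h =>
    congr 1; refine LinearMap.ext fun F => ?_
    have := ghostFactor_mul q h₁.flip
    simp only [LinearMap.comp_apply, LinearMap.mulLeft_apply, LinearMap.sub_apply,
      LinearMap.smul_apply, LinearMap.id_apply]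
    rw [← mul_assoc, this, sub_mul, smul_mul_assoc]
  case triple_ghosts r a x y₁ y₂ z y₁' y₂' h₁ h₂ h₃ h₁' h₂' h₃' h =>
    obtain ⟨⟨n1, n2⟩, s1, s2, s3, s4⟩ := triple_ghosts_side h₁ h₂ h₃ h₁' h₂' h₃'
    rw [ghostFactor_of_not_side s1, ghostFactor_of_side s2, ghostFactor_of_side s3,
      ghostFactor_of_not_side s4]
    congr 1; refine LinearMap.ext fun F => ?_
    by_cases hκ : κ < 0 <;>
      simp only [hκ, if_true, if_false, LinearMap.comp_apply, LinearMap.mulLeft_apply,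
        LinearMap.sub_apply, LinearMap.smul_apply, LinearMap.id_apply, one_mul, demazure_mul,
        map_sub, map_smul, permVars_Y, demazure_Y_lo, demazure_Y_hi, refl_lo, refl_hi,
        demazure_Y_of_ne a n1 n2, refl_of_ne a n1 n2] <;>
      simp only [Algebra.smul_def] <;> ring
  case triple_strands a t x y₁ y₂ z y₁' y₂' h₁ h₂ h₃ h₁' h₂' h₃' h =>
    obtain ⟨⟨n1, n2⟩, s1, s2, s3, s4⟩ := triple_strands_side h₁ h₂ h₃ h₁' h₂' h₃'
    rw [ghostFactor_of_side s1, ghostFactor_of_not_side s2, ghostFactor_of_not_side s3,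
      ghostFactor_of_side s4]
    congr 1; refine LinearMap.ext fun F => ?_
    by_cases hκ : κ < 0 <;>
      simp only [hκ, if_true, if_false, LinearMap.comp_apply, LinearMap.mulLeft_apply,
        LinearMap.sub_apply, LinearMap.add_apply, LinearMap.id_apply, one_mul,
        demazure_mul, map_sub, map_smul, permVars_Y, demazure_Y_lo, demazure_Y_hi, refl_lo,
        refl_hi, demazure_Y_of_ne a n1 n2, refl_of_ne a n1 n2] <;>
      simp only [Algebra.smul_def] <;> ring

variable (R κ m) in
/-- The action of the algebra of diagrams on Laurent polynomials: a crossing of strands acts by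
a Demazure operator, a crossing of a strand with a ghost by `ghostFactor`, a square on the
`r`-th strand by the multiplication by `Y_r`. -/
def polyAction (q : R) : Diag R κ m q →ₐ[R] Module.End R (PolyRep R κ m) :=
  RingQuot.liftAlgHom R ⟨polyFree q, fun _ _ h => polyFree_rel q h⟩

end Poly

/-! ### The type W affine Hecke algebra of a collection of ends -/

section Waha

variable (R : Type*) [CommRing R] {κ : ℝ} {m : ℕ} (q : R)

/-- The class of a slice. -/
def Slice.toDiag (g : Slice κ m) : Diag R κ m q :=
  RingQuot.mkAlgHom R (Rel R q) (FreeAlgebra.ι R g)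

/-- The idempotent `e_B` of vertical strands at `x ∈ B`. -/
def idem (x : Config κ m) : Diag R κ m q :=
  (Slice.move x x fun _ _ => Iff.rfl).toDiag R q

/-- The type W affine Hecke algebra of a collection `B` of generic configurations: the span of
the diagrams whose ends at the bottom and at the top belong to `B`. -/
def waha (B : Set (Config κ m)) : NonUnitalSubalgebra R (Diag R κ m q) :=
  NonUnitalAlgebra.adjoin R {u | ∃ x ∈ B, ∃ y ∈ B, ∃ v, u = idem R q x * v * idem R q y}

theorem idem_mul_mem {B : Set (Config κ m)} {x y : Config κ m} (hx : x ∈ B) (hy : y ∈ B)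
    (v : Diag R κ m q) : idem R q x * v * idem R q y ∈ waha R q B :=
  NonUnitalAlgebra.subset_adjoin R ⟨x, hx, y, hy, v, rfl⟩

open Classical in
/-- The diagram with the single crossing `a` and both ends at `x`, provided there is one. -/
def crossAt (x : Config κ m) (a : Adj m) : Diag R κ m q :=
  if h : IsCross a x x then (Slice.cross a x x h).toDiag R q else 0

/-- The truncation `e A e` of a (non-unital) algebra. -/
def truncation {A : Type*} [NonUnitalRing A] [Module R A] [IsScalarTower R A A]
    [SMulCommClass R A A] (e : A) : NonUnitalSubalgebra R A where
  carrier := {u | ∃ v, u = e * v * e}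
  zero_mem' := ⟨0, by simp⟩
  add_mem' := by
    rintro _ _ ⟨v, rfl⟩ ⟨w, rfl⟩
    exact ⟨v + w, by rw [mul_add, add_mul]⟩
  mul_mem' := by
    rintro _ _ ⟨v, rfl⟩ ⟨w, rfl⟩
    exact ⟨v * e * (e * w), by simp only [mul_assoc]⟩
  smul_mem' := by
    rintro c _ ⟨v, rfl⟩
    exact ⟨c • v, by rw [mul_smul_comm, smul_mul_assoc]⟩

end Waha

section TruncatedPoly

variable {R : Type*} [CommRing R] [IsDomain R] {κ : ℝ} {m : ℕ} {q : R}

theorem polyAction_slice (g : Slice κ m) :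
    polyAction R κ m q (g.toDiag R q) = block g.bot g.top (g.op q) := by
  rw [Slice.toDiag, polyAction, RingQuot.liftAlgHom_mkAlgHom_apply, polyFree_ι]

theorem polyAction_idem (x : Config κ m) (v : PolyRep R κ m) :
    polyAction R κ m q (idem R q x) v = Finsupp.single x (v x) := by
  rw [idem, polyAction_slice]
  simp [block, Slice.bot, Slice.top, Slice.op]

/-- The polynomial representation `P_B`, the direct sum of the Laurent polynomials over `B`. -/
def polyOn (R : Type*) [CommRing R] {κ : ℝ} {m : ℕ} (B : Set (Config κ m)) :
    Submodule R (PolyRep R κ m) :=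
  Finsupp.supported (Laurent R m) R B

theorem waha_maps {B : Set (Config κ m)} {u : Diag R κ m q} (hu : u ∈ waha R q B)
    (v : PolyRep R κ m) : polyAction R κ m q u v ∈ polyOn R B := by
  induction hu using NonUnitalAlgebra.adjoin_induction generalizing v with
  | mem u hu =>
    obtain ⟨x, hx, y, hy, w, rfl⟩ := hu
    rw [map_mul, map_mul, mul_assoc, Module.End.mul_apply, polyAction_idem]
    exact Finsupp.single_mem_supported R _ hx
  | add u w _ _ h1 h2 =>
    rw [map_add, LinearMap.add_apply]; exact add_mem (h1 v) (h2 v)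
  | zero => rw [map_zero, LinearMap.zero_apply]; exact zero_mem _
  | mul u w _ _ h1 h2 => rw [map_mul]; exact h1 _
  | smul c u _ h => rw [map_smul, LinearMap.smul_apply]; exact Submodule.smul_mem _ c (h v)

/-- The truncation `e P_B` of the polynomial representation, for `e` in the algebra of `B`. -/
def polyTrunc {B : Set (Config κ m)} (e : waha R q B) : Submodule R (PolyRep R κ m) :=
  (polyOn R B).map (polyAction R κ m q e.1)

/-- The action of `e W_B e` on `e P_B`. -/
def truncAct {B : Set (Config κ m)} {e : waha R q B} (u : truncation R e) (v : polyTrunc e) :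
    polyTrunc e :=
  ⟨polyAction R κ m q u.1.1 v.1, by
    obtain ⟨u, w, rfl⟩ := u
    refine ⟨polyAction R κ m q (w.1 * e.1) v.1,
      waha_maps (mul_mem w.2 e.2) _, ?_⟩
    rw [← Module.End.mul_apply, ← map_mul, ← mul_assoc]
    rfl⟩

end TruncatedPoly

/-! ### Symmetric groups, compositions, Young subgroups -/

theorem exists_redWord {m : ℕ} (w : Equiv.Perm (Fin m)) :
    ∃ l : List (Adj m), (l.map Adj.refl).prod = w ∧
      ∀ l' : List (Adj m), (l'.map Adj.refl).prod = w → l.length ≤ l'.length := by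
  have h : ∃ l : List (Adj m), (l.map Adj.refl).prod = w := by
    cases m with
    | zero => exact ⟨[], Subsingleton.elim _ _⟩
    | succ n =>
      have hw : w ∈ Submonoid.closure
          (Set.range fun i : Fin n => Equiv.swap i.castSucc i.succ) := by
        rw [Equiv.Perm.mclosure_swap_castSucc_succ]; trivial
      induction hw using Submonoid.closure_induction with
      | mem _ h =>
        obtain ⟨i, rfl⟩ := h
        exact ⟨[⟨i.1, by omega⟩], by simp [Adj.refl, Adj.lo, Adj.hi]; rfl⟩
      | one => exact ⟨[], rfl⟩
      | mul _ _ _ _ h1 h2 =>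
        obtain ⟨l1, rfl⟩ := h1
        obtain ⟨l2, rfl⟩ := h2
        exact ⟨l1 ++ l2, by simp⟩
  obtain ⟨l, hl, hmin⟩ := (measure (List.length (α := Adj m))).wf.has_min
    {l | (l.map Adj.refl).prod = w} h
  exact ⟨l, hl, fun l' hl' => not_lt.1 (hmin l' hl')⟩

/-- A reduced expression of a permutation in the simple reflections. -/
def redWord {m : ℕ} (w : Equiv.Perm (Fin m)) : List (Adj m) := (exists_redWord w).choose

/-- The length of a permutation. -/
def len {m : ℕ} (w : Equiv.Perm (Fin m)) : ℕ := (redWord w).length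

/-- Compositions of `m` with `n` (possibly zero) parts. -/
abbrev Comp (n m : ℕ) : Type := {μ : Fin n → ℕ // ∑ j, μ j = m}

instance (n m : ℕ) : Fintype (Comp n m) :=
  Fintype.subtype (Finset.piAntidiag Finset.univ m) (by simp)

/-- The blocks of a composition: the `t`-th of the `m` points, counted from the left, is
the `i`-th point of the `j`-th block. -/
def Comp.coord {n m : ℕ} (μ : Comp n m) : Fin m ≃ Σ j, Fin (μ.1 j) :=
  (finCongr μ.2.symm).trans finSigmaFinEquiv.symm

theorem Comp.coord_lt {n m : ℕ} (μ : Comp n m) {t t' : Fin m} (h : t < t') :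
    (μ.coord t).1 < (μ.coord t').1 ∨
      ((μ.coord t).1 = (μ.coord t').1 ∧ ((μ.coord t).2 : ℕ) < (μ.coord t').2) := by
  let g : ℕ → ℕ := fun i => if hi : i < n then μ.1 ⟨i, hi⟩ else 0
  have key (t : Fin m) :
      (t : ℕ) = ∑ j ∈ Finset.range (μ.coord t).1, g j + ((μ.coord t).2 : ℕ) := by
    have h1 : (t : ℕ) = finSigmaFinEquiv (μ.coord t) := by simp [Comp.coord]
    rw [h1, finSigmaFinEquiv_apply]
    congr 1
    rw [← Fin.sum_univ_eq_sum_range]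
    refine Finset.sum_congr rfl fun i _ => ?_
    simp only [g]
    rw [dif_pos (lt_trans i.2 (μ.coord t).1.2)]
    rfl
  have h1 := key t
  have h2 := key t'
  have hlt : (t : ℕ) < t' := h
  rcases lt_trichotomy (μ.coord t).1 (μ.coord t').1 with h3 | h3 | h3
  · exact Or.inl h3
  · refine Or.inr ⟨h3, ?_⟩
    have h4 : ∑ j ∈ Finset.range (μ.coord t).1, g j = ∑ j ∈ Finset.range (μ.coord t').1, g j :=
      congrArg (fun k : Fin n => ∑ j ∈ Finset.range k, g j) h3
    omega
  · exfalso
    have h4 : ∑ j ∈ Finset.range ((μ.coord t').1 + 1), g j ≤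
        ∑ j ∈ Finset.range (μ.coord t).1, g j :=
      Finset.sum_le_sum_of_subset (Finset.range_subset_range.2 h3)
    rw [Finset.sum_range_succ] at h4
    have h5 : g (μ.coord t').1 = μ.1 (μ.coord t').1 := by simp [g]
    have h6 := (μ.coord t').2.2
    omega

theorem Comp.coord_snd_lt {n m : ℕ} (μ : Comp n m) (t : Fin m) :
    ((μ.coord t).2 : ℕ) < m := by
  have h1 := (μ.coord t).2.2
  have h2 := Finset.single_le_sum (f := μ.1) (fun _ _ => Nat.zero_le _)
    (Finset.mem_univ (μ.coord t).1)
  rw [μ.2] at h2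
  omega

/-- The Young subgroup of a composition: the permutations which preserve its blocks. -/
def Comp.young {n m : ℕ} (μ : Comp n m) : Finset (Equiv.Perm (Fin m)) :=
  Finset.univ.filter fun w => ∀ t, (μ.coord (w t)).1 = (μ.coord t).1

/-- The longest element of the Young subgroup: it reverses each block. -/
def Comp.longest {n m : ℕ} (μ : Comp n m) : Equiv.Perm (Fin m) :=
  μ.coord.symm.permCongr (Equiv.sigmaCongrRight fun _ => Fin.revPerm)

/-! ### Clustered configurations -/

/-- A choice of real numbers `0 < ε ≪ |κ| ≪ s`. -/
structure Scale (κ : ℝ) (m : ℕ) where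
  /-- the distance of strands within a cluster -/
  ε : ℝ
  /-- the distance of clusters -/
  s : ℝ
  pos : 0 < ε
  small : m * ε < |κ|
  large : |κ| + m * ε < s

section Cluster

variable {κ : ℝ} {n m : ℕ} (σ : Scale κ m)

theorem Scale.offset_lt (μ : Comp n m) (t : Fin m) :
    ((μ.coord t).2 : ℕ) * σ.ε < |κ| ∧ 0 ≤ ((μ.coord t).2 : ℕ) * σ.ε ∧
      |κ| + ((μ.coord t).2 : ℕ) * σ.ε < σ.s := by
  have h1 : (((μ.coord t).2 : ℕ) : ℝ) < m := by exact_mod_cast μ.coord_snd_lt t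
  have h2 := mul_lt_mul_of_pos_right h1 σ.pos
  have h3 := mul_nonneg (Nat.cast_nonneg (α := ℝ) ((μ.coord t).2 : ℕ)) σ.pos.le
  exact ⟨h2.trans σ.small, h3, by linarith [σ.large]⟩

/-- The position of the `t`-th point of the clustered configuration. -/
def clusterPos (μ : Comp n m) (t : Fin m) : ℝ :=
  ((μ.coord t).2 : ℕ) * σ.ε + (((μ.coord t).1 : ℕ) + 1) * σ.s

theorem clusterPos_lt (μ : Comp n m) {t t' : Fin m} (h : (μ.coord t).1 < (μ.coord t').1) :
    clusterPos σ μ t + |κ| < clusterPos σ μ t' := by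
  obtain ⟨_, _, h3⟩ := σ.offset_lt μ t
  obtain ⟨_, h5, _⟩ := σ.offset_lt μ t'
  have h6 : (((μ.coord t).1 : ℕ) : ℝ) + 1 ≤ ((μ.coord t').1 : ℕ) := by exact_mod_cast h
  have h7 : 0 < σ.s := by
    have := σ.large
    have := abs_nonneg κ
    have := mul_nonneg (Nat.cast_nonneg (α := ℝ) m) σ.pos.le
    linarith
  have h8 := mul_le_mul_of_nonneg_right h6 h7.le
  unfold clusterPos
  linarith

theorem clusterPos_abs_sub_lt (μ : Comp n m) {t t' : Fin m}
    (h : (μ.coord t).1 = (μ.coord t').1) : |clusterPos σ μ t - clusterPos σ μ t'| < |κ| := by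
  obtain ⟨h1, h2, _⟩ := σ.offset_lt μ t
  obtain ⟨h3, h4, _⟩ := σ.offset_lt μ t'
  have h5 := congrArg (fun k : Fin n => ((k : ℕ) + 1 : ℝ) * σ.s) h
  unfold clusterPos
  rw [abs_lt]
  constructor <;> linarith

/-- The configuration `{iε + js | 0 ≤ i < μ_j}`, where `j` runs from `1` to `n`. -/
def cluster (μ : Comp n m) : Config κ m where
  pos := clusterPos σ μ
  strictMono := by
    intro t t' h
    rcases μ.coord_lt h with h1 | ⟨h1, h2⟩
    · have := clusterPos_lt σ μ h1
      have := abs_nonneg κ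
      linarith
    · have h3 : (((μ.coord t).2 : ℕ) : ℝ) < ((μ.coord t').2 : ℕ) := by exact_mod_cast h2
      have h4 := mul_lt_mul_of_pos_right h3 σ.pos
      have h5 := congrArg (fun k : Fin n => ((k : ℕ) + 1 : ℝ) * σ.s) h1
      unfold clusterPos
      linarith
  generic := by
    intro t t' h
    rcases lt_trichotomy (μ.coord t).1 (μ.coord t').1 with h1 | h1 | h1
    · have := clusterPos_lt σ μ h1
      have := neg_abs_le κ
      linarith
    · have := clusterPos_abs_sub_lt σ μ h1
      rw [h, add_sub_cancel_left] at this
      exact lt_irrefl _ this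
    · have := clusterPos_lt σ μ h1
      have := le_abs_self κ
      linarith

variable (n) in
/-- The collection of all clustered configurations. -/
def clusters : Set (Config κ m) := Set.range (cluster σ (n := n))

variable (R : Type*) [CommRing R] (q : R)

/-- The product `∏ y_i^{k-i}` (with `1 ≤ i ≤ k`) of squares on each cluster of size `k`. -/
def staircase (μ : Comp n m) : Diag R κ m q :=
  (List.ofFn fun t => (Slice.sq (cluster σ μ) t).toDiag R q ^
    (μ.1 (μ.coord t).1 - 1 - ((μ.coord t).2 : ℕ))).prod

/-- The idempotent `e'_μ`, which on each cluster of size `k` is the primitive idempotent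
`y_1^{k-1} ⋯ y_{k-1} ∂_{w_0}` of the nilHecke algebra. -/
def nilIdem (μ : Comp n m) : waha R q (clusters n σ) :=
  ⟨idem R q (cluster σ μ) *
      (staircase σ R q μ * ((redWord μ.longest).map (crossAt R q (cluster σ μ))).prod) *
      idem R q (cluster σ μ),
    idem_mul_mem R q (Set.mem_range_self μ) (Set.mem_range_self μ) _⟩

variable (n) in
/-- The idempotent `e' = ∑_μ e'_μ`. -/
def nilIdemSum : waha R q (clusters n σ) := ∑ μ, nilIdem σ R q μ

end Cluster

/-! ### The affine Hecke algebra and the affine Schur algebras -/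

section Hecke

variable (R : Type*) [CommRing R] (m : ℕ) (q : R)

/-- Generators of the affine Hecke algebra. -/
inductive HGen (m : ℕ) : Type
  | X (i : Fin m)
  | Xinv (i : Fin m)
  | T (a : Adj m)

open FreeAlgebra in
/-- Relations of the affine Hecke algebra. -/
inductive HRel {R : Type*} [CommRing R] {m : ℕ} (q : R) :
    FreeAlgebra R (HGen m) → FreeAlgebra R (HGen m) → Prop
  | X_Xinv (i : Fin m) : HRel q (ι R (.X i) * ι R (.Xinv i)) 1
  | Xinv_X (i : Fin m) : HRel q (ι R (.Xinv i) * ι R (.X i)) 1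
  | X_X (i j : Fin m) : HRel q (ι R (.X i) * ι R (.X j)) (ι R (.X j) * ι R (.X i))
  | T_T (a : Adj m) :
      HRel q (ι R (.T a) * ι R (.T a)) ((q - 1) • ι R (.T a) + algebraMap R _ q)
  | T_X_T (a : Adj m) : HRel q (ι R (.T a) * ι R (.X a.lo) * ι R (.T a)) (q • ι R (.X a.hi))
  | T_X (a : Adj m) (i : Fin m) (hlo : i ≠ a.lo) (hhi : i ≠ a.hi) :
      HRel q (ι R (.T a) * ι R (.X i)) (ι R (.X i) * ι R (.T a))
  | braid (a b : Adj m) (hab : b.1 = a.1 + 1) :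
      HRel q (ι R (.T a) * ι R (.T b) * ι R (.T a)) (ι R (.T b) * ι R (.T a) * ι R (.T b))
  | comm (a b : Adj m) (hab : a.1 + 1 < b.1) :
      HRel q (ι R (.T a) * ι R (.T b)) (ι R (.T b) * ι R (.T a))

/-- The affine Hecke algebra of rank `m` with parameter `q`. -/
abbrev Hecke : Type _ := RingQuot (HRel (R := R) (m := m) q)

variable {m}

/-- The generator `T_r`. -/
def heckeT (a : Adj m) : Hecke R m q := RingQuot.mkAlgHom R (HRel q) (FreeAlgebra.ι R (.T a))

/-- The element `T_w = T_{i_1} ⋯ T_{i_l}` for a reduced expression `w = s_{i_1} ⋯ s_{i_l}`. -/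
def heckeTw (w : Equiv.Perm (Fin m)) : Hecke R m q := ((redWord w).map (heckeT R q)).prod

/-- The quasi-idempotent `ε_μ = ∑ T_w` over the Young subgroup of `μ`. -/
def symmetrizer {n : ℕ} (μ : Comp n m) : Hecke R m q := ∑ w ∈ μ.young, heckeTw R q w

/-- The quasi-idempotent `ε⁻_μ = ∑ (-q)^{-ℓ(w)} T_w` over the Young subgroup of `μ`. -/
def antisymmetrizer {n : ℕ} (μ : Comp n m) : Hecke R m q :=
  ∑ w ∈ μ.young, (-Ring.inverse q) ^ len w • heckeTw R q w

/-- The algebra `End_H(⨁_k H ε_k)` for a finite family of elements `ε_k` of `H`.  Endomorphisms of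
left modules are written on the right of their arguments, as is needed to identify them with
matrices whose `(k, k')`-entry is in `ε_k H ε_k'`. -/
abbrev EndSum {H ι : Type*} [Ring H] (ε : ι → H) : Type _ :=
  (Module.End H (Π k, (Submodule.span H {ε k} : Submodule H H)))ᵐᵒᵖ

/-- The `(k, k')`-entry: the component in `H ε_k'` of the image of `ε_k`. -/
def EndSum.entry {H ι : Type*} [Ring H] [DecidableEq ι] {ε : ι → H} (φ : EndSum ε) (k k' : ι) : H :=
  (MulOpposite.unop φ (Pi.single k ⟨ε k, Submodule.mem_span_singleton_self _⟩) k' : _)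

variable (m) in
/-- The affine Schur algebra. -/
abbrev Schur (n : ℕ) : Type _ := EndSum (symmetrizer R q (n := n) (m := m))

variable (m) in
/-- The signed affine Schur algebra. -/
abbrev SignedSchur (n : ℕ) : Type _ := EndSum (antisymmetrizer R q (n := n) (m := m))

variable (m) in
/-- The polynomial representation of the affine Hecke algebra generated by an element `1⁻`
subject to the relations `T_r 1⁻ = -1⁻`. -/
abbrev HeckePoly : Type _ :=
  Hecke R m q ⧸ Submodule.span (Hecke R m q) (Set.range fun a : Adj m => heckeT R q a + 1)

/-- The subspace `ε_μ P` of the polynomial representation. -/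
def symPoly {n : ℕ} (μ : Comp n m) : Submodule R (HeckePoly R m q) :=
  LinearMap.range (Algebra.lsmul R R (HeckePoly R m q) (symmetrizer R q μ))

variable (m) in
/-- The polynomial representation `⨁_μ ε_μ P` of the affine Schur algebra. -/
abbrev SchurPoly (n : ℕ) : Type _ := Π μ : Comp n m, symPoly R q μ

variable {R q} in
/-- The element `w` is the result of the action of `φ` on the element `v` of the polynomial
representation of the affine Schur algebra: if `v` has the components `ε_ν p_ν`,
then `w` has the components `∑_ν φ_{μν} p_ν`. -/
def IsSchurAction {n : ℕ} (φ : Schur R m q n) (v w : SchurPoly R m q n) : Prop :=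
  ∀ p : Comp n m → HeckePoly R m q, (∀ ν, (v ν : HeckePoly R m q) = symmetrizer R q ν • p ν) →
    ∀ μ, (w μ : HeckePoly R m q) = ∑ ν, φ.entry μ ν • p ν

end Hecke

end WAHA

end

/-!
The algebra of diagrams acts on Laurent polynomials, and so does the affine Hecke algebra, by
Demazure–Lusztig operators. The theorem is obtained by comparing the two algebras inside the
operators on Laurent polynomials, where both act faithfully.

**Diagrams.** The order of the strands and ghosts of a configuration is a relation "strand `i` is
to the left of the ghost of strand `j`" with a simple characterization (`IsSide`), so
configurations up to isotopy are the chambers of an arrangement of walls. A diagram is minimal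
(`Min`) if it crosses no wall twice. As for reduced words of permutations, two minimal diagrams
with the same ends which induce the same permutation agree modulo diagrams with fewer crossings of
strands (`min_unique`). The proof is the usual one for Matsumoto's theorem: it compares the last
crossings, and the local cases are the relations of the algebra of diagrams, together with the two
triple points at which a third line passes both of two crossing lines (`cross_through_ghost`,
`cross_through_strand`), which are consequences of the defining relations. Therefore one minimal
diagram for each permutation, multiplied by Laurent polynomials in the squares, spans the diagrams
between two given configurations (`idem_mul_filt_mem`). A minimal diagram for `w` acts by a
combination of permutations with coefficients in the rational functions, in which the coefficient
of `w` is not zero and all other permutations are shorter (`Min.exists_lead`). By triangularity,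
diagrams between two configurations act faithfully (`eq_zero_of_act`), and the number of crossings
needed for an operator can be read off from its coefficients (`mem_opsLt_of_rep`).

**Hecke algebra.** When the distances of the strands are larger than `|κ|`, two adjacent strands
cross only after one of them has crossed the ghost of the other, so the minimal diagram of a
simple reflection acts by `(Y_r - q Y_{r+1}) ∂_r` or `(Y_{r+1} - q Y_r) ∂_r`, which is the
operator of `T_r` up to a constant (`min_far_refl`). It follows that the affine Hecke algebra is
the algebra of the diagrams with distant strands at both ends (`mem_ops_far_iff`), and it acts
faithfully (`hrep_injective`). The sign of `κ` decides whether `T_r` acts on constants by `-1` or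
by `q`, and hence which of the two kinds of quasi-idempotents corresponds to the clusters.

**Quasi-idempotents.** The quasi-idempotent `ε_μ` is an eigenvector of the `T_r` of the Young
subgroup. The symmetrizing diagram, in which all strands of each cluster cross and the clusters
are then spread out, has images with the same property. An operator with this property has nonzero
coefficients only in whole orbits of the Young subgroup, and a comparison of leading coefficients
shows that it factors through the symmetrizing diagram, and vanishes if it has too few crossings
(`Eigen.exists_factor`). Since the leading coefficients agree, `ε_μ` is a unit times the
symmetrizing diagram (`hrep_gammaSym`).

**Conclusion.** The map `u ↦ (ε_μ u_{μν})` sends the truncated algebra to matrices with entries in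
`H ε_ν` (`exists_hecke_of_ops`) whose rows satisfy the relations of the generators `ε_μ`, that is,
to endomorphisms. It is surjective by the factorization of eigenvectors (`exists_ops_of_hecke`),
and injective because the symmetrizing diagram of `μ` can be cancelled on the image of the
nilHecke idempotent (`nilOp_eq_of_symOp_eq`): it is the Demazure operator of the longest element
followed by the multiplication by a polynomial. For `κ < 0` the polynomial representation of the
affine Hecke algebra is identified with the Laurent polynomials (`toHeckePoly_hrep`), and `v ↦
(ε_μ v_μ)` is the isomorphism of the representations.
-/

noncomputable section

namespace WAHA

/-! ### Inversions and reduced words of permutations -/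

section Perm

variable {m : ℕ}

theorem Adj.lo_lt_hi (a : Adj m) : a.lo < a.hi := Nat.lt_succ_self _

theorem Adj.lt_hi_iff (a : Adj m) {i : Fin m} : i < a.hi ↔ i ≤ a.lo := by
  simp only [Adj.hi, Adj.lo, Fin.lt_def, Fin.le_def]; omega

theorem Adj.lo_lt_iff (a : Adj m) {i : Fin m} : a.lo < i ↔ a.hi ≤ i := by
  simp only [Adj.hi, Adj.lo, Fin.lt_def, Fin.le_def]; omega

theorem Adj.eq_of_lo_eq {a b : Adj m} (h : a.lo = b.lo) : a = b :=
  Subtype.ext (congrArg Fin.val h)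

theorem refl_mul_refl (a : Adj m) : a.refl * a.refl = 1 := Equiv.swap_mul_self _ _

theorem refl_inv (a : Adj m) : a.refl⁻¹ = a.refl := Equiv.swap_inv _ _

theorem refl_mul_cancel (a : Adj m) (w : Equiv.Perm (Fin m)) : a.refl * (a.refl * w) = w := by
  rw [← mul_assoc, refl_mul_refl, one_mul]

theorem mul_refl_cancel (a : Adj m) (w : Equiv.Perm (Fin m)) : w * a.refl * a.refl = w := by
  rw [mul_assoc, refl_mul_refl, mul_one]

theorem refl_mul_inv_apply (a : Adj m) (w : Equiv.Perm (Fin m)) (i : Fin m) :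
    (a.refl * w)⁻¹ i = w⁻¹ (a.refl i) := by
  rw [mul_inv_rev, refl_inv]; rfl

/-- An adjacent transposition preserves the order of every pair but the one it exchanges. -/
theorem refl_lt_refl (a : Adj m) {u v : Fin m} (h1 : ¬ (u = a.lo ∧ v = a.hi))
    (h2 : ¬ (u = a.hi ∧ v = a.lo)) : a.refl u < a.refl v ↔ u < v := by
  have e (u : Fin m) : ((a.refl u : Fin m) : ℕ) =
      if (u : ℕ) = a.1 then a.1 + 1 else if (u : ℕ) = a.1 + 1 then a.1 else u := by
    rw [Adj.refl, Equiv.swap_apply_def]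
    simp only [Adj.lo, Adj.hi, Fin.ext_iff]
    split_ifs <;> rfl
  simp only [Adj.lo, Adj.hi, Fin.ext_iff] at h1 h2
  rw [Fin.lt_def, Fin.lt_def, e, e]
  split_ifs <;> omega

/-- The pairs of positions whose order is reversed by a permutation. -/
def invSet (w : Equiv.Perm (Fin m)) : Finset (Fin m × Fin m) :=
  Finset.univ.filter fun p => p.1 < p.2 ∧ w p.2 < w p.1

/-- The number of inversions of a permutation. -/
def inv (w : Equiv.Perm (Fin m)) : ℕ := (invSet w).card

theorem mem_invSet {w : Equiv.Perm (Fin m)} {p : Fin m × Fin m} :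
    p ∈ invSet w ↔ p.1 < p.2 ∧ w p.2 < w p.1 := by simp [invSet]

theorem invSet_refl_mul {a : Adj m} {w : Equiv.Perm (Fin m)} (h : w⁻¹ a.lo < w⁻¹ a.hi) :
    invSet (a.refl * w) = insert (w⁻¹ a.lo, w⁻¹ a.hi) (invSet w) := by
  ext ⟨i, j⟩
  simp only [mem_invSet, Finset.mem_insert, Prod.mk.injEq, Equiv.Perm.mul_apply]
  have hlo (k : Fin m) : k = w⁻¹ a.lo ↔ w k = a.lo := by rw [Equiv.Perm.eq_inv_iff_eq]
  have hhi (k : Fin m) : k = w⁻¹ a.hi ↔ w k = a.hi := by rw [Equiv.Perm.eq_inv_iff_eq]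
  by_cases h1 : w i = a.lo ∧ w j = a.hi
  · have e1 := (hlo i).2 h1.1
    have e2 := (hhi j).2 h1.2
    subst e1 e2
    simp [refl_lo, refl_hi, a.lo_lt_hi]
    exact h
  by_cases h2 : w i = a.hi ∧ w j = a.lo
  · have e1 := (hhi i).2 h2.1
    have e2 := (hlo j).2 h2.2
    subst e1 e2
    simp [refl_lo, refl_hi, a.hi_ne_lo]
    exact fun h' => absurd h' h.not_gt
  rw [hlo, hhi, refl_lt_refl a (fun h => h2 ⟨h.2, h.1⟩) (fun h => h1 ⟨h.2, h.1⟩)]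
  tauto

theorem inv_refl_mul {a : Adj m} {w : Equiv.Perm (Fin m)} (h : w⁻¹ a.lo < w⁻¹ a.hi) :
    inv (a.refl * w) = inv w + 1 := by
  rw [inv, invSet_refl_mul h, Finset.card_insert_of_notMem, inv]
  simp [mem_invSet, a.lo_lt_hi.not_gt]

theorem inv_refl_mul_desc {a : Adj m} {w : Equiv.Perm (Fin m)} (h : w⁻¹ a.hi < w⁻¹ a.lo) :
    inv (a.refl * w) + 1 = inv w := by
  have h1 : (a.refl * w)⁻¹ a.lo < (a.refl * w)⁻¹ a.hi := by
    rwa [refl_mul_inv_apply, refl_mul_inv_apply, refl_lo, refl_hi]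
  rw [← inv_refl_mul h1, refl_mul_cancel]

theorem asc_or_desc (a : Adj m) (w : Equiv.Perm (Fin m)) :
    w a.lo < w a.hi ∨ w a.hi < w a.lo :=
  lt_or_gt_of_ne fun h => lo_ne_hi a (w.injective h)

theorem inv_refl_mul_le (a : Adj m) (w : Equiv.Perm (Fin m)) :
    inv (a.refl * w) ≤ inv w + 1 := by
  rcases asc_or_desc a w⁻¹ with h | h
  · exact (inv_refl_mul h).le
  · have := inv_refl_mul_desc h; omega

theorem asc_of_inv {a : Adj m} {w : Equiv.Perm (Fin m)} (h : inv w < inv (a.refl * w)) :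
    w⁻¹ a.lo < w⁻¹ a.hi := by
  rcases asc_or_desc a w⁻¹ with h1 | h1
  · exact h1
  · have := inv_refl_mul_desc h1; omega

@[simp] theorem inv_one : inv (1 : Equiv.Perm (Fin m)) = 0 := by
  simp only [inv, Finset.card_eq_zero, Finset.eq_empty_iff_forall_notMem, mem_invSet]
  intro p hp
  exact lt_asymm hp.1 hp.2

theorem inv_inv (w : Equiv.Perm (Fin m)) : inv w⁻¹ = inv w := by
  refine Finset.card_bij' (fun p _ => (w⁻¹ p.2, w⁻¹ p.1)) (fun p _ => (w p.2, w p.1))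
    ?_ ?_ ?_ ?_ <;> simp +contextual [mem_invSet]

theorem inv_mul_refl {a : Adj m} {w : Equiv.Perm (Fin m)} (h : w a.lo < w a.hi) :
    inv (w * a.refl) = inv w + 1 := by
  rw [← inv_inv, mul_inv_rev, refl_inv, inv_refl_mul (by simpa using h), inv_inv]

theorem inv_mul_refl_desc {a : Adj m} {w : Equiv.Perm (Fin m)} (h : w a.hi < w a.lo) :
    inv (w * a.refl) + 1 = inv w := by
  rw [← inv_inv, mul_inv_rev, refl_inv, inv_refl_mul_desc (by simpa using h), inv_inv]

theorem eq_one_of_adj {w : Equiv.Perm (Fin m)} (h : ∀ a : Adj m, w a.lo < w a.hi) : w = 1 := by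
  have hm : StrictMono w := by
    cases m with
    | zero => intro i; exact i.elim0
    | succ n => exact Fin.strictMono_iff_lt_succ.2 fun i => h ⟨i, by omega⟩
  have : (hm.orderIsoOfSurjective w w.surjective) = OrderIso.refl _ := Subsingleton.elim _ _
  exact Equiv.ext fun i => congrArg (fun e : Fin m ≃o Fin m => e i) this

theorem exists_desc {w : Equiv.Perm (Fin m)} (h : w ≠ 1) : ∃ a : Adj m, w a.hi < w a.lo := by
  by_contra! hc
  exact h (eq_one_of_adj fun a => lt_of_le_of_ne (hc a) fun e => lo_ne_hi a (w.injective e))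

theorem exists_desc_left {w : Equiv.Perm (Fin m)} (h : w ≠ 1) :
    ∃ a : Adj m, w⁻¹ a.hi < w⁻¹ a.lo := exists_desc (by simpa using h)

theorem inv_eq_zero {w : Equiv.Perm (Fin m)} : inv w = 0 ↔ w = 1 := by
  refine ⟨fun h => ?_, fun h => by rw [h, inv_one]⟩
  by_contra h1
  obtain ⟨a, ha⟩ := exists_desc_left h1
  have := inv_refl_mul_desc ha
  omega

/-- The permutation spelled by a word in the simple reflections. -/
abbrev wordPerm (l : List (Adj m)) : Equiv.Perm (Fin m) := (l.map Adj.refl).prod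

theorem inv_mul_wordPerm_le (l : List (Adj m)) (w : Equiv.Perm (Fin m)) :
    inv (wordPerm l * w) ≤ l.length + inv w := by
  induction l with
  | nil => simp [wordPerm]
  | cons a l ih =>
    have := inv_refl_mul_le a (wordPerm l * w)
    simp only [wordPerm, List.map_cons, List.prod_cons, List.length_cons, mul_assoc] at *
    omega

theorem inv_wordPerm_le (l : List (Adj m)) : inv (wordPerm l) ≤ l.length := by
  simpa using inv_mul_wordPerm_le l 1

theorem exists_reduced (w : Equiv.Perm (Fin m)) :
    ∃ l : List (Adj m), wordPerm l = w ∧ l.length = inv w := by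
  induction h : inv w generalizing w with
  | zero => exact ⟨[], by simp [wordPerm, inv_eq_zero.1 h], rfl⟩
  | succ k ih =>
    obtain ⟨a, ha⟩ := exists_desc_left (w := w) (fun e => by simp [e] at h)
    have h1 := inv_refl_mul_desc ha
    obtain ⟨l, hl, hk⟩ := ih (a.refl * w) (by omega)
    exact ⟨a :: l, by simp only [wordPerm, List.map_cons, List.prod_cons] at *; rw [hl, refl_mul_cancel],
      by simp [hk]⟩

theorem wordPerm_redWord (w : Equiv.Perm (Fin m)) : wordPerm (redWord w) = w :=
  (exists_redWord w).choose_spec.1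

theorem length_redWord (w : Equiv.Perm (Fin m)) : (redWord w).length = inv w := by
  obtain ⟨l, hl, hk⟩ := exists_reduced w
  have h1 := (exists_redWord w).choose_spec.2 l hl
  have h2 := inv_wordPerm_le (redWord w)
  rw [wordPerm_redWord] at h2
  exact le_antisymm (h1.trans hk.le) h2

theorem inv_mul_le (v w : Equiv.Perm (Fin m)) : inv (v * w) ≤ inv v + inv w := by
  have := inv_mul_wordPerm_le (redWord v) w
  rwa [wordPerm_redWord, length_redWord] at this

/-- If the first letter of a reduced word is split off, the rest is reduced. -/
theorem reduced_cons {a : Adj m} {l : List (Adj m)} {w : Equiv.Perm (Fin m)}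
    (hw : wordPerm (a :: l) = w) (hl : (a :: l).length = inv w) :
    wordPerm l = a.refl * w ∧ l.length = inv (a.refl * w) ∧ w⁻¹ a.hi < w⁻¹ a.lo := by
  have h1 : wordPerm l = a.refl * w := by
    rw [← hw]; simp only [wordPerm, List.map_cons, List.prod_cons]; rw [refl_mul_cancel]
  have h2 := inv_wordPerm_le l
  rw [h1] at h2
  simp only [List.length_cons] at hl
  rcases asc_or_desc a w⁻¹ with h | h
  · have := inv_refl_mul h; omega
  · have := inv_refl_mul_desc h
    exact ⟨h1, by omega, h⟩

theorem refl_apply_far {a b : Adj m} (h : a.1 + 1 < b.1) :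
    a.refl b.lo = b.lo ∧ a.refl b.hi = b.hi ∧ b.refl a.lo = a.lo ∧ b.refl a.hi = a.hi := by
  refine ⟨refl_of_ne _ ?_ ?_, refl_of_ne _ ?_ ?_, refl_of_ne _ ?_ ?_, refl_of_ne _ ?_ ?_⟩ <;>
    simp only [Adj.hi, Adj.lo, ne_eq, Fin.mk.injEq] <;> omega

theorem refl_apply_near {a b : Adj m} (h : b.1 = a.1 + 1) :
    b.lo = a.hi ∧ a.refl b.hi = b.hi ∧ b.refl a.lo = a.lo ∧ b.refl a.hi = b.hi := by
  have e : b.lo = a.hi := by simp only [Adj.hi, Adj.lo, Fin.mk.injEq]; omega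
  refine ⟨e, refl_of_ne _ ?_ ?_, refl_of_ne _ ?_ ?_, ?_⟩
  · simp only [Adj.hi, Adj.lo, ne_eq, Fin.mk.injEq]; omega
  · simp only [Adj.hi, Adj.lo, ne_eq, Fin.mk.injEq]; omega
  · simp only [Adj.hi, Adj.lo, ne_eq, Fin.mk.injEq]; omega
  · simp only [Adj.hi, Adj.lo, ne_eq, Fin.mk.injEq]; omega
  · rw [← e, refl_lo]

theorem refl_comm_far {a b : Adj m} (h : a.1 + 1 < b.1) : a.refl * b.refl = b.refl * a.refl := by
  obtain ⟨h1, h2, h3, h4⟩ := refl_apply_far h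
  refine Equiv.ext fun i => ?_
  simp only [Equiv.Perm.mul_apply]
  by_cases e1 : i = a.lo
  · subst e1; rw [h3, refl_lo, h4]
  by_cases e2 : i = a.hi
  · subst e2; rw [h4, refl_hi, h3]
  by_cases e3 : i = b.lo
  · subst e3; rw [h1, refl_lo, h2]
  by_cases e4 : i = b.hi
  · subst e4; rw [h2, refl_hi, h1]
  rw [refl_of_ne a e1 e2, refl_of_ne b e3 e4, refl_of_ne a e1 e2]

theorem refl_braid {a b : Adj m} (h : b.1 = a.1 + 1) :
    a.refl * (b.refl * a.refl) = b.refl * (a.refl * b.refl) := by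
  obtain ⟨h1, h2, h3, h4⟩ := refl_apply_near h
  have h5 : b.refl b.hi = a.hi := by rw [refl_hi, h1]
  refine Equiv.ext fun i => ?_
  simp only [Equiv.Perm.mul_apply]
  by_cases e1 : i = a.lo
  · subst e1; rw [refl_lo, h4, h2, h3, refl_lo, h4]
  by_cases e2 : i = a.hi
  · subst e2; rw [refl_hi, h3, refl_lo, h4, h2, h5]
  by_cases e3 : i = b.hi
  · subst e3; rw [h2, h5, refl_hi, h3]
  have q1 := refl_of_ne a e1 e2
  have q2 := refl_of_ne b (by rw [h1]; exact e2) e3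
  rw [q1, q2, q1, q2]

/-- **Matsumoto's theorem** for symmetric groups: in a monoid with elements which satisfy the braid
relations, the product along a reduced word depends only on the permutation. -/
theorem reduced_prod_eq {M : Type*} [Monoid M] (f : Adj m → M)
    (hc : ∀ a b : Adj m, a.1 + 1 < b.1 → f a * f b = f b * f a)
    (hb : ∀ a b : Adj m, b.1 = a.1 + 1 → f a * f b * f a = f b * f a * f b)
    {l l' : List (Adj m)} {w : Equiv.Perm (Fin m)} (hw : wordPerm l = w) (hl : l.length = inv w)
    (hw' : wordPerm l' = w) (hl' : l'.length = inv w) : (l.map f).prod = (l'.map f).prod := by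
  induction hk : inv w using Nat.strong_induction_on generalizing w l l' with
  | _ k ih =>
  cases l with
  | nil =>
    rw [← hl] at hl'
    rw [List.eq_nil_of_length_eq_zero hl']
  | cons a l =>
  cases l' with
  | nil => rw [← hl'] at hl; simp at hl
  | cons b l' =>
  obtain ⟨h1, h2, h3⟩ := reduced_cons hw hl
  obtain ⟨h1', h2', h3'⟩ := reduced_cons hw' hl'
  have ia := inv_refl_mul_desc h3
  have ib := inv_refl_mul_desc h3'
  -- both words are compared with words which begin with `a b` and `b a`
  have far (a b : Adj m) (hab : a.1 + 1 < b.1) (h3 : w⁻¹ a.hi < w⁻¹ a.lo)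
      (h3' : w⁻¹ b.hi < w⁻¹ b.lo) (l l' : List (Adj m)) (h1 : wordPerm l = a.refl * w)
      (h2 : l.length = inv (a.refl * w)) (h1' : wordPerm l' = b.refl * w)
      (h2' : l'.length = inv (b.refl * w)) :
      f a * (l.map f).prod = f b * (l'.map f).prod := by
    have ia := inv_refl_mul_desc h3
    have ib := inv_refl_mul_desc h3'
    obtain ⟨e1, e2, e3, e4⟩ := refl_apply_far hab
    have ic : inv (b.refl * (a.refl * w)) + 1 = inv (a.refl * w) := inv_refl_mul_desc (by
      rwa [refl_mul_inv_apply, refl_mul_inv_apply, e1, e2])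
    obtain ⟨l0, hl0, hl0'⟩ := exists_reduced (b.refl * (a.refl * w))
    have s1 := ih _ (by omega) h1 h2 (l' := b :: l0)
      (by simp only [wordPerm, List.map_cons, List.prod_cons] at *; rw [hl0, refl_mul_cancel])
      (by simp; omega) rfl
    have s2 := ih _ (by omega) h1' h2' (l' := a :: l0)
      (by simp only [wordPerm, List.map_cons, List.prod_cons] at *
          rw [hl0, ← mul_assoc b.refl, ← refl_comm_far hab, mul_assoc, refl_mul_cancel])
      (by simp; omega) rfl
    rw [s1, s2, List.map_cons, List.map_cons, List.prod_cons, List.prod_cons, ← mul_assoc,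
      ← mul_assoc, hc a b hab]
  -- both words are compared with words which begin with `a b a` and `b a b`
  have near (a b : Adj m) (hab : b.1 = a.1 + 1) (h3 : w⁻¹ a.hi < w⁻¹ a.lo)
      (h3' : w⁻¹ b.hi < w⁻¹ b.lo) (l l' : List (Adj m)) (h1 : wordPerm l = a.refl * w)
      (h2 : l.length = inv (a.refl * w)) (h1' : wordPerm l' = b.refl * w)
      (h2' : l'.length = inv (b.refl * w)) :
      f a * (l.map f).prod = f b * (l'.map f).prod := by
    have ia := inv_refl_mul_desc h3
    have ib := inv_refl_mul_desc h3'
    obtain ⟨e1, e2, e3, e4⟩ := refl_apply_near hab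
    rw [e1] at h3'
    have ic : inv (b.refl * (a.refl * w)) + 1 = inv (a.refl * w) := inv_refl_mul_desc (by
      rw [refl_mul_inv_apply, refl_mul_inv_apply, e2, e1, refl_hi]; exact h3'.trans h3)
    have id : inv (a.refl * (b.refl * (a.refl * w))) + 1 = inv (b.refl * (a.refl * w)) :=
      inv_refl_mul_desc (by
        rw [refl_mul_inv_apply, refl_mul_inv_apply, refl_mul_inv_apply, refl_mul_inv_apply, e3,
          refl_lo, e4, e2]
        exact h3')
    have br : a.refl * (b.refl * (a.refl * w)) = b.refl * (a.refl * (b.refl * w)) := by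
      have := congrArg (· * w) (refl_braid hab)
      simpa only [mul_assoc] using this
    obtain ⟨l0, hl0, hl0'⟩ := exists_reduced (a.refl * (b.refl * (a.refl * w)))
    have s1 := ih _ (by omega) h1 h2 (l' := b :: a :: l0)
      (by simp only [wordPerm, List.map_cons, List.prod_cons] at *
          rw [hl0, refl_mul_cancel, refl_mul_cancel])
      (by simp; omega) rfl
    have s2 := ih _ (by omega) h1' h2' (l' := a :: b :: l0)
      (by simp only [wordPerm, List.map_cons, List.prod_cons] at *
          rw [hl0, br, refl_mul_cancel, refl_mul_cancel])
      (by simp; omega) rfl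
    rw [s1, s2]
    simp only [List.map_cons, List.prod_cons, ← mul_assoc]
    rw [hb a b hab]
  rw [List.map_cons, List.map_cons, List.prod_cons, List.prod_cons]
  rcases lt_trichotomy a.1 b.1 with h | h | h
  · rcases (Nat.succ_le_of_lt h).lt_or_eq with h' | h'
    · exact far a b h' h3 h3' l l' h1 h2 h1' h2'
    · exact near a b h'.symm h3 h3' l l' h1 h2 h1' h2'
  · obtain rfl : a = b := Subtype.ext h
    rw [ih _ (by omega) h1 h2 h1' h2' rfl]
  · rcases (Nat.succ_le_of_lt h).lt_or_eq with h' | h'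
    · exact (far b a h' h3' h3 l' l h1' h2' h1 h2).symm
    · exact (near b a h'.symm h3' h3 l' l h1' h2' h1 h2).symm

section RedProd

variable {M : Type*} [Monoid M] {f : Adj m → M}
  (hc : ∀ a b : Adj m, a.1 + 1 < b.1 → f a * f b = f b * f a)
  (hb : ∀ a b : Adj m, b.1 = a.1 + 1 → f a * f b * f a = f b * f a * f b)

include hc hb

theorem redWord_prod_refl_mul {a : Adj m} {w : Equiv.Perm (Fin m)} (h : w⁻¹ a.lo < w⁻¹ a.hi) :
    ((redWord (a.refl * w)).map f).prod = f a * ((redWord w).map f).prod := by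
  have := reduced_prod_eq f hc hb (wordPerm_redWord (a.refl * w)) (length_redWord _)
    (l' := a :: redWord w)
    (by rw [wordPerm, List.map_cons, List.prod_cons]; exact congrArg _ (wordPerm_redWord w))
    (by rw [List.length_cons, length_redWord, inv_refl_mul h])
  rwa [List.map_cons, List.prod_cons] at this

theorem redWord_prod_mul_refl {a : Adj m} {w : Equiv.Perm (Fin m)} (h : w a.lo < w a.hi) :
    ((redWord (w * a.refl)).map f).prod = ((redWord w).map f).prod * f a := by
  have := reduced_prod_eq f hc hb (wordPerm_redWord (w * a.refl)) (length_redWord _)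
    (l' := redWord w ++ [a])
    (by rw [wordPerm, List.map_append, List.prod_append]
        exact congrArg₂ _ (wordPerm_redWord w) (by simp))
    (by rw [List.length_append, length_redWord, inv_mul_refl h]; rfl)
  rwa [List.map_append, List.prod_append, List.map_singleton, List.prod_singleton] at this

end RedProd

theorem redWord_one : redWord (1 : Equiv.Perm (Fin m)) = [] :=
  List.eq_nil_of_length_eq_zero (by rw [length_redWord, inv_one])

/-! ### Young subgroups -/

/-- The strands of the pair `a` belong to the same block of the composition. -/
def Comp.Inner {n : ℕ} (μ : Comp n m) (a : Adj m) : Prop :=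
  (μ.coord a.lo).1 = (μ.coord a.hi).1

theorem Comp.coord_mono {n : ℕ} (μ : Comp n m) {t t' : Fin m} (h : t ≤ t') :
    (μ.coord t).1 ≤ (μ.coord t').1 := by
  rcases h.eq_or_lt with rfl | h
  · rfl
  · rcases μ.coord_lt h with h | h
    · exact h.le
    · exact h.1.le

theorem Comp.mem_young {n : ℕ} {μ : Comp n m} {w : Equiv.Perm (Fin m)} :
    w ∈ μ.young ↔ ∀ t, (μ.coord (w t)).1 = (μ.coord t).1 := by simp [Comp.young]

theorem Comp.inv_mem_young {n : ℕ} {μ : Comp n m} {w : Equiv.Perm (Fin m)} (h : w ∈ μ.young) :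
    w⁻¹ ∈ μ.young := by
  rw [Comp.mem_young] at *
  intro t
  conv_rhs => rw [← Equiv.apply_symm_apply w t, h]
  rfl

theorem Comp.mul_mem_young {n : ℕ} {μ : Comp n m} {v w : Equiv.Perm (Fin m)} (hv : v ∈ μ.young)
    (hw : w ∈ μ.young) : v * w ∈ μ.young := by
  rw [Comp.mem_young] at *
  intro t
  rw [Equiv.Perm.mul_apply, hv, hw]

theorem Comp.Inner.refl_mem {n : ℕ} {μ : Comp n m} {a : Adj m} (h : μ.Inner a) :
    a.refl ∈ μ.young := by
  rw [Comp.mem_young]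
  intro t
  by_cases h1 : t = a.lo
  · subst h1; rw [refl_lo]; exact h.symm
  by_cases h2 : t = a.hi
  · subst h2; rw [refl_hi]; exact h
  rw [refl_of_ne a h1 h2]

/-- A descent of an element of a Young subgroup is within a block. -/
theorem Comp.inner_of_desc {n : ℕ} {μ : Comp n m} {w : Equiv.Perm (Fin m)} (hw : w ∈ μ.young)
    {a : Adj m} (h : w a.hi < w a.lo) : μ.Inner a := by
  rw [Comp.mem_young] at hw
  refine le_antisymm (μ.coord_mono a.lo_lt_hi.le) ?_
  have := μ.coord_mono h.le
  rwa [hw, hw] at this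

/-- The letters of a reduced word of an element of a Young subgroup are within blocks. -/
theorem Comp.inner_of_mem_reduced {n : ℕ} {μ : Comp n m} {w : Equiv.Perm (Fin m)}
    (hw : w ∈ μ.young) {l : List (Adj m)} (hl : wordPerm l = w) (hl' : l.length = inv w) :
    ∀ a ∈ l, μ.Inner a := by
  induction l generalizing w with
  | nil => simp
  | cons b l ih =>
    obtain ⟨h1, h2, h3⟩ := reduced_cons hl hl'
    have hb : μ.Inner b := Comp.inner_of_desc (Comp.inv_mem_young hw) h3
    intro a ha
    rcases List.mem_cons.1 ha with rfl | ha
    · exact hb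
    · exact ih (Comp.mul_mem_young hb.refl_mem hw) h1 h2 a ha

theorem Comp.inner_of_mem_redWord {n : ℕ} {μ : Comp n m} {w : Equiv.Perm (Fin m)}
    (hw : w ∈ μ.young) : ∀ a ∈ redWord w, μ.Inner a :=
  Comp.inner_of_mem_reduced hw (wordPerm_redWord w) (length_redWord w)

theorem Comp.lt_iff_coord {n : ℕ} (μ : Comp n m) {t t' : Fin m}
    (h : (μ.coord t).1 = (μ.coord t').1) :
    t < t' ↔ ((μ.coord t).2 : ℕ) < (μ.coord t').2 := by
  have key {t t' : Fin m} (h : (μ.coord t).1 = (μ.coord t').1) (h' : t < t') :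
      ((μ.coord t).2 : ℕ) < (μ.coord t').2 := by
    rcases μ.coord_lt h' with h1 | h1
    · exact absurd h h1.ne
    · exact h1.2
  refine ⟨key h, fun h' => ?_⟩
  rcases lt_trichotomy t t' with h1 | rfl | h1
  · exact h1
  · exact absurd h' (lt_irrefl _)
  · exact absurd h' (key h.symm h1).not_gt

theorem Comp.coord_longest {n : ℕ} (μ : Comp n m) (t : Fin m) :
    μ.coord (μ.longest t) = ⟨(μ.coord t).1, (μ.coord t).2.rev⟩ := by
  simp [Comp.longest, Equiv.permCongr_apply]

theorem Comp.longest_mem {n : ℕ} (μ : Comp n m) : μ.longest ∈ μ.young := by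
  rw [Comp.mem_young]
  intro t
  rw [μ.coord_longest]

theorem Comp.longest_lt {n : ℕ} (μ : Comp n m) {t t' : Fin m}
    (h : (μ.coord t).1 = (μ.coord t').1) : μ.longest t < μ.longest t' ↔ t' < t := by
  rw [μ.lt_iff_coord (by rw [μ.coord_longest, μ.coord_longest]; exact h), μ.lt_iff_coord h.symm,
    μ.coord_longest, μ.coord_longest]
  have h1 := (μ.coord t).2.2
  have h2 := (μ.coord t').2.2
  have h3 := congrArg μ.1 h
  simp only [Fin.val_rev]
  omega

theorem Comp.longest_mul_self {n : ℕ} (μ : Comp n m) : μ.longest * μ.longest = 1 := by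
  refine Equiv.ext fun t => μ.coord.injective ?_
  rw [Equiv.Perm.mul_apply, μ.coord_longest]
  rw [Sigma.ext_iff]
  have := μ.coord_longest t
  generalize μ.coord (μ.longest t) = z at *
  subst this
  simp

theorem Comp.longest_inv {n : ℕ} (μ : Comp n m) : μ.longest⁻¹ = μ.longest :=
  inv_eq_of_mul_eq_one_left μ.longest_mul_self

/-- If all simple reflections of the Young subgroup are left descents of `w`, then `w⁻¹` reverses
the order of all the blocks. -/
theorem Comp.inv_lt_of_desc {n : ℕ} {μ : Comp n m} {w : Equiv.Perm (Fin m)}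
    (h : ∀ a, μ.Inner a → w a.hi < w a.lo) {t t' : Fin m} (htt : t < t')
    (hb : (μ.coord t).1 = (μ.coord t').1) : w t' < w t := by
  have key (k : ℕ) : ∀ t t' : Fin m, (t' : ℕ) = t + (k + 1) → (μ.coord t).1 = (μ.coord t').1 →
      w t' < w t := by
    induction k with
    | zero =>
      intro t t' h1 h2
      have e : t' = Adj.hi ⟨t, by omega⟩ := Fin.ext h1
      rw [e] at h2 ⊢
      exact h ⟨t, by omega⟩ h2
    | succ k ih =>
      intro t t' h1 h2
      let u : Fin m := ⟨t + (k + 1), by omega⟩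
      have h3 : (μ.coord t).1 = (μ.coord u).1 := by
        refine le_antisymm (μ.coord_mono (Fin.le_def.2 (by simp [u]))) ?_
        rw [h2]
        exact μ.coord_mono (Fin.le_def.2 (by simp [u]; omega))
      refine lt_trans ?_ (ih t u rfl h3)
      have e : t' = Adj.hi ⟨u, by simp [u]; omega⟩ := Fin.ext (by rw [h1]; rfl)
      rw [h3, e] at h2
      rw [e]
      exact h ⟨u, by simp [u]; omega⟩ h2
  exact key (t' - t - 1) t t' (by have := Fin.lt_def.1 htt; omega) hb

/-- In a Young subgroup only the longest element has all simple reflections as descents. -/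
theorem Comp.eq_longest {n : ℕ} {μ : Comp n m} {w : Equiv.Perm (Fin m)} (hw : w ∈ μ.young)
    (h : ∀ a, μ.Inner a → w a.hi < w a.lo) : w = μ.longest := by
  have h1 : w * μ.longest = 1 := by
    by_contra hne
    obtain ⟨a, ha⟩ := exists_desc hne
    have hi := Comp.inner_of_desc (Comp.mul_mem_young hw μ.longest_mem) ha
    simp only [Equiv.Perm.mul_apply] at ha
    have h2 : μ.longest a.hi < μ.longest a.lo := (μ.longest_lt hi.symm).2 a.lo_lt_hi
    refine absurd ha (Comp.inv_lt_of_desc h h2 ?_).not_gt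
    rw [μ.coord_longest, μ.coord_longest]
    exact hi.symm
  have := congrArg (· * μ.longest) h1
  simpa [mul_assoc, μ.longest_mul_self] using this

/-- The minimal representatives of the cosets of a Young subgroup: lengths add when they are
multiplied by the longest element. -/
theorem Comp.inv_mul_longest {n : ℕ} (μ : Comp n m) {w : Equiv.Perm (Fin m)}
    (h : ∀ t t', t < t' → (μ.coord t).1 = (μ.coord t').1 → w t < w t') :
    inv (w * μ.longest) = inv w + inv μ.longest := by
  refine le_antisymm (inv_mul_le _ _) ?_
  classical
  have hL (t : Fin m) : (μ.coord (μ.longest t)).1 = (μ.coord t).1 := by rw [μ.coord_longest]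
  -- the inversions of the product are those of `longest` and the translates of those of `w`
  let J : Finset (Fin m × Fin m) := (invSet w).image fun p => (μ.longest p.1, μ.longest p.2)
  have hne (p : Fin m × Fin m) (hp : p ∈ invSet w) : (μ.coord p.1).1 ≠ (μ.coord p.2).1 := by
    intro e
    rw [mem_invSet] at hp
    exact lt_asymm hp.2 (h _ _ hp.1 e)
  have hll (t : Fin m) : μ.longest (μ.longest t) = t := by
    rw [← Equiv.Perm.mul_apply, μ.longest_mul_self]; rfl
  have hJ : J.card = inv w := Finset.card_image_of_injective _ fun p p' e => by
    simp only [Prod.mk.injEq, EmbeddingLike.apply_eq_iff_eq] at e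
    exact Prod.ext e.1 e.2
  have hd : Disjoint J (invSet μ.longest) := by
    rw [Finset.disjoint_left]
    intro p hp hp'
    obtain ⟨p₀, hp₀, rfl⟩ := Finset.mem_image.1 hp
    rw [mem_invSet] at hp'
    simp only [hll] at hp'
    exact lt_asymm hp'.2 (mem_invSet.1 hp₀).1
  rw [← hJ, inv, inv, ← Finset.card_union_of_disjoint hd]
  refine Finset.card_le_card fun p hp => ?_
  rw [mem_invSet, Equiv.Perm.mul_apply, Equiv.Perm.mul_apply]
  rcases Finset.mem_union.1 hp with hp | hp
  · obtain ⟨p₀, hp₀, rfl⟩ := Finset.mem_image.1 hp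
    simp only [hll]
    refine ⟨?_, (mem_invSet.1 hp₀).2⟩
    by_contra hle
    have h1 := μ.coord_mono (not_lt.1 hle)
    rw [hL, hL] at h1
    exact hne p₀ hp₀ (le_antisymm (μ.coord_mono (mem_invSet.1 hp₀).1.le) h1)
  · replace hp := mem_invSet.1 hp
    refine ⟨hp.1, h _ _ hp.2 ?_⟩
    rw [hL, hL]
    refine le_antisymm ?_ (μ.coord_mono hp.1.le)
    have := μ.coord_mono hp.2.le
    rwa [hL, hL] at this

end Perm

/-! ### Chambers as monotone relations -/

section Grid

variable {m : ℕ}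

/-- The relations `S` of the form "strand `i` is to the left of the ghost of strand `j`": they
are preserved when `i` moves to the left and `j` to the right, and `S i i` is decided by the sign
of `κ`. -/
structure IsSide (κ : ℝ) (S : Fin m → Fin m → Prop) : Prop where
  mono : ∀ ⦃i i' j j' : Fin m⦄, S i j → i' ≤ i → j ≤ j' → S i' j'
  diag : ∀ i, S i i ↔ 0 < κ

theorem Config.isSide {κ : ℝ} (x : Config κ m) : IsSide κ (Side x) where
  mono i i' j j' h hi hj := by
    have h1 := x.strictMono.monotone hi
    have h2 := x.strictMono.monotone hj
    unfold Side at *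
    linarith
  diag i := by simp [Side]

/-- Every relation as above comes from a configuration: the strands are placed from left to right,
each between the positions which bound it from below and those which bound it from above. -/
theorem IsSide.exists_config_of_pos {κ : ℝ} (hκ : 0 < κ) {S : Fin m → Fin m → Prop}
    (hS : IsSide κ S) : ∃ x : Config κ m, ∀ i j, Side x i j ↔ S i j := by
  have key (k : ℕ) : k ≤ m → ∃ p : Fin m → ℝ, ∀ i j : Fin m, (i : ℕ) < k → (j : ℕ) < k →
      (i < j → p i < p j) ∧ (p i < p j + κ ↔ S i j) ∧ p i ≠ p j + κ := by
    induction k with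
    | zero => exact fun _ => ⟨0, fun i j h => absurd h (Nat.not_lt_zero _)⟩
    | succ k ih =>
      intro hk
      obtain ⟨p, hp⟩ := ih (by omega)
      classical
      let e : Fin m := ⟨k, hk⟩
      -- the position of the next strand has to be larger than those of the strands placed before
      -- and than those of the ghosts to its left, and smaller than those of the ghosts to its
      -- right
      obtain ⟨v, hv1, hv2⟩ := Order.exists_between_finsets
        ((Finset.univ.filter fun i : Fin m => (i : ℕ) < k).image p ∪
          (Finset.univ.filter fun j : Fin m => (j : ℕ) < k ∧ ¬ S e j).image fun j => p j + κ)
        ((Finset.univ.filter fun j : Fin m => (j : ℕ) < k ∧ S e j).image fun j => p j + κ) (by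
          intro a ha b hb
          simp only [Finset.mem_union, Finset.mem_image, Finset.mem_filter, Finset.mem_univ,
            true_and] at ha hb
          obtain ⟨j, ⟨hj, hj'⟩, rfl⟩ := hb
          rcases ha with ⟨i, hi, rfl⟩ | ⟨i, ⟨hi, hi'⟩, rfl⟩
          · exact (hp i j hi hj).2.1.2 (hS.mono hj' (Fin.le_def.2 hi.le) le_rfl)
          · have : i < j := not_le.1 fun h => hi' (hS.mono hj' le_rfl h)
            have := (hp i j hi hj).1 this
            linarith)
      simp only [Finset.mem_union, Finset.mem_image, Finset.mem_filter, Finset.mem_univ,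
        true_and] at hv1 hv2
      have b1 (i : Fin m) (hi : (i : ℕ) < k) : p i < v := hv1 _ (Or.inl ⟨i, hi, rfl⟩)
      have b2 (j : Fin m) (hj : (j : ℕ) < k) (h : ¬ S e j) : p j + κ < v :=
        hv1 _ (Or.inr ⟨j, ⟨hj, h⟩, rfl⟩)
      have b3 (j : Fin m) (hj : (j : ℕ) < k) (h : S e j) : v < p j + κ :=
        hv2 _ ⟨j, ⟨hj, h⟩, rfl⟩
      have ne (i : Fin m) (hi : (i : ℕ) < k) : i ≠ e := fun h => by
        rw [h] at hi; exact lt_irrefl _ hi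
      have eq (i : Fin m) (hi : ¬ (i : ℕ) < k) (hi' : (i : ℕ) < k + 1) : i = e :=
        Fin.ext (by simp [e]; omega)
      refine ⟨Function.update p e v, fun i j hi hj => ?_⟩
      by_cases hi' : (i : ℕ) < k <;> by_cases hj' : (j : ℕ) < k
      · rw [Function.update_of_ne (ne i hi'), Function.update_of_ne (ne j hj')]
        exact hp i j hi' hj'
      · rw [Function.update_of_ne (ne i hi')]
        obtain rfl := eq j hj' hj
        rw [Function.update_self]
        have := b1 i hi'
        refine ⟨fun _ => this, iff_of_true (by linarith) ?_, by intro h; linarith⟩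
        exact hS.mono ((hS.diag e).2 hκ) (Fin.le_def.2 hi'.le) le_rfl
      · rw [Function.update_of_ne (ne j hj')]
        obtain rfl := eq i hi' hi
        rw [Function.update_self]
        refine ⟨fun h => absurd (Fin.lt_def.1 h) (by simp [e]; omega), ?_, ?_⟩
        · by_cases h : S e j
          · exact iff_of_true (b3 j hj' h) h
          · exact iff_of_false (b2 j hj' h).not_gt h
        · by_cases h : S e j
          · exact (b3 j hj' h).ne
          · exact (b2 j hj' h).ne'
      · obtain rfl := eq i hi' hi
        obtain rfl := eq j hj' hj
        exact ⟨fun h => absurd h (lt_irrefl _), iff_of_true (by linarith) ((hS.diag _).2 hκ),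
          by intro h; linarith⟩
  obtain ⟨p, hp⟩ := key m le_rfl
  exact ⟨⟨p, fun i j h => (hp i j i.2 j.2).1 h, fun i j => (hp i j i.2 j.2).2.2⟩,
    fun i j => (hp i j i.2 j.2).2.1⟩

/-- Reflecting the roles of strands and ghosts changes the sign of `κ`. -/
theorem IsSide.dual {κ : ℝ} (hκ : κ ≠ 0) {S : Fin m → Fin m → Prop} (hS : IsSide κ S) :
    IsSide (-κ) fun i j => ¬ S j i where
  mono i i' j j' h hi hj h' := h (hS.mono h' hj hi)
  diag i := by
    rw [hS.diag, not_lt, neg_pos]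
    exact ⟨fun h => lt_of_le_of_ne h hκ, le_of_lt⟩

theorem IsSide.exists_config {κ : ℝ} (hκ : κ ≠ 0) {S : Fin m → Fin m → Prop}
    (hS : IsSide κ S) : ∃ x : Config κ m, ∀ i j, Side x i j ↔ S i j := by
  rcases lt_or_gt_of_ne hκ with h | h
  · obtain ⟨x, hx⟩ := (hS.dual hκ).exists_config_of_pos (neg_pos.2 h)
    refine ⟨⟨x.pos, x.strictMono, fun i j e => x.generic j i (by linarith)⟩, fun i j => ?_⟩
    have h1 := hx j i
    have h2 := x.generic j i
    rw [← not_iff_not, ← h1]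
    simp only [Side]
    rw [not_lt]
    refine ⟨fun h => lt_of_le_of_ne (by linarith) h2, fun h => by linarith⟩
  · exact hS.exists_config_of_pos h

/-- The value of `S` at `(r, t)` may be changed. -/
def Corner (S : Fin m → Fin m → Prop) (r t : Fin m) : Prop :=
  (S r t ∧ (∀ i, r < i → ¬ S i t) ∧ ∀ j, j < t → ¬ S r j) ∨
    (¬ S r t ∧ (∀ i, i < r → S i t) ∧ ∀ j, t < j → S r j)

/-- The relation `S` with its value at `(r, t)` changed. -/
def toggle (S : Fin m → Fin m → Prop) (r t i j : Fin m) : Prop := S i j ↔ ¬ (i = r ∧ j = t)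

theorem toggle_of_ne {S : Fin m → Fin m → Prop} {r t i j : Fin m} (h : ¬ (i = r ∧ j = t)) :
    toggle S r t i j ↔ S i j := by simp [toggle, h]

theorem toggle_self {S : Fin m → Fin m → Prop} {r t : Fin m} : toggle S r t r t ↔ ¬ S r t := by
  simp [toggle]

theorem IsSide.toggle {κ : ℝ} {S : Fin m → Fin m → Prop} (hS : IsSide κ S) {r t : Fin m}
    (hne : r ≠ t) (h : Corner S r t) : IsSide κ (toggle S r t) where
  mono i i' j j' h1 hi hj := by
    by_cases e : i = r ∧ j = t
    · obtain ⟨rfl, rfl⟩ := e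
      by_cases e' : i' = i ∧ j' = j
      · rwa [e'.1, e'.2]
      rw [toggle_self] at h1
      rw [toggle_of_ne e']
      rcases h with h | ⟨_, h2, h3⟩
      · exact absurd h.1 h1
      rcases hi.eq_or_lt with rfl | hi
      · rcases hj.eq_or_lt with rfl | hj
        · exact absurd ⟨rfl, rfl⟩ e'
        · exact h3 _ hj
      · exact hS.mono (h2 _ hi) le_rfl hj
    · rw [toggle_of_ne e] at h1
      by_cases e' : i' = r ∧ j' = t
      · obtain ⟨rfl, rfl⟩ := e'
        rw [toggle_self]
        rcases h with ⟨_, h2, h3⟩ | ⟨h, _⟩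
        · rcases hi.eq_or_lt with rfl | hi
          · rcases hj.eq_or_lt with rfl | hj
            · exact absurd ⟨rfl, rfl⟩ e
            · exact absurd h1 (h3 _ hj)
          · exact absurd (hS.mono h1 le_rfl hj) (h2 _ hi)
        · exact h
      · rw [toggle_of_ne e']
        exact hS.mono h1 hi hj
  diag i := by
    rw [toggle_of_ne (fun h => hne (h.1.symm.trans h.2)), hS.diag]

/-- Two values of `S` may be changed independently, unless they are at adjacent places of the same
row or column. -/
theorem Corner.of_toggle {S : Fin m → Fin m → Prop} {r t r' t' : Fin m} (h' : Corner S r' t')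
    (hne : ¬ (r' = r ∧ t' = t)) (hc : r = r' ∨ t = t' → (S r t ↔ S r' t')) :
    Corner (toggle S r t) r' t' := by
  have aux (i j : Fin m) (hij : i = r' ∨ j = t') (h1 : S i j ↔ ¬ S r' t') :
      toggle S r t i j ↔ S i j := by
    refine toggle_of_ne fun h => ?_
    obtain ⟨rfl, rfl⟩ := h
    have := hc hij
    tauto
  rcases h' with ⟨h1, h2, h3⟩ | ⟨h1, h2, h3⟩
  · refine Or.inl ⟨(toggle_of_ne hne).2 h1, fun i hi => ?_, fun j hj => ?_⟩
    · rw [aux i t' (Or.inr rfl) (iff_of_false (h2 i hi) (not_not.2 h1))]; exact h2 i hi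
    · rw [aux r' j (Or.inl rfl) (iff_of_false (h3 j hj) (not_not.2 h1))]; exact h3 j hj
  · refine Or.inr ⟨mt (toggle_of_ne hne).1 h1, fun i hi => ?_, fun j hj => ?_⟩
    · rw [aux i t' (Or.inr rfl) (iff_of_true (h2 i hi) h1)]; exact h2 i hi
    · rw [aux r' j (Or.inl rfl) (iff_of_true (h3 j hj) h1)]; exact h3 j hj

/-- The wall between the strand `r` and the ghost of `t` bounds the chamber `S` and separates it
from the chamber of `c`. -/
def GDesc (κ : ℝ) (S : Fin m → Fin m → Prop) (c : Fin m → ℝ) (r t : Fin m) : Prop :=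
  Corner S r t ∧ (S r t ↔ ¬ c r < c t + κ)

/-- The wall between two adjacent strands bounds the chamber `S` and separates it from the
chamber of `c`. -/
def XDesc (S : Fin m → Fin m → Prop) (c : Fin m → ℝ) (a : Adj m) : Prop :=
  c a.hi < c a.lo ∧ (∀ j, S a.lo j ↔ S a.hi j) ∧ ∀ i, S i a.lo ↔ S i a.hi

theorem GDesc.ne {κ : ℝ} {S : Fin m → Fin m → Prop} (hS : IsSide κ S) {c : Fin m → ℝ}
    {r t : Fin m} (h : GDesc κ S c r t) : r ≠ t := by
  rintro rfl
  have h1 := h.2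
  rw [hS.diag, lt_add_iff_pos_right] at h1
  exact iff_not_self h1

theorem exists_adj_inverted {c : Fin m → ℝ} {p p' : Fin m} (hp : p ≤ p') (h : c p' < c p) :
    ∃ a : Adj m, p ≤ a.lo ∧ a.hi ≤ p' ∧ c a.hi < c a.lo := by
  by_contra! hc
  have key (k : ℕ) (hk : (p : ℕ) + k < m) (hk' : (p : ℕ) + k ≤ p') : c p ≤ c ⟨p + k, hk⟩ := by
    induction k with
    | zero => exact le_rfl
    | succ k ih =>
      refine (ih (by omega) (by omega)).trans ?_
      exact hc ⟨p + k, hk⟩ (Fin.le_def.2 (by simp [Adj.lo])) (Fin.le_def.2 hk')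
  have h1 : (p : ℕ) + (p' - p) = p' := by have := Fin.le_def.1 hp; omega
  have := key (p' - p) (by rw [h1]; exact p'.2) h1.le
  simp only [h1] at this
  exact absurd h this.not_gt

/-- If two adjacent strands have to be exchanged and there are strands whose position relative to
the ghosts of the two differs, then there is some other wall to be crossed, away from the walls
between the two strands and a ghost. The search moves away from `a` on the side determined by the
sign of `κ`, so it terminates. -/
theorem exists_desc_of_col {κ : ℝ} (hκ : κ ≠ 0) {S : Fin m → Fin m → Prop} (hS : IsSide κ S)
    {c : Fin m → ℝ} (a : Adj m) (ha : c a.hi < c a.lo) (p : Fin m) (h1 : S p a.hi)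
    (h2 : ¬ S p a.lo) :
    (∃ b, XDesc S c b) ∨ ∃ r t, GDesc κ S c r t ∧ (0 < κ → a.lo ≤ t ∧ a.lo < r) ∧
      (κ < 0 → t ≤ a.hi ∧ r ≤ a.lo) ∧ (r = a.lo → S r t) ∧ (r = a.hi → ¬ S r t) := by
  induction hk : (if 0 < κ then m - a.1 else a.1) using Nat.strong_induction_on
    generalizing a p with
  | _ k ih =>
  classical
  have pos (p : Fin m) (h : ¬ S p a.lo) (hκ : 0 < κ) : a.lo < p :=
    not_le.1 fun h' => h (hS.mono ((hS.diag _).2 hκ) h' le_rfl)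
  have neg (p : Fin m) (h : S p a.hi) (hκ : κ < 0) : p ≤ a.lo :=
    a.lt_hi_iff.1 (not_le.1 fun h' => hκ.not_gt ((hS.diag _).1 (hS.mono h h' le_rfl)))
  -- the strands between the two ghosts; the first and the last of them are next to the ghosts
  let P : Finset (Fin m) := Finset.univ.filter fun p => S p a.hi ∧ ¬ S p a.lo
  have hP {p : Fin m} : p ∈ P ↔ S p a.hi ∧ ¬ S p a.lo := by simp [P]
  have hne : P.Nonempty := ⟨p, hP.2 ⟨h1, h2⟩⟩
  obtain ⟨x1, x2⟩ := hP.1 (P.min'_mem hne)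
  obtain ⟨y1, y2⟩ := hP.1 (P.max'_mem hne)
  have hmin (i : Fin m) (hi : i ∈ P) : P.min' hne ≤ i := P.min'_le i hi
  have hmax (i : Fin m) (hi : i ∈ P) : i ≤ P.max' hne := P.le_max' i hi
  generalize P.min' hne = x at *
  generalize P.max' hne = y at *
  have cx : Corner S x a.lo := by
    refine Or.inr ⟨x2, fun i hi => ?_, fun j hj => hS.mono x1 le_rfl (a.lo_lt_iff.1 hj)⟩
    by_contra h
    exact hi.not_ge (hmin i (hP.2 ⟨hS.mono x1 hi.le le_rfl, h⟩))
  have cy : Corner S y a.hi := by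
    refine Or.inl ⟨y1, fun i hi h => ?_, fun j hj h => y2 (hS.mono h le_rfl (a.lt_hi_iff.1 hj))⟩
    refine hi.not_ge (hmax i (hP.2 ⟨h, fun h' => y2 (hS.mono h' hi.le le_rfl)⟩))
  by_cases dx : c x < c a.lo + κ
  · have g : GDesc κ S c x a.lo := ⟨cx, iff_of_false x2 (not_not.2 dx)⟩
    exact Or.inr ⟨x, a.lo, g, fun h => ⟨le_rfl, pos x x2 h⟩,
      fun h => ⟨a.lo_lt_hi.le, neg x x1 h⟩, fun h => absurd h (g.ne hS), fun _ => x2⟩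
  by_cases dy : c y < c a.hi + κ
  swap
  · have g : GDesc κ S c y a.hi := ⟨cy, iff_of_true y1 dy⟩
    exact Or.inr ⟨y, a.hi, g, fun h => ⟨a.lo_lt_hi.le, pos y y2 h⟩,
      fun h => ⟨le_rfl, neg y y1 h⟩, fun _ => y1, fun h => absurd h (g.ne hS)⟩
  have hxy : x ≤ y := hmin y (hP.2 ⟨y1, y2⟩)
  -- neither wall has to be crossed, so the first and the last of these strands, and hence two
  -- adjacent ones, have to be exchanged
  obtain ⟨b, b1, b2, b3⟩ := exists_adj_inverted hxy (c := c) (by linarith)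
  have rows (j : Fin m) : S b.lo j ↔ S b.hi j := by
    refine ⟨fun h => ?_, fun h => hS.mono h b.lo_lt_hi.le le_rfl⟩
    by_contra h'
    by_cases hj : a.hi ≤ j
    · exact h' (hS.mono y1 b2 hj)
    · exact x2 (hS.mono h b1 (a.lt_hi_iff.1 (not_le.1 hj)))
  by_cases cols : ∀ i, S i b.lo ↔ S i b.hi
  · exact Or.inl ⟨b, b3, rows, cols⟩
  obtain ⟨i, hi⟩ := not_forall.1 cols
  have hi1 : S i b.hi ∧ ¬ S i b.lo := by
    have : S i b.lo → S i b.hi := fun h => hS.mono h le_rfl b.lo_lt_hi.le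
    tauto
  have hb1 (h : 0 < κ) : a.hi ≤ b.lo := a.lo_lt_iff.1 ((pos x x2 h).trans_le b1)
  have hb2 (h : κ < 0) : b.hi ≤ a.lo := b2.trans (neg y y1 h)
  have hlt : (if 0 < κ then m - b.1 else b.1) < k := by
    rw [← hk]
    have := b.2
    split_ifs with h
    · have := Fin.le_def.1 (hb1 h)
      simp only [Adj.lo, Adj.hi] at this
      omega
    · have := Fin.le_def.1 (hb2 (lt_of_le_of_ne (not_lt.1 h) hκ))
      simp only [Adj.lo, Adj.hi] at this
      omega
  rcases ih _ hlt b b3 i hi1.1 hi1.2 rfl with h | ⟨r, t, g, g1, g2, -, -⟩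
  · exact Or.inl h
  have hlh := a.lo_lt_hi
  refine Or.inr ⟨r, t, g, fun h => ?_, fun h => ?_, fun h => ?_, fun h => ?_⟩
  · exact ⟨hlh.le.trans ((hb1 h).trans (g1 h).1), hlh.trans ((hb1 h).trans_lt (g1 h).2)⟩
  · exact ⟨((g2 h).1.trans (hb2 h)).trans hlh.le, (g2 h).2.trans (b.lo_lt_hi.le.trans (hb2 h))⟩
  · subst h
    rcases lt_or_gt_of_ne hκ with h' | h'
    · exact absurd ((g2 h').2.trans_lt (b.lo_lt_hi.trans_le (hb2 h'))) (lt_irrefl _)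
    · exact absurd (hlh.trans ((hb1 h').trans_lt (g1 h').2)) (lt_irrefl _)
  · subst h
    rcases lt_or_gt_of_ne hκ with h' | h'
    · exact absurd (hlh.trans_le ((g2 h').2.trans (b.lo_lt_hi.le.trans (hb2 h')))) (lt_irrefl _)
    · exact absurd ((hb1 h').trans_lt (g1 h').2) (lt_irrefl _)

theorem corner_dual {S : Fin m → Fin m → Prop} {r t : Fin m} :
    Corner (fun i j => ¬ S j i) r t ↔ Corner S t r := by
  simp only [Corner, not_not]
  tauto

theorem gDesc_dual {κ : ℝ} {S : Fin m → Fin m → Prop} {c : Fin m → ℝ}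
    (hg : ∀ i j, c i ≠ c j + κ) {r t : Fin m} :
    GDesc (-κ) (fun i j => ¬ S j i) c r t ↔ GDesc κ S c t r := by
  rw [GDesc, GDesc, corner_dual]
  have : c r < c t + -κ ↔ ¬ c t < c r + κ := by
    rw [not_lt]
    exact ⟨fun h => by linarith, fun h => by
      have := lt_of_le_of_ne h (hg t r).symm; linarith⟩
  rw [this]
  tauto

/-- The same for two adjacent strands with different positions relative to some ghost, by exchanging
the roles of strands and ghosts. -/
theorem exists_desc_of_row {κ : ℝ} (hκ : κ ≠ 0) {S : Fin m → Fin m → Prop} (hS : IsSide κ S)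
    {c : Fin m → ℝ} (hg : ∀ i j, c i ≠ c j + κ) (a : Adj m) (ha : c a.hi < c a.lo) (p : Fin m)
    (h1 : S a.lo p) (h2 : ¬ S a.hi p) :
    (∃ b, XDesc S c b) ∨ ∃ r t, GDesc κ S c r t ∧ (κ < 0 → a.lo ≤ r ∧ a.lo < t) ∧
      (0 < κ → r ≤ a.hi ∧ t ≤ a.lo) ∧ (t = a.lo → ¬ S r t) ∧ (t = a.hi → S r t) := by
  rcases exists_desc_of_col (neg_ne_zero.2 hκ) (hS.dual hκ) (c := c) a ha p h2 (not_not.2 h1) with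
    ⟨b, h3, h4, h5⟩ | ⟨t, r, g, g1, g2, g3, g4⟩
  · exact Or.inl ⟨b, h3, fun j => not_iff_not.1 (h5 j), fun i => not_iff_not.1 (h4 i)⟩
  · rw [gDesc_dual hg] at g
    refine Or.inr ⟨r, t, g, fun h => g1 (by linarith), fun h => g2 (by linarith), g3, fun h => ?_⟩
    exact not_not.1 (g4 h)

/-- A chamber with no wall which separates it from the chamber of `c` coincides with it. -/
theorem eq_of_no_desc {κ : ℝ} (hκ : κ ≠ 0) {S : Fin m → Fin m → Prop} (hS : IsSide κ S)
    {c : Fin m → ℝ} (hc : Function.Injective c) (hg : ∀ i j, c i ≠ c j + κ)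
    (hX : ∀ a, ¬ XDesc S c a) (hG : ∀ r t, ¬ GDesc κ S c r t) :
    (∀ a : Adj m, c a.lo < c a.hi) ∧ ∀ i j, S i j ↔ c i < c j + κ := by
  have h1 (a : Adj m) : c a.lo < c a.hi := by
    by_contra h
    have ha : c a.hi < c a.lo := lt_of_le_of_ne (not_lt.1 h) fun e => a.hi_ne_lo (hc e)
    by_cases rows : ∀ j, S a.lo j ↔ S a.hi j
    · by_cases cols : ∀ i, S i a.lo ↔ S i a.hi
      · exact hX a ⟨ha, rows, cols⟩
      · obtain ⟨i, hi⟩ := not_forall.1 cols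
        have hm : S i a.lo → S i a.hi := fun h => hS.mono h le_rfl a.lo_lt_hi.le
        rcases exists_desc_of_col hκ hS a ha i (by tauto) (by tauto) with ⟨b, h⟩ | ⟨r, t, h, -⟩
        · exact hX b h
        · exact hG r t h
    · obtain ⟨j, hj⟩ := not_forall.1 rows
      have hm : S a.hi j → S a.lo j := fun h => hS.mono h a.lo_lt_hi.le le_rfl
      rcases exists_desc_of_row hκ hS hg a ha j (by tauto) (by tauto) with ⟨b, h⟩ | ⟨r, t, h, -⟩
      · exact hX b h
      · exact hG r t h
  refine ⟨h1, ?_⟩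
  have hm : Monotone c := by
    intro i j hij
    by_contra h
    obtain ⟨a, _, _, ha⟩ := exists_adj_inverted hij (not_le.1 h)
    exact lt_asymm ha (h1 a)
  have hS' : ∀ ⦃i i' j j' : Fin m⦄, c i < c j + κ → i' ≤ i → j ≤ j' → c i' < c j' + κ := by
    intro i i' j j' h hi hj
    have := hm hi
    have := hm hj
    linarith
  by_contra hne
  push Not at hne
  obtain ⟨i, j, hij⟩ := hne
  classical
  by_cases hsub : ∃ i j, S i j ∧ ¬ c i < c j + κ
  · -- a maximal place of the difference is a corner
    obtain ⟨i, j, hij⟩ := hsub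
    obtain ⟨⟨i, j⟩, hp, hmax⟩ := Finset.exists_max_image
      (Finset.univ.filter fun p : Fin m × Fin m => S p.1 p.2 ∧ ¬ c p.1 < c p.2 + κ)
      (fun p => (p.1 : ℤ) - p.2) ⟨(i, j), by simpa using hij⟩
    simp only [Finset.mem_filter, Finset.mem_univ, true_and, Prod.forall] at hp hmax
    refine hG i j ⟨Or.inl ⟨hp.1, fun i' hi h => ?_, fun j' hj h => ?_⟩, iff_of_true hp.1 hp.2⟩
    · have := hmax i' j ⟨h, fun h' => hp.2 (hS' h' hi.le le_rfl)⟩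
      have := Fin.lt_def.1 hi
      omega
    · have := hmax i j' ⟨h, fun h' => hp.2 (hS' h' le_rfl hj.le)⟩
      have := Fin.lt_def.1 hj
      omega
  -- a minimal place of the difference is a corner
  · push Not at hsub
    obtain ⟨⟨i, j⟩, hp, hmax⟩ := Finset.exists_min_image
      (Finset.univ.filter fun p : Fin m × Fin m => ¬ S p.1 p.2 ∧ c p.1 < c p.2 + κ)
      (fun p => (p.1 : ℤ) - p.2) ⟨(i, j), by
        have := hsub i j
        simp only [Finset.mem_filter, Finset.mem_univ, true_and]
        exact hij.resolve_left fun e => e.2.not_gt (this e.1)⟩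
    simp only [Finset.mem_filter, Finset.mem_univ, true_and, Prod.forall] at hp hmax
    refine hG i j ⟨Or.inr ⟨hp.1, fun i' hi => ?_, fun j' hj => ?_⟩,
      iff_of_false hp.1 (not_not.2 hp.2)⟩
    · by_contra h
      have := hmax i' j ⟨h, hS' hp.2 hi.le le_rfl⟩
      have := Fin.lt_def.1 hi
      omega
    · by_contra h
      have := hmax i j' ⟨h, hS' hp.2 le_rfl hj.le⟩
      have := Fin.lt_def.1 hj
      omega

/-- Two walls which concern the same strand or the same ghost, and are crossed in opposite
directions, meet at the crossing of two adjacent strands `a` with a ghost or of a strand with the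
ghosts of `a`, or there is a third wall, either between two strands or crossed independently of
both. -/
theorem GDesc.compat {κ : ℝ} (hκ : κ ≠ 0) {S : Fin m → Fin m → Prop} (hS : IsSide κ S)
    {c : Fin m → ℝ} (hg : ∀ i j, c i ≠ c j + κ) {r t r' t' : Fin m}
    (h : GDesc κ S c r t) (h' : GDesc κ S c r' t') (hr : S r t) (hr' : ¬ S r' t')
    (hc : r = r' ∨ t = t') :
    (∃ a : Adj m, r = a.lo ∧ r' = a.hi ∧ t = t' ∧ ∀ i, S i a.lo ↔ S i a.hi) ∨
    (∃ a : Adj m, t' = a.lo ∧ t = a.hi ∧ r = r' ∧ ∀ j, S a.lo j ↔ S a.hi j) ∨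
    (∃ b, XDesc S c b) ∨
    ∃ p u, GDesc κ S c p u ∧ (p = r ∨ u = t → S p u) ∧ (p = r' ∨ u = t' → ¬ S p u) := by
  have d1 := h.2.1 hr
  have d2 : c r' < c t' + κ := not_not.1 (mt h'.2.2 hr')
  obtain ⟨-, k1, k2⟩ := h.1.resolve_right (fun e => e.1 hr)
  obtain ⟨-, k3, k4⟩ := h'.1.resolve_left (fun e => hr' e.1)
  rcases hc with rfl | rfl
  · -- two ghosts next to the strand
    have htt : t' < t := by
      by_contra hle
      exact hr' (hS.mono hr le_rfl (not_lt.1 hle))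
    have hadj : (t' : ℕ) + 1 = t := by
      by_contra hne
      have h1 : (t' : ℕ) + 1 < t := by have := Fin.lt_def.1 htt; omega
      exact k2 ⟨t' + 1, by omega⟩ (Fin.lt_def.2 h1) (k4 _ (Fin.lt_def.2 (Nat.lt_succ_self _)))
    let a : Adj m := ⟨t', by omega⟩
    have e1 : t' = a.lo := rfl
    have e2 : t = a.hi := Fin.ext hadj.symm
    have ha : c a.hi < c a.lo := by rw [← e1, ← e2]; linarith
    by_cases rows : ∀ j, S a.lo j ↔ S a.hi j
    · exact Or.inr (Or.inl ⟨a, e1, e2, rfl, rows⟩)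
    obtain ⟨p, hp⟩ := not_forall.1 rows
    have hm : S a.hi p → S a.lo p := fun h => hS.mono h a.lo_lt_hi.le le_rfl
    rcases exists_desc_of_row hκ hS hg a ha p (by tauto) (by tauto) with h3 | ⟨p, u, g, g1, g2, g3, g4⟩
    · exact Or.inr (Or.inr (Or.inl h3))
    refine Or.inr (Or.inr (Or.inr ⟨p, u, g, ?_⟩))
    have hpr : p ≠ r := by
      rintro rfl
      rcases lt_or_gt_of_ne hκ with hκ' | hκ'
      · -- the strand is to the left of `a`
        have h5 : p < a.hi := not_le.1 fun h => by
          have := hS.mono hr h (show t ≤ a.hi from e2.le)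
          exact hκ'.not_gt ((hS.diag _).1 this)
        have h6 := a.lt_hi_iff.1 h5
        exact h'.ne hS ((le_antisymm h6 (g1 hκ').1).trans e1.symm)
      · have h5 : a.lo < p := not_le.1 fun h => hr' (hS.mono ((hS.diag _).2 hκ') h e1.ge)
        have h6 := a.lo_lt_iff.1 h5
        exact h.ne hS ((le_antisymm (g2 hκ').1 h6).trans e2.symm)
    refine ⟨fun e => ?_, fun e => ?_⟩
    · exact g4 ((e.resolve_left hpr).trans e2)
    · exact g3 ((e.resolve_left hpr).trans e1)
  · have hrr : r < r' := by
      by_contra hle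
      exact hr' (hS.mono hr (not_lt.1 hle) le_rfl)
    have hadj : (r : ℕ) + 1 = r' := by
      by_contra hne
      have h1 : (r : ℕ) + 1 < r' := by have := Fin.lt_def.1 hrr; omega
      exact k1 ⟨r + 1, by omega⟩ (Fin.lt_def.2 (Nat.lt_succ_self _)) (k3 _ (Fin.lt_def.2 h1))
    let a : Adj m := ⟨r, by omega⟩
    have e1 : r = a.lo := rfl
    have e2 : r' = a.hi := Fin.ext hadj.symm
    have ha : c a.hi < c a.lo := by rw [← e1, ← e2]; linarith
    by_cases cols : ∀ i, S i a.lo ↔ S i a.hi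
    · exact Or.inl ⟨a, e1, e2, rfl, cols⟩
    obtain ⟨p, hp⟩ := not_forall.1 cols
    have hm : S p a.lo → S p a.hi := fun h => hS.mono h le_rfl a.lo_lt_hi.le
    rcases exists_desc_of_col hκ hS a ha p (by tauto) (by tauto) with h3 | ⟨p, u, g, g1, g2, g3, g4⟩
    · exact Or.inr (Or.inr (Or.inl h3))
    refine Or.inr (Or.inr (Or.inr ⟨p, u, g, ?_⟩))
    have hut : u ≠ t := by
      rintro rfl
      rcases lt_or_gt_of_ne hκ with hκ' | hκ'
      · have h5 : a.lo < u := not_le.1 fun h => by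
          have := hS.mono hr e1.ge h
          exact hκ'.not_gt ((hS.diag _).1 this)
        have h6 := a.lo_lt_iff.1 h5
        exact h'.ne hS (e2.trans (le_antisymm h6 (g2 hκ').1))
      · have h5 : u < a.hi := not_le.1 fun h => hr' (hS.mono ((hS.diag _).2 hκ') e2.le h)
        have h6 := a.lt_hi_iff.1 h5
        exact h.ne hS (e1.trans (le_antisymm (g1 hκ').1 h6))
    refine ⟨fun e => ?_, fun e => ?_⟩
    · exact g3 ((e.resolve_right hut).trans e1)
    · exact g4 ((e.resolve_right hut).trans e2)

end Grid

/-! ### Relations in the algebra of diagrams -/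

section DiagRel

variable {κ : ℝ} {m : ℕ}

theorem IsMove.refl (x : Config κ m) : IsMove x x := fun _ _ => Iff.rfl

theorem IsMove.trans {x y z : Config κ m} (h : IsMove x y) (h' : IsMove y z) : IsMove x z :=
  fun i j => (h i j).trans (h' i j)

theorem IsGhost.symm {r t : Fin m} {x y : Config κ m} (h : IsGhost r t x y) : IsGhost r t y x :=
  fun i j => by rw [← h i j, Iff.comm (a := Side y i j)]

theorem IsGhost.of_move {r t : Fin m} {x y z : Config κ m} (h : IsGhost r t x y)
    (h' : IsMove y z) : IsGhost r t x z := fun i j => by rw [← h i j, h' i j]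

theorem isGhost_iff {r t : Fin m} {x y : Config κ m} :
    IsGhost r t x y ↔ ∀ i j, Side x i j ↔ toggle (Side y) r t i j := by
  unfold IsGhost toggle
  refine forall_congr' fun i => forall_congr' fun j => ?_
  tauto

theorem IsGhost.move {r t : Fin m} {x x' y : Config κ m} (h : IsGhost r t x y)
    (h' : IsGhost r t x' y) : IsMove x x' := fun i j => by
  rw [isGhost_iff] at h h'
  rw [h, h']

theorem IsGhost.corner {r t : Fin m} {x y : Config κ m} (h : IsGhost r t x y) :
    Corner (Side y) r t := by
  by_cases hs : Side y r t
  · refine Or.inl ⟨hs, fun i hi h' => ?_, fun j hj h' => ?_⟩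
    · have h1 := (h.symm.same (i := i) (j := t) fun e => hi.ne' e.1).1 h'
      exact h.symm.flip.1 hs (x.isSide.mono h1 hi.le le_rfl)
    · have h1 := (h.symm.same (i := r) (j := j) fun e => hj.ne e.2).1 h'
      exact h.symm.flip.1 hs (x.isSide.mono h1 le_rfl hj.le)
  · have hx : Side x r t := h.flip.2 hs
    refine Or.inr ⟨hs, fun i hi => ?_, fun j hj => ?_⟩
    · exact (h.same fun e => hi.ne e.1).1 (x.isSide.mono hx hi.le le_rfl)
    · exact (h.same fun e => hj.ne' e.2).1 (x.isSide.mono hx le_rfl hj.le)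

theorem exists_isGhost (hκ : κ ≠ 0) {r t : Fin m} (hne : r ≠ t) {y : Config κ m}
    (h : Corner (Side y) r t) : ∃ x, IsGhost r t x y := by
  obtain ⟨x, hx⟩ := (y.isSide.toggle hne h).exists_config hκ
  exact ⟨x, isGhost_iff.2 hx⟩

theorem forall_refl {p : Fin m → Prop} {a : Adj m} (h : p a.lo ↔ p a.hi) (i : Fin m) :
    p (a.refl i) ↔ p i := by
  by_cases h1 : i = a.lo
  · subst h1; rw [refl_lo, h]
  by_cases h2 : i = a.hi
  · subst h2; rw [refl_hi, h]
  rw [refl_of_ne a h1 h2]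

theorem isCross_self {a : Adj m} {x : Config κ m} (hr : ∀ j, Side x a.lo j ↔ Side x a.hi j)
    (hc : ∀ i, Side x i a.lo ↔ Side x i a.hi) : IsCross a x x := fun i j => by
  rw [forall_refl (p := fun i => Side x i (a.refl j)) (hr _), forall_refl (p := Side x i) (hc _)]

theorem IsCross.isMove {a : Adj m} {x y : Config κ m} (h : IsCross a x y) : IsMove x y :=
  fun i j => by
    rw [h, forall_refl (p := fun i => Side y i (a.refl j)) (h.symm.row _),
      forall_refl (p := Side y i) (h.symm.col _)]

theorem IsCross.self {a : Adj m} {x y : Config κ m} (h : IsCross a x y) : IsCross a y y :=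
  isCross_self h.symm.row h.symm.col

variable (R : Type*) [CommRing R] (q : R)

theorem toDiag_rel {u v : FreeDiag R κ m} (h : Rel R q u v) :
    RingQuot.mkAlgHom R (Rel R q) u = RingQuot.mkAlgHom R (Rel R q) v :=
  RingQuot.mkAlgHom_rel R h

variable {R}

theorem diag_neg_smul (c : R) (u : Diag R κ m q) : (-c) • u = -(c • u) := by
  refine eq_neg_of_add_eq_zero_left ?_
  rw [← add_smul, neg_add_cancel, zero_smul]

/-- The class of a motion without crossings. -/
abbrev dMove {x y : Config κ m} (h : IsMove x y) : Diag R κ m q := (Slice.move x y h).toDiag R q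

/-- The class of a square. -/
abbrev dSq (x : Config κ m) (i : Fin m) : Diag R κ m q := (Slice.sq x i).toDiag R q

/-- The class of an inverse square. -/
abbrev dSqInv (x : Config κ m) (i : Fin m) : Diag R κ m q := (Slice.sqInv x i).toDiag R q

/-- The class of a crossing of strands. -/
abbrev dCross {a : Adj m} {x y : Config κ m} (h : IsCross a x y) : Diag R κ m q :=
  (Slice.cross a x y h).toDiag R q

/-- The class of a crossing of a strand and a ghost. -/
abbrev dGhost {r t : Fin m} {x y : Config κ m} (h : IsGhost r t x y) : Diag R κ m q :=
  (Slice.ghost r t x y h).toDiag R q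

theorem dMove_refl (x : Config κ m) (h : IsMove x x) : dMove q h = idem R q x := rfl

theorem idem_mul_slice (g : Slice κ m) : idem R q g.top * g.toDiag R q = g.toDiag R q := by
  have hrel := toDiag_rel R q (Rel.id_slice g)
  simp only [map_mul] at hrel
  exact hrel

theorem slice_mul_idem (g : Slice κ m) : g.toDiag R q * idem R q g.bot = g.toDiag R q := by
  have hrel := toDiag_rel R q (Rel.slice_id g)
  simp only [map_mul] at hrel
  exact hrel

theorem idem_mul_idem (x : Config κ m) : idem R q x * idem R q x = idem R q x :=
  idem_mul_slice q (Slice.move x x (IsMove.refl x))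

theorem idem_mul_idem_of_ne {x y : Config κ m} (h : x ≠ y) : idem R q x * idem R q y = 0 := by
  have hrel := toDiag_rel R q (Rel.id_id x y h)
  simp only [map_mul, map_zero] at hrel
  exact hrel

theorem move_mul_move {x y z : Config κ m} (h₁ : IsMove x y) (h₂ : IsMove y z)
    (h : IsMove x z) : dMove (R := R) q h₂ * dMove q h₁ = dMove q h := by
  have hrel := toDiag_rel R q (Rel.move_move x y z h₁ h₂ h)
  simp only [map_mul] at hrel
  exact hrel

theorem move_mul_cross {a : Adj m} {x y z : Config κ m} (h₁ : IsCross a x y) (h₂ : IsMove y z)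
    (h : IsCross a x z) : dMove (R := R) q h₂ * dCross q h₁ = dCross q h := by
  have hrel := toDiag_rel R q (Rel.move_cross a x y z h₁ h₂ h)
  simp only [map_mul] at hrel
  exact hrel

theorem cross_mul_move {a : Adj m} {x y z : Config κ m} (h₁ : IsMove x y) (h₂ : IsCross a y z)
    (h : IsCross a x z) : dCross (R := R) q h₂ * dMove q h₁ = dCross q h := by
  have hrel := toDiag_rel R q (Rel.cross_move a x y z h₁ h₂ h)
  simp only [map_mul] at hrel
  exact hrel

theorem move_mul_ghost {r t : Fin m} {x y z : Config κ m} (h₁ : IsGhost r t x y)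
    (h₂ : IsMove y z) (h : IsGhost r t x z) :
    dMove (R := R) q h₂ * dGhost q h₁ = dGhost q h := by
  have hrel := toDiag_rel R q (Rel.move_ghost r t x y z h₁ h₂ h)
  simp only [map_mul] at hrel
  exact hrel

theorem ghost_mul_move {r t : Fin m} {x y z : Config κ m} (h₁ : IsMove x y)
    (h₂ : IsGhost r t y z) (h : IsGhost r t x z) :
    dGhost (R := R) q h₂ * dMove q h₁ = dGhost q h := by
  have hrel := toDiag_rel R q (Rel.ghost_move r t x y z h₁ h₂ h)
  simp only [map_mul] at hrel
  exact hrel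

theorem cross_mul_cross_far {a b : Adj m} (hab : a.1 + 1 < b.1) {x : Config κ m}
    (ha : IsCross a x x) (hb : IsCross b x x) :
    dCross (R := R) q ha * dCross q hb = dCross q hb * dCross q ha := by
  have hrel := toDiag_rel R q (Rel.cross_cross a b hab x x x x hb ha ha hb)
  simp only [map_mul] at hrel
  exact hrel

theorem cross_braid {a b : Adj m} (hab : b.1 = a.1 + 1) {x : Config κ m}
    (ha : IsCross a x x) (hb : IsCross b x x) :
    dCross (R := R) q ha * dCross q hb * dCross q ha =
      dCross q hb * dCross q ha * dCross q hb := by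
  have hrel := toDiag_rel R q (Rel.braid a b hab x x x x x x ha hb ha hb ha hb)
  simp only [map_mul] at hrel
  exact hrel

theorem cross_bigon {a : Adj m} {x y z : Config κ m} (h₁ : IsCross a x y) (h₂ : IsCross a y z) :
    dCross (R := R) q h₂ * dCross q h₁ = 0 := by
  have hrel := toDiag_rel R q (Rel.bigon a x y z h₁ h₂)
  simp only [map_mul, map_zero] at hrel
  exact hrel

theorem ghost_mul_cross {a : Adj m} {r t : Fin m} (hr : a.refl r = r) (ht : a.refl t = t)
    {x y y' z : Config κ m} (h₁ : IsCross a x y) (h₂ : IsGhost r t y z)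
    (h₁' : IsGhost r t x y') (h₂' : IsCross a y' z) :
    dGhost (R := R) q h₂ * dCross q h₁ = dCross q h₂' * dGhost q h₁' := by
  have key (r' t' : Fin m) (hr : a.refl r = r') (ht : a.refl t = t')
      (h₁' : IsGhost r' t' x y') :
      dGhost (R := R) q h₂ * dCross q h₁ = dCross q h₂' * dGhost q h₁' := by
    subst hr ht
    have hrel := toDiag_rel R q (Rel.cross_ghost a r t x y y' z h₁ h₂ h₁' h₂')
    simp only [map_mul] at hrel
    exact hrel
  exact key r t hr ht h₁'

theorem ghost_mul_ghost {r t r' t' : Fin m} (hne : ¬ (r = r' ∧ t = t')) {x y y' z : Config κ m}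
    (h₁ : IsGhost r t x y) (h₂ : IsGhost r' t' y z) (h₁' : IsGhost r' t' x y')
    (h₂' : IsGhost r t y' z) :
    dGhost (R := R) q h₂ * dGhost q h₁ = dGhost q h₂' * dGhost q h₁' := by
  have hrel := toDiag_rel R q (Rel.ghost_ghost r t r' t' hne x y y' z h₁ h₂ h₁' h₂')
  simp only [map_mul] at hrel
  exact hrel

theorem sq_mul_sqInv (x : Config κ m) (i : Fin m) :
    dSq (R := R) q x i * dSqInv q x i = idem R q x := by
  have hrel := toDiag_rel R q (Rel.sq_sqInv x i)
  simp only [map_mul] at hrel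
  exact hrel

theorem sqInv_mul_sq (x : Config κ m) (i : Fin m) :
    dSqInv (R := R) q x i * dSq q x i = idem R q x := by
  have hrel := toDiag_rel R q (Rel.sqInv_sq x i)
  simp only [map_mul] at hrel
  exact hrel

theorem sq_mul_sq (x : Config κ m) (i j : Fin m) :
    dSq (R := R) q x i * dSq q x j = dSq q x j * dSq q x i := by
  have hrel := toDiag_rel R q (Rel.sq_sq x i j)
  simp only [map_mul] at hrel
  exact hrel

theorem move_mul_sq {x y : Config κ m} (h : IsMove x y) (i : Fin m) :
    dMove (R := R) q h * dSq q x i = dSq q y i * dMove q h := by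
  have hrel := toDiag_rel R q (Rel.move_sq x y h i)
  simp only [map_mul] at hrel
  exact hrel

theorem ghost_mul_sq {r t : Fin m} {x y : Config κ m} (h : IsGhost r t x y) (i : Fin m) :
    dGhost (R := R) q h * dSq q x i = dSq q y i * dGhost q h := by
  have hrel := toDiag_rel R q (Rel.ghost_sq r t x y h i)
  simp only [map_mul] at hrel
  exact hrel

theorem cross_mul_sq {a : Adj m} {x y : Config κ m} (h : IsCross a x y) {i : Fin m}
    (hlo : i ≠ a.lo) (hhi : i ≠ a.hi) :
    dCross (R := R) q h * dSq q x i = dSq q y i * dCross q h := by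
  have hrel := toDiag_rel R q (Rel.cross_sq a x y h i hlo hhi)
  simp only [map_mul] at hrel
  exact hrel

theorem sq_lo_mul_cross {a : Adj m} {x y : Config κ m} (h : IsCross a x y) :
    dSq (R := R) q y a.lo * dCross q h = dCross q h * dSq q x a.hi + dMove q h.isMove := by
  have := toDiag_rel R q (Rel.nil_lo a x y h h.isMove)
  rw [map_sub, map_mul, map_mul, sub_eq_iff_eq_add'] at this
  exact this

theorem cross_mul_sq_lo {a : Adj m} {x y : Config κ m} (h : IsCross a x y) :
    dCross (R := R) q h * dSq q x a.lo = dSq q y a.hi * dCross q h + dMove q h.isMove := by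
  have := toDiag_rel R q (Rel.nil_hi a x y h h.isMove)
  rw [map_sub, map_mul, map_mul, sub_eq_iff_eq_add'] at this
  exact this

theorem ghost_bigon {r t : Fin m} {x y z : Config κ m} (h₁ : IsGhost r t x y)
    (h₂ : IsGhost r t y z) (h : IsMove x z) :
    dGhost (R := R) q h₂ * dGhost q h₁ = (dSq q z r - q • dSq q z t) * dMove q h := by
  have hrel := toDiag_rel R q (Rel.ghost_bigon r t x y z h₁ h₂ h)
  simp only [map_mul, map_sub, map_smul] at hrel
  exact hrel

theorem triple_ghosts {r : Fin m} {a : Adj m} {x y y' : Config κ m}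
    (h₁ : IsGhost r a.lo x y) (h₂ : IsCross a y y) (h₁' : IsGhost r a.hi x y')
    (h₂' : IsCross a y' y') :
    dGhost (R := R) q h₁.symm * dCross q h₂ * dGhost q h₁ =
      dGhost q h₁'.symm * dCross q h₂' * dGhost q h₁' - q • idem R q x := by
  have hrel := toDiag_rel R q
    (Rel.triple_ghosts r a x y y x y' y' h₁ h₂ h₁.symm h₁' h₂' h₁'.symm (IsMove.refl x))
  simp only [map_mul, map_sub, map_smul] at hrel
  exact hrel

theorem triple_strands {a : Adj m} {t : Fin m} {x y y' : Config κ m}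
    (h₁ : IsGhost a.lo t x y) (h₂ : IsCross a y y) (h₁' : IsGhost a.hi t x y')
    (h₂' : IsCross a y' y') :
    dGhost (R := R) q h₁.symm * dCross q h₂ * dGhost q h₁ =
      dGhost q h₁'.symm * dCross q h₂' * dGhost q h₁' + idem R q x := by
  have hrel := toDiag_rel R q
    (Rel.triple_strands a t x y y x y' y' h₁ h₂ h₁.symm h₁' h₂' h₁'.symm (IsMove.refl x))
  simp only [map_mul, map_add] at hrel
  exact hrel

/-- The bigon of a strand and a ghost, without the motion. -/
theorem ghost_bigon_self {r t : Fin m} {x y : Config κ m} (h : IsGhost r t x y) :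
    dGhost (R := R) q h.symm * dGhost q h = dSq q x r - q • dSq q x t := by
  have h1 := ghost_bigon (R := R) q h h.symm (IsMove.refl x)
  rw [h1, dMove_refl, sub_mul, smul_mul_assoc]
  rw [show idem R q x = idem R q (Slice.sq x r).bot from rfl, slice_mul_idem,
    show idem R q (Slice.sq x r).bot = idem R q (Slice.sq x t).bot from rfl, slice_mul_idem]

/-- A formal consequence of the relations of the nilHecke algebra and of a triple point at which a
line `M` passes between two crossing lines: the relation at a triple point where the third line
passes both of the crossing lines from `A` on one side of them to `B` on the other side. -/
theorem cross_through {D : Type*} [Ring D] [Algebra R D] {e : R} (he : IsUnit e)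
    {cA cB g₁ g₂ g₁' g₂' fA fA' F F' iA iB iM : D}
    (h₁ : g₂' * cB * g₂ = g₁ * cA * g₁' + e • iM) (hM : iM * g₁ = g₁) (hA : g₁ * iA = g₁)
    (h₂ : g₂' * g₂ * g₁ = g₁ * fA) (h₃ : g₁' * g₁ = fA') (h₄ : fA * cA = cA * fA' + e • iA)
    (h₅ : g₂ * g₂' = F) (h₆ : F * cB = cB * F' + e • iB) (h₇ : cB * F = F' * cB + e • iB)
    (hB : iB * g₂ = g₂) (hB' : iB * cB = cB) (hcA : cA * cA = 0) (hcB : cB * cB = 0) :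
    cB * (g₂ * g₁) = g₂ * g₁ * cA := by
  -- the difference `Δ` is annihilated by the bigon `F`, and the commutation relations of `F` and
  -- `cB`, whose error term is the unit `e`, then show that `e ^ 2` annihilates `Δ`
  obtain ⟨Δ, hΔ⟩ : ∃ Δ, Δ = cB * (g₂ * g₁) - g₂ * g₁ * cA := ⟨_, rfl⟩
  have e1 : g₂' * Δ = 0 := by
    have : g₂' * Δ = g₂' * cB * g₂ * g₁ - g₂' * g₂ * g₁ * cA := by rw [hΔ]; noncomm_ring
    rw [this, h₁, h₂, mul_assoc g₁ fA, h₄, add_mul, mul_assoc (g₁ * cA), h₃, smul_mul_assoc, hM,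
      mul_add, mul_smul_comm, hA, mul_assoc, sub_self]
  have e2 : F * Δ = 0 := by rw [← h₅, mul_assoc, e1, mul_zero]
  have e3 : cB * Δ = -(Δ * cA) := by
    rw [hΔ, mul_sub, sub_mul, ← mul_assoc cB cB, hcB, zero_mul, mul_assoc (g₂ * g₁) cA, hcA,
      mul_zero]
    noncomm_ring
  have e4 : iB * Δ = Δ := by
    rw [hΔ, mul_sub, ← mul_assoc, hB', mul_assoc g₂, ← mul_assoc iB, hB]
  have e5 : cB * F' * Δ + e • Δ = 0 := by
    have : F * cB * Δ = 0 := by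
      rw [mul_assoc, e3, mul_neg, ← mul_assoc, e2, zero_mul, neg_zero]
    rwa [h₆, add_mul, smul_mul_assoc, e4] at this
  have e6 : e • (cB * Δ) = 0 := by
    have := congrArg (cB * ·) e5
    simp only [mul_add, mul_zero, ← mul_assoc, hcB, zero_mul, zero_add, mul_smul_comm] at this
    exact this
  have e7 : F' * cB * Δ + e • Δ = 0 := by
    have : cB * F * Δ = 0 := by rw [mul_assoc, e2, mul_zero]
    rwa [h₇, add_mul, smul_mul_assoc, e4] at this
  have e8 : e • (e • Δ) = 0 := by
    have := congrArg (e • ·) e7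
    simp only [smul_add, smul_zero] at this
    rwa [mul_assoc, ← mul_smul_comm, e6, mul_zero, zero_add] at this
  have e9 : Δ = 0 := by
    rw [he.smul_eq_zero, he.smul_eq_zero] at e8
    exact e8
  rw [e9] at hΔ
  exact sub_eq_zero.1 hΔ.symm

/-- A ghost which passes two crossing strands can pass their crossing. -/
theorem cross_through_ghost {a : Adj m} {t : Fin m} (h1 : t ≠ a.lo) (h2 : t ≠ a.hi)
    {x y z : Config κ m} (hx : IsCross a x x) (hz : IsCross a z z) :
    (∀ (hxy : IsGhost a.hi t x y) (hyz : IsGhost a.lo t y z),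
      dCross (R := R) q hz * (dGhost q hyz * dGhost q hxy) =
        dGhost q hyz * dGhost q hxy * dCross q hx) ∧
    ∀ (hxy : IsGhost a.lo t x y) (hyz : IsGhost a.hi t y z),
      dCross (R := R) q hz * (dGhost q hyz * dGhost q hxy) =
        dGhost q hyz * dGhost q hxy * dCross q hx := by
  have key (e : R) (he : IsUnit e) (u u' : Fin m)
      (hrel : ∀ {x y : Config κ m} (h : IsCross a x y),
        (dSq q y u - q • dSq q y t) * dCross (R := R) q h =
          dCross q h * (dSq q x u' - q • dSq q x t) + e • dMove q h.isMove ∧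
        dCross (R := R) q h * (dSq q x u - q • dSq q x t) =
          (dSq q y u' - q • dSq q y t) * dCross q h + e • dMove q h.isMove)
      (hxy : IsGhost u' t x y) (hyz : IsGhost u t y z)
      (htr : dGhost (R := R) q hyz.symm * dCross q hz * dGhost q hyz =
        dGhost q hxy * dCross q hx * dGhost q hxy.symm + e • idem R q y) :
      dCross (R := R) q hz * (dGhost q hyz * dGhost q hxy) =
        dGhost q hyz * dGhost q hxy * dCross q hx := by
    refine cross_through he htr (idem_mul_slice q (Slice.ghost _ _ _ _ hxy))
      (slice_mul_idem q (Slice.ghost _ _ _ _ hxy)) ?_ (ghost_bigon_self q hxy) (hrel hx).1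
      (ghost_bigon_self q hyz.symm) (hrel hz).1 (hrel hz).2
      (idem_mul_slice q (Slice.ghost _ _ _ _ hyz)) (idem_mul_slice q (Slice.cross _ _ _ hz))
      (cross_bigon q hx hx) (cross_bigon q hz hz)
    rw [ghost_bigon_self, sub_mul, mul_sub, smul_mul_assoc, mul_smul_comm, ghost_mul_sq,
      ghost_mul_sq]
  refine ⟨fun hxy hyz => ?_, fun hxy hyz => ?_⟩
  · refine key 1 isUnit_one a.lo a.hi (fun h => ⟨?_, ?_⟩) hxy hyz ?_
    · rw [sub_mul, mul_sub, smul_mul_assoc, mul_smul_comm, cross_mul_sq q h h1 h2,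
        sq_lo_mul_cross, one_smul]
      abel
    · rw [sub_mul, mul_sub, smul_mul_assoc, mul_smul_comm, cross_mul_sq q h h1 h2,
        cross_mul_sq_lo, one_smul]
      abel
    · rw [one_smul]
      exact triple_strands q hyz hz hxy.symm hx
  · refine key (-1) isUnit_one.neg a.hi a.lo (fun h => ⟨?_, ?_⟩) hxy hyz ?_
    · rw [sub_mul, mul_sub, smul_mul_assoc, mul_smul_comm, cross_mul_sq q h h1 h2,
        cross_mul_sq_lo, diag_neg_smul, one_smul]
      abel
    · rw [sub_mul, mul_sub, smul_mul_assoc, mul_smul_comm, cross_mul_sq q h h1 h2,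
        sq_lo_mul_cross, diag_neg_smul, one_smul]
      abel
    · rw [diag_neg_smul, one_smul, triple_strands q hxy.symm hx hyz hz]
      abel

/-- A strand which passes the ghosts of two crossing strands can pass their crossing. -/
theorem cross_through_strand (hq : IsUnit q) {a : Adj m} {r : Fin m} (h1 : r ≠ a.lo) (h2 : r ≠ a.hi)
    {x y z : Config κ m} (hx : IsCross a x x) (hz : IsCross a z z) :
    (∀ (hxy : IsGhost r a.hi x y) (hyz : IsGhost r a.lo y z),
      dCross (R := R) q hz * (dGhost q hyz * dGhost q hxy) =
        dGhost q hyz * dGhost q hxy * dCross q hx) ∧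
    ∀ (hxy : IsGhost r a.lo x y) (hyz : IsGhost r a.hi y z),
      dCross (R := R) q hz * (dGhost q hyz * dGhost q hxy) =
        dGhost q hyz * dGhost q hxy * dCross q hx := by
  have key (e : R) (he : IsUnit e) (u u' : Fin m)
      (hrel : ∀ {x y : Config κ m} (h : IsCross a x y),
        (dSq q y r - q • dSq q y u) * dCross (R := R) q h =
          dCross q h * (dSq q x r - q • dSq q x u') + e • dMove q h.isMove ∧
        dCross (R := R) q h * (dSq q x r - q • dSq q x u) =
          (dSq q y r - q • dSq q y u') * dCross q h + e • dMove q h.isMove)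
      (hxy : IsGhost r u' x y) (hyz : IsGhost r u y z)
      (htr : dGhost (R := R) q hyz.symm * dCross q hz * dGhost q hyz =
        dGhost q hxy * dCross q hx * dGhost q hxy.symm + e • idem R q y) :
      dCross (R := R) q hz * (dGhost q hyz * dGhost q hxy) =
        dGhost q hyz * dGhost q hxy * dCross q hx := by
    refine cross_through he htr (idem_mul_slice q (Slice.ghost _ _ _ _ hxy))
      (slice_mul_idem q (Slice.ghost _ _ _ _ hxy)) ?_ (ghost_bigon_self q hxy) (hrel hx).1
      (ghost_bigon_self q hyz.symm) (hrel hz).1 (hrel hz).2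
      (idem_mul_slice q (Slice.ghost _ _ _ _ hyz)) (idem_mul_slice q (Slice.cross _ _ _ hz))
      (cross_bigon q hx hx) (cross_bigon q hz hz)
    rw [ghost_bigon_self, sub_mul, mul_sub, smul_mul_assoc, mul_smul_comm, ghost_mul_sq,
      ghost_mul_sq]
  refine ⟨fun hxy hyz => ?_, fun hxy hyz => ?_⟩
  · refine key (-q) hq.neg a.lo a.hi (fun h => ⟨?_, ?_⟩) hxy hyz ?_
    · rw [sub_mul, mul_sub, smul_mul_assoc, mul_smul_comm, cross_mul_sq q h h1 h2,
        sq_lo_mul_cross, smul_add, diag_neg_smul]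
      abel
    · rw [sub_mul, mul_sub, smul_mul_assoc, mul_smul_comm, cross_mul_sq q h h1 h2,
        cross_mul_sq_lo, smul_add, diag_neg_smul]
      abel
    · rw [diag_neg_smul, triple_ghosts q hyz hz hxy.symm hx]
      abel
  · refine key q hq a.hi a.lo (fun h => ⟨?_, ?_⟩) hxy hyz ?_
    · rw [sub_mul, mul_sub, smul_mul_assoc, mul_smul_comm, cross_mul_sq q h h1 h2,
        cross_mul_sq_lo, smul_add]
      abel
    · rw [sub_mul, mul_sub, smul_mul_assoc, mul_smul_comm, cross_mul_sq q h h1 h2,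
        sq_lo_mul_cross, smul_add]
      abel
    · rw [triple_ghosts q hxy.symm hx hyz hz]
      abel

end DiagRel

/-! ### Minimal diagrams -/

section Minimal

variable {R : Type*} [CommRing R] {κ : ℝ} {m : ℕ} (q : R)

/-- The number of crossings of strands in a slice. -/
def Slice.cr : Slice κ m → ℕ
  | cross _ _ _ _ => 1
  | _ => 0

variable (R κ m) in
/-- The span of the diagrams with less than `k` crossings of strands. -/
def Filt (k : ℕ) : Submodule R (Diag R κ m q) :=
  Submodule.span R {u | ∃ l : List (Slice κ m), (l.map Slice.cr).sum < k ∧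
    (l.map (Slice.toDiag R q)).prod = u}

theorem filt_mono {k k' : ℕ} (h : k ≤ k') : Filt R κ m q k ≤ Filt R κ m q k' :=
  Submodule.span_mono fun _ ⟨l, hl, e⟩ => ⟨l, hl.trans_le h, e⟩

theorem filt_zero : Filt R κ m q 0 = ⊥ := by simp [Filt]

theorem word_mem_filt (l : List (Slice κ m)) :
    (l.map (Slice.toDiag R q)).prod ∈ Filt R κ m q ((l.map Slice.cr).sum + 1) :=
  Submodule.subset_span ⟨l, Nat.lt_succ_self _, rfl⟩

theorem slice_mem_filt (g : Slice κ m) : g.toDiag R q ∈ Filt R κ m q (g.cr + 1) := by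
  simpa using word_mem_filt q [g]

variable {q}

theorem mul_mem_filt {a b : ℕ} {u v : Diag R κ m q} (hu : u ∈ Filt R κ m q (a + 1))
    (hv : v ∈ Filt R κ m q b) : u * v ∈ Filt R κ m q (a + b) := by
  have h := Submodule.mul_mem_mul hu hv
  rw [Filt, Filt, Submodule.span_mul_span] at h
  refine Submodule.span_mono ?_ h
  rintro _ ⟨_, ⟨l, hl, rfl⟩, _, ⟨l', hl', rfl⟩, rfl⟩
  refine ⟨l ++ l', ?_, by simp⟩
  rw [List.map_append, List.sum_append]
  omega

theorem mul_mem_filt' {a b : ℕ} {u v : Diag R κ m q} (hu : u ∈ Filt R κ m q a)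
    (hv : v ∈ Filt R κ m q (b + 1)) : u * v ∈ Filt R κ m q (a + b) := by
  have h := Submodule.mul_mem_mul hu hv
  rw [Filt, Filt, Submodule.span_mul_span] at h
  refine Submodule.span_mono ?_ h
  rintro _ ⟨_, ⟨l, hl, rfl⟩, _, ⟨l', hl', rfl⟩, rfl⟩
  refine ⟨l ++ l', ?_, by simp⟩
  rw [List.map_append, List.sum_append]
  omega

theorem exists_mem_filt (u : Diag R κ m q) : ∃ k, u ∈ Filt R κ m q k := by
  obtain ⟨u, rfl⟩ := RingQuot.mkAlgHom_surjective R (Rel R q) u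
  induction u using FreeAlgebra.induction with
  | grade0 r =>
    refine ⟨1, ?_⟩
    rw [AlgHom.commutes, Algebra.algebraMap_eq_smul_one]
    exact Submodule.smul_mem _ _ (by simpa using word_mem_filt (R := R) (κ := κ) (m := m) q [])
  | grade1 g => exact ⟨_, slice_mem_filt q g⟩
  | mul u v hu hv =>
    obtain ⟨k, hk⟩ := hu
    obtain ⟨l, hl⟩ := hv
    exact ⟨k + l, by rw [map_mul]; exact mul_mem_filt (filt_mono q (Nat.le_succ k) hk) hl⟩
  | add u v hu hv =>
    obtain ⟨k, hk⟩ := hu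
    obtain ⟨l, hl⟩ := hv
    exact ⟨max k l, by
      rw [map_add]
      exact add_mem (filt_mono q (le_max_left _ _) hk) (filt_mono q (le_max_right _ _) hl)⟩

theorem slice_mul_mem_filt (g : Slice κ m) {k : ℕ} {v : Diag R κ m q} (hv : v ∈ Filt R κ m q k) :
    g.toDiag R q * v ∈ Filt R κ m q (g.cr + k) := mul_mem_filt (slice_mem_filt q g) hv

theorem ghost_mul_sub_mem {r t : Fin m} {x y : Config κ m} (h : IsGhost r t x y) {k : ℕ}
    {u v : Diag R κ m q} (huv : u - v ∈ Filt R κ m q k) :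
    dGhost q h * u - dGhost q h * v ∈ Filt R κ m q k := by
  rw [← mul_sub]
  simpa [Slice.cr] using slice_mul_mem_filt (Slice.ghost r t x y h) huv

theorem cross_mul_sub_mem {a : Adj m} {x y : Config κ m} (h : IsCross a x y) {k : ℕ}
    {u v : Diag R κ m q} (huv : u - v ∈ Filt R κ m q k) :
    dCross q h * u - dCross q h * v ∈ Filt R κ m q (k + 1) := by
  rw [← mul_sub, add_comm]
  exact slice_mul_mem_filt (Slice.cross a x y h) huv

theorem sub_mem_trans {k : ℕ} {u v w : Diag R κ m q} (h : u - v ∈ Filt R κ m q k)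
    (h' : v - w ∈ Filt R κ m q k) : u - w ∈ Filt R κ m q k := by
  have := add_mem h h'
  rwa [sub_add_sub_cancel] at this

theorem sub_mem_symm {k : ℕ} {u v : Diag R κ m q} (h : u - v ∈ Filt R κ m q k) :
    v - u ∈ Filt R κ m q k := by
  have := neg_mem h
  rwa [neg_sub] at this

variable (q) in
/-- The diagrams `g` from `x` to `y` which connect the strand `i` of `x` to the strand `w i` of `y`
and cross no wall (between two strands or a strand and a ghost) twice. -/
inductive Min (x : Config κ m) : Config κ m → Equiv.Perm (Fin m) → Diag R κ m q → Prop
  | base {y : Config κ m} (h : IsMove x y) : Min x y 1 (dMove q h)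
  | ghost {r t : Fin m} {y z : Config κ m} {w : Equiv.Perm (Fin m)} {g : Diag R κ m q}
      (h : IsGhost r t y z) (asc : Side y r t ↔ Side x (w⁻¹ r) (w⁻¹ t)) (hg : Min x y w g) :
      Min x z w (dGhost q h * g)
  | cross {a : Adj m} {y z : Config κ m} {w : Equiv.Perm (Fin m)} {g : Diag R κ m q}
      (h : IsCross a y z) (asc : w⁻¹ a.lo < w⁻¹ a.hi) (hg : Min x y w g) :
      Min x z (a.refl * w) (dCross q h * g)

theorem Min.move {x y z : Config κ m} {w : Equiv.Perm (Fin m)} {g : Diag R κ m q}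
    (hg : Min q x y w g) (h : IsMove y z) : Min q x z w (dMove q h * g) := by
  cases hg with
  | base h' =>
    rw [move_mul_move q h' h (h'.trans h)]
    exact Min.base _
  | ghost h' asc hg =>
    rw [← mul_assoc, move_mul_ghost q h' h (h'.of_move h)]
    exact Min.ghost _ asc hg
  | cross h' asc hg =>
    rw [← mul_assoc, move_mul_cross q h' h (fun i j => (h' i j).trans (h _ _))]
    exact Min.cross _ asc hg

theorem Min.mem_filt {x y : Config κ m} {w : Equiv.Perm (Fin m)} {g : Diag R κ m q}
    (hg : Min q x y w g) : g ∈ Filt R κ m q (inv w + 1) := by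
  induction hg with
  | base h => exact filt_mono q (by simp [Slice.cr]) (slice_mem_filt q (Slice.move _ _ h))
  | ghost h asc hg ih =>
    simpa [Slice.cr] using slice_mul_mem_filt (Slice.ghost _ _ _ _ h) ih
  | cross h asc hg ih =>
    rw [inv_refl_mul asc]
    exact filt_mono q (by simp [Slice.cr]; omega) (slice_mul_mem_filt (Slice.cross _ _ _ h) ih)

theorem Min.idem_mul {x y : Config κ m} {w : Equiv.Perm (Fin m)} {g : Diag R κ m q}
    (hg : Min q x y w g) : idem R q y * g = g := by
  cases hg with
  | base h => exact idem_mul_slice q (Slice.move _ _ h)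
  | ghost h asc hg => rw [← mul_assoc]; congr 1; exact idem_mul_slice q (Slice.ghost _ _ _ _ h)
  | cross h asc hg => rw [← mul_assoc]; congr 1; exact idem_mul_slice q (Slice.cross _ _ _ h)

theorem Min.mul_idem {x y : Config κ m} {w : Equiv.Perm (Fin m)} {g : Diag R κ m q}
    (hg : Min q x y w g) : g * idem R q x = g := by
  induction hg with
  | base h => exact slice_mul_idem q (Slice.move _ _ h)
  | ghost h asc hg ih => rw [mul_assoc, ih]
  | cross h asc hg ih => rw [mul_assoc, ih]

/-- The pairs of a strand and a ghost whose order at `x` differs from the one at `y`, the strands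
being connected by `w`. -/
def sep (x y : Config κ m) (w : Equiv.Perm (Fin m)) : Finset (Fin m × Fin m) :=
  open Classical in
  Finset.univ.filter fun p => ¬ (Side x p.1 p.2 ↔ Side y (w p.1) (w p.2))

theorem mem_sep {x y : Config κ m} {w : Equiv.Perm (Fin m)} {p : Fin m × Fin m} :
    p ∈ sep x y w ↔ ¬ (Side x p.1 p.2 ↔ Side y (w p.1) (w p.2)) := by simp [sep]

/-- The number of walls which separate the ends. -/
def dist (x y : Config κ m) (w : Equiv.Perm (Fin m)) : ℕ := (sep x y w).card + inv w

theorem sep_ghost {x y z : Config κ m} {w : Equiv.Perm (Fin m)} {r t : Fin m}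
    (h : IsGhost r t y z) (asc : Side y r t ↔ Side x (w⁻¹ r) (w⁻¹ t)) :
    sep x z w = insert (w⁻¹ r, w⁻¹ t) (sep x y w) ∧ (w⁻¹ r, w⁻¹ t) ∉ sep x y w := by
  have e : (w⁻¹ r, w⁻¹ t) ∉ sep x y w := by
    rw [mem_sep, not_not]
    simp only [Equiv.Perm.coe_inv, Equiv.apply_symm_apply]
    exact asc.symm
  refine ⟨?_, e⟩
  ext ⟨i, j⟩
  rw [Finset.mem_insert, mem_sep, mem_sep]
  by_cases hij : w i = r ∧ w j = t
  · obtain ⟨rfl, rfl⟩ := hij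
    have h1 := h.flip
    simp only [Equiv.Perm.coe_inv, Equiv.symm_apply_apply] at asc ⊢
    tauto
  · have h1 := h.same hij
    have h2 : ¬ ((i, j) = (w⁻¹ r, w⁻¹ t)) := by
      intro e
      simp only [Prod.mk.injEq] at e
      obtain ⟨rfl, rfl⟩ := e
      simp at hij
    simp only [h2, false_or]
    rw [h1]

theorem sep_cross {x y z : Config κ m} {w : Equiv.Perm (Fin m)} {a : Adj m}
    (h : IsCross a y z) : sep x z (a.refl * w) = sep x y w := by
  ext ⟨i, j⟩
  rw [mem_sep, mem_sep, h (w i) (w j)]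
  rfl

theorem dist_ghost_lt {x y z : Config κ m} {w : Equiv.Perm (Fin m)} {r t : Fin m}
    (h : IsGhost r t y z) (asc : Side y r t ↔ Side x (w⁻¹ r) (w⁻¹ t)) :
    dist x y w < dist x z w := by
  obtain ⟨h1, h2⟩ := sep_ghost h asc
  rw [dist, dist, h1, Finset.card_insert_of_notMem h2]
  omega

theorem dist_cross_lt {x y z : Config κ m} {w : Equiv.Perm (Fin m)} {a : Adj m}
    (h : IsCross a y z) (hw : w⁻¹ a.hi < w⁻¹ a.lo) : dist x y (a.refl * w) < dist x z w := by
  have h1 := inv_refl_mul_desc hw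
  have h2 := sep_cross (x := x) (w := a.refl * w) h
  rw [refl_mul_cancel] at h2
  rw [dist, dist, h2]
  omega

/-- The positions in `x` of the strands at `y`. -/
def cref (x : Config κ m) (w : Equiv.Perm (Fin m)) (i : Fin m) : ℝ := x.pos (w⁻¹ i)

/-- Any two configurations are connected by a minimal diagram which induces a given permutation: the
walls which separate them are crossed one after the other, starting at `y`. -/
theorem exists_min (hκ : κ ≠ 0) (x y : Config κ m) (w : Equiv.Perm (Fin m)) :
    ∃ g, Min q x y w g := by
  induction hk : dist x y w using Nat.strong_induction_on generalizing y w with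
  | _ k ih =>
  subst hk
  by_cases hX : ∃ a, XDesc (Side y) (cref x w) a
  · obtain ⟨a, h1, h2, h3⟩ := hX
    have hc : IsCross a y y := isCross_self h2 h3
    have hw : w⁻¹ a.hi < w⁻¹ a.lo := x.strictMono.lt_iff_lt.1 h1
    obtain ⟨g, hg⟩ := ih _ (dist_cross_lt hc hw) y _ rfl
    have := Min.cross hc (by
      rwa [refl_mul_inv_apply, refl_mul_inv_apply, refl_lo, refl_hi]) hg
    rw [refl_mul_cancel] at this
    exact ⟨_, this⟩
  by_cases hG : ∃ r t, GDesc κ (Side y) (cref x w) r t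
  · obtain ⟨r, t, h⟩ := hG
    obtain ⟨z, hz⟩ := exists_isGhost hκ (h.ne y.isSide) h.1
    have asc : Side z r t ↔ Side x (w⁻¹ r) (w⁻¹ t) := by
      have h1 := hz.flip
      have h2 : Side y r t ↔ ¬ Side x (w⁻¹ r) (w⁻¹ t) := h.2
      tauto
    obtain ⟨g, hg⟩ := ih _ (dist_ghost_lt hz asc) z _ rfl
    exact ⟨_, Min.ghost hz asc hg⟩
  push Not at hX hG
  obtain ⟨h1, h2⟩ := eq_of_no_desc hκ y.isSide (c := cref x w)
    (fun i j h => w⁻¹.injective (x.strictMono.injective h)) (fun i j => x.generic _ _) hX hG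
  have hw : w⁻¹ = 1 := eq_one_of_adj fun a => x.strictMono.lt_iff_lt.1 (h1 a)
  obtain rfl : w = 1 := inv_eq_one.1 hw
  exact ⟨_, Min.base fun i j => (h2 i j).symm⟩

variable (q) in
/-- The minimal diagrams which end with the crossing of the strand `r` and the ghost of `t`. -/
def EndG (x : Config κ m) (r t : Fin m) (z : Config κ m) (w : Equiv.Perm (Fin m))
    (g : Diag R κ m q) : Prop :=
  ∃ y, ∃ h : IsGhost r t y z, ∃ g₀, (Side y r t ↔ Side x (w⁻¹ r) (w⁻¹ t)) ∧
    Min q x y w g₀ ∧ g = dGhost q h * g₀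

variable (q) in
/-- The minimal diagrams which end with the crossing of the strands `a`. -/
def EndX (x : Config κ m) (a : Adj m) (z : Config κ m) (w : Equiv.Perm (Fin m))
    (g : Diag R κ m q) : Prop :=
  ∃ y, ∃ h : IsCross a y z, ∃ g₀, w⁻¹ a.hi < w⁻¹ a.lo ∧
    Min q x y (a.refl * w) g₀ ∧ g = dCross q h * g₀

variable (q) in
/-- Minimal diagrams with the same ends at distance less than `N` agree modulo diagrams with fewer
crossings. -/
def UpTo (x : Config κ m) (N : ℕ) : Prop :=
  ∀ ⦃y w⦄ ⦃g g' : Diag R κ m q⦄, dist x y w < N → Min q x y w g → Min q x y w g' →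
    g - g' ∈ Filt R κ m q (inv w)

theorem EndG.at {x z : Config κ m} {r t : Fin m} {w : Equiv.Perm (Fin m)} {g : Diag R κ m q}
    (hE : EndG q x r t z w g) {y : Config κ m} (hy : IsGhost r t y z) :
    ∃ g₀, Min q x y w g₀ ∧ g = dGhost q hy * g₀ := by
  obtain ⟨y', h, g₀, -, hg, rfl⟩ := hE
  refine ⟨_, hg.move (h.move hy), ?_⟩
  rw [← mul_assoc, ghost_mul_move q (h.move hy) hy h]

theorem EndX.at {x z : Config κ m} {a : Adj m} {w : Equiv.Perm (Fin m)} {g : Diag R κ m q}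
    (hE : EndX q x a z w g) (hz : IsCross a z z) :
    ∃ g₀, Min q x z (a.refl * w) g₀ ∧ g = dCross q hz * g₀ := by
  obtain ⟨y', h, g₀, -, hg, rfl⟩ := hE
  refine ⟨_, hg.move h.isMove, ?_⟩
  rw [← mul_assoc, cross_mul_move q h.isMove hz h]

theorem EndG.asc {x z : Config κ m} {r t : Fin m} {w : Equiv.Perm (Fin m)} {g : Diag R κ m q}
    (hE : EndG q x r t z w g) : Side z r t ↔ ¬ Side x (w⁻¹ r) (w⁻¹ t) := by
  obtain ⟨y', h, g₀, h1, -⟩ := hE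
  have := h.flip
  tauto

theorem EndG.gDesc {x z : Config κ m} {r t : Fin m} {w : Equiv.Perm (Fin m)} {g : Diag R κ m q}
    (hE : EndG q x r t z w g) : GDesc κ (Side z) (cref x w) r t := by
  refine ⟨?_, hE.asc⟩
  obtain ⟨y', h, -⟩ := hE
  exact h.corner

theorem EndX.xDesc {x z : Config κ m} {a : Adj m} {w : Equiv.Perm (Fin m)} {g : Diag R κ m q}
    (hE : EndX q x a z w g) : XDesc (Side z) (cref x w) a := by
  obtain ⟨y', h, g₀, h1, -⟩ := hE
  exact ⟨x.strictMono h1, h.symm.row, h.symm.col⟩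

theorem exists_endG (hκ : κ ≠ 0) {x z : Config κ m} {r t : Fin m} {w : Equiv.Perm (Fin m)}
    (h : GDesc κ (Side z) (cref x w) r t) : ∃ g, EndG q x r t z w g := by
  obtain ⟨y, hy⟩ := exists_isGhost hκ (h.ne z.isSide) h.1
  obtain ⟨g, hg⟩ := exists_min (q := q) hκ x y w
  have h1 := hy.flip
  have h2 : Side z r t ↔ ¬ Side x (w⁻¹ r) (w⁻¹ t) := h.2
  exact ⟨_, y, hy, g, by tauto, hg, rfl⟩

theorem exists_endX (hκ : κ ≠ 0) {x z : Config κ m} {a : Adj m} {w : Equiv.Perm (Fin m)}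
    (h : XDesc (Side z) (cref x w) a) : ∃ g, EndX q x a z w g := by
  obtain ⟨g, hg⟩ := exists_min (q := q) hκ x z (a.refl * w)
  exact ⟨_, z, isCross_self h.2.1 h.2.2, g, x.strictMono.lt_iff_lt.1 h.1, hg, rfl⟩

theorem Min.cross_desc {x y z : Config κ m} {a : Adj m} {w : Equiv.Perm (Fin m)}
    {g : Diag R κ m q} (hg : Min q x y (a.refl * w) g) (h : IsCross a y z)
    (hw : w⁻¹ a.hi < w⁻¹ a.lo) : Min q x z w (dCross q h * g) := by
  have := Min.cross h (by rwa [refl_mul_inv_apply, refl_mul_inv_apply, refl_lo, refl_hi]) hg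
  rwa [refl_mul_cancel] at this

theorem IsGhost.square {r t r' t' : Fin m} {y₀ y₁ y₂ z : Config κ m} (h₁ : IsGhost r t y₁ z)
    (h₂ : IsGhost r' t' y₂ z) (h₁' : IsGhost r' t' y₀ y₁) : IsGhost r t y₀ y₂ := fun i j => by
  have e1 := h₁ i j
  have e2 := h₂ i j
  have e3 := h₁' i j
  by_cases c1 : i = r ∧ j = t <;> by_cases c2 : i = r' ∧ j = t' <;>
    simp only [c1, c2, not_true, not_false_iff, iff_true, iff_false] at e1 e2 e3 ⊢ <;> tauto

theorem IsGhost.isCross_fixed {a : Adj m} {r t : Fin m} {y z : Config κ m} (hz : IsCross a z z)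
    (h : IsGhost r t y z) (hr : a.refl r = r) (ht : a.refl t = t) : IsCross a y y := fun i j => by
  have e1 := h i j
  have e2 := h (a.refl i) (a.refl j)
  have e3 : a.refl i = r ↔ i = r := by rw [← a.refl.injective.eq_iff (a := i), hr]
  have e4 : a.refl j = t ↔ j = t := by rw [← a.refl.injective.eq_iff (a := j), ht]
  rw [e3, e4, ← hz i j] at e2
  by_cases c : i = r ∧ j = t
  · rw [c.1, c.2, hr, ht]
  · rw [e1.2 c, e2.2 c]

/-- If a ghost passes both of two strands which can cross (or a strand both of their ghosts), the
strands can cross on the other side, too. -/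
theorem IsGhost.isCross_swapped {a : Adj m} {r t r' t' : Fin m} {y₁ y₂ z : Config κ m}
    (hz : IsCross a z z) (h₁ : IsGhost r t y₁ z) (h₂ : IsGhost r' t' y₂ y₁) (hr : a.refl r = r')
    (ht : a.refl t = t') (hne : ¬ (r = r' ∧ t = t')) : IsCross a y₂ y₂ := fun i j => by
  have hr' : a.refl r' = r := by rw [← hr, refl_refl]
  have ht' : a.refl t' = t := by rw [← ht, refl_refl]
  have e1 := h₁ i j
  have e2 := h₁ (a.refl i) (a.refl j)
  have e3 := h₂ i j
  have e4 := h₂ (a.refl i) (a.refl j)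
  have f1 : a.refl i = r ↔ i = r' := by rw [← a.refl.injective.eq_iff (a := i), hr']
  have f2 : a.refl j = t ↔ j = t' := by rw [← a.refl.injective.eq_iff (a := j), ht']
  have f3 : a.refl i = r' ↔ i = r := by rw [← a.refl.injective.eq_iff (a := i), hr]
  have f4 : a.refl j = t' ↔ j = t := by rw [← a.refl.injective.eq_iff (a := j), ht]
  rw [f1, f2, ← hz i j] at e2
  rw [f3, f4] at e4
  have c : ¬ ((i = r ∧ j = t) ∧ (i = r' ∧ j = t')) := fun ⟨c1, c2⟩ =>
    hne ⟨c1.1.symm.trans c2.1, c1.2.symm.trans c2.2⟩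
  clear f1 f2 f3 f4 h₁ h₂ hz
  generalize (i = r ∧ j = t) = A at *
  generalize (i = r' ∧ j = t') = B at *
  by_cases c1 : A
  · have c2 : ¬ B := fun h => c ⟨c1, h⟩
    have n1 := Classical.not_iff.1 fun h => e1.1 h c1
    have n4 := Classical.not_iff.1 fun h => e4.1 h c1
    rw [e3.2 c2]
    exact not_iff_not.1 (n1.trans ((e2.2 c2).symm.trans n4.symm))
  · rw [e4.2 c1]
    by_cases c2 : B
    · have n2 := Classical.not_iff.1 fun h => e2.1 h c2
      have n3 := Classical.not_iff.1 fun h => e3.1 h c2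
      exact not_iff_not.1 (n3.trans ((e1.2 c1).trans n2.symm))
    · exact (e3.2 c2).trans ((e1.2 c1).trans (e2.2 c2).symm)

/-- A strand crossing a ghost last and another strand crossing another ghost last. -/
theorem endG_endG (hκ : κ ≠ 0) {x z y₀ y₁ y₂ : Config κ m} {r t r' t' : Fin m}
    {w : Equiv.Perm (Fin m)}
    (IH : UpTo q x (dist x z w)) (hne : ¬ (r = r' ∧ t = t')) (h₁ : IsGhost r t y₁ z)
    (h₂ : IsGhost r' t' y₂ z) (h₁' : IsGhost r' t' y₀ y₁) (h₂' : IsGhost r t y₀ y₂)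
    {g g' : Diag R κ m q} (hg : EndG q x r t z w g) (hg' : EndG q x r' t' z w g') :
    g - g' ∈ Filt R κ m q (inv w) := by
  have hne' : ¬ (r' = r ∧ t' = t) := fun h => hne ⟨h.1.symm, h.2.symm⟩
  have a1 : Side y₁ r t ↔ Side x (w⁻¹ r) (w⁻¹ t) := by rw [h₁.flip, hg.asc, not_not]
  have a2 : Side y₂ r' t' ↔ Side x (w⁻¹ r') (w⁻¹ t') := by rw [h₂.flip, hg'.asc, not_not]
  have a3 : Side y₀ r' t' ↔ Side x (w⁻¹ r') (w⁻¹ t') := by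
    rw [h₁'.flip, h₁.same hne', hg'.asc, not_not]
  have a4 : Side y₀ r t ↔ Side x (w⁻¹ r) (w⁻¹ t) := by
    rw [h₂'.flip, h₂.same hne, hg.asc, not_not]
  obtain ⟨g₁, m1, rfl⟩ := hg.at h₁
  obtain ⟨g₂, m2, rfl⟩ := hg'.at h₂
  obtain ⟨g₀, m0⟩ := exists_min (q := q) hκ x y₀ w
  have c1 := ghost_mul_sub_mem h₁ (IH (dist_ghost_lt h₁ a1) m1 (Min.ghost h₁' a3 m0))
  have c2 := ghost_mul_sub_mem h₂ (IH (dist_ghost_lt h₂ a2) m2 (Min.ghost h₂' a4 m0))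
  have e : dGhost q h₁ * (dGhost q h₁' * g₀) = dGhost q h₂ * (dGhost q h₂' * g₀) := by
    rw [← mul_assoc, ← mul_assoc, ghost_mul_ghost q hne' h₁' h₁ h₂' h₂]
  rw [e] at c1
  exact sub_mem_trans c1 (sub_mem_symm c2)

theorem endG_endG_of_corner (hκ : κ ≠ 0) {x z : Config κ m} {r t r' t' : Fin m}
    {w : Equiv.Perm (Fin m)} (IH : UpTo q x (dist x z w))
    (hc : r = r' ∨ t = t' → (Side z r t ↔ Side z r' t'))
    {g g' : Diag R κ m q} (hg : EndG q x r t z w g) (hg' : EndG q x r' t' z w g') :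
    g - g' ∈ Filt R κ m q (inv w) := by
  have hD := hg.gDesc
  have hD' := hg'.gDesc
  obtain ⟨y₁, h₁⟩ := exists_isGhost hκ (hD.ne z.isSide) hD.1
  obtain ⟨y₂, h₂⟩ := exists_isGhost hκ (hD'.ne z.isSide) hD'.1
  by_cases hne : r = r' ∧ t = t'
  · obtain ⟨rfl, rfl⟩ := hne
    have a1 : Side y₁ r t ↔ Side x (w⁻¹ r) (w⁻¹ t) := by rw [h₁.flip, hg.asc, not_not]
    obtain ⟨g₁, m1, rfl⟩ := hg.at h₁
    obtain ⟨g₂, m2, rfl⟩ := hg'.at h₁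
    exact ghost_mul_sub_mem h₁ (IH (dist_ghost_lt h₁ a1) m1 m2)
  have hs1 : Side y₁ = toggle (Side z) r t := by
    funext i j; exact propext (isGhost_iff.1 h₁ i j)
  have hc' : Corner (Side y₁) r' t' := by
    rw [hs1]
    exact hD'.1.of_toggle (fun h => hne ⟨h.1.symm, h.2.symm⟩) hc
  obtain ⟨y₀, h₁'⟩ := exists_isGhost hκ (hD'.ne z.isSide) hc'
  exact endG_endG hκ IH hne h₁ h₂ h₁' (h₁.square h₂ h₁') hg hg'

/-- A strand crossing a ghost last and another strand crossing another ghost last, which meet in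
a triple point with the crossing of the two strands, or of the two ghosts. -/
theorem endG_endG_triple (hκ : κ ≠ 0) {x z y₁ y₂ : Config κ m} {a : Adj m} {r t r' t' : Fin m}
    {w : Equiv.Perm (Fin m)} (IH : UpTo q x (dist x z w)) (hr : a.refl r = r')
    (ht : a.refl t = t') (wa : w⁻¹ a.hi < w⁻¹ a.lo) (h₁ : IsGhost r t y₁ z)
    (h₂ : IsGhost r' t' y₂ z) (c₁ : IsCross a y₁ y₁) (c₂ : IsCross a y₂ y₂)
    (hd : Side z r t ↔ ¬ Side z r' t') {e : R}
    (hrel : dGhost q h₁ * dCross q c₁ * dGhost q h₁.symm =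
      dGhost q h₂ * dCross q c₂ * dGhost q h₂.symm + e • idem R q z)
    {g g' : Diag R κ m q} (hg : EndG q x r t z w g) (hg' : EndG q x r' t' z w g') :
    g - g' ∈ Filt R κ m q (inv w) := by
  have hr' : a.refl r' = r := by rw [← hr, refl_refl]
  have ht' : a.refl t' = t := by rw [← ht, refl_refl]
  have a1 : Side y₁ r t ↔ Side x (w⁻¹ r) (w⁻¹ t) := by rw [h₁.flip, hg.asc, not_not]
  have a2 : Side y₂ r' t' ↔ Side x (w⁻¹ r') (w⁻¹ t') := by rw [h₂.flip, hg'.asc, not_not]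
  have a3 : Side z r t ↔ Side x ((a.refl * w)⁻¹ r) ((a.refl * w)⁻¹ t) := by
    rw [refl_mul_inv_apply, refl_mul_inv_apply, hr, ht, hd, hg'.asc, not_not]
  have a4 : Side z r' t' ↔ Side x ((a.refl * w)⁻¹ r') ((a.refl * w)⁻¹ t') := by
    rw [refl_mul_inv_apply, refl_mul_inv_apply, hr', ht', ← not_iff_not, ← hd, hg.asc]
  obtain ⟨g₁, m1, rfl⟩ := hg.at h₁
  obtain ⟨g₂, m2, rfl⟩ := hg'.at h₂
  -- the two diagrams are compared with the two resolutions of the triple point, put on top of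
  -- `g₀`; the additional term `e g₀` has one crossing less
  obtain ⟨g₀, m0⟩ := exists_min (q := q) hκ x z (a.refl * w)
  have b1 := ghost_mul_sub_mem h₁ (IH (dist_ghost_lt h₁ a1) m1
    ((Min.ghost h₁.symm a3 m0).cross_desc c₁ wa))
  have b2 := ghost_mul_sub_mem h₂ (IH (dist_ghost_lt h₂ a2) m2
    ((Min.ghost h₂.symm a4 m0).cross_desc c₂ wa))
  have b3 : dGhost q h₁ * (dCross q c₁ * (dGhost q h₁.symm * g₀)) -
      dGhost q h₂ * (dCross q c₂ * (dGhost q h₂.symm * g₀)) ∈ Filt R κ m q (inv w) := by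
    have : dGhost q h₁ * (dCross q c₁ * (dGhost q h₁.symm * g₀)) =
        dGhost q h₂ * (dCross q c₂ * (dGhost q h₂.symm * g₀)) + e • g₀ := by
      rw [← mul_assoc, ← mul_assoc, hrel, add_mul, smul_mul_assoc, m0.idem_mul, mul_assoc,
        mul_assoc]
    rw [this, add_sub_cancel_left, ← inv_refl_mul_desc wa]
    exact Submodule.smul_mem _ _ m0.mem_filt
  exact sub_mem_trans (sub_mem_trans b1 b3) (sub_mem_symm b2)

/-- Two crossings of strands which can both be last. -/
theorem endX_endX (hκ : κ ≠ 0) {x z : Config κ m} {a b : Adj m} {w : Equiv.Perm (Fin m)}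
    (IH : UpTo q x (dist x z w)) {g g' : Diag R κ m q} (hg : EndX q x a z w g)
    (hg' : EndX q x b z w g') : g - g' ∈ Filt R κ m q (inv w) := by
  wlog hab : a.1 ≤ b.1 generalizing a b g g'
  · exact sub_mem_symm (this hg' hg (le_of_not_ge hab))
  have hD := hg.xDesc
  have hD' := hg'.xDesc
  have ha : IsCross a z z := isCross_self hD.2.1 hD.2.2
  have hb : IsCross b z z := isCross_self hD'.2.1 hD'.2.2
  have wa : w⁻¹ a.hi < w⁻¹ a.lo := x.strictMono.lt_iff_lt.1 hD.1
  have wb : w⁻¹ b.hi < w⁻¹ b.lo := x.strictMono.lt_iff_lt.1 hD'.1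
  have ia := inv_refl_mul_desc wa
  have ib := inv_refl_mul_desc wb
  have da := dist_cross_lt (x := x) ha wa
  have db := dist_cross_lt (x := x) hb wb
  obtain ⟨g₁, m1, rfl⟩ := hg.at ha
  obtain ⟨g₂, m2, rfl⟩ := hg'.at hb
  rcases hab.eq_or_lt with hab | hab
  · obtain rfl : a = b := Subtype.ext hab
    have := cross_mul_sub_mem ha (IH da m1 m2)
    rwa [ia] at this
  rcases (Nat.succ_le_of_lt hab).lt_or_eq with hab' | hab'
  · -- distant crossings commute
    obtain ⟨e1, e2, e3, e4⟩ := refl_apply_far hab'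
    obtain ⟨g₀, m0⟩ := exists_min (q := q) hκ x z (b.refl * (a.refl * w))
    have m1' := m0.cross_desc hb (by rwa [refl_mul_inv_apply, refl_mul_inv_apply, e1, e2])
    rw [← mul_assoc, ← refl_comm_far hab', mul_assoc] at m0
    have m2' := m0.cross_desc ha (by rwa [refl_mul_inv_apply, refl_mul_inv_apply, e3, e4])
    have c1 := cross_mul_sub_mem ha (IH da m1 m1')
    have c2 := cross_mul_sub_mem hb (IH db m2 m2')
    rw [ia] at c1
    rw [ib] at c2
    rw [← mul_assoc, cross_mul_cross_far q hab' ha hb, mul_assoc] at c1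
    exact sub_mem_trans c1 (sub_mem_symm c2)
  · -- three strands
    have hab' : b.1 = a.1 + 1 := hab'.symm
    obtain ⟨e1, e2, e3, e4⟩ := refl_apply_near hab'
    rw [e1] at wb
    have br : a.refl * (b.refl * (a.refl * w)) = b.refl * (a.refl * (b.refl * w)) := by
      have := congrArg (· * w) (refl_braid hab')
      simpa only [mul_assoc] using this
    have hbhi : b.refl b.hi = a.hi := by rw [refl_hi, e1]
    obtain ⟨g₀, m0⟩ := exists_min (q := q) hκ x z (a.refl * (b.refl * (a.refl * w)))
    have m1' := (m0.cross_desc ha (by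
      simp only [refl_mul_inv_apply, e1, e2, e3, e4, refl_lo, refl_hi, hbhi]; exact wb)).cross_desc hb (by
      simp only [refl_mul_inv_apply, e1, e2, e3, e4, refl_lo, refl_hi, hbhi]; exact wb.trans wa)
    rw [br] at m0
    have m2' := (m0.cross_desc hb (by
      simp only [refl_mul_inv_apply, e1, e2, e3, e4, refl_lo, refl_hi, hbhi]; exact wa)).cross_desc ha (by
      simp only [refl_mul_inv_apply, e1, e2, e3, e4, refl_lo, refl_hi, hbhi]; exact wb.trans wa)
    have c1 := cross_mul_sub_mem ha (IH da m1 m1')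
    have c2 := cross_mul_sub_mem hb (IH db m2 m2')
    rw [ia] at c1
    rw [ib] at c2
    have e : dCross q ha * (dCross q hb * (dCross q ha * g₀)) =
        dCross q hb * (dCross q ha * (dCross q hb * g₀)) := by
      simp only [← mul_assoc]
      rw [cross_braid q hab' ha hb]
    rw [e] at c1
    exact sub_mem_trans c1 (sub_mem_symm c2)

/-- A crossing of strands and a crossing with a ghost which can both be last, for a triple point at
which two adjacent strands and a ghost, or two ghosts and a strand, meet. -/
theorem endX_endG_through (hκ : κ ≠ 0) {x z y₁ y₂ : Config κ m} {a : Adj m} {r t r' t' : Fin m}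
    {w : Equiv.Perm (Fin m)} (IH : UpTo q x (dist x z w)) (hr : a.refl r = r')
    (ht : a.refl t = t') (hne : ¬ (r = r' ∧ t = t')) (hz : IsCross a z z) (hy : IsCross a y₂ y₂)
    (h₁ : IsGhost r t y₁ z) (h₂ : IsGhost r' t' y₂ y₁)
    (hd : Side x (w⁻¹ r') (w⁻¹ t') ↔ Side x (w⁻¹ r) (w⁻¹ t))
    (hrel : dCross (R := R) q hz * (dGhost q h₁ * dGhost q h₂) =
      dGhost q h₁ * dGhost q h₂ * dCross q hy)
    {g g' : Diag R κ m q} (hg : EndX q x a z w g) (hg' : EndG q x r t z w g') :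
    g - g' ∈ Filt R κ m q (inv w) := by
  have hr' : a.refl r' = r := by rw [← hr, refl_refl]
  have ht' : a.refl t' = t := by rw [← ht, refl_refl]
  have wa : w⁻¹ a.hi < w⁻¹ a.lo := x.strictMono.lt_iff_lt.1 hg.xDesc.1
  have ia := inv_refl_mul_desc wa
  have f4 := hz r t
  rw [hr, ht] at f4
  have a1 : Side y₁ r t ↔ Side x (w⁻¹ r) (w⁻¹ t) := by rw [h₁.flip, hg'.asc, not_not]
  have a2 : Side y₁ r t ↔ Side x ((a.refl * w)⁻¹ r) ((a.refl * w)⁻¹ t) := by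
    rw [refl_mul_inv_apply, refl_mul_inv_apply, hr, ht, hd, a1]
  have a3 : Side y₂ r' t' ↔ Side x (w⁻¹ r') (w⁻¹ t') := by
    rw [h₂.flip, h₁.same fun h => hne ⟨h.1.symm, h.2.symm⟩, ← f4, hg'.asc, not_not, hd]
  have a4 : Side y₂ r' t' ↔ Side x ((a.refl * w)⁻¹ r') ((a.refl * w)⁻¹ t') := by
    rw [refl_mul_inv_apply, refl_mul_inv_apply, hr', ht', a3, hd]
  obtain ⟨g₁, m1, rfl⟩ := hg.at hz
  obtain ⟨g₂, m2, rfl⟩ := hg'.at h₁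
  obtain ⟨g₀, m0⟩ := exists_min (q := q) hκ x y₂ (a.refl * w)
  have m1' := Min.ghost h₁ a2 (Min.ghost h₂ a4 m0)
  have m2' := Min.ghost h₂ a3 (m0.cross_desc hy wa)
  have c1 := cross_mul_sub_mem hz (IH (dist_cross_lt hz wa) m1 m1')
  have c2 := ghost_mul_sub_mem h₁ (IH (dist_ghost_lt h₁ a1) m2 m2')
  rw [ia] at c1
  have e : dCross q hz * (dGhost q h₁ * (dGhost q h₂ * g₀)) =
      dGhost q h₁ * (dGhost q h₂ * (dCross q hy * g₀)) := by
    rw [← mul_assoc (dGhost q h₁), ← mul_assoc, hrel]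
    simp only [mul_assoc]
  rw [e] at c1
  exact sub_mem_trans c1 (sub_mem_symm c2)

/-- A crossing of strands and a crossing with a ghost which can both be last: they are disjoint, or
the strand or the ghost passes both of the crossing strands or ghosts. -/
theorem endX_endG (hκ : κ ≠ 0) (hq : IsUnit q) {x z : Config κ m} {a : Adj m} {r t : Fin m}
    {w : Equiv.Perm (Fin m)} (IH : UpTo q x (dist x z w)) {g g' : Diag R κ m q}
    (hg : EndX q x a z w g) (hg' : EndG q x r t z w g') : g - g' ∈ Filt R κ m q (inv w) := by
  have hD := hg.xDesc
  have hD' := hg'.gDesc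
  have hz : IsCross a z z := isCross_self hD.2.1 hD.2.2
  have row := hD.2.1
  have col := hD.2.2
  have ca : cref x w a.hi < cref x w a.lo := hD.1
  have wa : w⁻¹ a.hi < w⁻¹ a.lo := x.strictMono.lt_iff_lt.1 ca
  have hlh := a.lo_lt_hi
  have hd0 := hD'.2
  have hrt := hD'.ne z.isSide
  have hcor := hD'.1
  obtain ⟨y₁, h₁⟩ := exists_isGhost hκ hrt hD'.1
  -- the crossing of the ghost is completed to a passage of the ghost through the crossing `a`
  have main (r' t' : Fin m) (hr : a.refl r = r') (ht : a.refl t = t') (hne : ¬ (r = r' ∧ t = t'))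
      (hc : (Side y₁ r' t' ∧ (∀ i, r' < i → ¬ Side y₁ i t') ∧ ∀ j, j < t' → ¬ Side y₁ r' j) ∨
        (¬ Side y₁ r' t' ∧ (∀ i, i < r' → Side y₁ i t') ∧ ∀ j, t' < j → Side y₁ r' j))
      (hd : Side x (w⁻¹ r') (w⁻¹ t') ↔ Side x (w⁻¹ r) (w⁻¹ t))
      (hrel : ∀ y₂ (h₂ : IsGhost r' t' y₂ y₁) (hy : IsCross a y₂ y₂),
        dCross (R := R) q hz * (dGhost q h₁ * dGhost q h₂) =
          dGhost q h₁ * dGhost q h₂ * dCross q hy) : g - g' ∈ Filt R κ m q (inv w) := by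
    have hne' : r' ≠ t' := by
      rw [← hr, ← ht]
      exact a.refl.injective.ne hrt
    obtain ⟨y₂, h₂⟩ := exists_isGhost hκ hne' hc
    have hy := IsGhost.isCross_swapped hz h₁ h₂ hr ht hne
    exact endX_endG_through hκ IH hr ht hne hz hy h₁ h₂ hd (hrel y₂ h₂ hy) hg hg'
  by_cases r1 : r = a.lo
  · subst r1
    have S0 : ¬ Side z a.lo t := by
      rcases hcor with ⟨s1, s2, -⟩ | h
      · exact absurd ((row t).1 s1) (s2 _ hlh)
      · exact h.1
    obtain ⟨-, s2, s3⟩ := hcor.resolve_left fun h => S0 h.1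
    have S1 : cref x w a.lo < cref x w t + κ := by
      by_contra h
      exact S0 (hd0.2 h)
    by_cases t1 : t = a.hi
    · -- impossible: the strands `a` and their ghosts would be crossing
      exfalso
      subst t1
      have e1 := z.isSide.diag a.lo
      rw [col] at e1
      rcases lt_or_gt_of_ne hκ with h | h
      · linarith
      · exact S0 (e1.2 h)
    have ft := refl_of_ne a hrt.symm t1
    refine main a.hi t (refl_lo a) ft (fun h => a.hi_ne_lo h.1.symm) (Or.inr ⟨?_, ?_, ?_⟩) ?_
      fun y₂ h₂ hy => (cross_through_ghost q hrt.symm t1 hy hz).1 h₂ h₁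
    · rw [h₁.same fun h => a.hi_ne_lo h.1, ← row]; exact S0
    · intro i hi
      rcases (a.lt_hi_iff.1 hi).eq_or_lt with rfl | h
      · exact h₁.flip.2 S0
      · rw [h₁.same fun h' => h.ne h'.1]; exact s2 _ h
    · intro j hj
      rw [h₁.same fun h' => a.hi_ne_lo h'.1, ← row]; exact s3 _ hj
    · exact iff_of_true (ca.trans S1) S1
  by_cases r2 : r = a.hi
  · subst r2
    have S0 : Side z a.hi t := by
      rcases hcor with h | ⟨s1, s2, -⟩
      · exact h.1
      · exact absurd ((row t).1 (s2 _ hlh)) s1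
    obtain ⟨-, s2, s3⟩ := hcor.resolve_right fun h => h.1 S0
    have S1 : ¬ cref x w a.hi < cref x w t + κ := hd0.1 S0
    by_cases t1 : t = a.lo
    · exfalso
      subst t1
      have e1 := z.isSide.diag a.lo
      rw [row] at e1
      have := e1.1 S0
      exact S1 (by linarith)
    have ft := refl_of_ne a t1 hrt.symm
    refine main a.lo t (refl_hi a) ft (fun h => a.hi_ne_lo h.1) (Or.inl ⟨?_, ?_, ?_⟩) ?_
      fun y₂ h₂ hy => (cross_through_ghost q t1 hrt.symm hy hz).2 h₂ h₁
    · rw [h₁.same fun h => r1 h.1.symm, row]; exact S0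
    · intro i hi
      rcases (a.lo_lt_iff.1 hi).eq_or_lt with rfl | h
      · exact fun h' => h₁.flip.1 h' S0
      · rw [h₁.same fun h' => h.ne' h'.1]; exact s2 _ h
    · intro j hj
      rw [h₁.same fun h' => r1 h'.1.symm, row]; exact s3 _ hj
    · exact iff_of_false (fun h => S1 (ca.trans h)) S1
  have fr := refl_of_ne a r1 r2
  by_cases t1 : t = a.lo
  · subst t1
    have S0 : Side z r a.lo := by
      rcases hcor with h | ⟨s1, -, s3⟩
      · exact h.1
      · exact absurd ((col r).2 (s3 _ hlh)) s1
    obtain ⟨-, s2, s3⟩ := hcor.resolve_right fun h => h.1 S0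
    have S1 : ¬ cref x w r < cref x w a.lo + κ := hd0.1 S0
    refine main r a.hi fr (refl_lo a) (fun h => a.hi_ne_lo h.2.symm) (Or.inl ⟨?_, ?_, ?_⟩) ?_
      fun y₂ h₂ hy => (cross_through_strand q hq r1 r2 hy hz).1 h₂ h₁
    · rw [h₁.same fun h => a.hi_ne_lo h.2, ← col]; exact S0
    · intro i hi
      rw [h₁.same fun h' => hi.ne' h'.1, ← col]; exact s2 _ hi
    · intro j hj
      rcases (a.lt_hi_iff.1 hj).eq_or_lt with rfl | h
      · exact fun h' => h₁.flip.1 h' S0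
      · rw [h₁.same fun h' => h.ne h'.2]; exact s3 _ h
    · exact iff_of_false (fun h => S1 (lt_trans h (show cref x w a.hi + κ < cref x w a.lo + κ by linarith))) S1
  by_cases t2 : t = a.hi
  · subst t2
    have S0 : ¬ Side z r a.hi := by
      rcases hcor with ⟨s1, -, s3⟩ | h
      · exact absurd ((col r).2 s1) (s3 _ hlh)
      · exact h.1
    obtain ⟨-, s2, s3⟩ := hcor.resolve_left fun h => S0 h.1
    have S1 : cref x w r < cref x w a.hi + κ := by
      by_contra h
      exact S0 (hd0.2 h)
    refine main r a.lo fr (refl_hi a) (fun h => a.hi_ne_lo h.2) (Or.inr ⟨?_, ?_, ?_⟩) ?_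
      fun y₂ h₂ hy => (cross_through_strand q hq r1 r2 hy hz).2 h₂ h₁
    · rw [h₁.same fun h => t1 h.2.symm, col]; exact S0
    · intro i hi
      rw [h₁.same fun h' => hi.ne h'.1, col]; exact s2 _ hi
    · intro j hj
      rcases (a.lo_lt_iff.1 hj).eq_or_lt with rfl | h
      · exact h₁.flip.2 S0
      · rw [h₁.same fun h' => h.ne' h'.2]; exact s3 _ h
    · exact iff_of_true (lt_trans S1 (show cref x w a.hi + κ < cref x w a.lo + κ by linarith)) S1
  -- the two crossings are disjoint
  have ft := refl_of_ne a t1 t2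
  have hy := h₁.isCross_fixed hz fr ft
  have ia := inv_refl_mul_desc wa
  have a1 : Side y₁ r t ↔ Side x (w⁻¹ r) (w⁻¹ t) := by rw [h₁.flip, hg'.asc, not_not]
  have a2 : Side y₁ r t ↔ Side x ((a.refl * w)⁻¹ r) ((a.refl * w)⁻¹ t) := by
    rw [refl_mul_inv_apply, refl_mul_inv_apply, fr, ft, a1]
  obtain ⟨g₁, m1, rfl⟩ := hg.at hz
  obtain ⟨g₂, m2, rfl⟩ := hg'.at h₁
  obtain ⟨g₀, m0⟩ := exists_min (q := q) hκ x y₁ (a.refl * w)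
  have c1 := cross_mul_sub_mem hz (IH (dist_cross_lt hz wa) m1 (Min.ghost h₁ a2 m0))
  have c2 := ghost_mul_sub_mem h₁ (IH (dist_ghost_lt h₁ a1) m2 (m0.cross_desc hy wa))
  rw [ia, ← mul_assoc, ← ghost_mul_cross q fr ft hy h₁ h₁ hz, mul_assoc] at c1
  exact sub_mem_trans c1 (sub_mem_symm c2)

theorem Min.last {x y : Config κ m} {w : Equiv.Perm (Fin m)} {g : Diag R κ m q}
    (hg : Min q x y w g) : (∃ h : IsMove x y, w = 1 ∧ g = dMove q h) ∨
      (∃ r t, EndG q x r t y w g) ∨ ∃ a, EndX q x a y w g := by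
  cases hg with
  | base h => exact Or.inl ⟨h, rfl, rfl⟩
  | ghost h asc hg => exact Or.inr (Or.inl ⟨_, _, _, h, _, asc, hg, rfl⟩)
  | @cross a y' _ w g h asc hg =>
    refine Or.inr (Or.inr ⟨a, _, h, _, ?_, by rwa [refl_mul_cancel], rfl⟩)
    rwa [refl_mul_inv_apply, refl_mul_inv_apply, refl_lo, refl_hi]

theorem EndG.not_move {x y : Config κ m} {r t : Fin m} {g : Diag R κ m q}
    (hg : EndG q x r t y 1 g) : ¬ IsMove x y := fun h => by
  have h1 := hg.asc
  have h2 := h r t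
  have h3 : Side y r t ↔ ¬ Side x r t := h1
  tauto

/-- Two ghost crossings at which the order of strand and ghost changes in opposite directions. -/
theorem endG_endG_opposite (hκ : κ ≠ 0) (hq : IsUnit q) {x z : Config κ m} {r t r' t' : Fin m}
    {w : Equiv.Perm (Fin m)} (IH : UpTo q x (dist x z w)) (hc : r = r' ∨ t = t')
    (hs : Side z r t) (hs' : ¬ Side z r' t')
    {g g' : Diag R κ m q} (hg : EndG q x r t z w g) (hg' : EndG q x r' t' z w g') :
    g - g' ∈ Filt R κ m q (inv w) := by
  have hD := hg.gDesc
  have hD' := hg'.gDesc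
  rcases hD.compat hκ z.isSide (fun i j => x.generic _ _) hD' hs hs' hc with
    ⟨a, rfl, rfl, rfl, col⟩ | ⟨a, rfl, rfl, rfl, row⟩ | ⟨b, hb⟩ | ⟨p, u, hK, k1, k2⟩
  · -- two strands and a ghost: the strands cross, and the ghost can pass on either side
    obtain ⟨y₁, h₁⟩ := exists_isGhost hκ (hD.ne z.isSide) hD.1
    obtain ⟨y₂, h₂⟩ := exists_isGhost hκ (hD'.ne z.isSide) hD'.1
    have n1 := (hD.ne z.isSide).symm
    have n2 := (hD'.ne z.isSide).symm
    have ft := refl_of_ne a n1 n2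
    have wa : w⁻¹ a.hi < w⁻¹ a.lo := by
      refine x.strictMono.lt_iff_lt.1 ?_
      have e1 : ¬ cref x w a.lo < cref x w t + κ := hD.2.1 hs
      have e2 : cref x w a.hi < cref x w t + κ := by
        by_contra h
        exact hs' (hD'.2.2 h)
      exact lt_of_lt_of_le e2 (not_lt.1 e1)
    obtain ⟨-, -, s3⟩ := hD.1.resolve_right fun h => h.1 hs
    obtain ⟨-, -, s3'⟩ := hD'.1.resolve_left fun h => hs' h.1
    have row (j : Fin m) (hj : j ≠ t) : Side z a.lo j ↔ Side z a.hi j := by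
      rcases lt_or_gt_of_ne hj with h | h
      · exact iff_of_false (s3 _ h) fun h' => s3 _ h h'.lo_of_hi
      · exact iff_of_true (s3' _ h).lo_of_hi (s3' _ h)
    have c₁ : IsCross a y₁ y₁ := by
      refine isCross_self (fun j => ?_) fun i => ?_
      · by_cases hj : j = t
        · subst hj
          rw [h₁.flip, h₁.same (i := a.hi) fun h => a.hi_ne_lo h.1]
          exact iff_of_false (not_not.2 hs) hs'
        · rw [h₁.same fun h => hj h.2, h₁.same fun h => hj h.2, row j hj]
      · rw [h₁.same fun h => n1 h.2.symm, h₁.same fun h => n2 h.2.symm, col]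
    have c₂ : IsCross a y₂ y₂ := by
      refine isCross_self (fun j => ?_) fun i => ?_
      · by_cases hj : j = t
        · subst hj
          rw [h₂.flip, h₂.same (i := a.lo) fun h => a.hi_ne_lo h.1.symm]
          exact iff_of_true hs hs'
        · rw [h₂.same fun h => hj h.2, h₂.same fun h => hj h.2, row j hj]
      · rw [h₂.same fun h => n1 h.2.symm, h₂.same fun h => n2 h.2.symm, col]
    refine endG_endG_triple hκ IH (e := 1) (refl_lo a) ft wa h₁ h₂ c₁ c₂ (iff_of_true hs hs') ?_ hg hg'
    rw [one_smul]
    exact triple_strands q h₁.symm c₁ h₂.symm c₂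
  · -- a strand and two ghosts: the ghosts cross, and the strand can pass on either side
    obtain ⟨y₁, h₁⟩ := exists_isGhost hκ (hD.ne z.isSide) hD.1
    obtain ⟨y₂, h₂⟩ := exists_isGhost hκ (hD'.ne z.isSide) hD'.1
    have n1 := hD'.ne z.isSide
    have n2 := hD.ne z.isSide
    have fr := refl_of_ne a n1 n2
    have wa : w⁻¹ a.hi < w⁻¹ a.lo := by
      refine x.strictMono.lt_iff_lt.1 ?_
      have e1 : ¬ cref x w r < cref x w a.hi + κ := hD.2.1 hs
      have e2 : cref x w r < cref x w a.lo + κ := by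
        by_contra h
        exact hs' (hD'.2.2 h)
      have : cref x w a.hi < cref x w a.lo := by linarith
      exact this
    obtain ⟨-, s2, -⟩ := hD.1.resolve_right fun h => h.1 hs
    obtain ⟨-, s2', -⟩ := hD'.1.resolve_left fun h => hs' h.1
    have col (i : Fin m) (hi : i ≠ r) : Side z i a.lo ↔ Side z i a.hi := by
      rcases lt_or_gt_of_ne hi with h | h
      · exact iff_of_true (s2' _ h) (s2' _ h).hi_of_lo
      · exact iff_of_false (fun h' => s2 _ h h'.hi_of_lo) (s2 _ h)
    have c₁ : IsCross a y₁ y₁ := by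
      refine isCross_self (fun j => ?_) fun i => ?_
      · rw [h₁.same fun h => n1 h.1.symm, h₁.same fun h => n2 h.1.symm, row]
      · by_cases hi : i = r
        · subst hi
          rw [h₁.flip, h₁.same (j := a.lo) fun h => a.hi_ne_lo h.2.symm]
          exact iff_of_false hs' (not_not.2 hs)
        · rw [h₁.same fun h => hi h.1, h₁.same fun h => hi h.1, col i hi]
    have c₂ : IsCross a y₂ y₂ := by
      refine isCross_self (fun j => ?_) fun i => ?_
      · rw [h₂.same fun h => n1 h.1.symm, h₂.same fun h => n2 h.1.symm, row]
      · by_cases hi : i = r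
        · subst hi
          rw [h₂.flip, h₂.same (j := a.hi) fun h => a.hi_ne_lo h.2]
          exact iff_of_true hs' hs
        · rw [h₂.same fun h => hi h.1, h₂.same fun h => hi h.1, col i hi]
    refine endG_endG_triple hκ IH (e := q) fr (refl_hi a) wa h₁ h₂ c₁ c₂ (iff_of_true hs hs') ?_ hg hg'
    have := triple_ghosts q h₂.symm c₂ h₁.symm c₁
    exact (sub_eq_iff_eq_add.1 this.symm)
  -- both diagrams are compared with one which ends at the third wall
  · obtain ⟨k, hk⟩ := exists_endX (q := q) hκ hb
    exact sub_mem_trans (sub_mem_symm (endX_endG hκ hq IH hk hg)) (endX_endG hκ hq IH hk hg')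
  · obtain ⟨k, hk⟩ := exists_endG (q := q) hκ hK
    refine sub_mem_trans (endG_endG_of_corner hκ IH (fun h => ?_) hg hk)
      (endG_endG_of_corner hκ IH (fun h => ?_) hk hg')
    · exact iff_of_true hs (k1 (h.imp Eq.symm Eq.symm))
    · exact iff_of_false (k2 h) hs'

/-- Minimal diagrams with the same ends, inducing the same permutation, agree modulo diagrams
with fewer crossings of strands. -/
theorem min_unique (hκ : κ ≠ 0) (hq : IsUnit q) {x y : Config κ m} {w : Equiv.Perm (Fin m)}
    {g g' : Diag R κ m q} (hg : Min q x y w g) (hg' : Min q x y w g') :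
    g - g' ∈ Filt R κ m q (inv w) := by
  suffices h : ∀ N, UpTo q x N from h _ (Nat.lt_succ_self _) hg hg'
  clear hg hg' g g'
  intro N
  induction N with
  | zero => intro y w g g' h; omega
  | succ N ih =>
    intro y w g g' h hg hg'
    have IH : UpTo q x (dist x y w) := fun y' w' k k' h' => ih (by omega)
    rcases hg.last with ⟨h1, rfl, rfl⟩ | ⟨r, t, h1⟩ | ⟨a, h1⟩ <;>
      rcases hg'.last with ⟨h2, h3, rfl⟩ | ⟨r', t', h2⟩ | ⟨b, h2⟩
    · rw [sub_self]; exact zero_mem _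
    · exact absurd h1 h2.not_move
    · exact absurd (x.strictMono.lt_iff_lt.1 h2.xDesc.1) (lt_asymm b.lo_lt_hi)
    · subst h3; exact absurd h2 h1.not_move
    · by_cases hc : r = r' ∨ t = t' → (Side y r t ↔ Side y r' t')
      · exact endG_endG_of_corner hκ IH hc h1 h2
      · obtain ⟨hc, hs⟩ := Classical.not_imp.1 hc
        by_cases s1 : Side y r t
        · exact endG_endG_opposite hκ hq IH hc s1 (fun s2 => hs (iff_of_true s1 s2)) h1 h2
        · refine sub_mem_symm (endG_endG_opposite hκ hq IH (hc.imp Eq.symm Eq.symm) ?_ s1 h2 h1)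
          by_contra s2
          exact hs (iff_of_false s1 s2)
    · exact sub_mem_symm (endX_endG hκ hq IH h2 h1)
    · subst h3; exact absurd (x.strictMono.lt_iff_lt.1 h1.xDesc.1) (lt_asymm a.lo_lt_hi)
    · exact endX_endG hκ hq IH h1 h2
    · exact endX_endX hκ IH h1 h2

/-- A minimal diagram on top of a minimal diagram is minimal if no wall is crossed twice. -/
theorem Min.concat {x y z : Config κ m} {v w : Equiv.Perm (Fin m)} {g g' : Diag R κ m q}
    (hg : Min q x y w g) (hg' : Min q y z v g')
    (hs : ∀ i j, ¬ (Side y i j ↔ Side z (v i) (v j)) →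
      (Side x (w⁻¹ i) (w⁻¹ j) ↔ Side y i j))
    (hi : inv (v * w) = inv v + inv w) : Min q x z (v * w) (g' * g) := by
  induction hg' with
  | base h => simpa using hg.move h
  | @ghost r t y' z v g' h asc hg' ih =>
    rw [mul_assoc]
    refine Min.ghost h ?_ (ih (fun i j hij => hs i j fun e => ?_) hi)
    · rw [asc]
      refine (hs (v⁻¹ r) (v⁻¹ t) ?_).symm
      have h1 : Side y (v⁻¹ r) (v⁻¹ t) ↔ Side y' r t := asc.symm
      have h2 : Side z (v (v⁻¹ r)) (v (v⁻¹ t)) ↔ Side z r t := by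
        rw [← Equiv.Perm.mul_apply, ← Equiv.Perm.mul_apply, mul_inv_cancel]; rfl
      rw [h1, h2, h.flip]
      tauto
    · have h1 := (sep_ghost h asc).1
      have h2 : (i, j) ∈ sep y z v := by
        rw [h1]; exact Finset.mem_insert_of_mem (mem_sep.2 hij)
      exact mem_sep.1 h2 e
  | @cross a y' z v g' h asc hg' ih =>
    have h1 := inv_refl_mul asc
    have h2 := inv_mul_le v w
    have h3 := inv_refl_mul_le a (v * w)
    rw [← mul_assoc] at h3
    rw [mul_assoc, mul_assoc]
    refine Min.cross h (asc_of_inv ?_) (ih (fun i j hij => hs i j fun e => ?_) (by omega))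
    · rw [← mul_assoc]; omega
    · have h4 := h (v i) (v j)
      exact hij (e.trans h4.symm)

end Minimal

/-! ### Laurent polynomials in commuting units -/

section LaurentHom

variable {R : Type*} [CommRing R] {m : ℕ}

/-- Laurent polynomials are generated by the variables and their inverses. -/
theorem laurent_induction {P : Laurent R m → Prop} (hY : ∀ i, P (Y R i)) (hYi : ∀ i, P (Yinv R i))
    (h1 : P 1) (hadd : ∀ F G, P F → P G → P (F + G)) (hmul : ∀ F G, P F → P G → P (F * G))
    (hsmul : ∀ (c : R) F, P F → P (c • F)) (F : Laurent R m) : P F := by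
  have hpow {G : Laurent R m} (hG : P G) (k : ℕ) : P (G ^ k) := by
    induction k with
    | zero => simpa using h1
    | succ k ih => rw [pow_succ]; exact hmul _ _ ih hG
  have hz (i : Fin m) (z : ℤ) : P (AddMonoidAlgebra.single (Pi.single i z) 1) := by
    obtain ⟨k, rfl | rfl⟩ := z.eq_nat_or_neg
    · have : (AddMonoidAlgebra.single (Pi.single i (k : ℤ)) 1 : Laurent R m) = Y R i ^ k := by
        rw [Y, AddMonoidAlgebra.single_pow, ← Pi.single_smul]; simp
      rw [this]; exact hpow (hY i) k
    · have : (AddMonoidAlgebra.single (Pi.single i (-(k : ℤ))) 1 : Laurent R m) =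
          Yinv R i ^ k := by
        rw [Yinv, AddMonoidAlgebra.single_pow, ← Pi.single_smul]; simp
      rw [this]; exact hpow (hYi i) k
  have hprod (b : Fin m → ℤ) (s : Finset (Fin m)) :
      P (∏ i ∈ s, AddMonoidAlgebra.single (Pi.single i (b i)) 1) := by
    classical
    induction s using Finset.induction_on with
    | empty => simpa using h1
    | insert i s hi ih => rw [Finset.prod_insert hi]; exact hmul _ _ (hz i _) ih
  refine AddMonoidAlgebra.induction_on (motive := P) F (fun b => ?_) hadd hsmul
  have e : (AddMonoidAlgebra.of R (Fin m → ℤ)) (Multiplicative.ofAdd b) =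
      ∏ i, AddMonoidAlgebra.single (Pi.single i (b i)) 1 := by
    rw [AddMonoidAlgebra.prod_single, Finset.univ_sum_single]
    simp
  rw [e]; exact hprod b _

variable {A : Type*} [Ring A] [Algebra R A]

/-- The substitution of pairwise commuting units into Laurent polynomials. -/
def laurentHom (R : Type*) [CommRing R] [Algebra R A] (u : Fin m → Aˣ)
    (hu : ∀ i j, u i * u j = u j * u i) : Laurent R m →ₐ[R] A :=
  AddMonoidAlgebra.lift R A (Fin m → ℤ) <| (Units.coeHom A).comp <|
    (MonoidHom.noncommPiCoprod (fun i => zpowersHom Aˣ (u i)) fun i j _ x y =>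
      (show Commute (u i) (u j) from hu i j).zpow_zpow _ _).comp
    { toFun := fun a i => Multiplicative.ofAdd (a.toAdd i)
      map_one' := rfl
      map_mul' := fun _ _ => rfl }

theorem laurentHom_single (u : Fin m → Aˣ) (hu : ∀ i j, u i * u j = u j * u i) (i : Fin m) (z : ℤ) :
    laurentHom R u hu (AddMonoidAlgebra.single (Pi.single i z) 1) = ((u i ^ z : Aˣ) : A) := by
  rw [laurentHom, AddMonoidAlgebra.lift_single, one_smul]
  have : (fun j => Multiplicative.ofAdd ((Pi.single i z : Fin m → ℤ) j)) =
      Pi.mulSingle (M := fun _ => Multiplicative ℤ) i (Multiplicative.ofAdd z) := by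
    funext j
    by_cases h : j = i
    · subst h; simp
    · simp [h]
  simp only [MonoidHom.comp_apply, MonoidHom.coe_mk, OneHom.coe_mk, toAdd_ofAdd, this]
  exact congrArg Units.val (MonoidHom.noncommPiCoprod_mulSingle
    (ϕ := fun i => zpowersHom Aˣ (u i)) i (Multiplicative.ofAdd z))

theorem laurentHom_Y (u : Fin m → Aˣ) (hu : ∀ i j, u i * u j = u j * u i) (i : Fin m) :
    laurentHom R u hu (Y R i) = u i := by
  rw [Y, laurentHom_single, zpow_one]

theorem laurentHom_Yinv (u : Fin m → Aˣ) (hu : ∀ i j, u i * u j = u j * u i) (i : Fin m) :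
    laurentHom R u hu (Yinv R i) = ((u i)⁻¹ : Aˣ) := by
  rw [Yinv, laurentHom_single, zpow_neg_one]

end LaurentHom

/-! ### Squares as Laurent polynomials -/

section Squares

variable {R : Type*} [CommRing R] {κ : ℝ} {m : ℕ} (q : R)

theorem idem_mul_sq (x : Config κ m) (i : Fin m) : idem R q x * dSq q x i = dSq q x i :=
  idem_mul_slice q (Slice.sq x i)

theorem sq_mul_idem (x : Config κ m) (i : Fin m) : dSq q x i * idem R q x = dSq q x i :=
  slice_mul_idem q (Slice.sq x i)

theorem idem_mul_sqInv (x : Config κ m) (i : Fin m) : idem R q x * dSqInv q x i = dSqInv q x i :=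
  idem_mul_slice q (Slice.sqInv x i)

theorem sqInv_mul_idem (x : Config κ m) (i : Fin m) : dSqInv q x i * idem R q x = dSqInv q x i :=
  slice_mul_idem q (Slice.sqInv x i)

/-- The square on a strand at `x`, completed by the identity of all other configurations
to a unit. -/
def sqUnit (x : Config κ m) (i : Fin m) : (Diag R κ m q)ˣ where
  val := dSq q x i + (1 - idem R q x)
  inv := dSqInv q x i + (1 - idem R q x)
  val_inv := by
    have h := idem_mul_idem (R := R) q x
    rw [add_mul, mul_add, mul_add, sq_mul_sqInv, mul_sub, mul_one, sq_mul_idem, sub_self, sub_mul,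
      sub_mul, one_mul, one_mul, idem_mul_sqInv, sub_self, mul_sub, mul_one, h]
    abel
  inv_val := by
    have h := idem_mul_idem (R := R) q x
    rw [add_mul, mul_add, mul_add, sqInv_mul_sq, mul_sub, mul_one, sqInv_mul_idem, sub_self, sub_mul,
      sub_mul, one_mul, one_mul, idem_mul_sq, sub_self, mul_sub, mul_one, h]
    abel

theorem sqUnit_comm (x : Config κ m) (i j : Fin m) :
    sqUnit q x i * sqUnit q x j = sqUnit q x j * sqUnit (R := R) q x i := by
  refine Units.ext ?_
  change (dSq q x i + (1 - idem R q x)) * (dSq q x j + (1 - idem R q x)) =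
    (dSq q x j + (1 - idem R q x)) * (dSq q x i + (1 - idem R q x))
  simp only [add_mul, mul_add, mul_sub, mul_one, sub_mul, one_mul, idem_mul_sq, sq_mul_idem,
    sub_self, idem_mul_idem]
  rw [sq_mul_sq]
  abel

/-- The Laurent polynomial in the squares on the strands at `x`. -/
def sqPoly (x : Config κ m) (F : Laurent R m) : Diag R κ m q :=
  laurentHom R (sqUnit q x) (sqUnit_comm q x) F * idem R q x

theorem sqPoly_Y (x : Config κ m) (i : Fin m) : sqPoly q x (Y R i) = dSq q x i := by
  rw [sqPoly, laurentHom_Y]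
  change (dSq q x i + (1 - idem R q x)) * idem R q x = _
  rw [add_mul, sq_mul_idem, sub_mul, one_mul, idem_mul_idem, sub_self, add_zero]

theorem sqPoly_Yinv (x : Config κ m) (i : Fin m) : sqPoly q x (Yinv R i) = dSqInv q x i := by
  rw [sqPoly, laurentHom_Yinv]
  change (dSqInv q x i + (1 - idem R q x)) * idem R q x = _
  rw [add_mul, sqInv_mul_idem, sub_mul, one_mul, idem_mul_idem, sub_self, add_zero]

theorem sqPoly_one (x : Config κ m) : sqPoly q x 1 = idem R q x := by
  rw [sqPoly, map_one, one_mul]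

theorem sqPoly_add (x : Config κ m) (F G : Laurent R m) :
    sqPoly q x (F + G) = sqPoly q x F + sqPoly q x G := by
  rw [sqPoly, map_add, add_mul]; rfl

theorem sqPoly_smul (x : Config κ m) (c : R) (F : Laurent R m) :
    sqPoly q x (c • F) = c • sqPoly q x F := by
  rw [sqPoly, map_smul, smul_mul_assoc]; rfl

theorem sqPoly_zero (x : Config κ m) : sqPoly q x (0 : Laurent R m) = 0 := by
  rw [sqPoly, map_zero, zero_mul]

theorem idem_mul_sqPoly (x : Config κ m) (F : Laurent R m) :
    idem R q x * sqPoly q x F = sqPoly q x F := by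
  have h : ∀ F : Laurent R m, idem R q x * laurentHom R (sqUnit q x) (sqUnit_comm q x) F =
      laurentHom R (sqUnit q x) (sqUnit_comm q x) F * idem R q x := by
    refine laurent_induction (fun i => ?_) (fun i => ?_) ?_ (fun F G hF hG => ?_)
      (fun F G hF hG => ?_) (fun c F hF => ?_)
    · rw [laurentHom_Y]
      change idem R q x * (dSq q x i + (1 - idem R q x)) = (dSq q x i + (1 - idem R q x)) * _
      rw [add_mul, mul_add, idem_mul_sq, sq_mul_idem, mul_sub, sub_mul, one_mul, mul_one]
    · rw [laurentHom_Yinv]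
      change idem R q x * (dSqInv q x i + (1 - idem R q x)) =
        (dSqInv q x i + (1 - idem R q x)) * _
      rw [add_mul, mul_add, idem_mul_sqInv, sqInv_mul_idem, mul_sub, sub_mul, one_mul, mul_one]
    · rw [map_one, one_mul, mul_one]
    · rw [map_add, mul_add, add_mul, hF, hG]
    · rw [map_mul, ← mul_assoc, hF, mul_assoc, hG, mul_assoc]
    · rw [map_smul, mul_smul_comm, smul_mul_assoc, hF]
  rw [sqPoly, ← mul_assoc, h, mul_assoc, idem_mul_idem]

theorem sqPoly_mul (x : Config κ m) (F G : Laurent R m) :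
    sqPoly q x (F * G) = sqPoly q x F * sqPoly q x G := by
  have h := idem_mul_sqPoly q x G
  rw [sqPoly, sqPoly, mul_assoc _ (idem R q x), h, map_mul, sqPoly, mul_assoc]

/-- A diagram which commutes with squares commutes with Laurent polynomials in them. -/
theorem mul_sqPoly_of_sq {x y : Config κ m} {u : Diag R κ m q} (hx : u * idem R q x = u)
    (hy : idem R q y * u = u) (h : ∀ i, u * dSq q x i = dSq q y i * u) (F : Laurent R m) :
    u * sqPoly q x F = sqPoly q y F * u := by
  revert F
  refine laurent_induction (fun i => ?_) (fun i => ?_) ?_ (fun F G hF hG => ?_)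
    (fun F G hF hG => ?_) (fun c F hF => ?_)
  · rw [sqPoly_Y, sqPoly_Y, h]
  · rw [sqPoly_Yinv, sqPoly_Yinv]
    have h1 : dSqInv q y i * (dSq q y i * u) * dSqInv q x i = u * dSqInv q x i := by
      rw [← mul_assoc, sqInv_mul_sq, hy]
    rw [← h1, ← h, mul_assoc, mul_assoc, sq_mul_sqInv, hx]
  · rw [sqPoly_one, sqPoly_one, hx, hy]
  · rw [sqPoly_add, sqPoly_add, mul_add, add_mul, hF, hG]
  · rw [sqPoly_mul, sqPoly_mul, ← mul_assoc, hF, mul_assoc, hG, mul_assoc]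
  · rw [sqPoly_smul, sqPoly_smul, mul_smul_comm, smul_mul_assoc, hF]

theorem move_mul_sqPoly {x y : Config κ m} (h : IsMove x y) (F : Laurent R m) :
    dMove q h * sqPoly q x F = sqPoly q y F * dMove q h :=
  mul_sqPoly_of_sq q (slice_mul_idem q (Slice.move _ _ h)) (idem_mul_slice q (Slice.move _ _ h))
    (move_mul_sq q h) F

theorem ghost_mul_sqPoly {r t : Fin m} {x y : Config κ m} (h : IsGhost r t x y) (F : Laurent R m) :
    dGhost q h * sqPoly q x F = sqPoly q y F * dGhost q h :=
  mul_sqPoly_of_sq q (slice_mul_idem q (Slice.ghost _ _ _ _ h))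
    (idem_mul_slice q (Slice.ghost _ _ _ _ h)) (ghost_mul_sq q h) F

theorem demazure_one [IsDomain R] (a : Adj m) : demazure R a 1 = 0 := by
  have := demazure_mul (R := R) a 1 1
  simpa using this

/-- The relations of squares and crossings of strands, extended to Laurent polynomials. -/
theorem cross_mul_sqPoly [IsDomain R] {a : Adj m} {x y : Config κ m} (h : IsCross a x y)
    (F : Laurent R m) : dCross q h * sqPoly q x F =
      sqPoly q y (permVars a.refl F) * dCross q h + sqPoly q y (demazure R a F) * dMove q h.isMove := by
  have hc : dCross (R := R) q h * idem R q x = dCross q h := slice_mul_idem q (Slice.cross _ _ _ h)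
  have hc' : idem R q y * dCross (R := R) q h = dCross q h := idem_mul_slice q (Slice.cross _ _ _ h)
  have hm : idem R q y * dMove (R := R) q h.isMove = dMove q h.isMove :=
    idem_mul_slice q (Slice.move _ _ h.isMove)
  have hm' : dMove (R := R) q h.isMove * idem R q x = dMove q h.isMove :=
    slice_mul_idem q (Slice.move _ _ h.isMove)
  have hY (i : Fin m) : dCross q h * sqPoly q x (Y R i) =
      sqPoly q y (permVars a.refl (Y R i)) * dCross q h +
        sqPoly q y (demazure R a (Y R i)) * dMove q h.isMove := by
    rw [permVars_Y, sqPoly_Y, sqPoly_Y]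
    by_cases h1 : i = a.lo
    · subst h1
      rw [cross_mul_sq_lo, refl_lo, demazure_Y_lo, sqPoly_one, hm]
    by_cases h2 : i = a.hi
    · subst h2
      rw [refl_hi, demazure_Y_hi, sq_lo_mul_cross, ← neg_one_smul R (1 : Laurent R m), sqPoly_smul,
        sqPoly_one, smul_mul_assoc, hm, diag_neg_smul, one_smul]
      abel
    · rw [refl_of_ne a h1 h2, demazure_Y_of_ne a h1 h2, sqPoly_zero, zero_mul, add_zero,
        cross_mul_sq q h h1 h2]
  revert F
  refine laurent_induction hY (fun i => ?_) ?_ (fun F G hF hG => ?_)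
    (fun F G hF hG => ?_) (fun c F hF => ?_)
  · have e1 := congrArg (sqPoly q y (permVars a.refl (Yinv R i)) * · * sqPoly q x (Yinv R i)) (hY i)
    simp only [mul_add, add_mul] at e1
    rw [← mul_assoc, ← mul_assoc, ← mul_assoc, ← sqPoly_mul, ← sqPoly_mul, ← map_mul, Yinv_mul_Y, map_one,
      sqPoly_one, hc', mul_assoc _ (sqPoly q x _), ← sqPoly_mul, Y_mul_Yinv, sqPoly_one, mul_assoc _ _ (idem R q x),
      hc, mul_assoc _ _ (sqPoly q x (Yinv R i)), move_mul_sqPoly, ← mul_assoc,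
      ← sqPoly_mul] at e1
    have e2 : demazure R a (Yinv R i) =
        -(permVars a.refl (Yinv R i) * demazure R a (Y R i) * Yinv R i) := by
      have h1 := demazure_mul (R := R) a (Y R i) (Yinv R i)
      rw [Y_mul_Yinv, demazure_one] at h1
      have h2 : permVars a.refl (Yinv R i) * permVars a.refl (Y R i) = 1 := by
        rw [← map_mul, Yinv_mul_Y, map_one]
      linear_combination -(permVars a.refl (Yinv R i)) * h1 - demazure R a (Yinv R i) * h2
    rw [e2, ← neg_one_smul R, sqPoly_smul, smul_mul_assoc, diag_neg_smul, one_smul, e1]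
    abel
  · rw [map_one, sqPoly_one, hc, sqPoly_one, hc', demazure_one, sqPoly_zero, zero_mul, add_zero]
  · rw [map_add, map_add, sqPoly_add, sqPoly_add, sqPoly_add, mul_add, hF, hG, add_mul, add_mul]
    abel
  · rw [sqPoly_mul, ← mul_assoc, hF, add_mul, mul_assoc _ _ (sqPoly q x G), hG,
      mul_assoc _ _ (sqPoly q x G), move_mul_sqPoly, demazure_mul, map_mul, sqPoly_mul, sqPoly_add,
      sqPoly_mul, sqPoly_mul]
    noncomm_ring
  · rw [map_smul, map_smul, sqPoly_smul, sqPoly_smul, sqPoly_smul, mul_smul_comm, hF, smul_add,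
      smul_mul_assoc, smul_mul_assoc]

end Squares

/-! ### Minimal diagrams and squares span -/

section Spanning

variable {R : Type*} [CommRing R] {κ : ℝ} {m : ℕ} {q : R}

/-- A choice of minimal diagrams. -/
def minDiag (q : R) (hκ : κ ≠ 0) (x y : Config κ m) (w : Equiv.Perm (Fin m)) : Diag R κ m q :=
  (exists_min (q := q) hκ x y w).choose

theorem minDiag_min (hκ : κ ≠ 0) (x y : Config κ m) (w : Equiv.Perm (Fin m)) :
    Min q x y w (minDiag q hκ x y w) :=
  (exists_min (q := q) hκ x y w).choose_spec

/-- The linear combinations of minimal diagrams with Laurent polynomials in the squares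
as coefficients. -/
def combo (q : R) (hκ : κ ≠ 0) (x y : Config κ m) :
    (Equiv.Perm (Fin m) → Laurent R m) →ₗ[R] Diag R κ m q where
  toFun p := ∑ w, sqPoly q y (p w) * minDiag q hκ x y w
  map_add' p p' := by
    simp only [Pi.add_apply, sqPoly_add, add_mul, Finset.sum_add_distrib]
  map_smul' c p := by
    simp only [Pi.smul_apply, sqPoly_smul, smul_mul_assoc, Finset.smul_sum, RingHom.id_apply]

/-- The combinations of minimal diagrams with less than `k` crossings of strands. -/
def ComboLt (q : R) (hκ : κ ≠ 0) (x y : Config κ m) (k : ℕ) : Submodule R (Diag R κ m q) :=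
  Submodule.map (combo q hκ x y)
    { carrier := {p | ∀ w, k ≤ inv w → p w = 0}
      zero_mem' := fun _ _ => rfl
      add_mem' := fun h h' w hw => by rw [Pi.add_apply, h w hw, h' w hw, add_zero]
      smul_mem' := fun c p h w hw => by rw [Pi.smul_apply, h w hw, smul_zero] }

theorem mem_comboLt {hκ : κ ≠ 0} {x y : Config κ m} {k : ℕ} {u : Diag R κ m q} :
    u ∈ ComboLt q hκ x y k ↔ ∃ p : Equiv.Perm (Fin m) → Laurent R m,
      (∀ w, k ≤ inv w → p w = 0) ∧ ∑ w, sqPoly q y (p w) * minDiag q hκ x y w = u := Iff.rfl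

theorem comboLt_mono {hκ : κ ≠ 0} {x y : Config κ m} {k k' : ℕ} (h : k ≤ k') :
    ComboLt q hκ x y k ≤ ComboLt q hκ x y k' := by
  rintro _ ⟨p, hp, rfl⟩
  exact ⟨p, fun w hw => hp w (h.trans hw), rfl⟩

theorem minDiag_mem {hκ : κ ≠ 0} {x y : Config κ m} {w : Equiv.Perm (Fin m)} {k : ℕ}
    (h : inv w < k) (F : Laurent R m) : sqPoly q y F * minDiag q hκ x y w ∈ ComboLt q hκ x y k := by
  classical
  refine mem_comboLt.2 ⟨Pi.single w F, fun v hv => ?_, ?_⟩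
  · rw [Pi.single_eq_of_ne]
    rintro rfl
    omega
  · rw [Finset.sum_eq_single w, Pi.single_eq_same]
    · intro v _ hv
      rw [Pi.single_eq_of_ne hv, sqPoly_zero, zero_mul]
    · simp

theorem sqPoly_mul_mem {hκ : κ ≠ 0} {x y : Config κ m} {k : ℕ} {u : Diag R κ m q}
    (h : u ∈ ComboLt q hκ x y k) (F : Laurent R m) : sqPoly q y F * u ∈ ComboLt q hκ x y k := by
  obtain ⟨p, hp, rfl⟩ := mem_comboLt.1 h
  refine mem_comboLt.2 ⟨fun w => F * p w, fun w hw => (congrArg (F * ·) (hp w hw)).trans (mul_zero F), ?_⟩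
  rw [Finset.mul_sum]
  refine Finset.sum_congr rfl fun w _ => ?_
  rw [sqPoly_mul, mul_assoc]

theorem comboLt_induction {hκ : κ ≠ 0} {x y : Config κ m} {k : ℕ} {M : Submodule R (Diag R κ m q)}
    (f : Diag R κ m q →ₗ[R] Diag R κ m q)
    (h : ∀ w F, inv w < k → f (sqPoly q y F * minDiag q hκ x y w) ∈ M) {u : Diag R κ m q}
    (hu : u ∈ ComboLt q hκ x y k) : f u ∈ M := by
  obtain ⟨p, hp, rfl⟩ := mem_comboLt.1 hu
  rw [map_sum]
  refine sum_mem fun w _ => ?_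
  by_cases hw : inv w < k
  · exact h w _ hw
  · rw [hp w (not_lt.1 hw), sqPoly_zero, zero_mul, map_zero]
    exact zero_mem _

/-- The diagrams with less than `k` crossings of strands are combinations of minimal diagrams with
less than `k` crossings. -/
theorem idem_mul_filt_mem [IsDomain R] (hκ : κ ≠ 0) (hq : IsUnit q) (x : Config κ m) {k : ℕ} :
    ∀ (y : Config κ m) {u : Diag R κ m q}, u ∈ Filt R κ m q k →
      idem R q y * u * idem R q x ∈ ComboLt q hκ x y k := by
  induction k using Nat.strong_induction_on with
  | _ k IH =>
  -- a diagram which is minimal up to diagrams with fewer crossings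
  have near {y : Config κ m} {w : Equiv.Perm (Fin m)} {k' : ℕ} (hk : inv w < k') {j : ℕ}
      (hj : j < k) (hjk : j ≤ k') {g g' : Diag R κ m q} (hg : g ∈ ComboLt q hκ x y k')
      (h1 : idem R q y * g' = g') (h2 : g' * idem R q x = g')
      (h3 : idem R q y * g = g) (h4 : g * idem R q x = g)
      (hgg : g' - g ∈ Filt R κ m q j) : g' ∈ ComboLt q hκ x y k' := by
    have e := IH j hj y hgg
    rw [mul_sub, sub_mul, h1, h2, h3, h4] at e
    have := add_mem (comboLt_mono hjk e) hg
    rwa [sub_add_cancel] at this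
  have minDiag_mem' {y : Config κ m} {w : Equiv.Perm (Fin m)} {k' : ℕ} (h : inv w < k') :
      minDiag q hκ x y w ∈ ComboLt q hκ x y k' := by
    have := minDiag_mem (q := q) (hκ := hκ) (x := x) (y := y) h 1
    rwa [sqPoly_one, (minDiag_min hκ x y w).idem_mul] at this
  have near_min {y : Config κ m} {w : Equiv.Perm (Fin m)} {k' : ℕ} (hk : inv w < k')
      (hk' : inv w < k) {g : Diag R κ m q} (hg : Min q x y w g) : g ∈ ComboLt q hκ x y k' := by
    have hm := minDiag_min (q := q) hκ x y w
    exact near hk hk' hk.le (minDiag_mem' hk) hg.idem_mul hg.mul_idem hm.idem_mul hm.mul_idem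
      (min_unique hκ hq hg hm)
  -- a slice on top of a minimal diagram either gives a minimal diagram, or crosses a wall for the
  -- second time, which produces a bigon
  have slice (g : Slice κ m) {k' : ℕ} (hk : k' + g.cr ≤ k) {u : Diag R κ m q}
      (hu : u ∈ ComboLt q hκ x g.bot k') : g.toDiag R q * u ∈ ComboLt q hκ x g.top (k' + g.cr) := by
    refine comboLt_induction (LinearMap.mulLeft R (g.toDiag R q)) (fun w F hw => ?_) hu
    rw [LinearMap.mulLeft_apply, ← mul_assoc]
    have hm := minDiag_min (q := q) hκ x g.bot w
    cases g with
    | move z y h =>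
      change dMove q h * sqPoly q z F * _ ∈ ComboLt q hκ x y k'
      rw [move_mul_sqPoly, mul_assoc]
      exact sqPoly_mul_mem (near_min hw (by simp [Slice.cr] at hk; omega) (hm.move h)) F
    | sq z i =>
      change dSq q z i * sqPoly q z F * _ ∈ ComboLt q hκ x z k'
      rw [← sqPoly_Y, ← sqPoly_mul]
      exact minDiag_mem hw _
    | sqInv z i =>
      change dSqInv q z i * sqPoly q z F * _ ∈ ComboLt q hκ x z k'
      rw [← sqPoly_Yinv, ← sqPoly_mul]
      exact minDiag_mem hw _
    | ghost r t z y h =>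
      change dGhost q h * sqPoly q z F * minDiag q hκ x z w ∈ ComboLt q hκ x y k'
      change k' ≤ k at hk
      replace hm : Min q x z w (minDiag q hκ x z w) := hm
      rw [ghost_mul_sqPoly, mul_assoc]
      refine sqPoly_mul_mem ?_ F
      by_cases asc : Side z r t ↔ Side x (w⁻¹ r) (w⁻¹ t)
      · exact near_min hw (by omega) (Min.ghost h asc hm)
      have asc' : Side y r t ↔ Side x (w⁻¹ r) (w⁻¹ t) := by
        have := h.flip
        tauto
      have hm' := minDiag_min (q := q) hκ x y w
      have e := ghost_mul_sub_mem h (min_unique hκ hq hm (Min.ghost h.symm asc' hm'))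
      rw [← mul_assoc (dGhost q h), ghost_bigon_self q h.symm] at e
      have hgi : idem R q y * dGhost q h = dGhost q h := idem_mul_slice q (Slice.ghost _ _ _ _ h)
      refine near hw (by omega) hw.le ?_ ?_ ?_ ?_ ?_ e
      · rw [← sqPoly_Y, ← sqPoly_Y, sub_mul, smul_mul_assoc]
        exact sub_mem (minDiag_mem hw _) (Submodule.smul_mem _ _ (minDiag_mem hw _))
      · rw [← mul_assoc, hgi]
      · rw [mul_assoc, hm.mul_idem]
      · rw [← mul_assoc, mul_sub, mul_smul_comm, idem_mul_sq, idem_mul_sq]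
      · rw [mul_assoc, hm'.mul_idem]
    | cross a z y h =>
      change dCross q h * sqPoly q z F * minDiag q hκ x z w ∈ ComboLt q hκ x y (k' + 1)
      change k' + 1 ≤ k at hk
      replace hm : Min q x z w (minDiag q hκ x z w) := hm
      rw [cross_mul_sqPoly, add_mul, mul_assoc, mul_assoc]
      refine add_mem (sqPoly_mul_mem ?_ _)
        (sqPoly_mul_mem (near_min (by omega) (by omega) (hm.move h.isMove)) _)
      rcases asc_or_desc a w⁻¹ with asc | desc
      · have e := Min.cross h asc hm
        have ei := inv_refl_mul asc
        have hm' := minDiag_min (q := q) hκ x y (a.refl * w)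
        have e2 := min_unique hκ hq e hm'
        rw [ei] at e2
        exact near (w := a.refl * w) (by omega) (by omega) (by omega) (minDiag_mem' (by omega))
          e.idem_mul e.mul_idem hm'.idem_mul hm'.mul_idem e2
      · have hz : IsCross a z z := h.symm.self
        have ei := inv_refl_mul_desc desc
        have hm' := minDiag_min (q := q) hκ x z (a.refl * w)
        have e := cross_mul_sub_mem h (min_unique hκ hq hm (hm'.cross_desc hz desc))
        rw [← mul_assoc (dCross q h), cross_bigon, zero_mul, sub_zero] at e
        have e2 := IH _ (by omega) y e
        have hci : idem R q y * dCross q h = dCross q h := idem_mul_slice q (Slice.cross _ _ _ h)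
        rw [← mul_assoc, hci, mul_assoc, hm.mul_idem] at e2
        exact comboLt_mono (by omega) e2
  have word (l : List (Slice κ m)) : ∀ (y : Config κ m) (k' : ℕ), k' ≤ k →
      (l.map Slice.cr).sum < k' →
      idem R q y * (l.map (Slice.toDiag R q)).prod * idem R q x ∈ ComboLt q hκ x y k' := by
    induction l with
    | nil =>
      intro y k' hk hl
      rw [List.map_nil, List.prod_nil, mul_one]
      by_cases hxy : y = x
      · subst hxy
        rw [idem_mul_idem]
        have hl' : inv (1 : Equiv.Perm (Fin m)) < k' := by
          rw [inv_one]; exact lt_of_le_of_lt (Nat.zero_le _) hl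
        exact near_min hl' (by omega) (Min.base (IsMove.refl y))
      · rw [idem_mul_idem_of_ne q hxy]; exact zero_mem _
    | cons g l ih =>
      intro y k' hk hl
      rw [List.map_cons, List.sum_cons] at hl
      rw [List.map_cons, List.prod_cons]
      by_cases hy : y = g.top
      · subst hy
        have h1 := slice g (k' := k' - g.cr) (by omega) (ih g.bot (k' - g.cr) (by omega) (by omega))
        rw [Nat.sub_add_cancel (by omega), ← mul_assoc, ← mul_assoc, slice_mul_idem] at h1
        rwa [← mul_assoc, idem_mul_slice]
      · rw [← idem_mul_slice, ← mul_assoc, ← mul_assoc, idem_mul_idem_of_ne q hy, zero_mul,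
          zero_mul, zero_mul]
        exact zero_mem _
  intro y u hu
  induction hu using Submodule.span_induction with
  | mem u hu =>
    obtain ⟨l, hl, rfl⟩ := hu
    exact word l y k le_rfl hl
  | zero => rw [mul_zero, zero_mul]; exact zero_mem _
  | add u v _ _ h1 h2 => rw [mul_add, add_mul]; exact add_mem h1 h2
  | smul c u _ h => rw [mul_smul_comm, smul_mul_assoc]; exact Submodule.smul_mem _ c h

end Spanning

/-! ### Coefficients of operators on Laurent polynomials -/

section Coefficients

variable {R : Type*} [CommRing R] [IsDomain R] {m : ℕ}

/-- Rational functions. -/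
abbrev Rat (R : Type*) [CommRing R] [IsDomain R] (m : ℕ) : Type _ := FractionRing (Laurent R m)

/-- The inclusion of Laurent polynomials into rational functions. -/
abbrev toRat (R : Type*) [CommRing R] [IsDomain R] (m : ℕ) : Laurent R m →+* Rat R m :=
  algebraMap (Laurent R m) (Rat R m)

theorem toRat_injective : Function.Injective (toRat R m) :=
  IsFractionRing.injective (Laurent R m) (Rat R m)

theorem toRat_ne_zero {F : Laurent R m} (h : F ≠ 0) : toRat R m F ≠ 0 := fun h' =>
  h (toRat_injective (h'.trans (map_zero (toRat R m)).symm))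

theorem permVars_one (F : Laurent R m) : permVars 1 F = F := by
  have : (permVars 1 : Laurent R m →ₐ[R] Laurent R m) = AlgHom.id R _ := by
    refine AddMonoidAlgebra.algHom_ext (fun b => ?_) (by ext)
    rw [permVars_single]; rfl
  rw [this]; rfl

theorem permVars_inv_cancel (w : Equiv.Perm (Fin m)) (F : Laurent R m) :
    permVars w⁻¹ (permVars w F) = F := by
  rw [permVars_comp, inv_mul_cancel, permVars_one]

theorem permVars_cancel_inv (w : Equiv.Perm (Fin m)) (F : Laurent R m) :
    permVars w (permVars w⁻¹ F) = F := by
  rw [permVars_comp, mul_inv_cancel, permVars_one]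

theorem permVars_injective (w : Equiv.Perm (Fin m)) :
    Function.Injective (permVars w : Laurent R m → Laurent R m) :=
  Function.LeftInverse.injective (permVars_inv_cancel w)

/-- The action of permutations on rational functions. -/
def permRat (w : Equiv.Perm (Fin m)) : Rat R m →+* Rat R m :=
  IsFractionRing.lift (g := (toRat R m).comp (permVars (R := R) w).toRingHom)
    fun _ _ h => permVars_injective w (toRat_injective h)

theorem permRat_toRat (w : Equiv.Perm (Fin m)) (F : Laurent R m) :
    permRat w (toRat R m F) = toRat R m (permVars w F) :=
  IsFractionRing.lift_algebraMap _ F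

/-- The operator `T` on Laurent polynomials is the combination `∑ f_v v` of permutations with
coefficients in the rational functions. -/
def Rep (T : Laurent R m →ₗ[R] Laurent R m) (f : Equiv.Perm (Fin m) → Rat R m) : Prop :=
  ∀ F, toRat R m (T F) = ∑ v, f v * toRat R m (permVars v F)

/-- The coefficients are determined by the operator, by the independence of characters. -/
theorem Rep.unique {T : Laurent R m →ₗ[R] Laurent R m} {f g : Equiv.Perm (Fin m) → Rat R m}
    (hf : Rep T f) (hg : Rep T g) : f = g := by
  let χ : Equiv.Perm (Fin m) → (Laurent R m →* Rat R m) := fun v =>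
    ((toRat R m).comp (permVars (R := R) v).toRingHom).toMonoidHom
  have hχ (v : Equiv.Perm (Fin m)) (F) : χ v F = toRat R m (permVars v F) := rfl
  have hinj : Function.Injective χ := by
    intro v w h
    ext i
    have h1 := DFunLike.congr_fun h (Y R i)
    rw [hχ, hχ, permVars_Y, permVars_Y] at h1
    by_contra h2
    exact Y_sub_Y_ne_zero (R := R) (i := v i) (j := w i) (fun e => h2 (congrArg Fin.val e))
      (sub_eq_zero.2 (toRat_injective h1))
  have hli := (linearIndependent_monoidHom (Laurent R m) (Rat R m)).comp χ hinj
  rw [Fintype.linearIndependent_iff] at hli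
  have := hli (fun v => f v - g v) (by
    funext F
    rw [Finset.sum_apply]
    simp only [Pi.smul_apply, Function.comp_apply, smul_eq_mul, hχ, sub_mul, Pi.zero_apply,
      Finset.sum_sub_distrib]
    rw [← hf F, ← hg F, sub_self])
  funext v
  exact sub_eq_zero.1 (this v)

theorem rep_zero : Rep (0 : Laurent R m →ₗ[R] Laurent R m) 0 := fun F => by simp

theorem Rep.sub {S T : Laurent R m →ₗ[R] Laurent R m} {f g : Equiv.Perm (Fin m) → Rat R m}
    (hS : Rep S f) (hT : Rep T g) : Rep (S - T) (f - g) := fun F => by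
  simp only [LinearMap.sub_apply, map_sub, hS F, hT F, Pi.sub_apply, sub_mul,
    Finset.sum_sub_distrib]

theorem Rep.add {S T : Laurent R m →ₗ[R] Laurent R m} {f g : Equiv.Perm (Fin m) → Rat R m}
    (hS : Rep S f) (hT : Rep T g) : Rep (S + T) (f + g) := fun F => by
  simp only [LinearMap.add_apply, map_add, hS F, hT F, Pi.add_apply, add_mul,
    Finset.sum_add_distrib]

theorem Rep.sum {ι : Type*} (s : Finset ι) {T : ι → Laurent R m →ₗ[R] Laurent R m}
    {f : ι → Equiv.Perm (Fin m) → Rat R m} (h : ∀ i ∈ s, Rep (T i) (f i)) :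
    Rep (∑ i ∈ s, T i) (∑ i ∈ s, f i) := fun F => by
  simp only [LinearMap.sum_apply, map_sum, Finset.sum_apply, Finset.sum_mul]
  rw [Finset.sum_comm]
  exact Finset.sum_congr rfl fun i hi => h i hi F

/-- The multiplication by a Laurent polynomial. -/
abbrev mulOp (p : Laurent R m) : Laurent R m →ₗ[R] Laurent R m := LinearMap.mulLeft R p

theorem mulOp_zero : mulOp (0 : Laurent R m) = 0 := by ext; simp

theorem Rep.mul_left {T : Laurent R m →ₗ[R] Laurent R m} {f : Equiv.Perm (Fin m) → Rat R m}
    (hT : Rep T f) (p : Laurent R m) : Rep (mulOp p ∘ₗ T) fun v => toRat R m p * f v := fun F => by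
  simp only [LinearMap.comp_apply, LinearMap.mulLeft_apply, map_mul, hT F, Finset.mul_sum,
    mul_assoc]

theorem Rep.mul_right {T : Laurent R m →ₗ[R] Laurent R m} {f : Equiv.Perm (Fin m) → Rat R m}
    (hT : Rep T f) (p : Laurent R m) :
    Rep (T ∘ₗ mulOp p) fun v => f v * toRat R m (permVars v p) := fun F => by
  simp only [LinearMap.comp_apply, LinearMap.mulLeft_apply, hT (p * F), map_mul, mul_assoc]

theorem rep_one : Rep (LinearMap.id : Laurent R m →ₗ[R] Laurent R m) (Pi.single 1 1) := fun F => by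
  rw [Finset.sum_eq_single 1]
  · simp [permVars_one]
  · intro v _ hv
    rw [Pi.single_eq_of_ne hv, zero_mul]
  · simp

theorem Rep.perm {T : Laurent R m →ₗ[R] Laurent R m} {f : Equiv.Perm (Fin m) → Rat R m}
    (hT : Rep T f) (w : Equiv.Perm (Fin m)) :
    Rep ((permVars w).toLinearMap ∘ₗ T) fun v => permRat w (f (w⁻¹ * v)) := fun F => by
  rw [LinearMap.comp_apply, AlgHom.toLinearMap_apply, ← permRat_toRat, hT F, map_sum]
  refine Fintype.sum_equiv (Equiv.mulLeft w) _ _ fun v => ?_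
  simp only [Equiv.coe_mulLeft, inv_mul_cancel_left, map_mul, permRat_toRat, permVars_comp]

/-- The difference by which the Demazure operator divides. -/
abbrev delta (R : Type*) [CommRing R] [IsDomain R] {m : ℕ} (a : Adj m) : Rat R m :=
  toRat R m (Y R a.hi - Y R a.lo)

theorem delta_ne_zero (a : Adj m) : delta R a ≠ 0 :=
  toRat_ne_zero (Y_sub_Y_ne_zero a.hi_ne_lo)

theorem Rep.demazure {T : Laurent R m →ₗ[R] Laurent R m} {f : Equiv.Perm (Fin m) → Rat R m}
    (hT : Rep T f) (a : Adj m) : Rep (demazure R a ∘ₗ T) fun v =>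
      (permRat a.refl (f (a.refl * v)) - f v) / delta R a := fun F => by
  have h1 := congrArg (toRat R m) (demazure_spec a (T F))
  have h2 := hT.perm a.refl F
  rw [LinearMap.comp_apply, AlgHom.toLinearMap_apply, refl_inv] at h2
  rw [map_mul, map_sub (toRat R m) (permVars a.refl (T F)), h2, hT F] at h1
  simp only [div_mul_eq_mul_div]
  rw [← Finset.sum_div, eq_div_iff (delta_ne_zero a), mul_comm]
  simp only [LinearMap.comp_apply, sub_mul, Finset.sum_sub_distrib]
  exact h1

/-- The coefficient of `w` is not zero, and all others which are not zero belong to shorter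
permutations. -/
def Lead (f : Equiv.Perm (Fin m) → Rat R m) (w : Equiv.Perm (Fin m)) : Prop :=
  f w ≠ 0 ∧ ∀ v, f v ≠ 0 → v = w ∨ inv v < inv w

theorem lead_one : Lead (Pi.single 1 1 : Equiv.Perm (Fin m) → Rat R m) 1 := by
  refine ⟨by simp, fun v hv => Or.inl ?_⟩
  by_contra h
  exact hv (Pi.single_eq_of_ne h _)

theorem Lead.mul_left {f : Equiv.Perm (Fin m) → Rat R m} {w : Equiv.Perm (Fin m)} (h : Lead f w)
    {p : Laurent R m} (hp : p ≠ 0) : Lead (fun v => toRat R m p * f v) w :=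
  ⟨mul_ne_zero (toRat_ne_zero hp) h.1, fun v hv => h.2 v (right_ne_zero_of_mul hv)⟩

theorem Lead.demazure_add {T : Laurent R m →ₗ[R] Laurent R m} {f : Equiv.Perm (Fin m) → Rat R m}
    {w : Equiv.Perm (Fin m)} (hT : Rep T f) (hf : Lead f w) {a : Adj m} (asc : w⁻¹ a.lo < w⁻¹ a.hi)
    {p : Laurent R m} (hp : p ≠ 0) (c : Laurent R m) :
    ∃ f', Rep ((mulOp c + mulOp p ∘ₗ demazure R a) ∘ₗ T) f' ∧ Lead f' (a.refl * w) := by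
  have e := inv_refl_mul asc
  have h1 := (hT.mul_left c).add ((hT.demazure a).mul_left p)
  rw [← LinearMap.comp_assoc, ← LinearMap.add_comp] at h1
  refine ⟨_, h1, ?_, fun v hv => ?_⟩
  · have h0 : f (a.refl * w) = 0 := by
      by_contra h
      rcases hf.2 _ h with h | h
      · rw [h] at e; omega
      · omega
    simp only [Pi.add_apply, h0, mul_zero, zero_add, refl_mul_cancel, sub_zero]
    refine mul_ne_zero (toRat_ne_zero hp) (div_ne_zero ?_ (delta_ne_zero a))
    rw [Ne, map_eq_zero]
    exact hf.1
  · by_cases h1 : f v = 0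
    · by_cases h2 : f (a.refl * v) = 0
      · exact absurd (by simp [h1, h2]) hv
      · rcases hf.2 _ h2 with h | h
        · left; rw [← h, refl_mul_cancel]
        · right
          have := inv_refl_mul_le a (a.refl * v)
          rw [refl_mul_cancel] at this
          omega
    · right
      rcases hf.2 _ h1 with rfl | h <;> omega

/-- Operators with different leading permutations are independent. -/
theorem lead_triangular {f : Equiv.Perm (Fin m) → Equiv.Perm (Fin m) → Rat R m}
    (hf : ∀ w, Lead (f w) w) {p : Equiv.Perm (Fin m) → Laurent R m} {k : ℕ}
    (h : ∀ v, k ≤ inv v → ∑ w, toRat R m (p w) * f w v = 0) (w : Equiv.Perm (Fin m))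
    (hw : k ≤ inv w) : p w = 0 := by
  classical
  by_contra hp
  -- the longest permutation which occurs is the leading one of a single operator
  obtain ⟨w, h1, h2⟩ := (Finset.univ.filter fun w => p w ≠ 0 ∧ k ≤ inv w).exists_max_image inv
    ⟨w, by simp [hp, hw]⟩
  simp only [Finset.mem_filter, Finset.mem_univ, true_and] at h1 h2
  have e := h w h1.2
  rw [Finset.sum_eq_single w] at e
  · exact mul_ne_zero (toRat_ne_zero h1.1) (hf w).1 e
  · intro w' _ hw'
    by_contra h3
    rcases (hf w').2 w (right_ne_zero_of_mul h3) with h4 | h4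
    · exact hw' h4.symm
    · have h5 : p w' ≠ 0 := fun h6 => left_ne_zero_of_mul h3 (by rw [h6, map_zero])
      have := h2 w' ⟨h5, by omega⟩
      omega
  · simp

end Coefficients

/-! ### The operators of diagrams between two configurations -/

section Operators

variable {R : Type*} [CommRing R] [IsDomain R] {κ : ℝ} {m : ℕ} {q : R}

variable (q) in
/-- The operator by which a diagram maps the Laurent polynomials at `x` to those at `y`. -/
def act (x y : Config κ m) : Diag R κ m q →ₗ[R] (Laurent R m →ₗ[R] Laurent R m) where
  toFun u := Finsupp.lapply y ∘ₗ polyAction R κ m q u ∘ₗ Finsupp.lsingle x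
  map_add' u v := by rw [map_add]; rfl
  map_smul' c u := by rw [map_smul]; rfl

theorem act_apply (x y : Config κ m) (u : Diag R κ m q) (F : Laurent R m) :
    act q x y u F = polyAction R κ m q u (Finsupp.single x F) y := rfl

theorem act_slice (g : Slice κ m) : act q g.bot g.top (g.toDiag R q) = g.op q := by
  refine LinearMap.ext fun F => ?_
  rw [act_apply, polyAction_slice]
  simp [block]

theorem act_idem_mul (x y : Config κ m) (u : Diag R κ m q) :
    act q x y (idem R q y * u) = act q x y u := by
  refine LinearMap.ext fun F => ?_
  rw [act_apply, map_mul, Module.End.mul_apply, polyAction_idem, Finsupp.single_eq_same]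
  rfl

theorem act_mul_idem (x y : Config κ m) (u : Diag R κ m q) :
    act q x y (u * idem R q x) = act q x y u := by
  refine LinearMap.ext fun F => ?_
  rw [act_apply, map_mul, Module.End.mul_apply, polyAction_idem, Finsupp.single_eq_same]
  rfl

theorem act_mul (x y z : Config κ m) (v u : Diag R κ m q) :
    act q x z (v * (idem R q y * u)) = act q y z v ∘ₗ act q x y u := by
  refine LinearMap.ext fun F => ?_
  rw [act_apply, map_mul, map_mul, Module.End.mul_apply, Module.End.mul_apply, polyAction_idem]
  rfl

theorem act_idem (x : Config κ m) : act q x x (idem R q x) = LinearMap.id :=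
  act_slice (Slice.move x x fun _ _ => Iff.rfl)

theorem act_slice_mul (x : Config κ m) (g : Slice κ m) (u : Diag R κ m q) :
    act q x g.top (g.toDiag R q * u) = g.op q ∘ₗ act q x g.bot u := by
  rw [← slice_mul_idem, mul_assoc, act_mul, act_slice]

theorem act_sqPoly (x : Config κ m) (F : Laurent R m) : act q x x (sqPoly q x F) = mulOp F := by
  revert F
  refine laurent_induction (fun i => ?_) (fun i => ?_) ?_ (fun F G hF hG => ?_)
    (fun F G hF hG => ?_) (fun c F hF => ?_)
  · rw [sqPoly_Y]; exact act_slice (Slice.sq x i)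
  · rw [sqPoly_Yinv]; exact act_slice (Slice.sqInv x i)
  · rw [sqPoly_one, act_idem]; ext; simp
  · rw [sqPoly_add, map_add, hF, hG]; ext; simp [add_mul]
  · rw [sqPoly_mul, ← idem_mul_sqPoly q x G, act_mul, hF, hG]; ext; simp [mul_assoc]
  · rw [sqPoly_smul, map_smul, hF]; ext; simp

theorem ghostFactor_ne_zero {r t : Fin m} (h : r ≠ t) (x : Config κ m) :
    ghostFactor q r t x ≠ 0 := by
  unfold ghostFactor
  split_ifs
  · exact one_ne_zero
  · intro e
    have h1 := sub_eq_zero.1 e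
    have h2 := congrArg (fun F : Laurent R m => F.coeff (Pi.single r 1)) h1
    simp only [Y, AddMonoidAlgebra.smul_single] at h2
    have h3 : (Pi.single t 1 : Fin m → ℤ) ≠ Pi.single r 1 := fun e => by
      have := congrFun e t
      simp [h.symm] at this
    simp [h3] at h2

/-- Each crossing of strands contributes a Demazure operator, whose reflection part increases the
length of the leading permutation; all other crossings contribute nonzero factors. -/
theorem Min.exists_lead {x y : Config κ m} {w : Equiv.Perm (Fin m)} {g : Diag R κ m q}
    (hg : Min q x y w g) : ∃ f, Rep (act q x y g) f ∧ Lead f w := by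
  induction hg with
  | @base y h =>
    refine ⟨_, ?_, lead_one⟩
    have : act q x y (dMove q h) = LinearMap.id := act_slice (Slice.move _ _ h)
    rw [this]
    exact rep_one
  | @ghost r t y z w g h asc hg ih =>
    obtain ⟨f, hf, hl⟩ := ih
    have : act q x z (dGhost q h * g) = mulOp (ghostFactor q r t y) ∘ₗ act q x y g :=
      act_slice_mul x (Slice.ghost _ _ _ _ h) g
    rw [this]
    exact ⟨_, hf.mul_left _, hl.mul_left (ghostFactor_ne_zero h.ne y)⟩
  | @cross a y z w g h asc hg ih =>
    obtain ⟨f, hf, hl⟩ := ih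
    have : act q x z (dCross q h * g) = (mulOp 0 + mulOp 1 ∘ₗ demazure R a) ∘ₗ act q x y g := by
      rw [show act q x z (dCross q h * g) = demazure R a ∘ₗ act q x y g from
        act_slice_mul x (Slice.cross _ _ _ h) g]
      ext; simp
    rw [this]
    exact hl.demazure_add hf asc one_ne_zero 0

/-- A minimal diagram which does not permute the strands acts by the product of the factors of all
pairs of a strand and a ghost which have to cross. -/
theorem Min.act_one {x y : Config κ m} {g : Diag R κ m q} (hg : Min q x y 1 g) :
    act q x y g = mulOp (∏ p ∈ sep x y 1, ghostFactor q p.1 p.2 x) := by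
  obtain ⟨w, hw⟩ : ∃ w : Equiv.Perm (Fin m), w = 1 := ⟨_, rfl⟩
  rw [← hw] at hg ⊢
  induction hg with
  | @base y h =>
    have : sep x y 1 = ∅ := by
      ext p
      simp [mem_sep, h p.1 p.2]
    rw [this, Finset.prod_empty]
    have : act q x y (dMove q h) = LinearMap.id := act_slice (Slice.move _ _ h)
    rw [this]
    ext; simp
  | @ghost r t y z w g h asc hg ih =>
    obtain ⟨h1, h2⟩ := sep_ghost h asc
    have : act q x z (dGhost q h * g) = mulOp (ghostFactor q r t y) ∘ₗ act q x y g :=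
      act_slice_mul x (Slice.ghost _ _ _ _ h) g
    subst hw
    rw [this, ih rfl, h1, Finset.prod_insert h2, ghostFactor_congr q asc]
    ext; simp [mul_assoc]
  | @cross a y z w g h asc hg ih =>
    exfalso
    have := inv_refl_mul asc
    rw [hw, inv_one] at this
    omega

variable (q) in
/-- The operators of the diagrams with less than `k` crossings of strands. -/
def OpsLt (x y : Config κ m) (k : ℕ) : Submodule R (Laurent R m →ₗ[R] Laurent R m) :=
  (Filt R κ m q k).map (act q x y)

variable (q) in
/-- The operators of the diagrams from `x` to `y`. -/
def Ops (x y : Config κ m) : Submodule R (Laurent R m →ₗ[R] Laurent R m) :=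
  LinearMap.range (act q x y)

theorem opsLt_le {x y : Config κ m} {k : ℕ} : OpsLt q x y k ≤ Ops q x y := by
  rintro _ ⟨u, -, rfl⟩
  exact ⟨u, rfl⟩

theorem opsLt_mono {x y : Config κ m} {k k' : ℕ} (h : k ≤ k') : OpsLt q x y k ≤ OpsLt q x y k' :=
  Submodule.map_mono (filt_mono q h)

theorem opsLt_zero {x y : Config κ m} {T : Laurent R m →ₗ[R] Laurent R m}
    (h : T ∈ OpsLt q x y 0) : T = 0 := by
  rw [OpsLt, filt_zero, Submodule.map_bot] at h
  exact h

theorem exists_opsLt {x y : Config κ m} {T : Laurent R m →ₗ[R] Laurent R m} (h : T ∈ Ops q x y) :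
    ∃ k, T ∈ OpsLt q x y k := by
  obtain ⟨u, rfl⟩ := h
  obtain ⟨k, hk⟩ := exists_mem_filt u
  exact ⟨k, u, hk, rfl⟩

theorem idem_mul_mem_filt {k : ℕ} {u : Diag R κ m q} (h : u ∈ Filt R κ m q k) (x : Config κ m) :
    idem R q x * u ∈ Filt R κ m q k := by
  have h1 : _ ∈ Filt R κ m q (0 + k) := slice_mul_mem_filt (Slice.move x x fun _ _ => Iff.rfl) h
  rwa [zero_add] at h1

theorem ops_comp {x y z : Config κ m} {S T : Laurent R m →ₗ[R] Laurent R m} (hS : S ∈ Ops q y z)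
    (hT : T ∈ Ops q x y) : S ∘ₗ T ∈ Ops q x z := by
  obtain ⟨v, rfl⟩ := hS
  obtain ⟨u, rfl⟩ := hT
  exact ⟨_, act_mul x y z v u⟩

theorem opsLt_comp {x y z : Config κ m} {a b : ℕ} {S T : Laurent R m →ₗ[R] Laurent R m}
    (hS : S ∈ OpsLt q y z (a + 1)) (hT : T ∈ OpsLt q x y b) : S ∘ₗ T ∈ OpsLt q x z (a + b) := by
  obtain ⟨v, hv, rfl⟩ := hS
  obtain ⟨u, hu, rfl⟩ := hT
  exact ⟨_, mul_mem_filt hv (idem_mul_mem_filt hu y), act_mul x y z v u⟩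

theorem opsLt_comp' {x y z : Config κ m} {a b : ℕ} {S T : Laurent R m →ₗ[R] Laurent R m}
    (hS : S ∈ OpsLt q y z a) (hT : T ∈ OpsLt q x y (b + 1)) : S ∘ₗ T ∈ OpsLt q x z (a + b) := by
  obtain ⟨v, hv, rfl⟩ := hS
  obtain ⟨u, hu, rfl⟩ := hT
  exact ⟨_, mul_mem_filt' hv (idem_mul_mem_filt hu y), act_mul x y z v u⟩

theorem sqPoly_mem_filt (x : Config κ m) (F : Laurent R m) : sqPoly q x F ∈ Filt R κ m q 1 := by
  revert F
  refine laurent_induction (fun i => ?_) (fun i => ?_) ?_ (fun F G hF hG => ?_)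
    (fun F G hF hG => ?_) (fun c F hF => ?_)
  · rw [sqPoly_Y]; exact slice_mem_filt q (Slice.sq x i)
  · rw [sqPoly_Yinv]; exact slice_mem_filt q (Slice.sqInv x i)
  · rw [sqPoly_one]; exact slice_mem_filt q (Slice.move x x fun _ _ => Iff.rfl)
  · rw [sqPoly_add]; exact add_mem hF hG
  · rw [sqPoly_mul]; exact mul_mem_filt (a := 0) (b := 1) hF hG
  · rw [sqPoly_smul]; exact Submodule.smul_mem _ c hF

theorem mulOp_mem (x : Config κ m) (p : Laurent R m) : mulOp p ∈ OpsLt q x x 1 :=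
  ⟨_, sqPoly_mem_filt x p, act_sqPoly x p⟩

theorem mulOp_comp_mem {x y : Config κ m} {k : ℕ} {T : Laurent R m →ₗ[R] Laurent R m}
    (h : T ∈ OpsLt q x y k) (p : Laurent R m) : mulOp p ∘ₗ T ∈ OpsLt q x y k := by
  have := opsLt_comp (a := 0) (mulOp_mem y p) h
  rwa [zero_add] at this

theorem comp_mulOp_mem {x y : Config κ m} {k : ℕ} {T : Laurent R m →ₗ[R] Laurent R m}
    (h : T ∈ OpsLt q x y k) (p : Laurent R m) : T ∘ₗ mulOp p ∈ OpsLt q x y k :=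
  opsLt_comp' (b := 0) h (mulOp_mem x p)

variable (q) in
/-- The operators of minimal diagrams. -/
def MinOp (x y : Config κ m) (w : Equiv.Perm (Fin m)) (T : Laurent R m →ₗ[R] Laurent R m) : Prop :=
  ∃ g, Min q x y w g ∧ act q x y g = T

theorem exists_minOp (hκ : κ ≠ 0) (x y : Config κ m) (w : Equiv.Perm (Fin m)) :
    ∃ T, MinOp q x y w T := by
  obtain ⟨g, hg⟩ := exists_min (q := q) hκ x y w
  exact ⟨_, g, hg, rfl⟩

theorem MinOp.mem {x y : Config κ m} {w : Equiv.Perm (Fin m)} {T : Laurent R m →ₗ[R] Laurent R m}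
    (h : MinOp q x y w T) : T ∈ OpsLt q x y (inv w + 1) := by
  obtain ⟨g, hg, rfl⟩ := h
  exact ⟨g, hg.mem_filt, rfl⟩

theorem MinOp.sub_mem (hκ : κ ≠ 0) (hq : IsUnit q) {x y : Config κ m} {w : Equiv.Perm (Fin m)}
    {T T' : Laurent R m →ₗ[R] Laurent R m} (h : MinOp q x y w T) (h' : MinOp q x y w T') :
    T - T' ∈ OpsLt q x y (inv w) := by
  obtain ⟨g, hg, rfl⟩ := h
  obtain ⟨g', hg', rfl⟩ := h'
  exact ⟨g - g', min_unique hκ hq hg hg', map_sub _ _ _⟩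

theorem MinOp.exists_lead {x y : Config κ m} {w : Equiv.Perm (Fin m)}
    {T : Laurent R m →ₗ[R] Laurent R m} (h : MinOp q x y w T) : ∃ f, Rep T f ∧ Lead f w := by
  obtain ⟨g, hg, rfl⟩ := h
  exact hg.exists_lead

theorem MinOp.comp {x y z : Config κ m} {v w : Equiv.Perm (Fin m)}
    {S T : Laurent R m →ₗ[R] Laurent R m} (hT : MinOp q x y w T) (hS : MinOp q y z v S)
    (hs : ∀ i j, ¬ (Side y i j ↔ Side z (v i) (v j)) →
      (Side x (w⁻¹ i) (w⁻¹ j) ↔ Side y i j))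
    (hi : inv (v * w) = inv v + inv w) : MinOp q x z (v * w) (S ∘ₗ T) := by
  obtain ⟨g, hg, rfl⟩ := hT
  obtain ⟨g', hg', rfl⟩ := hS
  refine ⟨_, hg.concat hg' hs hi, ?_⟩
  conv_lhs => rw [← hg.idem_mul]
  exact act_mul x y z g' g

theorem MinOp.eq_mulOp {x y : Config κ m} {T : Laurent R m →ₗ[R] Laurent R m}
    (h : MinOp q x y 1 T) : T = mulOp (∏ p ∈ sep x y 1, ghostFactor q p.1 p.2 x) := by
  obtain ⟨g, hg, rfl⟩ := h
  exact hg.act_one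

/-- The coefficients of a combination of operators of minimal diagrams. -/
theorem exists_rep_combo (hκ : κ ≠ 0) (x y : Config κ m) :
    ∃ f : Equiv.Perm (Fin m) → Equiv.Perm (Fin m) → Rat R m, (∀ w, Lead (f w) w) ∧
      ∀ p : Equiv.Perm (Fin m) → Laurent R m,
        Rep (act q x y (∑ w, sqPoly q y (p w) * minDiag q hκ x y w))
          (fun v => ∑ w, toRat R m (p w) * f w v) := by
  choose f hf hl using fun w => (minDiag_min (q := q) hκ x y w).exists_lead
  refine ⟨f, hl, fun p => ?_⟩
  have h1 (w) : act q x y (sqPoly q y (p w) * minDiag q hκ x y w) =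
      mulOp (p w) ∘ₗ act q x y (minDiag q hκ x y w) := by
    rw [← (minDiag_min (q := q) hκ x y w).idem_mul, act_mul, act_sqPoly]
    rw [(minDiag_min (q := q) hκ x y w).idem_mul]
  rw [map_sum]
  have h2 := Rep.sum Finset.univ (fun w _ => (h1 w).symm ▸ (hf w).mul_left (p w))
  convert h2 using 1
  funext v
  rw [Finset.sum_apply]

/-- The coefficients of long permutations determine the number of crossings of strands that
are needed. -/
theorem mem_comboLt_of_rep (hκ : κ ≠ 0) (hq : IsUnit q) {x y : Config κ m} {u : Diag R κ m q}
    {f : Equiv.Perm (Fin m) → Rat R m} (hf : Rep (act q x y u) f) {k : ℕ}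
    (hk : ∀ v, k ≤ inv v → f v = 0) :
    idem R q y * u * idem R q x ∈ ComboLt q hκ x y k := by
  obtain ⟨k', hk'⟩ := exists_mem_filt u
  have h1 := idem_mul_filt_mem hκ hq x y hk'
  obtain ⟨p, -, hp⟩ := mem_comboLt.1 h1
  obtain ⟨f', hl, hr⟩ := exists_rep_combo (q := q) hκ x y
  have h2 := hr p
  rw [hp, act_mul_idem, act_idem_mul] at h2
  refine mem_comboLt.2 ⟨p, lead_triangular hl fun v hv => ?_, hp⟩
  rw [← hk v hv, hf.unique h2]

/-- The action of the diagrams between two configurations is faithful. -/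
theorem eq_zero_of_act (hκ : κ ≠ 0) (hq : IsUnit q) {x y : Config κ m} {u : Diag R κ m q}
    (h : act q x y u = 0) : idem R q y * u * idem R q x = 0 := by
  have h1 := mem_comboLt_of_rep hκ hq (x := x) (y := y) (u := u) (f := 0) (by rw [h]; exact rep_zero)
    (k := 0) fun _ _ => rfl
  obtain ⟨p, hp, hp'⟩ := mem_comboLt.1 h1
  rw [← hp']
  exact Finset.sum_eq_zero fun w _ => by rw [hp w (Nat.zero_le _), sqPoly_zero, zero_mul]

theorem comboLt_le_filt {hκ : κ ≠ 0} {x y : Config κ m} {k : ℕ} :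
    ComboLt q hκ x y k ≤ Filt R κ m q k := fun u hu => by
  refine comboLt_induction LinearMap.id (fun w F hw => ?_) hu
  have := mul_mem_filt (a := 0) (sqPoly_mem_filt (q := q) y F) (minDiag_min (q := q) hκ x y w).mem_filt
  rw [zero_add] at this
  exact filt_mono q hw this

/-- The number of crossings of strands needed for an operator can be read off from its
coefficients. -/
theorem mem_opsLt_of_rep (hκ : κ ≠ 0) (hq : IsUnit q) {x y : Config κ m}
    {T : Laurent R m →ₗ[R] Laurent R m} (hT : T ∈ Ops q x y) {f : Equiv.Perm (Fin m) → Rat R m}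
    (hf : Rep T f) {k : ℕ} (hk : ∀ v, k ≤ inv v → f v = 0) : T ∈ OpsLt q x y k := by
  obtain ⟨u, rfl⟩ := hT
  refine ⟨_, comboLt_le_filt (mem_comboLt_of_rep hκ hq hf hk), ?_⟩
  rw [act_mul_idem, act_idem_mul]

/-- The expansion of an operator in terms of minimal diagrams, with its coefficients. -/
theorem exists_combo_of_mem (hκ : κ ≠ 0) (hq : IsUnit q) {x y : Config κ m} {k : ℕ}
    {T : Laurent R m →ₗ[R] Laurent R m} (hT : T ∈ OpsLt q x y k) :
    ∃ (p : Equiv.Perm (Fin m) → Laurent R m) (B : Equiv.Perm (Fin m) → Laurent R m →ₗ[R] Laurent R m),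
      (∀ w, k ≤ inv w → p w = 0) ∧ (∀ w, MinOp q x y w (B w)) ∧ T = ∑ w, mulOp (p w) ∘ₗ B w := by
  obtain ⟨u, hu, rfl⟩ := hT
  obtain ⟨p, hp, hp'⟩ := mem_comboLt.1 (idem_mul_filt_mem hκ hq x y hu)
  refine ⟨p, fun w => act q x y (minDiag q hκ x y w), hp, fun w => ⟨_, minDiag_min hκ x y w, rfl⟩, ?_⟩
  rw [← act_idem_mul, ← act_mul_idem, ← hp', map_sum]
  refine Finset.sum_congr rfl fun w _ => ?_
  rw [← (minDiag_min (q := q) hκ x y w).idem_mul, act_mul, act_sqPoly]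

/-- To show that the operators between two configurations belong to a subspace, it is enough to
treat one minimal diagram for each permutation, modulo diagrams with fewer crossings. -/
theorem opsLt_induction (hκ : κ ≠ 0) (hq : IsUnit q) {x y : Config κ m}
    {M : Submodule R (Laurent R m →ₗ[R] Laurent R m)}
    (h : ∀ w p, OpsLt q x y (inv w) ≤ M → ∃ B, MinOp q x y w B ∧ mulOp p ∘ₗ B ∈ M) (k : ℕ) :
    OpsLt q x y k ≤ M := by
  induction k using Nat.strong_induction_on with
  | _ k IH =>
  intro T hT
  obtain ⟨p, B, hp, hB, rfl⟩ := exists_combo_of_mem hκ hq hT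
  refine sum_mem fun w _ => ?_
  by_cases hw : k ≤ inv w
  · rw [hp w hw, mulOp_zero, LinearMap.zero_comp]
    exact zero_mem _
  obtain ⟨B', hB', hM⟩ := h w (p w) (IH _ (not_le.1 hw))
  have h1 := IH _ (not_le.1 hw) (mulOp_comp_mem ((hB w).sub_mem hκ hq hB') (p w))
  rw [LinearMap.comp_sub] at h1
  have := add_mem h1 hM
  rwa [sub_add_cancel] at this

theorem ops_le (hκ : κ ≠ 0) (hq : IsUnit q) {x y : Config κ m}
    {M : Submodule R (Laurent R m →ₗ[R] Laurent R m)}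
    (h : ∀ w p, OpsLt q x y (inv w) ≤ M → ∃ B, MinOp q x y w B ∧ mulOp p ∘ₗ B ∈ M) :
    Ops q x y ≤ M := fun T hT => by
  obtain ⟨k, hk⟩ := exists_opsLt hT
  exact opsLt_induction hκ hq h k hk

theorem MinOp.comp_mulOp (hκ : κ ≠ 0) (hq : IsUnit q) {x y : Config κ m} {w : Equiv.Perm (Fin m)}
    {T : Laurent R m →ₗ[R] Laurent R m} (h : MinOp q x y w T) (p : Laurent R m) :
    T ∘ₗ mulOp p - mulOp (permVars w p) ∘ₗ T ∈ OpsLt q x y (inv w) := by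
  obtain ⟨f, hf, hl⟩ := h.exists_lead
  refine mem_opsLt_of_rep hκ hq (opsLt_le (Submodule.sub_mem _ (comp_mulOp_mem h.mem p)
    (mulOp_comp_mem h.mem _))) ((hf.mul_right p).sub (hf.mul_left _)) fun v hv => ?_
  rw [Pi.sub_apply, mul_comm, ← sub_mul]
  by_cases h0 : f v = 0
  · rw [h0, mul_zero]
  · rcases hl.2 v h0 with rfl | h1
    · rw [sub_self, zero_mul]
    · omega

end Operators

/-! ### The structure of the affine Hecke algebra -/

section HeckeStructure

variable {R : Type*} [CommRing R] {m : ℕ} (q : R)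

/-- The generator `X_i`. -/
def heckeX (i : Fin m) : Hecke R m q := RingQuot.mkAlgHom R (HRel q) (FreeAlgebra.ι R (.X i))

/-- The generator `X_i⁻¹`. -/
def heckeXinv (i : Fin m) : Hecke R m q :=
  RingQuot.mkAlgHom R (HRel q) (FreeAlgebra.ι R (.Xinv i))

theorem hecke_rel {u v : FreeAlgebra R (HGen m)} (h : HRel q u v) :
    RingQuot.mkAlgHom R (HRel q) u = RingQuot.mkAlgHom R (HRel q) v :=
  RingQuot.mkAlgHom_rel R h

theorem hecke_one_sub_smul (h : Hecke R m q) : (1 - q) • h = -((q - 1) • h) := by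
  refine eq_neg_of_add_eq_zero_left ?_
  rw [← add_smul]
  simp

theorem hecke_X_mul_Xinv (i : Fin m) : heckeX q i * heckeXinv q i = 1 := by
  have h := hecke_rel q (HRel.X_Xinv i)
  rwa [map_mul, map_one] at h

theorem hecke_Xinv_mul_X (i : Fin m) : heckeXinv q i * heckeX q i = 1 := by
  have h := hecke_rel q (HRel.Xinv_X i)
  rwa [map_mul, map_one] at h

theorem hecke_X_comm (i j : Fin m) : heckeX q i * heckeX q j = heckeX q j * heckeX q i := by
  have h := hecke_rel q (HRel.X_X i j)
  rwa [map_mul, map_mul] at h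

theorem hecke_T_mul_T (a : Adj m) :
    heckeT R q a * heckeT R q a = (q - 1) • heckeT R q a + q • 1 := by
  have h := hecke_rel q (HRel.T_T a)
  rw [map_mul, map_add, map_smul, AlgHom.commutes, Algebra.algebraMap_eq_smul_one] at h
  exact h

theorem hecke_T_X_T (a : Adj m) :
    heckeT R q a * heckeX q a.lo * heckeT R q a = q • heckeX q a.hi := by
  have h := hecke_rel q (HRel.T_X_T a)
  rw [map_mul, map_mul, map_smul] at h
  exact h

theorem hecke_T_X (a : Adj m) {i : Fin m} (hlo : i ≠ a.lo) (hhi : i ≠ a.hi) :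
    heckeT R q a * heckeX q i = heckeX q i * heckeT R q a := by
  have h := hecke_rel q (HRel.T_X a i hlo hhi)
  rwa [map_mul, map_mul] at h

theorem hecke_braid (a b : Adj m) (hab : b.1 = a.1 + 1) :
    heckeT R q a * heckeT R q b * heckeT R q a = heckeT R q b * heckeT R q a * heckeT R q b := by
  have h := hecke_rel q (HRel.braid a b hab)
  simp only [map_mul] at h
  exact h

theorem hecke_comm (a b : Adj m) (hab : a.1 + 1 < b.1) :
    heckeT R q a * heckeT R q b = heckeT R q b * heckeT R q a := by
  have h := hecke_rel q (HRel.comm a b hab)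
  rwa [map_mul, map_mul] at h

theorem heckeTw_one : heckeTw R q (1 : Equiv.Perm (Fin m)) = 1 := by
  rw [heckeTw, redWord_one, List.map_nil, List.prod_nil]

theorem heckeTw_refl_mul {a : Adj m} {w : Equiv.Perm (Fin m)} (h : w⁻¹ a.lo < w⁻¹ a.hi) :
    heckeTw R q (a.refl * w) = heckeT R q a * heckeTw R q w :=
  redWord_prod_refl_mul (hecke_comm q) (hecke_braid q) h

theorem heckeTw_desc {a : Adj m} {w : Equiv.Perm (Fin m)} (h : w⁻¹ a.hi < w⁻¹ a.lo) :
    heckeTw R q w = heckeT R q a * heckeTw R q (a.refl * w) := by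
  rw [← heckeTw_refl_mul, refl_mul_cancel]
  rwa [refl_mul_inv_apply, refl_mul_inv_apply, refl_lo, refl_hi]

/-- The unit `X_i`. -/
def heckeUnit (i : Fin m) : (Hecke R m q)ˣ :=
  ⟨heckeX q i, heckeXinv q i, hecke_X_mul_Xinv q i, hecke_Xinv_mul_X q i⟩

/-- Laurent polynomials in the `X_i`. -/
def heckeL : Laurent R m →ₐ[R] Hecke R m q :=
  laurentHom R (heckeUnit q) fun i j => Units.ext (hecke_X_comm q i j)

theorem heckeL_Y (i : Fin m) : heckeL q (Y R i) = heckeX q i := laurentHom_Y _ _ i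

theorem heckeL_Yinv (i : Fin m) : heckeL q (Yinv R i) = heckeXinv q i := laurentHom_Yinv _ _ i

variable {q}

theorem hecke_T_mul_X_lo (hq : IsUnit q) (a : Adj m) : heckeT R q a * heckeX q a.lo =
    heckeX q a.hi * heckeT R q a - (q - 1) • heckeX q a.hi := by
  have h1 := hecke_T_X_T q a
  have h2 := congrArg (· * heckeT R q a) h1
  simp only [mul_assoc, hecke_T_mul_T, mul_add, mul_smul_comm, mul_one, smul_mul_assoc] at h1 h2
  rw [h1, smul_comm, ← smul_add] at h2
  have h3 := hq.smul_left_cancel.1 h2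
  rw [← h3, add_sub_cancel_left]

theorem hecke_T_mul_X_hi (hq : IsUnit q) (a : Adj m) : heckeT R q a * heckeX q a.hi =
    heckeX q a.lo * heckeT R q a + (q - 1) • heckeX q a.hi := by
  have h1 := hecke_T_X_T q a
  have h2 := congrArg (heckeT R q a * ·) h1
  simp only [← mul_assoc, hecke_T_mul_T, add_mul, mul_smul_comm, one_mul, smul_mul_assoc] at h1 h2
  rw [h1, smul_comm, ← smul_add] at h2
  have h3 := hq.smul_left_cancel.1 h2
  rw [← h3, add_comm]

/-- Laurent polynomials can be moved to the left of `T_r`. -/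
theorem hecke_T_mul_L [IsDomain R] (hq : IsUnit q) (a : Adj m) (F : Laurent R m) :
    heckeT R q a * heckeL q F = heckeL q (permVars a.refl F) * heckeT R q a +
      heckeL q ((1 - q) • (Y R a.hi * demazure R a F)) := by
  have hY (i : Fin m) : heckeT R q a * heckeL q (Y R i) =
      heckeL q (permVars a.refl (Y R i)) * heckeT R q a +
        heckeL q ((1 - q) • (Y R a.hi * demazure R a (Y R i))) := by
    rw [permVars_Y, heckeL_Y, heckeL_Y]
    by_cases h1 : i = a.lo
    · subst h1
      rw [hecke_T_mul_X_lo hq, refl_lo, demazure_Y_lo, mul_one, map_smul, heckeL_Y, sub_eq_add_neg,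
        hecke_one_sub_smul]
    by_cases h2 : i = a.hi
    · subst h2
      rw [hecke_T_mul_X_hi hq, refl_hi, demazure_Y_hi, mul_neg, mul_one, smul_neg, ← neg_smul,
        neg_sub, map_smul, heckeL_Y]
    · rw [refl_of_ne a h1 h2, demazure_Y_of_ne a h1 h2, mul_zero, smul_zero, map_zero, add_zero,
        hecke_T_X q a h1 h2]
  revert F
  refine laurent_induction hY (fun i => ?_) ?_ (fun F G hF hG => ?_)
    (fun F G hF hG => ?_) (fun c F hF => ?_)
  · have e1 := congrArg (heckeL q (permVars a.refl (Yinv R i)) * · * heckeL q (Yinv R i)) (hY i)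
    simp only [mul_add, add_mul] at e1
    rw [← mul_assoc, ← mul_assoc, ← map_mul, ← map_mul (permVars _), Yinv_mul_Y, map_one, map_one,
      mul_assoc _ (heckeL q (Y R i)), ← map_mul, Y_mul_Yinv, map_one, mul_one, one_mul, mul_assoc,
      ← map_mul, ← map_mul] at e1
    have e2 : demazure R a (Yinv R i) =
        -(permVars a.refl (Yinv R i) * demazure R a (Y R i) * Yinv R i) := by
      have h1 := demazure_mul (R := R) a (Y R i) (Yinv R i)
      rw [Y_mul_Yinv, demazure_one] at h1
      have h2 : permVars a.refl (Yinv R i) * permVars a.refl (Y R i) = 1 := by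
        rw [← map_mul, Yinv_mul_Y, map_one]
      linear_combination -(permVars a.refl (Yinv R i)) * h1 - demazure R a (Yinv R i) * h2
    rw [e1, e2, add_assoc, ← map_add]
    convert (add_zero _).symm using 2
    rw [← map_zero (heckeL q)]
    congr 1
    simp only [Algebra.smul_def]
    ring
  · rw [map_one, map_one, map_one, demazure_one, mul_zero, smul_zero, map_zero, add_zero, one_mul,
      mul_one]
  · simp only [map_add, mul_add, hF, hG, add_mul, smul_add]
    abel
  · rw [map_mul (heckeL q), ← mul_assoc, hF, add_mul, mul_assoc, hG, demazure_mul,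
      map_mul (permVars _), mul_add, map_mul (heckeL q) (permVars _ _), ← mul_assoc, add_assoc,
      ← map_mul (heckeL q) _ ((1 - q) • _), ← map_mul (heckeL q) _ G, ← map_add]
    congr 2
    simp only [Algebra.smul_def]
    ring
  · simp only [map_smul, mul_smul_comm, hF, smul_add, smul_mul_assoc]
    rw [smul_comm c]

/-- The affine Hecke algebra is spanned by the products of Laurent polynomials and `T_w`. -/
theorem hecke_spanning [IsDomain R] (hq : IsUnit q) (h : Hecke R m q) :
    ∃ p : Equiv.Perm (Fin m) → Laurent R m, h = ∑ w, heckeL q (p w) * heckeTw R q w := by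
  classical
  let S : Submodule R (Hecke R m q) :=
    Submodule.span R {h | ∃ p w, h = heckeL q p * heckeTw R q w}
  have key (g : HGen m) {s : Hecke R m q} (hs : s ∈ S) :
      RingQuot.mkAlgHom R (HRel q) (FreeAlgebra.ι R g) * s ∈ S := by
    induction hs using Submodule.span_induction with
    | mem s hs =>
      obtain ⟨p, w, rfl⟩ := hs
      cases g with
      | X i =>
        change heckeX q i * _ ∈ S
        rw [← heckeL_Y, ← mul_assoc, ← map_mul]
        exact Submodule.subset_span ⟨_, _, rfl⟩
      | Xinv i =>
        change heckeXinv q i * _ ∈ S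
        rw [← heckeL_Yinv, ← mul_assoc, ← map_mul]
        exact Submodule.subset_span ⟨_, _, rfl⟩
      | T a =>
        change heckeT R q a * _ ∈ S
        rw [← mul_assoc, hecke_T_mul_L hq, add_mul, mul_assoc]
        refine add_mem ?_ (Submodule.subset_span ⟨_, _, rfl⟩)
        rcases asc_or_desc a w⁻¹ with h | h
        · rw [← heckeTw_refl_mul q h]
          exact Submodule.subset_span ⟨_, _, rfl⟩
        · rw [heckeTw_desc q h, ← mul_assoc (heckeT R q a), hecke_T_mul_T, add_mul, smul_mul_assoc,
            ← heckeTw_desc q h, smul_mul_assoc, one_mul, mul_add, mul_smul_comm, mul_smul_comm]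
          exact add_mem (Submodule.smul_mem _ _ (Submodule.subset_span ⟨_, _, rfl⟩))
            (Submodule.smul_mem _ _ (Submodule.subset_span ⟨_, _, rfl⟩))
    | zero => rw [mul_zero]; exact zero_mem _
    | add u v _ _ h1 h2 => rw [mul_add]; exact add_mem h1 h2
    | smul c u _ h => rw [mul_smul_comm]; exact Submodule.smul_mem _ c h
  have key2 (u : FreeAlgebra R (HGen m)) : ∀ s ∈ S, RingQuot.mkAlgHom R (HRel q) u * s ∈ S := by
    induction u using FreeAlgebra.induction with
    | grade0 r =>
      intro s hs
      rw [AlgHom.commutes, ← Algebra.smul_def]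
      exact Submodule.smul_mem _ r hs
    | grade1 g => exact fun s hs => key g hs
    | mul u v hu hv =>
      intro s hs
      rw [map_mul, mul_assoc]
      exact hu _ (hv _ hs)
    | add u v hu hv =>
      intro s hs
      rw [map_add, add_mul]
      exact add_mem (hu _ hs) (hv _ hs)
  have hS : h ∈ S := by
    obtain ⟨u, rfl⟩ := RingQuot.mkAlgHom_surjective R (HRel q) h
    rw [← mul_one (RingQuot.mkAlgHom R (HRel q) u)]
    exact key2 u 1 (Submodule.subset_span ⟨1, 1, by rw [map_one, heckeTw_one, mul_one]⟩)
  induction hS using Submodule.span_induction with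
  | mem s hs =>
    obtain ⟨p, w, rfl⟩ := hs
    refine ⟨Pi.single w p, ?_⟩
    rw [Finset.sum_eq_single w, Pi.single_eq_same]
    · intro v _ hv
      rw [Pi.single_eq_of_ne hv, map_zero, zero_mul]
    · simp
  | zero => exact ⟨0, by simp⟩
  | add u v _ _ h1 h2 =>
    obtain ⟨p, rfl⟩ := h1
    obtain ⟨p', rfl⟩ := h2
    exact ⟨p + p', by simp [add_mul, Finset.sum_add_distrib]⟩
  | smul c u _ h =>
    obtain ⟨p, rfl⟩ := h
    exact ⟨c • p, by simp [Finset.smul_sum]⟩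

end HeckeStructure

/-! ### The polynomial representations of the affine Hecke algebra -/

section HeckeRep

variable {R : Type*} [CommRing R] [IsDomain R] {m : ℕ}

/-- Two operators with the same commutation relations with the variables agree if they agree
at `1`. -/
theorem eq_zero_of_comm_Y {E : Laurent R m →ₗ[R] Laurent R m} (w : Equiv.Perm (Fin m))
    (hE : ∀ i F, E (Y R i * F) = Y R (w i) * E F) (h1 : E 1 = 0) : E = 0 := by
  have h : ∀ p F, E (p * F) = permVars w p * E F := by
    refine laurent_induction (fun i F => ?_) (fun i F => ?_) (fun F => ?_) (fun p p' hp hp' F => ?_)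
      (fun p p' hp hp' F => ?_) (fun c p hp F => ?_)
    · rw [permVars_Y]; exact hE i F
    · have e := hE i (Yinv R i * F)
      rw [← mul_assoc, Y_mul_Yinv, one_mul] at e
      rw [e, ← mul_assoc, ← permVars_Y, ← map_mul, Yinv_mul_Y, map_one, one_mul]
    · rw [one_mul, map_one, one_mul]
    · rw [add_mul, map_add, map_add, hp, hp', add_mul]
    · rw [mul_assoc, hp, hp', map_mul, mul_assoc]
    · rw [smul_mul_assoc, map_smul, hp, map_smul, smul_mul_assoc]
  refine LinearMap.ext fun F => ?_
  rw [← mul_one F, h, h1, mul_zero]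
  rfl

/-- The element `-(c' Y_r + c'' Y_{r+1})`. -/
def fac (c' c'' : R) (a : Adj m) : Laurent R m := -(c' • Y R a.lo + c'' • Y R a.hi)

/-- The Demazure–Lusztig operator `c' + fac_r ∂_r`, with the eigenvalues `c'` and `c''`. -/
def opT (c' c'' : R) (a : Adj m) : Laurent R m →ₗ[R] Laurent R m :=
  mulOp (c' • 1) + mulOp (fac c' c'' a) ∘ₗ demazure R a

theorem opT_apply (c' c'' : R) (a : Adj m) (F : Laurent R m) :
    opT c' c'' a F = c' • F + fac c' c'' a * demazure R a F := by
  simp [opT]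

theorem demazure_fac (c' c'' : R) (a : Adj m) :
    demazure R a (fac c' c'' a) = (c'' - c') • 1 := by
  rw [fac, map_neg, map_add, map_smul, map_smul, demazure_Y_lo, demazure_Y_hi, sub_smul, smul_neg]
  abel

theorem permVars_fac (c' c'' : R) (a : Adj m) : permVars a.refl (fac c' c'' a) =
    -(c' • Y R a.hi + c'' • Y R a.lo) := by
  rw [fac, map_neg, map_add, map_smul, map_smul, permVars_Y, permVars_Y, refl_lo, refl_hi]

theorem opT_one (c' c'' : R) (a : Adj m) : opT c' c'' a 1 = c' • 1 := by
  rw [opT_apply, demazure_one, mul_zero, add_zero]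

variable {q c' c'' : R} (hs : c' + c'' = q - 1) (hp : c' * c'' = -q)

include hs in
theorem opT_Y_lo (a : Adj m) (F : Laurent R m) :
    opT c' c'' a (Y R a.lo * F) = Y R a.hi * opT c' c'' a F - (q - 1) • (Y R a.hi * F) := by
  rw [opT_apply, opT_apply, demazure_mul, demazure_Y_lo, permVars_Y, refl_lo, ← hs, fac]
  simp only [Algebra.smul_def, map_add]
  ring

include hs in
theorem opT_Y_hi (a : Adj m) (F : Laurent R m) :
    opT c' c'' a (Y R a.hi * F) = Y R a.lo * opT c' c'' a F + (q - 1) • (Y R a.hi * F) := by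
  rw [opT_apply, opT_apply, demazure_mul, demazure_Y_hi, permVars_Y, refl_hi, ← hs, fac]
  simp only [Algebra.smul_def, map_add]
  ring

theorem opT_Y_of_ne (c' c'' : R) (a : Adj m) {i : Fin m} (h1 : i ≠ a.lo) (h2 : i ≠ a.hi)
    (F : Laurent R m) : opT c' c'' a (Y R i * F) = Y R i * opT c' c'' a F := by
  rw [opT_apply, opT_apply, demazure_mul, demazure_Y_of_ne a h1 h2, permVars_Y,
    refl_of_ne a h1 h2]
  simp only [Algebra.smul_def]
  ring

include hs hp in
theorem opT_opT (a : Adj m) (F : Laurent R m) :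
    opT c' c'' a (opT c' c'' a F) = (q - 1) • opT c' c'' a F + q • F := by
  have hq : q = -(c' * c'') := by rw [hp, neg_neg]
  rw [← hs, opT_apply c' c'' a (opT c' c'' a F), opT_apply, map_add, demazure_mul, demazure_demazure,
    demazure_fac, map_smul, hq]
  simp only [Algebra.smul_def, map_add, map_neg, map_mul, map_sub]
  ring

include hs hp in
theorem opT_comm (a b : Adj m) (hab : a.1 + 1 < b.1) (F : Laurent R m) :
    opT c' c'' a (opT c' c'' b F) = opT c' c'' b (opT c' c'' a F) := by
  have n1 : b.hi ≠ a.lo := by simp only [Adj.hi, Adj.lo, ne_eq, Fin.mk.injEq]; omega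
  have n2 : b.hi ≠ a.hi := by simp only [Adj.hi, ne_eq, Fin.mk.injEq]; omega
  have n3 : b.lo ≠ a.lo := by simp only [Adj.lo, ne_eq, Fin.mk.injEq]; omega
  have n4 : b.lo ≠ a.hi := by simp only [Adj.hi, Adj.lo, ne_eq, Fin.mk.injEq]; omega
  obtain ⟨e1, e2, e3, e4⟩ := refl_apply_far hab
  have h := eq_zero_of_comm_Y (E := opT c' c'' a ∘ₗ opT c' c'' b - opT c' c'' b ∘ₗ opT c' c'' a)
    (a.refl * b.refl) (fun i F => ?_) ?_
  · have := DFunLike.congr_fun h F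
    exact sub_eq_zero.1 this
  · simp only [LinearMap.sub_apply, LinearMap.comp_apply, Equiv.Perm.mul_apply]
    by_cases h1 : i = a.lo
    · subst h1
      simp only [opT_Y_lo hs, opT_Y_of_ne c' c'' b n3.symm n1.symm, opT_Y_of_ne c' c'' b n4.symm n2.symm,
        map_sub, map_smul, e3, refl_lo, mul_sub]
      abel
    by_cases h2 : i = a.hi
    · subst h2
      simp only [opT_Y_hi hs, opT_Y_of_ne c' c'' b n3.symm n1.symm, opT_Y_of_ne c' c'' b n4.symm n2.symm,
        map_add, map_smul, e4, refl_hi, mul_sub]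
      abel
    by_cases h3 : i = b.lo
    · subst h3
      simp only [opT_Y_lo hs, opT_Y_of_ne c' c'' a n3 n4, opT_Y_of_ne c' c'' a n1 n2,
        map_sub, map_smul, e2, refl_lo, mul_sub]
      abel
    by_cases h4 : i = b.hi
    · subst h4
      simp only [opT_Y_hi hs, opT_Y_of_ne c' c'' a n3 n4, opT_Y_of_ne c' c'' a n1 n2,
        map_add, map_smul, e1, refl_hi, mul_sub]
      abel
    · rw [refl_of_ne b h3 h4, refl_of_ne a h1 h2]
      simp only [opT_Y_of_ne c' c'' a h1 h2, opT_Y_of_ne c' c'' b h3 h4, mul_sub]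
  · simp only [LinearMap.sub_apply, LinearMap.comp_apply, opT_one, map_smul, smul_comm, sub_self]

include hs hp in
/-- The braid relation. By the quadratic relation, both sides have the same commutation relations
with the variables, and they agree at `1`. -/
theorem opT_braid (a b : Adj m) (hab : b.1 = a.1 + 1) (F : Laurent R m) :
    opT c' c'' a (opT c' c'' b (opT c' c'' a F)) = opT c' c'' b (opT c' c'' a (opT c' c'' b F)) := by
  obtain ⟨e1, e2, e3, e4⟩ := refl_apply_near hab
  have n1 : b.hi ≠ a.lo := by simp only [Adj.hi, Adj.lo, ne_eq, Fin.mk.injEq]; omega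
  have n2 : b.hi ≠ a.hi := by simp only [Adj.hi, ne_eq, Fin.mk.injEq]; omega
  have n3 : a.lo ≠ b.lo := by simp only [Adj.lo, ne_eq, Fin.mk.injEq]; omega
  have A1 := opT_Y_lo hs a
  have A2 := opT_Y_hi hs a
  have A3 := opT_Y_of_ne c' c'' a n1 n2
  have B1 := opT_Y_lo hs b
  have B2 := opT_Y_hi hs b
  have B3 := opT_Y_of_ne c' c'' b n3 n1.symm
  have A4 := opT_opT hs hp a
  have B4 := opT_opT hs hp b
  rw [e1] at B1 B2
  have ba : b.refl b.hi = a.hi := by rw [refl_hi, e1]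
  have h := eq_zero_of_comm_Y (E := opT c' c'' a ∘ₗ opT c' c'' b ∘ₗ opT c' c'' a -
    opT c' c'' b ∘ₗ opT c' c'' a ∘ₗ opT c' c'' b) (a.refl * (b.refl * a.refl)) (fun i F => ?_) ?_
  · have := DFunLike.congr_fun h F
    exact sub_eq_zero.1 this
  · simp only [LinearMap.sub_apply, LinearMap.comp_apply, Equiv.Perm.mul_apply]
    by_cases h1 : i = a.lo
    · subst h1
      simp only [A1, A2, A3, B1, B2, B3, map_sub, map_add, map_smul, refl_lo, e2, e4, mul_sub, A4, B4]
      simp only [Algebra.smul_def]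
      ring
    by_cases h2 : i = a.hi
    · subst h2
      simp only [A1, A2, A3, B1, B2, B3, map_sub, map_add, map_smul, refl_hi, refl_lo, e3, mul_sub, A4, B4]
      simp only [Algebra.smul_def]
      ring
    by_cases h3 : i = b.hi
    · subst h3
      simp only [A1, A2, A3, B1, B2, B3, map_sub, map_add, map_smul, refl_hi, e2, ba, mul_sub, A4, B4]
      simp only [Algebra.smul_def]
      ring
    · have h4 : i ≠ b.lo := by rwa [e1]
      rw [refl_of_ne a h1 h2, refl_of_ne b h4 h3, refl_of_ne a h1 h2]
      simp only [opT_Y_of_ne c' c'' a h1 h2, opT_Y_of_ne c' c'' b h4 h3, mul_sub]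
  · simp only [LinearMap.sub_apply, LinearMap.comp_apply, opT_one, map_smul, sub_self]

/-- The images of the generators of the affine Hecke algebra. -/
def heckeGenOp (c' c'' : R) : HGen m → Module.End R (Laurent R m)
  | .X i => mulOp (Y R i)
  | .Xinv i => mulOp (Yinv R i)
  | .T a => opT c' c'' a

/-- The action of the affine Hecke algebra on Laurent polynomials in which `T_r` acts on constants
by `c'`. -/
def heckeRep : Hecke R m q →ₐ[R] Module.End R (Laurent R m) :=
  RingQuot.liftAlgHom R ⟨FreeAlgebra.lift R (heckeGenOp c' c''), fun u v h => by
    induction h <;>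
      simp only [map_mul, map_add, map_smul, map_one, FreeAlgebra.lift_ι_apply, heckeGenOp,
        AlgHom.commutes] <;>
      refine LinearMap.ext fun F => ?_ <;>
      simp only [Module.End.mul_apply, LinearMap.mulLeft_apply, Module.End.one_apply,
        LinearMap.add_apply, LinearMap.smul_apply, Module.algebraMap_end_apply]
    case X_Xinv i => rw [← mul_assoc, Y_mul_Yinv, one_mul]
    case Xinv_X i => rw [← mul_assoc, Yinv_mul_Y, one_mul]
    case X_X i j => rw [mul_left_comm]
    case T_T a => exact opT_opT hs hp a F
    case T_X_T a =>
      rw [opT_Y_lo hs, opT_opT hs hp, mul_add, mul_smul_comm, mul_smul_comm, add_sub_cancel_left]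
    case T_X a i hlo hhi => exact opT_Y_of_ne c' c'' a hlo hhi F
    case braid a b hab => exact opT_braid hs hp a b hab F
    case comm a b hab => exact opT_comm hs hp a b hab F⟩

theorem heckeRep_T (a : Adj m) : heckeRep hs hp (heckeT R q a) = opT c' c'' a := by
  rw [heckeT, heckeRep, RingQuot.liftAlgHom_mkAlgHom_apply, FreeAlgebra.lift_ι_apply]
  rfl

theorem heckeRep_L (F : Laurent R m) : heckeRep hs hp (heckeL q F) = mulOp F := by
  revert F
  refine laurent_induction (fun i => ?_) (fun i => ?_) ?_ (fun F G hF hG => ?_)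
    (fun F G hF hG => ?_) (fun c F hF => ?_)
  · rw [heckeL_Y, heckeX, heckeRep, RingQuot.liftAlgHom_mkAlgHom_apply, FreeAlgebra.lift_ι_apply]
    rfl
  · rw [heckeL_Yinv, heckeXinv, heckeRep, RingQuot.liftAlgHom_mkAlgHom_apply,
      FreeAlgebra.lift_ι_apply]
    rfl
  · rw [map_one, map_one]; ext; simp
  · rw [map_add, map_add, hF, hG]; ext; simp [add_mul]
  · rw [map_mul, map_mul, hF, hG]; ext; simp [mul_assoc]
  · rw [map_smul, map_smul, hF]; ext; simp

theorem fac_ne_zero (hc : c' ≠ 0) (a : Adj m) : fac c' c'' a ≠ 0 := by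
  intro h
  have h2 := congrArg (fun F : Laurent R m => F.coeff (Pi.single a.lo 1)) h
  have h3 : (Pi.single a.hi 1 : Fin m → ℤ) ≠ Pi.single a.lo 1 := fun e => by
    have := congrFun e a.hi
    simp [a.hi_ne_lo] at this
  simp [fac, Y, h3, hc] at h2

/-- The operator of `T_w` has the leading permutation `w`. -/
theorem heckeRep_Tw_lead (hc : c' ≠ 0) (w : Equiv.Perm (Fin m)) :
    ∃ f, Rep (heckeRep hs hp (heckeTw R q w)) f ∧ Lead f w := by
  induction hk : inv w using Nat.strong_induction_on generalizing w with
  | _ k ih =>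
  by_cases h : w = 1
  · subst h
    rw [heckeTw_one, map_one]
    exact ⟨_, rep_one, lead_one⟩
  · obtain ⟨a, ha⟩ := exists_desc_left h
    have h1 := inv_refl_mul_desc ha
    obtain ⟨f, hf, hl⟩ := ih _ (by omega) (a.refl * w) rfl
    rw [heckeTw_desc q ha, map_mul, heckeRep_T]
    have := hl.demazure_add hf (a := a)
      (by rwa [refl_mul_inv_apply, refl_mul_inv_apply, refl_lo, refl_hi])
      (fac_ne_zero (c'' := c'') hc a) (c' • 1)
    rwa [refl_mul_cancel] at this

/-- The products of Laurent polynomials and `T_w` span, and the operators of the `T_w` have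
different leading permutations. -/
theorem heckeRep_injective (hq : IsUnit q) (hc : c' ≠ 0) :
    Function.Injective (heckeRep (m := m) hs hp) := by
  rw [injective_iff_map_eq_zero]
  intro h h0
  obtain ⟨p, rfl⟩ := hecke_spanning hq h
  choose f hf hl using heckeRep_Tw_lead (m := m) hs hp hc
  have h1 := Rep.sum Finset.univ fun w _ => (hf w).mul_left (p w)
  have h2 : ∑ w, mulOp (p w) ∘ₗ heckeRep hs hp (heckeTw R q w) = 0 := by
    rw [← h0, map_sum]
    refine Finset.sum_congr rfl fun w _ => ?_
    rw [map_mul, heckeRep_L]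
    rfl
  rw [h2] at h1
  have h3 := rep_zero.unique h1
  have h4 := lead_triangular hl (p := p) (k := 0) fun v _ => by
    have := congrFun h3 v
    rw [Finset.sum_apply] at this
    exact this.symm
  refine Finset.sum_eq_zero fun w _ => ?_
  rw [h4 w (Nat.zero_le _), map_zero, zero_mul]

/-- The element `∑ γ^{ℓ(w)} T_w`, summed over the Young subgroup. -/
def gammaSym (q γ : R) {n : ℕ} (μ : Comp n m) : Hecke R m q :=
  ∑ w ∈ μ.young, γ ^ len w • heckeTw R q w

include hs hp in
/-- The quasi-idempotents of Young subgroups are eigenvectors of the `T_r`. -/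
theorem hecke_T_mul_gammaSym {γ : R} (hγ : γ * c' = -1) {n : ℕ} {μ : Comp n m} {a : Adj m}
    (ha : μ.Inner a) : heckeT R q a * gammaSym q γ μ = c'' • gammaSym q γ μ := by
  rw [← sub_eq_zero, gammaSym, Finset.mul_sum, Finset.smul_sum, ← Finset.sum_sub_distrib]
  have pair {w : Equiv.Perm (Fin m)} (h : w⁻¹ a.lo < w⁻¹ a.hi) :
      (heckeT R q a * γ ^ len w • heckeTw R q w - c'' • γ ^ len w • heckeTw R q w) +
      (heckeT R q a * γ ^ len (a.refl * w) • heckeTw R q (a.refl * w) -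
        c'' • γ ^ len (a.refl * w) • heckeTw R q (a.refl * w)) = 0 := by
    have e : len (a.refl * w) = len w + 1 := by
      rw [len, len, length_redWord, length_redWord, inv_refl_mul h]
    rw [heckeTw_refl_mul q h, e, pow_succ]
    have hq1 : q - 1 = c' + c'' := hs.symm
    simp only [mul_smul_comm, ← mul_assoc, hecke_T_mul_T, add_mul, smul_mul_assoc, one_mul]
    match_scalars
    · linear_combination γ ^ len w * (hγ + γ * hq1)
    · linear_combination γ ^ len w * (γ * hp - c'' * hγ)
  -- the terms of `w` and `a.refl * w` cancel
  refine Finset.sum_involution (fun w _ => a.refl * w) (fun w hw => ?_) (fun w hw _ h => ?_)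
    (fun w hw => Comp.mul_mem_young ha.refl_mem hw) (fun w hw => refl_mul_cancel a w)
  · rcases asc_or_desc a w⁻¹ with h | h
    · exact pair h
    · have := pair (w := a.refl * w)
        (by rwa [refl_mul_inv_apply, refl_mul_inv_apply, refl_lo, refl_hi])
      rw [refl_mul_cancel] at this
      rw [add_comm]
      exact this
  · have h1 := mul_eq_right.1 h
    have h2 := congrArg (fun v : Equiv.Perm (Fin m) => v a.lo) h1
    exact a.hi_ne_lo ((refl_lo a).symm.trans h2)

end HeckeRep

/-! ### The configuration of distant strands -/

section FarConfig

variable {R : Type*} [CommRing R] [IsDomain R] {κ : ℝ} {m : ℕ} {q : R}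

/-- The order of strands and ghosts when the strands are at distances larger than `|κ|`. -/
def Far (κ : ℝ) (i j : Fin m) : Prop := i < j ∨ 0 < κ ∧ i = j

theorem isSide_far : IsSide κ (Far κ : Fin m → Fin m → Prop) where
  mono i i' j j' h hi hj := by
    rcases h with h | ⟨h, rfl⟩
    · exact Or.inl (hi.trans_lt (h.trans_le hj))
    · rcases (hi.trans hj).lt_or_eq with h1 | h1
      · exact Or.inl h1
      · exact Or.inr ⟨h, h1⟩
  diag i := by simp [Far]

/-- A configuration of strands at distances larger than `|κ|`. -/
def farConfig (hκ : κ ≠ 0) (m : ℕ) : Config κ m :=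
  ((isSide_far (κ := κ) (m := m)).exists_config hκ).choose

theorem side_far {hκ : κ ≠ 0} {i j : Fin m} : Side (farConfig hκ m) i j ↔ Far κ i j :=
  ((isSide_far (κ := κ) (m := m)).exists_config hκ).choose_spec i j

theorem far_iff_of_ne {i j : Fin m} (h : i ≠ j) : Far κ i j ↔ i < j := by simp [Far, h]

theorem far_refl_iff {a : Adj m} {i j : Fin m} (h1 : ¬ (i = a.lo ∧ j = a.hi))
    (h2 : ¬ (i = a.hi ∧ j = a.lo)) : Far κ (a.refl i) (a.refl j) ↔ Far κ i j := by
  by_cases h : i = j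
  · subst h; simp [Far]
  · rw [far_iff_of_ne h, far_iff_of_ne (fun e => h (a.refl.injective e)), refl_lt_refl a h1 h2]

/-- The eigenvalue of `T_r` on the constants. -/
def eig₁ (κ : ℝ) (q : R) : R := open Classical in if κ < 0 then -1 else q

/-- The eigenvalue of `T_r` on the images of the quasi-idempotents. -/
def eig₂ (κ : ℝ) (q : R) : R := open Classical in if κ < 0 then q else -1

theorem eig_add : eig₁ κ q + eig₂ κ q = q - 1 := by
  unfold eig₁ eig₂
  split_ifs <;> ring

theorem eig_mul : eig₁ κ q * eig₂ κ q = -q := by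
  unfold eig₁ eig₂
  split_ifs <;> ring

variable (κ m q) in
/-- The representation of the affine Hecke algebra on Laurent polynomials which matches the
polynomial representation of the diagrams. -/
abbrev hrep : Hecke R m q →ₐ[R] Module.End R (Laurent R m) :=
  heckeRep (eig_add (κ := κ)) eig_mul

/-- The factor with which the Demazure operator occurs in the operator of `T_r`. -/
abbrev efac (κ : ℝ) (q : R) (a : Adj m) : Laurent R m := fac (eig₁ κ q) (eig₂ κ q) a

theorem act_dMove {x y : Config κ m} (h : IsMove x y) : act q x y (dMove q h) = LinearMap.id :=
  act_slice (Slice.move _ _ h)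

theorem act_dGhost_mul (x : Config κ m) {y z : Config κ m} {r t : Fin m} (h : IsGhost r t y z)
    (u : Diag R κ m q) :
    act q x z (dGhost q h * u) = mulOp (ghostFactor q r t y) ∘ₗ act q x y u :=
  act_slice_mul x (Slice.ghost _ _ _ _ h) u

theorem act_dCross_mul (x : Config κ m) {y z : Config κ m} {a : Adj m} (h : IsCross a y z)
    (u : Diag R κ m q) : act q x z (dCross q h * u) = demazure R a ∘ₗ act q x y u :=
  act_slice_mul x (Slice.cross _ _ _ h) u

/-- The crossing of two adjacent distant strands: one of them crosses the ghost of the other before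
they cross, and crosses back afterwards. -/
theorem min_far_refl (hκ : κ ≠ 0) (a : Adj m) : MinOp q (farConfig hκ m) (farConfig hκ m) a.refl
    (mulOp (efac κ q a) ∘ₗ demazure R a) := by
  obtain ⟨r, t, hne, hcor, hfac, hrt, h3, h1, h2⟩ : ∃ r t : Fin m, r ≠ t ∧ Corner (Far κ) r t ∧
      efac κ q a = Y R r - q • Y R t ∧ a.refl r = t ∧ (Far κ r t ↔ κ < 0) ∧
      (∀ j, toggle (Far κ) r t a.lo j ↔ toggle (Far κ) r t a.hi j) ∧
      ∀ i, toggle (Far κ) r t i a.lo ↔ toggle (Far κ) r t i a.hi := by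
    have hl : a.lo.val = a.1 := rfl
    have hh : a.hi.val = a.1 + 1 := rfl
    rcases lt_or_gt_of_ne hκ with h | h
    · have hf (i j : Fin m) : Far κ i j ↔ i.val < j.val := by
        simp only [Far, h.not_gt, Fin.lt_def, false_and, or_false]
      refine ⟨a.lo, a.hi, lo_ne_hi a, Or.inl ⟨?_, fun i hi => ?_, fun j hj => ?_⟩, ?_, refl_lo a, ?_,
        fun j => ?_, fun i => ?_⟩
      · rw [hf]; omega
      · rw [hf]; have : a.1 < i.1 := hi; omega
      · rw [hf]; have : j.1 < a.1 + 1 := hj; omega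
      · rw [efac, fac, eig₁, eig₂, if_pos h, if_pos h]; simp only [neg_smul, one_smul]; abel
      · rw [hf]; simp only [h, iff_true]; omega
      · simp only [toggle, hf, Fin.ext_iff, hl, hh]; grind
      · simp only [toggle, hf, Fin.ext_iff, hl, hh]; grind
    · have hf (i j : Fin m) : Far κ i j ↔ i.val ≤ j.val := by
        simp only [Far, h, Fin.lt_def, Fin.ext_iff, true_and]; omega
      refine ⟨a.hi, a.lo, a.hi_ne_lo, Or.inr ⟨?_, fun i hi => ?_, fun j hj => ?_⟩, ?_, refl_hi a, ?_,
        fun j => ?_, fun i => ?_⟩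
      · rw [hf]; omega
      · rw [hf]; have : i.1 < a.1 + 1 := hi; omega
      · rw [hf]; have : a.1 < j.1 := hj; omega
      · rw [efac, fac, eig₁, eig₂, if_neg h.not_gt, if_neg h.not_gt]
        simp only [neg_smul, one_smul]; abel
      · rw [hf]; simp only [h.not_gt, iff_false]; omega
      · simp only [toggle, hf, Fin.ext_iff, hl, hh]; grind
      · simp only [toggle, hf, Fin.ext_iff, hl, hh]; grind
  have hS : (Side (farConfig hκ m) : Fin m → Fin m → Prop) = Far κ := by
    funext i j; exact propext side_far
  obtain ⟨z, hz⟩ := exists_isGhost hκ hne (y := farConfig hκ m) (by rwa [hS])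
  have hzs := isGhost_iff.1 hz
  rw [hS] at hzs
  have hc : IsCross a z z := isCross_self (fun j => by rw [hzs, hzs, h1]) fun i => by
    rw [hzs, hzs, h2]
  have hm : IsMove (farConfig hκ m) (farConfig hκ m) := fun _ _ => Iff.rfl
  have b0 : Min q (farConfig hκ m) (farConfig hκ m) 1 _ := Min.base hm
  have b1 := Min.ghost hz.symm (by simp) b0
  have b2 := Min.cross hc (by simpa using a.lo_lt_hi) b1
  rw [mul_one] at b2
  have htr : a.refl t = r := by rw [← hrt, refl_refl]
  have hflip : Side z r t ↔ ¬ κ < 0 := by rw [hzs, toggle_self, h3]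
  have b3 := Min.ghost hz (by
    rw [refl_inv, hrt, htr, hflip, side_far, far_iff_of_ne hne.symm, ← h3, far_iff_of_ne hne, not_lt]
    exact ⟨fun h => lt_of_le_of_ne h hne.symm, le_of_lt⟩) b2
  refine ⟨_, b3, ?_⟩
  rw [act_dGhost_mul, act_dCross_mul, act_dGhost_mul, act_dMove]
  have g1 : ghostFactor q r t z = efac κ q a := by
    rw [hfac, ghostFactor, if_neg]
    rw [hflip]
    exact fun h => not_iff_self h
  have g2 : ghostFactor q r t (farConfig hκ m) = 1 := by
    rw [ghostFactor, if_pos]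
    rw [side_far, h3]
  rw [g1, g2]
  ext; simp

theorem minOp_id (x : Config κ m) : MinOp q x x 1 LinearMap.id :=
  ⟨_, Min.base fun _ _ => Iff.rfl, act_slice (Slice.move _ _ _)⟩

theorem MinOp.far_refl_mul (hκ : κ ≠ 0) {a : Adj m} {w : Equiv.Perm (Fin m)}
    {T : Laurent R m →ₗ[R] Laurent R m} (h : MinOp q (farConfig hκ m) (farConfig hκ m) w T)
    (asc : w⁻¹ a.lo < w⁻¹ a.hi) : MinOp q (farConfig hκ m) (farConfig hκ m) (a.refl * w)
      ((mulOp (efac κ q a) ∘ₗ demazure R a) ∘ₗ T) := by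
  refine h.comp (min_far_refl hκ a) (fun i j hij => ?_) ?_
  · rw [side_far, side_far] at *
    by_cases h1 : i = a.lo ∧ j = a.hi
    · rw [h1.1, h1.2, far_iff_of_ne asc.ne, far_iff_of_ne (lo_ne_hi a)]
      exact iff_of_true asc a.lo_lt_hi
    by_cases h2 : i = a.hi ∧ j = a.lo
    · rw [h2.1, h2.2, far_iff_of_ne asc.ne', far_iff_of_ne a.hi_ne_lo]
      exact iff_of_false asc.not_gt a.lo_lt_hi.not_gt
    · exact absurd (far_refl_iff h1 h2).symm hij
  · have : inv a.refl = 1 := by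
      have := inv_refl_mul (a := a) (w := 1) (by simpa using a.lo_lt_hi)
      rwa [mul_one, inv_one] at this
    rw [inv_refl_mul asc, this, add_comm]

/-- The operator of `T_w` is the one of a minimal diagram, up to diagrams with fewer crossings. -/
theorem exists_min_far (hκ : κ ≠ 0) (w : Equiv.Perm (Fin m)) :
    ∃ B, MinOp q (farConfig hκ m) (farConfig hκ m) w B ∧
      hrep κ m q (heckeTw R q w) - B ∈ OpsLt q (farConfig hκ m) (farConfig hκ m) (inv w) := by
  induction hk : inv w using Nat.strong_induction_on generalizing w with
  | _ k ih =>
  by_cases h : w = 1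
  · subst h
    refine ⟨_, minOp_id _, ?_⟩
    have e : hrep κ m q (heckeTw R q 1) - LinearMap.id = 0 := by
      rw [heckeTw_one, map_one]
      exact sub_self _
    rw [e]
    exact zero_mem _
  · obtain ⟨a, ha⟩ := exists_desc_left h
    have h1 := inv_refl_mul_desc ha
    have asc : (a.refl * w)⁻¹ a.lo < (a.refl * w)⁻¹ a.hi := by
      rwa [refl_mul_inv_apply, refl_mul_inv_apply, refl_lo, refl_hi]
    obtain ⟨B, hB, hd⟩ := ih _ (by omega) (a.refl * w) rfl
    have hB' := hB.far_refl_mul hκ asc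
    rw [refl_mul_cancel] at hB'
    refine ⟨_, hB', ?_⟩
    have hT : opT (eig₁ κ q) (eig₂ κ q) a ∈ OpsLt q (farConfig hκ m) (farConfig hκ m) (1 + 1) := by
      refine add_mem (opsLt_mono (by omega) (mulOp_mem _ _)) ?_
      have := (min_far_refl (q := q) hκ a).mem
      rwa [← mul_one a.refl, inv_refl_mul (by simpa using a.lo_lt_hi), inv_one] at this
    have e : hrep κ m q (heckeTw R q w) - (mulOp (efac κ q a) ∘ₗ demazure R a) ∘ₗ B =
        opT (eig₁ κ q) (eig₂ κ q) a ∘ₗ (hrep κ m q (heckeTw R q (a.refl * w)) - B) +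
          mulOp (eig₁ κ q • 1) ∘ₗ B := by
      rw [heckeTw_desc q ha, map_mul, heckeRep_T, LinearMap.comp_sub, Module.End.mul_eq_comp]
      conv_rhs => enter [1, 2]; rw [opT, LinearMap.add_comp]
      abel
    rw [e]
    refine add_mem ?_ ?_
    · have := opsLt_comp hT hd
      rwa [add_comm, h1, hk] at this
    · have := mulOp_comp_mem hB.mem (eig₁ κ q • 1)
      rwa [h1, hk] at this

theorem hrep_L_mul (F : Laurent R m) (h : Hecke R m q) :
    hrep κ m q (heckeL q F * h) = mulOp F ∘ₗ hrep κ m q h := by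
  rw [map_mul, heckeRep_L]
  rfl

theorem hrep_Tw_mem (hκ : κ ≠ 0) (w : Equiv.Perm (Fin m)) :
    hrep κ m q (heckeTw R q w) ∈ OpsLt q (farConfig hκ m) (farConfig hκ m) (inv w + 1) := by
  obtain ⟨B, hB, hd⟩ := exists_min_far (q := q) hκ w
  have := add_mem (opsLt_mono (Nat.le_succ _) hd) hB.mem
  rwa [sub_add_cancel] at this

/-- The affine Hecke algebra acts on Laurent polynomials by the operators of the diagrams with
distant strands at the ends. -/
theorem mem_ops_far_iff (hκ : κ ≠ 0) (hq : IsUnit q) {T : Laurent R m →ₗ[R] Laurent R m} :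
    T ∈ Ops q (farConfig hκ m) (farConfig hκ m) ↔ ∃ h, hrep κ m q h = T := by
  constructor
  · intro hT
    have h1 : Ops q (farConfig hκ m) (farConfig hκ m) ≤ LinearMap.range (hrep κ m q).toLinearMap := by
      refine ops_le hκ hq fun w p hle => ?_
      obtain ⟨B, hB, hd⟩ := exists_min_far (q := q) hκ w
      refine ⟨B, hB, ?_⟩
      have h1 := hle (mulOp_comp_mem hd p)
      have h2 : mulOp p ∘ₗ hrep κ m q (heckeTw R q w) ∈ LinearMap.range (hrep κ m q).toLinearMap :=
        ⟨_, hrep_L_mul p _⟩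
      have := sub_mem h2 h1
      rwa [LinearMap.comp_sub, sub_sub_cancel] at this
    obtain ⟨h, rfl⟩ := h1 hT
    exact ⟨h, rfl⟩
  · rintro ⟨h, rfl⟩
    obtain ⟨p, rfl⟩ := hecke_spanning hq h
    rw [map_sum]
    refine sum_mem fun w _ => ?_
    rw [hrep_L_mul]
    exact opsLt_le (mulOp_comp_mem (hrep_Tw_mem hκ w) _)

theorem hrep_injective (hq : IsUnit q) : Function.Injective (hrep κ m q) := by
  refine heckeRep_injective _ _ hq ?_
  unfold eig₁
  split_ifs
  · exact neg_ne_zero.2 one_ne_zero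
  · exact hq.ne_zero

end FarConfig

/-! ### Demazure operators of permutations -/

section DemazureWords

variable {R : Type*} [CommRing R] [IsDomain R] {m n : ℕ}

variable (R) in
/-- The Demazure operator `∂_w`. -/
def demW (w : Equiv.Perm (Fin m)) : Laurent R m →ₗ[R] Laurent R m :=
  ((redWord w).map fun a => (demazure R a : Module.End R (Laurent R m))).prod

theorem demW_one : demW R (1 : Equiv.Perm (Fin m)) = LinearMap.id := by
  rw [demW, redWord_one]
  rfl

theorem demW_refl_mul {a : Adj m} {w : Equiv.Perm (Fin m)} (h : w⁻¹ a.lo < w⁻¹ a.hi) :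
    demW R (a.refl * w) = demazure R a ∘ₗ demW R w :=
  redWord_prod_refl_mul (f := fun a => (demazure R a : Module.End R (Laurent R m)))
    (fun a b h => LinearMap.ext (demazure_comm a b h))
    (fun a b h => LinearMap.ext (demazure_braid a b h)) h

theorem demW_mul_refl {a : Adj m} {w : Equiv.Perm (Fin m)} (h : w a.lo < w a.hi) :
    demW R (w * a.refl) = demW R w ∘ₗ demazure R a :=
  redWord_prod_mul_refl (f := fun a => (demazure R a : Module.End R (Laurent R m)))
    (fun a b h => LinearMap.ext (demazure_comm a b h))
    (fun a b h => LinearMap.ext (demazure_braid a b h)) h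

theorem permVars_demW {a : Adj m} {w : Equiv.Perm (Fin m)} (h : w⁻¹ a.hi < w⁻¹ a.lo)
    (F : Laurent R m) : permVars a.refl (demW R w F) = demW R w F := by
  have h1 : (a.refl * w)⁻¹ a.lo < (a.refl * w)⁻¹ a.hi := by
    rwa [refl_mul_inv_apply, refl_mul_inv_apply, refl_lo, refl_hi]
  rw [← refl_mul_cancel a w, demW_refl_mul h1]
  exact permVars_demazure a _

theorem demazure_eq_zero {a : Adj m} {F : Laurent R m} (h : permVars a.refl F = F) :
    demazure R a F = 0 := by
  apply mul_left_cancel₀ (Y_sub_Y_ne_zero (R := R) a.hi_ne_lo)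
  rw [demazure_spec, h, sub_self, mul_zero]

theorem Comp.longest_desc (μ : Comp n m) {a : Adj m} (ha : μ.Inner a) :
    μ.longest⁻¹ a.hi < μ.longest⁻¹ a.lo := by
  rw [μ.longest_inv]
  exact (μ.longest_lt ha.symm).2 a.lo_lt_hi

theorem permVars_demW_longest (μ : Comp n m) {a : Adj m} (ha : μ.Inner a) (F : Laurent R m) :
    permVars a.refl (demW R μ.longest F) = demW R μ.longest F :=
  permVars_demW (μ.longest_desc ha) F

theorem demazure_demW_longest (μ : Comp n m) {a : Adj m} (ha : μ.Inner a) :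
    demazure R a ∘ₗ demW R μ.longest = 0 :=
  LinearMap.ext fun F => by
    rw [LinearMap.comp_apply, demazure_eq_zero (permVars_demW_longest μ ha F), LinearMap.zero_apply]

/-- Demazure operators are linear over the invariant Laurent polynomials. -/
theorem demW_mul_of_invariant {μ : Comp n m} {w : Equiv.Perm (Fin m)} (hw : w ∈ μ.young)
    {F : Laurent R m} (hF : ∀ a, μ.Inner a → permVars a.refl F = F) (G : Laurent R m) :
    demW R w (G * F) = demW R w G * F := by
  have key (l : List (Adj m)) (hl : ∀ a ∈ l, μ.Inner a) :
      (l.map fun a => (demazure R a : Module.End R (Laurent R m))).prod (G * F) =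
        (l.map fun a => (demazure R a : Module.End R (Laurent R m))).prod G * F := by
    induction l with
    | nil => rfl
    | cons a l ih =>
      rw [List.map_cons, List.prod_cons, Module.End.mul_apply, Module.End.mul_apply,
        ih fun b hb => hl b (List.mem_cons_of_mem _ hb), mul_comm _ F, demazure_mul,
        hF a (hl a List.mem_cons_self), demazure_eq_zero (hF a (hl a List.mem_cons_self)),
        zero_mul, add_zero, mul_comm]
  exact key _ (Comp.inner_of_mem_redWord hw)

/-! ### The staircase monomial -/

/-- The monomial with the given exponents. -/
def monom (R : Type*) [CommRing R] (c : Fin m → ℕ) : Laurent R m := ∏ t, Y R t ^ c t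

theorem demazure_monom {c c' : Fin m → ℕ} {a : Adj m} (hlo : c a.lo = c' a.lo + 1)
    (hhi : c' a.hi = c' a.lo) (hc : ∀ t, t ≠ a.lo → c t = c' t) :
    demazure R a (monom R c) = monom R c' := by
  have h1 : permVars a.refl (monom R c') = monom R c' := by
    rw [monom, map_prod]
    simp only [map_pow, permVars_Y]
    refine Fintype.prod_equiv a.refl _ _ fun t => ?_
    congr 1
    by_cases h1 : t = a.lo
    · rw [h1, refl_lo, hhi]
    by_cases h2 : t = a.hi
    · rw [h2, refl_hi, hhi]
    · rw [refl_of_ne a h1 h2]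
  have h2 : monom R c = monom R c' * Y R a.lo := by
    rw [monom, monom, ← Finset.mul_prod_erase _ _ (Finset.mem_univ a.lo),
      ← Finset.mul_prod_erase _ (fun t => Y R t ^ c' t) (Finset.mem_univ a.lo), hlo, pow_succ]
    rw [Finset.prod_congr rfl fun t ht => by rw [hc t (Finset.ne_of_mem_erase ht)]]
    ring
  rw [h2, demazure_mul, h1, demazure_Y_lo, demazure_eq_zero h1, zero_mul, add_zero, mul_one]

/-- The Lehmer code of a permutation. -/
def code (w : Equiv.Perm (Fin m)) (i : Fin m) : ℕ :=
  (Finset.univ.filter fun j => i < j ∧ w j < w i).card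

theorem code_lo_le {w : Equiv.Perm (Fin m)} {a : Adj m} (h : w a.lo < w a.hi) :
    code w a.lo ≤ code w a.hi := by
  refine Finset.card_le_card fun j hj => ?_
  simp only [Finset.mem_filter, Finset.mem_univ, true_and] at hj ⊢
  refine ⟨lt_of_le_of_ne (a.lo_lt_iff.1 hj.1) ?_, hj.2.trans h⟩
  rintro rfl
  exact h.not_gt hj.2

theorem code_lo_of_desc {w : Equiv.Perm (Fin m)} {a : Adj m} (h : w a.hi < w a.lo) :
    code w a.lo = (Finset.univ.filter fun j => a.hi < j ∧ w j < w a.lo).card + 1 := by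
  rw [code, ← Finset.card_insert_of_notMem (a := a.hi) (by simp)]
  congr 1
  ext j
  simp only [Finset.mem_filter, Finset.mem_univ, true_and, Finset.mem_insert, a.lo_lt_iff,
    le_iff_eq_or_lt]
  constructor
  · rintro ⟨rfl | h1, h2⟩
    · exact Or.inl rfl
    · exact Or.inr ⟨h1, h2⟩
  · rintro (rfl | h1)
    · exact ⟨Or.inl rfl, h⟩
    · exact ⟨Or.inr h1.1, h1.2⟩

theorem code_hi_lt {w : Equiv.Perm (Fin m)} {a : Adj m} (h : w a.hi < w a.lo) :
    code w a.hi < code w a.lo := by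
  rw [code_lo_of_desc h, Nat.lt_succ_iff]
  refine Finset.card_le_card fun j hj => ?_
  simp only [Finset.mem_filter, Finset.mem_univ, true_and] at hj ⊢
  exact ⟨hj.1, hj.2.trans h⟩

theorem code_mul_refl_hi {w : Equiv.Perm (Fin m)} {a : Adj m} (h : w a.hi < w a.lo) :
    code (w * a.refl) a.hi + 1 = code w a.lo := by
  rw [code_lo_of_desc h, code]
  congr 2
  ext j
  simp only [Finset.mem_filter, Finset.mem_univ, true_and, Equiv.Perm.mul_apply, refl_hi]
  refine and_congr_right fun hj => ?_
  rw [refl_of_ne a (a.lo_lt_hi.trans hj).ne' hj.ne']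

theorem code_mul_refl_lo {w : Equiv.Perm (Fin m)} {a : Adj m} (h : w a.hi < w a.lo) :
    code (w * a.refl) a.lo = code w a.hi := by
  rw [code, code]
  congr 1
  ext j
  simp only [Finset.mem_filter, Finset.mem_univ, true_and, Equiv.Perm.mul_apply, refl_lo]
  constructor
  · rintro ⟨h1, h2⟩
    rcases (a.lo_lt_iff.1 h1).eq_or_lt with rfl | h3
    · rw [refl_hi] at h2
      exact absurd h2 h.not_gt
    · rw [refl_of_ne a h1.ne' h3.ne'] at h2
      exact ⟨h3, h2⟩
  · rintro ⟨h1, h2⟩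
    have h3 := a.lo_lt_hi.trans h1
    rw [refl_of_ne a h3.ne' h1.ne']
    exact ⟨h3, h2⟩

theorem code_mul_refl_of_ne {w : Equiv.Perm (Fin m)} {a : Adj m} {t : Fin m} (h1 : t ≠ a.lo)
    (h2 : t ≠ a.hi) : code (w * a.refl) t = code w t := by
  refine Finset.card_equiv a.refl fun j => ?_
  simp only [Finset.mem_filter, Finset.mem_univ, true_and, Equiv.Perm.mul_apply,
    refl_of_ne a h1 h2]
  refine and_congr_left fun _ => ?_
  conv_rhs => rw [← refl_of_ne a h1 h2]
  rw [refl_lt_refl a (fun h => h1 h.1) (fun h => h2 h.1)]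

/-- A Demazure operator maps the monomial of the code of the permutation to `1`, provided
the code does not drop by more than `1` between neighbours. -/
theorem demW_code {w : Equiv.Perm (Fin m)} (hw : ∀ a : Adj m, code w a.lo ≤ code w a.hi + 1) :
    demW R w (monom R (code w)) = 1 := by
  induction hk : inv w using Nat.strong_induction_on generalizing w with
  | _ k ih =>
  by_cases h : w = 1
  · subst h
    rw [demW_one, LinearMap.id_apply, monom]
    refine Finset.prod_eq_one fun t _ => ?_
    have : code (1 : Equiv.Perm (Fin m)) t = 0 := by
      rw [code, Finset.card_eq_zero, Finset.filter_eq_empty_iff]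
      exact fun j _ hj => lt_asymm hj.1 hj.2
    rw [this, pow_zero]
  -- the first descent is used, so that the condition on the code is preserved
  obtain ⟨a, ha, hmin⟩ := (measure (fun a : Adj m => a.1)).wf.has_min
    {a : Adj m | w a.hi < w a.lo} (exists_desc h)
  replace ha : w a.hi < w a.lo := ha
  have e1 := inv_mul_refl_desc ha
  have c1 := code_mul_refl_hi ha
  have c2 := code_mul_refl_lo ha
  have c3 := code_hi_lt ha
  have c4 := hw a
  have hcode (t : Fin m) (ht : t ≠ a.lo) : code w t = code (w * a.refl) t := by
    by_cases h2 : t = a.hi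
    · rw [h2]; omega
    · exact (code_mul_refl_of_ne ht h2).symm
  have asc : (w * a.refl) a.lo < (w * a.refl) a.hi := by
    rwa [Equiv.Perm.mul_apply, Equiv.Perm.mul_apply, refl_lo, refl_hi]
  have hD := demW_mul_refl (R := R) asc
  rw [mul_refl_cancel] at hD
  rw [hD, LinearMap.comp_apply, demazure_monom (c' := code (w * a.refl)) (by omega) (by omega) hcode]
  refine ih _ (by omega) (fun b => ?_) rfl
  by_cases hb1 : b.lo = a.lo
  · obtain rfl := Adj.eq_of_lo_eq hb1
    omega
  by_cases hb2 : b.hi = a.lo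
  · have hnd : ¬ w b.hi < w b.lo := fun hd => by
      refine hmin b hd ?_
      have : b.1 + 1 = a.1 := congrArg Fin.val hb2
      exact show b.1 < a.1 by omega
    have h3 := code_lo_le (lt_of_le_of_ne (not_lt.1 hnd) fun e => lo_ne_hi b (w.injective e))
    rw [← hcode _ hb1, hb2]
    rw [hb2] at h3
    omega
  · rw [← hcode _ hb1, ← hcode _ hb2]
    exact hw b

theorem Comp.longest_apply_lt (μ : Comp n m) {t t' : Fin m} (h : t < t') :
    μ.longest t' < μ.longest t ↔ (μ.coord t').1 = (μ.coord t).1 := by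
  constructor
  · intro h1
    have h2 := μ.coord_mono h1.le
    rw [μ.coord_longest, μ.coord_longest] at h2
    exact le_antisymm h2 (μ.coord_mono h.le)
  · exact fun h1 => (μ.longest_lt h1).2 h

theorem code_longest (μ : Comp n m) (t : Fin m) :
    code μ.longest t = μ.1 (μ.coord t).1 - 1 - ((μ.coord t).2 : ℕ) := by
  rw [← Fin.card_Ioi]
  symm
  refine Finset.card_bij (fun i _ => μ.coord.symm ⟨(μ.coord t).1, i⟩) (fun i hi => ?_)
    (fun i _ i' _ e => ?_) (fun t' ht' => ?_)
  · rw [Finset.mem_Ioi] at hi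
    have h1 : t < μ.coord.symm ⟨(μ.coord t).1, i⟩ := by
      rw [μ.lt_iff_coord (by rw [Equiv.apply_symm_apply]), Equiv.apply_symm_apply]
      exact hi
    rw [Finset.mem_filter]
    refine ⟨Finset.mem_univ _, h1, (μ.longest_apply_lt h1).2 ?_⟩
    rw [Equiv.apply_symm_apply]
  · have := μ.coord.symm.injective e
    simpa using this
  · rw [Finset.mem_filter] at ht'
    obtain ⟨-, h1, h2⟩ := ht'
    have h3 := (μ.longest_apply_lt h1).1 h2
    rw [μ.lt_iff_coord h3.symm] at h1
    rcases hc : μ.coord t' with ⟨j, i⟩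
    rw [hc] at h1 h3
    dsimp only at h1 h3
    subst h3
    exact ⟨i, Finset.mem_Ioi.2 h1, by rw [← hc, Equiv.symm_apply_apply]⟩

/-- The staircase monomial of a composition. -/
def stair (R : Type*) [CommRing R] (μ : Comp n m) : Laurent R m := monom R (code μ.longest)

theorem demW_stair (μ : Comp n m) : demW R μ.longest (stair R μ) = 1 := by
  refine demW_code fun a => ?_
  by_cases ha : μ.Inner a
  · have h1 : μ.longest a.hi < μ.longest a.lo := (μ.longest_apply_lt a.lo_lt_hi).2 ha.symm
    rw [code_lo_of_desc h1, Nat.succ_le_succ_iff]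
    refine Finset.card_le_card fun j hj => ?_
    simp only [Finset.mem_filter, Finset.mem_univ, true_and] at hj ⊢
    have h2 := (μ.longest_apply_lt (a.lo_lt_hi.trans hj.1)).1 hj.2
    exact ⟨hj.1, (μ.longest_apply_lt hj.1).2 (h2.trans ha)⟩
  · refine (code_lo_le ?_).trans (Nat.le_succ _)
    rcases asc_or_desc a μ.longest with h | h
    · exact h
    · exact absurd (((μ.longest_apply_lt a.lo_lt_hi).1 h).symm) ha

theorem demW_stair_demW (μ : Comp n m) :
    demW R μ.longest ∘ₗ mulOp (stair R μ) ∘ₗ demW R μ.longest = demW R μ.longest :=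
  LinearMap.ext fun F => by
    rw [LinearMap.comp_apply, LinearMap.comp_apply, LinearMap.mulLeft_apply,
      demW_mul_of_invariant μ.longest_mem (fun a ha => permVars_demW_longest μ ha F), demW_stair,
      one_mul]

end DemazureWords

/-! ### Clustered configurations -/

section ClusterOps

variable {R : Type*} [CommRing R] [IsDomain R] {κ : ℝ} {m n : ℕ} {q : R}

theorem side_cluster_of_eq {σ : Scale κ m} {μ : Comp n m} {i j : Fin m}
    (h : (μ.coord i).1 = (μ.coord j).1) : Side (cluster σ μ) i j ↔ 0 < κ := by
  have h1 := abs_lt.1 (clusterPos_abs_sub_lt σ μ h)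
  change clusterPos σ μ i < clusterPos σ μ j + κ ↔ _
  constructor
  · intro h2
    by_contra h3
    rw [abs_of_nonpos (not_lt.1 h3)] at h1
    linarith
  · intro h2
    rw [abs_of_pos h2] at h1
    linarith

theorem side_cluster_of_ne {σ : Scale κ m} {μ : Comp n m} {i j : Fin m}
    (h : (μ.coord i).1 ≠ (μ.coord j).1) : Side (cluster σ μ) i j ↔ i < j := by
  change clusterPos σ μ i < clusterPos σ μ j + κ ↔ _
  rcases lt_or_gt_of_ne h with h1 | h1
  · have h2 := clusterPos_lt σ μ h1
    have h3 : i < j := by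
      by_contra h3
      exact (μ.coord_mono (not_lt.1 h3)).not_gt h1
    have := neg_abs_le κ
    exact iff_of_true (by linarith) h3
  · have h2 := clusterPos_lt σ μ h1
    have h3 : ¬ i < j := fun h3 => (μ.coord_mono h3.le).not_gt h1
    have := le_abs_self κ
    exact iff_of_false (by linarith) h3

theorem isCross_cluster (σ : Scale κ m) {μ : Comp n m} {a : Adj m} (ha : μ.Inner a) :
    IsCross a (cluster σ μ) (cluster σ μ) := by
  refine isCross_self (fun j => ?_) fun i => ?_
  · by_cases h : (μ.coord a.lo).1 = (μ.coord j).1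
    · rw [side_cluster_of_eq h, side_cluster_of_eq (ha.symm.trans h)]
    · rw [side_cluster_of_ne h, side_cluster_of_ne fun e => h (ha.trans e), a.lo_lt_iff]
      refine ⟨fun h1 => lt_of_le_of_ne h1 ?_, le_of_lt⟩
      rintro rfl
      exact h ha
  · by_cases h : (μ.coord i).1 = (μ.coord a.lo).1
    · rw [side_cluster_of_eq h, side_cluster_of_eq (h.trans ha)]
    · rw [side_cluster_of_ne h, side_cluster_of_ne fun e => h (e.trans ha.symm), a.lt_hi_iff]
      refine ⟨le_of_lt, fun h1 => lt_of_le_of_ne h1 ?_⟩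
      rintro rfl
      exact h rfl

/-- The order of two strands of a cluster for which the first one and the ghost of the second one
have to cross when the cluster is spread out. -/
def Ord (κ : ℝ) (i j : Fin m) : Prop := κ < 0 ∧ i < j ∨ 0 < κ ∧ j < i

theorem mem_sep_cluster {hκ : κ ≠ 0} {σ : Scale κ m} {μ : Comp n m} {i j : Fin m} :
    ¬ (Side (cluster σ μ) i j ↔ Side (farConfig hκ m) i j) ↔
      (μ.coord i).1 = (μ.coord j).1 ∧ Ord κ i j := by
  rw [side_far]
  by_cases hij : i = j
  · subst hij
    rw [side_cluster_of_eq rfl]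
    simp [Far, Ord]
  rw [far_iff_of_ne hij]
  by_cases h : (μ.coord i).1 = (μ.coord j).1
  · rw [side_cluster_of_eq h]
    rcases lt_or_gt_of_ne hκ with h1 | h1
    · simp [h, h1, h1.not_gt, Ord]
    · simp only [h, h1, h1.not_gt, Ord, true_iff, false_and, true_and, false_or, not_lt]
      exact ⟨fun h => lt_of_le_of_ne h (Ne.symm hij), le_of_lt⟩
  · rw [side_cluster_of_ne h]
    simp [h]

variable (κ q) in
open Classical in
/-- The product of the factors of the crossings of strands and ghosts which occur when the
clusters are spread out. -/
def spread (μ : Comp n m) : Laurent R m :=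
  ∏ p ∈ Finset.univ.filter (fun p : Fin m × Fin m => (μ.coord p.1).1 = (μ.coord p.2).1 ∧ Ord κ p.1 p.2),
    (Y R p.1 - q • Y R p.2)

/-- The operator of spreading the clusters out. -/
theorem min_cluster_far (hκ : κ ≠ 0) (σ : Scale κ m) (μ : Comp n m) :
    MinOp q (cluster σ μ) (farConfig hκ m) 1 (mulOp (spread κ q μ)) := by
  obtain ⟨T, hT⟩ := exists_minOp (q := q) hκ (cluster σ μ) (farConfig hκ m) 1
  have h1 := hT.eq_mulOp
  rw [h1] at hT
  convert hT using 2
  rw [spread]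
  refine Finset.prod_congr ?_ fun p hp => ?_
  · ext p
    simp only [Finset.mem_filter, Finset.mem_univ, true_and]
    rw [mem_sep, Equiv.Perm.one_apply, Equiv.Perm.one_apply, mem_sep_cluster]
  · rw [mem_sep, Equiv.Perm.one_apply, Equiv.Perm.one_apply, mem_sep_cluster] at hp
    rw [ghostFactor, side_cluster_of_eq hp.1, if_neg]
    rcases lt_or_gt_of_ne hκ with h | h <;> simp [h, h.not_gt]

/-- Gathering the clusters contributes no factors. -/
theorem min_far_cluster (hκ : κ ≠ 0) (σ : Scale κ m) (μ : Comp n m) :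
    MinOp q (farConfig hκ m) (cluster σ μ) 1 LinearMap.id := by
  obtain ⟨T, hT⟩ := exists_minOp (q := q) hκ (farConfig hκ m) (cluster σ μ) 1
  have h1 := hT.eq_mulOp
  rw [h1] at hT
  convert hT using 1
  rw [Finset.prod_eq_one]
  · ext; simp
  · intro p hp
    rw [mem_sep, Equiv.Perm.one_apply, Equiv.Perm.one_apply, Iff.comm] at hp
    have h2 := side_cluster_of_eq (σ := σ) (mem_sep_cluster.1 hp).1
    rw [h2] at hp
    rw [ghostFactor, if_pos]
    by_cases h3 : Side (farConfig hκ m) p.1 p.2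
    · simp only [h3, iff_true, not_lt, true_iff] at hp ⊢
      exact lt_of_le_of_ne hp hκ
    · simp only [h3, iff_false, not_not, false_iff, not_lt] at hp ⊢
      exact (not_le.1 hp).le

theorem exists_efac (hκ : κ ≠ 0) (q : R) (a : Adj m) : ∃ r t : Fin m, a.refl r = t ∧ a.refl t = r ∧
    efac κ q a = Y R r - q • Y R t ∧ Ord κ r t ∧ ¬ Ord κ t r ∧
      ∀ u v, ¬ (u = r ∧ v = t) → ¬ (u = t ∧ v = r) → (Ord κ (a.refl u) (a.refl v) ↔ Ord κ u v) := by
  have hl := a.lo_lt_hi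
  rcases lt_or_gt_of_ne hκ with h | h
  · have hO (i j : Fin m) : Ord κ i j ↔ i < j := by simp [Ord, h, h.not_gt]
    refine ⟨a.lo, a.hi, refl_lo a, refl_hi a, ?_, (hO _ _).2 hl, fun h1 => hl.not_gt ((hO _ _).1 h1),
      fun u v h1 h2 => ?_⟩
    · rw [efac, fac, eig₁, eig₂, if_pos h, if_pos h]; simp only [neg_smul, one_smul]; abel
    · rw [hO, hO, refl_lt_refl a h1 h2]
  · have hO (i j : Fin m) : Ord κ i j ↔ j < i := by simp [Ord, h, h.not_gt]
    refine ⟨a.hi, a.lo, refl_hi a, refl_lo a, ?_, (hO _ _).2 hl, fun h1 => hl.not_gt ((hO _ _).1 h1),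
      fun u v h1 h2 => ?_⟩
    · rw [efac, fac, eig₁, eig₂, if_neg h.not_gt, if_neg h.not_gt]
      simp only [neg_smul, one_smul]; abel
    · rw [hO, hO, refl_lt_refl a (fun e => h1 e.symm) (fun e => h2 e.symm)]

/-- Up to the factor of the exchanged strands, the factors of a cluster are permuted by a
reflection. -/
theorem efac_mul_spread (hκ : κ ≠ 0) {μ : Comp n m} {a : Adj m} (ha : μ.Inner a) :
    efac κ q a * permVars a.refl (spread κ q μ) = permVars a.refl (efac κ q a) * spread κ q μ := by
  classical
  obtain ⟨r, t, hrt, htr, hfac, h1, h2, h3⟩ := exists_efac hκ q a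
  have hin (i : Fin m) : (μ.coord (a.refl i)).1 = (μ.coord i).1 := Comp.mem_young.1 ha.refl_mem i
  have hne : r ≠ t := by
    rintro rfl
    exact h2 h1
  have hmem : (r, t) ∈ Finset.univ.filter
      (fun p : Fin m × Fin m => (μ.coord p.1).1 = (μ.coord p.2).1 ∧ Ord κ p.1 p.2) := by
    simp only [Finset.mem_filter, Finset.mem_univ, true_and]
    exact ⟨by rw [← hrt, hin], h1⟩
  rw [spread, ← Finset.mul_prod_erase _ _ hmem, map_mul, ← hfac]
  have : permVars a.refl (∏ p ∈ (Finset.univ.filter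
      (fun p : Fin m × Fin m => (μ.coord p.1).1 = (μ.coord p.2).1 ∧ Ord κ p.1 p.2)).erase (r, t),
      (Y R p.1 - q • Y R p.2)) = ∏ p ∈ (Finset.univ.filter
      (fun p : Fin m × Fin m => (μ.coord p.1).1 = (μ.coord p.2).1 ∧ Ord κ p.1 p.2)).erase (r, t),
      (Y R p.1 - q • Y R p.2) := by
    rw [map_prod]
    refine Finset.prod_equiv (Equiv.prodCongr a.refl a.refl) (fun p => ?_) fun p _ => ?_
    · simp only [Finset.mem_erase, Finset.mem_filter, Finset.mem_univ, true_and, Equiv.prodCongr_apply,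
        Prod.map_fst, Prod.map_snd, hin]
      obtain ⟨u, v⟩ := p
      by_cases e1 : u = r ∧ v = t
      · obtain ⟨rfl, rfl⟩ := e1
        simp [hrt, htr, h2]
      by_cases e2 : u = t ∧ v = r
      · obtain ⟨rfl, rfl⟩ := e2
        simp [hrt, htr, h2]
      · have e3 : ¬ (a.refl u = r ∧ a.refl v = t) := fun e => e2
          ⟨by rw [← refl_refl a u, e.1, hrt], by rw [← refl_refl a v, e.2, htr]⟩
        simp only [ne_eq, Prod.mk.injEq, Prod.map_apply, e1, e3, not_false_eq_true, true_and,
          h3 u v e1 e2]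
    · simp [permVars_Y]
  rw [this]
  ring

variable (κ q) in
/-- The images of `T` are eigenvectors of the `T_r` of the Young subgroup, like those of the
quasi-idempotent. -/
def Eigen (μ : Comp n m) (T : Laurent R m →ₗ[R] Laurent R m) : Prop :=
  ∀ a, μ.Inner a → ∀ F, efac κ q a * permVars a.refl (T F) = permVars a.refl (efac κ q a) * T F

theorem Eigen.sub {μ : Comp n m} {S T : Laurent R m →ₗ[R] Laurent R m} (hS : Eigen κ q μ S)
    (hT : Eigen κ q μ T) : Eigen κ q μ (S - T) := fun a ha F => by
  rw [LinearMap.sub_apply, map_sub, mul_sub, mul_sub, hS a ha, hT a ha]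

theorem Eigen.smul {μ : Comp n m} {T : Laurent R m →ₗ[R] Laurent R m}
    (hT : Eigen κ q μ T) (c : R) : Eigen κ q μ (c • T) := fun a ha F => by
  rw [LinearMap.smul_apply, map_smul, mul_smul_comm, mul_smul_comm, hT a ha]

variable (κ q) in
/-- The operator of the symmetrizing diagram of `μ`: the strands of each cluster cross, and the
clusters are spread out. -/
def symOp (μ : Comp n m) : Laurent R m →ₗ[R] Laurent R m :=
  mulOp (spread κ q μ) ∘ₗ demW R μ.longest

theorem eigen_symOp_comp (hκ : κ ≠ 0) (μ : Comp n m) (A : Laurent R m →ₗ[R] Laurent R m) :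
    Eigen κ q μ (symOp κ q μ ∘ₗ A) := fun a ha F => by
  simp only [symOp, LinearMap.comp_apply, LinearMap.mulLeft_apply, map_mul,
    permVars_demW_longest μ ha]
  rw [← mul_assoc, efac_mul_spread hκ ha, mul_assoc]

/-- The nonzero coefficients of an operator whose images are eigenvectors form orbits of the Young
subgroup. -/
theorem Eigen.coeff_ne_zero (hq : q ≠ 0) {μ : Comp n m} {T : Laurent R m →ₗ[R] Laurent R m}
    (hT : Eigen κ q μ T) {f : Equiv.Perm (Fin m) → Rat R m} (hf : Rep T f) {a : Adj m}
    (ha : μ.Inner a) {w : Equiv.Perm (Fin m)} (hw : f w ≠ 0) : f (a.refl * w) ≠ 0 := by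
  have h0 : efac κ q a ≠ 0 := fac_ne_zero (by
    unfold eig₁
    split_ifs
    · exact neg_ne_zero.2 one_ne_zero
    · exact hq) a
  have h1 : permVars a.refl (efac κ q a) ≠ 0 := fun h => h0 (permVars_injective a.refl (by
    rw [h, map_zero]))
  have e : mulOp (efac κ q a) ∘ₗ (permVars a.refl).toLinearMap ∘ₗ T =
      mulOp (permVars a.refl (efac κ q a)) ∘ₗ T := LinearMap.ext fun F => hT a ha F
  have r1 := (hf.perm a.refl).mul_left (efac κ q a)
  have r2 := hf.mul_left (permVars a.refl (efac κ q a))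
  rw [e] at r1
  have h2 := congrFun (r1.unique r2) w
  rw [refl_inv] at h2
  intro h3
  rw [h3, map_zero, mul_zero] at h2
  exact mul_ne_zero (toRat_ne_zero h1) hw h2.symm

/-- Crossings within the clusters can be put on top of a minimal diagram if lengths add. -/
theorem MinOp.demW_comp {σ : Scale κ m} {μ : Comp n m} {x : Config κ m} {w y : Equiv.Perm (Fin m)}
    {T : Laurent R m →ₗ[R] Laurent R m} (hT : MinOp q x (cluster σ μ) w T)
    (hw : ∀ t t', t < t' → (μ.coord t).1 = (μ.coord t').1 → w⁻¹ t < w⁻¹ t') (hy : y ∈ μ.young) :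
    MinOp q x (cluster σ μ) (y * w) (demW R y ∘ₗ T) := by
  induction hk : inv y using Nat.strong_induction_on generalizing y with
  | _ k ih =>
  by_cases h : y = 1
  · subst h
    rw [demW_one, one_mul]
    exact hT
  · obtain ⟨a, ha⟩ := exists_desc_left h
    have hin := Comp.inner_of_desc (Comp.inv_mem_young hy) ha
    have h1 := inv_refl_mul_desc ha
    have asc : (a.refl * y)⁻¹ a.lo < (a.refl * y)⁻¹ a.hi := by
      rwa [refl_mul_inv_apply, refl_mul_inv_apply, refl_lo, refl_hi]
    have hy' := Comp.mul_mem_young hin.refl_mem hy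
    obtain ⟨g, hg, hg'⟩ := ih _ (by omega) hy' rfl
    have hb (i : Fin m) := Comp.mem_young.1 (Comp.inv_mem_young hy') i
    have h2 := Min.cross (isCross_cluster σ hin) (by
      rw [mul_inv_rev]
      exact hw _ _ asc (by rw [hb, hb]; exact hin)) hg
    rw [← mul_assoc, refl_mul_cancel] at h2
    refine ⟨_, h2, ?_⟩
    rw [act_dCross_mul, hg', ← LinearMap.comp_assoc, ← demW_refl_mul asc, refl_mul_cancel]

theorem inv_longest_mul {μ : Comp n m} {w : Equiv.Perm (Fin m)}
    (hw : ∀ t t', t < t' → (μ.coord t).1 = (μ.coord t').1 → w⁻¹ t < w⁻¹ t') :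
    inv (μ.longest * w) = inv μ.longest + inv w := by
  have := μ.inv_mul_longest hw
  rw [← inv_inv, mul_inv_rev, μ.longest_inv, this, inv_inv, add_comm]

/-- The symmetrizing diagram on top of a minimal diagram which does not exchange strands of a
cluster is minimal. -/
theorem MinOp.symOp_comp (hκ : κ ≠ 0) {σ : Scale κ m} {μ : Comp n m} {x : Config κ m}
    {w : Equiv.Perm (Fin m)} {T : Laurent R m →ₗ[R] Laurent R m} (hT : MinOp q x (cluster σ μ) w T)
    (hw : ∀ t t', t < t' → (μ.coord t).1 = (μ.coord t').1 → w⁻¹ t < w⁻¹ t') :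
    MinOp q x (farConfig hκ m) (μ.longest * w) (symOp κ q μ ∘ₗ T) := by
  have h1 := (hT.demW_comp hw μ.longest_mem).comp (min_cluster_far hκ σ μ) (fun i j hij => ?_)
    (by rw [one_mul, inv_one, zero_add])
  · rwa [one_mul, ← LinearMap.comp_assoc] at h1
  · obtain ⟨h2, h3⟩ := mem_sep_cluster.1 hij
    rw [side_cluster_of_eq h2, mul_inv_rev, μ.longest_inv]
    have hb : (μ.coord (μ.longest i)).1 = (μ.coord (μ.longest j)).1 := by
      rw [μ.coord_longest, μ.coord_longest]
      exact h2
    have hd := x.isSide.diag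
    rcases h3 with ⟨h, h3⟩ | ⟨h, h3⟩
    · have h4 := hw _ _ ((μ.longest_lt h2.symm).2 h3) hb.symm
      refine iff_of_false (fun h5 => ?_) h.not_gt
      exact h.not_gt ((hd _).1 (x.isSide.mono h5 h4.le le_rfl))
    · have h4 := hw _ _ ((μ.longest_lt h2).2 h3) hb
      exact iff_of_true (x.isSide.mono ((hd _).2 h) le_rfl h4.le) h

theorem min_symOp (hκ : κ ≠ 0) (σ : Scale κ m) (μ : Comp n m) :
    MinOp q (cluster σ μ) (farConfig hκ m) μ.longest (symOp κ q μ) := by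
  have := (minOp_id (q := q) (cluster σ μ)).symOp_comp hκ fun t t' h _ => by simpa using h
  rwa [mul_one, LinearMap.comp_id] at this

/-- An operator whose images are eigenvectors factors through the symmetrizing diagram; it
vanishes if it has too few crossings for this. -/
theorem Eigen.exists_factor (hκ : κ ≠ 0) (hq : IsUnit q) (σ : Scale κ m) {μ : Comp n m}
    {x : Config κ m} {k : ℕ} {T : Laurent R m →ₗ[R] Laurent R m} (hE : Eigen κ q μ T)
    (hT : T ∈ OpsLt q x (farConfig hκ m) k) :
    ∃ A ∈ Ops q x (cluster σ μ), T = symOp κ q μ ∘ₗ A ∧ (k ≤ inv μ.longest → A = 0) := by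
  induction k generalizing T with
  | zero => exact ⟨0, zero_mem _, by rw [opsLt_zero hT, LinearMap.comp_zero], fun _ => rfl⟩
  | succ k ih =>
  obtain ⟨p, B, hp, hB, rfl⟩ := exists_combo_of_mem hκ hq hT
  have key (w : Equiv.Perm (Fin m)) : ∃ A ∈ Ops q x (cluster σ μ), mulOp (p w) ∘ₗ B w -
      symOp κ q μ ∘ₗ A ∈ OpsLt q x (farConfig hκ m) k ∧ (k + 1 ≤ inv μ.longest → A = 0) := by
    have triv (h : mulOp (p w) ∘ₗ B w ∈ OpsLt q x (farConfig hκ m) k) :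
        ∃ A ∈ Ops q x (cluster σ μ), mulOp (p w) ∘ₗ B w -
          symOp κ q μ ∘ₗ A ∈ OpsLt q x (farConfig hκ m) k ∧ (k + 1 ≤ inv μ.longest → A = 0) :=
      ⟨0, zero_mem _, by rwa [LinearMap.comp_zero, sub_zero], fun _ => rfl⟩
    by_cases hp0 : p w = 0
    · refine triv ?_
      rw [hp0, mulOp_zero, LinearMap.zero_comp]
      exact zero_mem _
    have hk : inv w ≤ k := by
      by_contra h
      exact hp0 (hp w (not_le.1 h))
    rcases hk.lt_or_eq with hk | hk
    · exact triv (opsLt_mono hk (mulOp_comp_mem (hB w).mem _))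
    -- the coefficient of `w` is not zero, so all simple reflections of the Young subgroup are
    -- descents
    choose f hf hl using fun w => (hB w).exists_lead
    have hrep := Rep.sum Finset.univ fun w _ => (hf w).mul_left (p w)
    have hle (v : Equiv.Perm (Fin m)) (hv : k < inv v) :
        (∑ w, fun v => toRat R m (p w) * f w v) v = 0 := by
      rw [Finset.sum_apply]
      refine Finset.sum_eq_zero fun u _ => ?_
      by_contra h
      have h1 := hl u |>.2 v (right_ne_zero_of_mul h)
      have h2 : p u ≠ 0 := fun h3 => left_ne_zero_of_mul h (by rw [h3, map_zero])
      have h3 : ¬ k + 1 ≤ inv u := fun h3 => h2 (hp u h3)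
      rcases h1 with rfl | h1 <;> omega
    have hw0 : (∑ w, fun v => toRat R m (p w) * f w v) w ≠ 0 := by
      rw [Finset.sum_apply, Finset.sum_eq_single w]
      · exact mul_ne_zero (toRat_ne_zero hp0) (hl w).1
      · intro u _ hu
        by_contra h
        have h1 := hl u |>.2 w (right_ne_zero_of_mul h)
        have h2 : p u ≠ 0 := fun h3 => left_ne_zero_of_mul h (by rw [h3, map_zero])
        have h3 : ¬ k + 1 ≤ inv u := fun h3 => h2 (hp u h3)
        rcases h1 with h1 | h1
        · exact hu h1.symm
        · omega
      · simp
    have hdesc (a : Adj m) (ha : μ.Inner a) : w⁻¹ a.hi < w⁻¹ a.lo := by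
      rcases asc_or_desc a w⁻¹ with h | h
      · have h1 := hE.coeff_ne_zero hq.ne_zero hrep ha hw0
        exact absurd (hle _ (by rw [inv_refl_mul h]; omega)) h1
      · exact h
    have hv (t t' : Fin m) (h : t < t') (hb : (μ.coord t).1 = (μ.coord t').1) :
        (μ.longest * w)⁻¹ t < (μ.longest * w)⁻¹ t' := by
      rw [mul_inv_rev, μ.longest_inv]
      refine Comp.inv_lt_of_desc hdesc ((μ.longest_lt hb.symm).2 h) ?_
      rw [μ.coord_longest, μ.coord_longest]
      exact hb.symm
    have hlw : μ.longest * (μ.longest * w) = w := by rw [← mul_assoc, μ.longest_mul_self, one_mul]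
    have hinv := inv_longest_mul hv
    rw [hlw] at hinv
    -- hence a minimal diagram of `w` can be chosen to end with the symmetrizing diagram
    obtain ⟨B', hB'⟩ := exists_minOp (q := q) hκ x (cluster σ μ) (μ.longest * w)
    have h1 := hB'.symOp_comp hκ hv
    rw [hlw] at h1
    refine ⟨mulOp (permVars μ.longest⁻¹ (p w)) ∘ₗ B',
      opsLt_le (mulOp_comp_mem hB'.mem _), ?_, fun h => by omega⟩
    have h2 := mulOp_comp_mem ((hB w).sub_mem hκ hq h1) (p w)
    have h3 := opsLt_comp' ((min_symOp (q := q) hκ σ μ).comp_mulOp hκ hq (permVars μ.longest⁻¹ (p w)))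
      hB'.mem
    rw [permVars_cancel_inv] at h3
    rw [hk] at h2
    rw [← hinv, hk] at h3
    have h4 := sub_mem h2 h3
    convert h4 using 1
    rw [LinearMap.comp_sub, LinearMap.sub_comp]
    simp only [LinearMap.comp_assoc]
    abel
  choose A hA hA' hA0 using key
  have hd : ∑ w, mulOp (p w) ∘ₗ B w - symOp κ q μ ∘ₗ ∑ w, A w ∈ OpsLt q x (farConfig hκ m) k := by
    have e : symOp κ q μ ∘ₗ ∑ w, A w = ∑ w, symOp κ q μ ∘ₗ A w :=
      LinearMap.ext fun F => by simp [LinearMap.sum_apply]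
    rw [e, ← Finset.sum_sub_distrib]
    exact sum_mem fun w _ => hA' w
  obtain ⟨A', h1, h2, h3⟩ := ih (hE.sub (eigen_symOp_comp hκ μ _)) hd
  refine ⟨A' + ∑ w, A w, add_mem h1 (sum_mem fun w _ => hA w), ?_, fun h => ?_⟩
  · rw [LinearMap.comp_add, ← h2, sub_add_cancel]
  · rw [h3 (by omega), Finset.sum_eq_zero fun w _ => hA0 w h, add_zero]

end ClusterOps

/-! ### The quasi-idempotents of the Hecke algebra as diagrams -/

section QuasiIdempotents

variable {R : Type*} [CommRing R] [IsDomain R] {κ : ℝ} {m n : ℕ} {q : R}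

theorem invSet_subset_longest {μ : Comp n m} {w : Equiv.Perm (Fin m)} (hw : w ∈ μ.young) :
    invSet w ⊆ invSet μ.longest := fun p hp => by
  rw [mem_invSet] at *
  refine ⟨hp.1, (μ.longest_apply_lt hp.1).2 (le_antisymm ?_ (μ.coord_mono hp.1.le))⟩
  have := μ.coord_mono hp.2.le
  rwa [Comp.mem_young.1 hw, Comp.mem_young.1 hw] at this

theorem inv_lt_inv_longest {μ : Comp n m} {w : Equiv.Perm (Fin m)} (hw : w ∈ μ.young)
    (h : w ≠ μ.longest) : inv w < inv μ.longest := by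
  refine Finset.card_lt_card ((invSet_subset_longest hw).ssubset_of_ne fun e => h ?_)
  refine Comp.eq_longest hw fun a ha => ?_
  have : (a.lo, a.hi) ∈ invSet μ.longest :=
    mem_invSet.2 ⟨a.lo_lt_hi, (μ.longest_apply_lt a.lo_lt_hi).2 ha.symm⟩
  rw [← e] at this
  exact (mem_invSet.1 this).2

theorem eigen_of_opT {μ : Comp n m} {T : Laurent R m →ₗ[R] Laurent R m}
    (h : ∀ a, μ.Inner a → opT (eig₁ κ q) (eig₂ κ q) a ∘ₗ T = eig₂ κ q • T) : Eigen κ q μ T := by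
  intro a ha F
  have h1 := DFunLike.congr_fun (h a ha) F
  rw [LinearMap.comp_apply, opT_apply, LinearMap.smul_apply] at h1
  have h2 := demazure_spec a (T F)
  rw [efac, permVars_fac]
  simp only [Algebra.smul_def] at h1
  simp only [fac, Algebra.smul_def] at h1 ⊢
  linear_combination (Y R a.hi - Y R a.lo) * h1 +
    (algebraMap R _ (eig₁ κ q) * Y R a.lo + algebraMap R _ (eig₂ κ q) * Y R a.hi) * h2

theorem eigen_of_hecke_mul {μ : Comp n m} {h : Hecke R m q}
    (hh : ∀ a, μ.Inner a → heckeT R q a * h = eig₂ κ q • h) : Eigen κ q μ (hrep κ m q h) := by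
  refine eigen_of_opT fun a ha => ?_
  have := congrArg (hrep κ m q) (hh a ha)
  rw [map_mul, heckeRep_T, map_smul] at this
  exact this

/-- The quasi-idempotent of a Young subgroup acts, up to a scalar, by the symmetrizing diagram: the
difference has too few crossings for an operator whose images are eigenvectors. -/
theorem hrep_gammaSym (hκ : κ ≠ 0) (hq : IsUnit q) (σ : Scale κ m) {γ : R} (hγ : γ * eig₁ κ q = -1)
    (μ : Comp n m) :
    hrep κ m q (gammaSym q γ μ) = γ ^ inv μ.longest • symOp κ q μ := by
  have hE : Eigen κ q μ (hrep κ m q (gammaSym q γ μ) - γ ^ inv μ.longest • symOp κ q μ) := by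
    have h1 : Eigen κ q μ (hrep κ m q (gammaSym q γ μ)) :=
      eigen_of_hecke_mul fun a ha => hecke_T_mul_gammaSym eig_add eig_mul hγ ha
    have h2 := eigen_symOp_comp (q := q) hκ μ LinearMap.id
    rw [LinearMap.comp_id] at h2
    exact h1.sub (h2.smul _)
  have hmin := (min_far_cluster (q := q) hκ σ μ).symOp_comp hκ fun t t' h _ => by simpa using h
  rw [mul_one, LinearMap.comp_id] at hmin
  have hd : hrep κ m q (gammaSym q γ μ) - γ ^ inv μ.longest • symOp κ q μ ∈
      OpsLt q (farConfig hκ m) (farConfig hκ m) (inv μ.longest) := by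
    rw [gammaSym, map_sum, ← Finset.add_sum_erase _ _ μ.longest_mem, add_sub_right_comm]
    refine add_mem ?_ (sum_mem fun w hw => ?_)
    · rw [map_smul, len, length_redWord]
      -- the leading term is the one of the longest element
      obtain ⟨B, hB, hB'⟩ := exists_min_far (q := q) hκ μ.longest
      have := add_mem hB' (hB.sub_mem hκ hq hmin)
      rw [sub_add_sub_cancel] at this
      have := Submodule.smul_mem _ (γ ^ inv μ.longest) this
      rwa [smul_sub] at this
    · rw [map_smul]
      refine Submodule.smul_mem _ _ ?_
      rw [Finset.mem_erase] at hw
      exact opsLt_mono (inv_lt_inv_longest hw.2 hw.1) (hrep_Tw_mem hκ w)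
  obtain ⟨A, -, h1, h2⟩ := hE.exists_factor hκ hq σ hd
  rw [h2 le_rfl, LinearMap.comp_zero] at h1
  exact sub_eq_zero.1 h1

theorem lt_of_asc {μ : Comp n m} {w : Equiv.Perm (Fin m)} (h : ∀ a, μ.Inner a → w a.lo < w a.hi)
    {t t' : Fin m} (htt : t < t') (hb : (μ.coord t).1 = (μ.coord t').1) : w t < w t' := by
  have := Comp.inv_lt_of_desc (μ := μ) (w := Fin.revPerm * w)
    (fun a ha => by simpa using h a ha) htt hb
  simpa using this

/-- A diagram with distant strands at the top which starts with the crossing of all the strands of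
each cluster is an element of the Hecke algebra on top of the symmetrizing diagram. -/
theorem exists_comp_symOp (hκ : κ ≠ 0) (hq : IsUnit q) (σ : Scale κ m) {ν : Comp n m}
    {T : Laurent R m →ₗ[R] Laurent R m} (hT : T ∈ Ops q (cluster σ ν) (farConfig hκ m)) :
    ∃ h, T ∘ₗ demW R ν.longest = hrep κ m q h ∘ₗ symOp κ q ν := by
  let M : Submodule R (Laurent R m →ₗ[R] Laurent R m) :=
    ((Ops q (farConfig hκ m) (farConfig hκ m)).map
      (LinearMap.lcomp R (Laurent R m) (symOp κ q ν))).comap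
      (LinearMap.lcomp R (Laurent R m) (demW R ν.longest))
  have hM (T) : T ∈ M ↔ ∃ S ∈ Ops q (farConfig hκ m) (farConfig hκ m),
      S ∘ₗ symOp κ q ν = T ∘ₗ demW R ν.longest := Iff.rfl
  have h1 : Ops q (cluster σ ν) (farConfig hκ m) ≤ M := by
    refine ops_le hκ hq fun w p _ => ?_
    -- either `w` does not exchange strands of a cluster, and the clusters can be spread out
    -- first, or a minimal diagram of `w` starts with a crossing in a cluster, which annihilates
    -- the Demazure operator
    by_cases h : ∀ a, ν.Inner a → w a.lo < w a.hi
    · obtain ⟨B, hB⟩ := exists_minOp (q := q) hκ (farConfig hκ m) (farConfig hκ m) w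
      have h2 := (min_cluster_far (q := q) hκ σ ν).comp hB (fun i j hij => ?_)
        (by rw [mul_one, inv_one, add_zero])
      · rw [mul_one] at h2
        refine ⟨_, h2, (hM _).2 ⟨mulOp p ∘ₗ B, opsLt_le (mulOp_comp_mem hB.mem p), ?_⟩⟩
        simp only [symOp, LinearMap.comp_assoc]
      · rw [_root_.inv_one]; simp only [Equiv.Perm.one_apply]
        by_contra h3
        obtain ⟨h4, h5⟩ := mem_sep_cluster.1 h3
        have hne : i ≠ j := by
          rintro rfl
          simp [Ord] at h5
        apply hij
        rw [side_far, side_far, far_iff_of_ne hne, far_iff_of_ne fun e => hne (w.injective e)]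
        rcases lt_or_gt_of_ne hne with h6 | h6
        · exact iff_of_true h6 (lt_of_asc h h6 h4)
        · exact iff_of_false h6.not_gt (lt_of_asc h h6 h4.symm).not_gt
    · push Not at h
      obtain ⟨a, ha, hle⟩ := h
      have hd : w a.hi < w a.lo := lt_of_le_of_ne hle fun e => a.hi_ne_lo (w.injective e)
      obtain ⟨B, hB⟩ := exists_minOp (q := q) hκ (cluster σ ν) (farConfig hκ m) (w * a.refl)
      have ha1 : inv a.refl = 1 := by
        have := inv_refl_mul (a := a) (w := 1) (by simpa using a.lo_lt_hi)
        rwa [mul_one, inv_one] at this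
      have hX : MinOp q (cluster σ ν) (cluster σ ν) a.refl (demazure R a) := by
        have := (minOp_id (q := q) (cluster σ ν)).demW_comp (fun t t' h _ => by simpa using h)
          ha.refl_mem
        have e := demW_refl_mul (R := R) (a := a) (w := 1) (by simpa using a.lo_lt_hi)
        rw [mul_one] at e this
        rwa [e, demW_one, LinearMap.comp_id, LinearMap.comp_id] at this
      have h2 := hX.comp hB (fun i j _ => ?_) (by
        rw [mul_refl_cancel, ha1]
        exact (inv_mul_refl_desc hd).symm)
      · rw [mul_refl_cancel] at h2
        refine ⟨_, h2, (hM _).2 ⟨0, zero_mem _, ?_⟩⟩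
        rw [LinearMap.zero_comp, LinearMap.comp_assoc, LinearMap.comp_assoc,
          demazure_demW_longest ν ha, LinearMap.comp_zero, LinearMap.comp_zero]
      · rw [refl_inv]
        exact ((isCross_cluster σ ha) i j).symm
  obtain ⟨S, hS, hS'⟩ := (hM T).1 (h1 hT)
  obtain ⟨h, rfl⟩ := (mem_ops_far_iff hκ hq).1 hS
  exact ⟨h, hS'.symm⟩

theorem spread_ne_zero (hκ : κ ≠ 0) (σ : Scale κ m) (μ : Comp n m) : spread κ q μ ≠ 0 := by
  intro h
  obtain ⟨f, hf, hl⟩ := (min_cluster_far (q := q) hκ σ μ).exists_lead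
  rw [h, mulOp_zero] at hf
  exact hl.1 (congrFun (hf.unique rep_zero) 1)

variable (R) in
/-- The operator of the primitive idempotent of the nilHecke algebra. -/
def nilOp (μ : Comp n m) : Laurent R m →ₗ[R] Laurent R m :=
  mulOp (stair R μ) ∘ₗ demW R μ.longest

theorem demW_comp_nilOp (μ : Comp n m) : demW R μ.longest ∘ₗ nilOp R μ = demW R μ.longest :=
  demW_stair_demW μ

theorem nilOp_comp_nilOp (μ : Comp n m) : nilOp R μ ∘ₗ nilOp R μ = nilOp R μ := by
  nth_rw 1 [nilOp]
  rw [LinearMap.comp_assoc, demW_comp_nilOp, nilOp]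

theorem symOp_comp_nilOp (μ : Comp n m) : symOp κ q μ ∘ₗ nilOp R μ = symOp κ q μ := by
  rw [symOp, LinearMap.comp_assoc, demW_comp_nilOp]

/-- The symmetrizing diagram is left cancellable on the image of the nilHecke idempotent. -/
theorem nilOp_eq_of_symOp_eq (hκ : κ ≠ 0) (σ : Scale κ m) {μ : Comp n m} {F G : Laurent R m}
    (h : symOp κ q μ F = symOp κ q μ G) : nilOp R μ F = nilOp R μ G := by
  have : demW R μ.longest F = demW R μ.longest G := mul_left_cancel₀ (spread_ne_zero hκ σ μ) h
  exact congrArg (stair R μ * ·) this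

variable {γ : R} (hγ : γ * eig₁ κ q = -1)

include hγ in
theorem isUnit_gamma : IsUnit γ :=
  isUnit_iff_exists_inv.2 ⟨-eig₁ κ q, by rw [mul_neg, hγ, neg_neg]⟩

include hγ in
theorem hrep_gammaSym_comp_nilOp (hκ : κ ≠ 0) (hq : IsUnit q) (σ : Scale κ m) (μ : Comp n m) :
    hrep κ m q (gammaSym q γ μ) ∘ₗ nilOp R μ = hrep κ m q (gammaSym q γ μ) := by
  rw [hrep_gammaSym hκ hq σ hγ, LinearMap.smul_comp, symOp_comp_nilOp]

include hγ in
theorem nilOp_eq_of_hrep_gammaSym_eq (hκ : κ ≠ 0) (hq : IsUnit q) (σ : Scale κ m) {μ : Comp n m}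
    {F G : Laurent R m}
    (h : hrep κ m q (gammaSym q γ μ) F = hrep κ m q (gammaSym q γ μ) G) :
    nilOp R μ F = nilOp R μ G := by
  rw [hrep_gammaSym hκ hq σ hγ] at h
  have h1 := ((isUnit_gamma hγ).pow (inv μ.longest)).ne_zero
  exact nilOp_eq_of_symOp_eq hκ σ (smul_right_injective _ h1 h)

include hγ in
/-- Diagrams between clusters give elements of the modules generated by the quasi-idempotents. -/
theorem exists_hecke_of_ops (hκ : κ ≠ 0) (hq : IsUnit q) (σ : Scale κ m) {μ ν : Comp n m}
    {T : Laurent R m →ₗ[R] Laurent R m} (hT : T ∈ Ops q (cluster σ ν) (cluster σ μ))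
    (hT' : T ∘ₗ nilOp R ν = T) :
    ∃ h, hrep κ m q (h * gammaSym q γ ν) = hrep κ m q (gammaSym q γ μ) ∘ₗ T := by
  have h1 : (symOp κ q μ ∘ₗ T) ∘ₗ mulOp (stair R ν) ∈ Ops q (cluster σ ν) (farConfig hκ m) :=
    ops_comp (ops_comp (opsLt_le (min_symOp hκ σ μ).mem) hT) (opsLt_le (mulOp_mem _ _))
  obtain ⟨h, hh⟩ := exists_comp_symOp hκ hq σ h1
  obtain ⟨γ', hγ'⟩ := ((isUnit_gamma hγ).pow (inv ν.longest)).exists_right_inv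
  refine ⟨(γ ^ inv μ.longest * γ') • h, ?_⟩
  rw [map_mul, map_smul, hrep_gammaSym hκ hq σ hγ, hrep_gammaSym hκ hq σ hγ, LinearMap.smul_comp]
  rw [LinearMap.comp_assoc, ← nilOp, LinearMap.comp_assoc, hT'] at hh
  rw [hh, smul_mul_assoc, mul_smul_comm, smul_smul, mul_assoc, mul_comm γ', hγ', mul_one]
  rfl

include hγ in
/-- Elements of the modules generated by the quasi-idempotents which are eigenvectors come from
diagrams between clusters. -/
theorem exists_ops_of_hecke (hκ : κ ≠ 0) (hq : IsUnit q) (σ : Scale κ m) {μ ν : Comp n m}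
    {g : Hecke R m q} (hg : ∀ a, μ.Inner a →
      heckeT R q a * (g * gammaSym q γ ν) = eig₂ κ q • (g * gammaSym q γ ν)) :
    ∃ A ∈ Ops q (cluster σ ν) (cluster σ μ),
      hrep κ m q (gammaSym q γ μ) ∘ₗ nilOp R μ ∘ₗ A ∘ₗ nilOp R ν =
        hrep κ m q (g * gammaSym q γ ν) := by
  have hE := eigen_of_hecke_mul hg
  have e : hrep κ m q (g * gammaSym q γ ν) =
      γ ^ inv ν.longest • (hrep κ m q g ∘ₗ symOp κ q ν) := by
    rw [map_mul, hrep_gammaSym hκ hq σ hγ, mul_smul_comm]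
    rfl
  have hmem : hrep κ m q (g * gammaSym q γ ν) ∈ Ops q (cluster σ ν) (farConfig hκ m) := by
    rw [e]
    exact Submodule.smul_mem _ _ (ops_comp ((mem_ops_far_iff hκ hq).2 ⟨g, rfl⟩)
      (opsLt_le (min_symOp hκ σ ν).mem))
  obtain ⟨k, hk⟩ := exists_opsLt hmem
  obtain ⟨A, hA, hA', -⟩ := hE.exists_factor hκ hq σ hk
  obtain ⟨γ', hγ'⟩ := ((isUnit_gamma hγ).pow (inv μ.longest)).exists_right_inv
  refine ⟨γ' • A, Submodule.smul_mem _ _ hA, ?_⟩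
  rw [← LinearMap.comp_assoc, hrep_gammaSym_comp_nilOp hγ hκ hq σ, hrep_gammaSym hκ hq σ hγ,
    LinearMap.smul_comp, LinearMap.smul_comp, LinearMap.comp_smul, smul_smul, hγ', one_smul,
    ← LinearMap.comp_assoc, ← hA', e, LinearMap.smul_comp, LinearMap.comp_assoc, symOp_comp_nilOp]

end QuasiIdempotents

/-! ### Endomorphisms of sums of cyclic modules -/

section EndSums

variable {R H ι : Type*} [CommRing R] [Ring H] [Algebra R H] [Fintype ι] [DecidableEq ι] {ε : ι → H}

theorem EndSum.entry_mem (φ : EndSum ε) (k k' : ι) :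
    ∃ g, g * ε k' = φ.entry k k' := by
  have := (MulOpposite.unop φ (Pi.single k ⟨ε k, Submodule.mem_span_singleton_self _⟩) k').2
  exact Submodule.mem_span_singleton.1 this

theorem EndSum.entry_add (φ ψ : EndSum ε) (k k' : ι) :
    (φ + ψ).entry k k' = φ.entry k k' + ψ.entry k k' := rfl

theorem EndSum.entry_zero (k k' : ι) : (0 : EndSum ε).entry k k' = 0 := rfl

theorem EndSum.entry_smul (c : R) (φ : EndSum ε) (k k' : ι) :
    (c • φ).entry k k' = c • φ.entry k k' := rfl

theorem EndSum.ext_entry {φ ψ : EndSum ε} (h : ∀ k k', φ.entry k k' = ψ.entry k k') : φ = ψ := by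
  refine MulOpposite.unop_injective (LinearMap.pi_ext fun k x => ?_)
  obtain ⟨x, hx⟩ := x
  obtain ⟨a, rfl⟩ := Submodule.mem_span_singleton.1 hx
  have e : (⟨a • ε k, hx⟩ : Submodule.span H {ε k}) =
      a • ⟨ε k, Submodule.mem_span_singleton_self _⟩ := rfl
  rw [e, Pi.single_smul, map_smul, map_smul]
  congr 1
  funext k'
  exact Subtype.ext (h k k')

theorem EndSum.entry_mul (φ ψ : EndSum ε) {k : ι} {g : ι → H} (hg : ∀ l, g l * ε l = φ.entry k l)
    (k' : ι) : (φ * ψ).entry k k' = ∑ l, g l * ψ.entry l k' := by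
  have e : MulOpposite.unop φ (Pi.single k ⟨ε k, Submodule.mem_span_singleton_self _⟩) =
      ∑ l, g l • Pi.single l ⟨ε l, Submodule.mem_span_singleton_self _⟩ := by
    funext l
    rw [Finset.sum_apply, Finset.sum_eq_single l]
    · rw [Pi.smul_apply, Pi.single_eq_same]
      exact Subtype.ext (hg l).symm
    · intro l' _ hl
      rw [Pi.smul_apply, Pi.single_eq_of_ne hl.symm, smul_zero]
    · simp
  have h1 : (φ * ψ).entry k k' = (MulOpposite.unop ψ (MulOpposite.unop φ
      (Pi.single k ⟨ε k, Submodule.mem_span_singleton_self _⟩)) k' : _) := rfl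
  rw [h1, e, map_sum, Finset.sum_apply, AddSubmonoidClass.coe_finsetSum]
  refine Finset.sum_congr rfl fun l _ => ?_
  rw [map_smul]
  rfl

/-- A matrix whose columns belong to the cyclic modules comes from an endomorphism if its rows are
annihilated by the annihilators of the generators. -/
theorem EndSum.exists_entry {M : ι → ι → H} (hM : ∀ k k', ∃ g, g * ε k' = M k k')
    (hann : ∀ k k' a, a * ε k = 0 → a * M k k' = 0) :
    ∃ φ : EndSum ε, ∀ k k', φ.entry k k' = M k k' := by
  -- `a ε_k` is mapped to `a` times the `k`-th row; this does not depend on the choice of `a`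
  let v (k : ι) : Π k', (Submodule.span H {ε k'} : Submodule H H) := fun k' =>
    ⟨M k k', Submodule.mem_span_singleton.2 (hM k k')⟩
  have hv (k : ι) (a b : H) (h : a • ε k = b • ε k) : a • v k = b • v k := by
    funext k'
    refine Subtype.ext (sub_eq_zero.1 ?_)
    have := hann k k' (a - b) (by rw [sub_mul]; exact sub_eq_zero.2 h)
    rwa [sub_mul] at this
  choose c hc using fun (k : ι) (x : (Submodule.span H {ε k} : Submodule H H)) =>
    Submodule.mem_span_singleton.1 x.2
  let f (k : ι) : (Submodule.span H {ε k} : Submodule H H) →ₗ[H]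
      Π k', (Submodule.span H {ε k'} : Submodule H H) :=
    { toFun x := c k x • v k
      map_add' x y := by
        rw [← add_smul]
        exact hv k _ _ (by rw [add_smul, hc, hc, hc]; rfl)
      map_smul' a x := by
        rw [RingHom.id_apply, smul_smul]
        exact hv k _ _ (by rw [mul_smul, hc, hc]; rfl) }
  refine ⟨MulOpposite.op (∑ k, f k ∘ₗ LinearMap.proj k), fun k k' => ?_⟩
  have h1 : (∑ l, f l ∘ₗ LinearMap.proj l :
      Module.End H (Π k, (Submodule.span H {ε k} : Submodule H H)))
      (Pi.single k ⟨ε k, Submodule.mem_span_singleton_self _⟩) = v k := by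
    rw [LinearMap.sum_apply, Finset.sum_eq_single k]
    · rw [LinearMap.comp_apply, LinearMap.proj_apply, Pi.single_eq_same]
      have := hv k (c k ⟨ε k, Submodule.mem_span_singleton_self _⟩) 1 (by rw [hc, one_smul])
      rwa [one_smul] at this
    · intro l _ hl
      rw [LinearMap.comp_apply, LinearMap.proj_apply, Pi.single_eq_of_ne hl, map_zero]
    · simp
  exact congrArg Subtype.val (congrFun h1 k')

/-- The relations of the generators hold for the entries. -/
theorem EndSum.mul_entry_eq (φ : EndSum ε) {k : ι} {a b : H} (h : a * ε k = b * ε k) (k' : ι) :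
    a * φ.entry k k' = b * φ.entry k k' := by
  have h1 (a : H) : a * φ.entry k k' = (MulOpposite.unop φ
      (Pi.single k (a • ⟨ε k, Submodule.mem_span_singleton_self _⟩)) k' : _) := by
    rw [Pi.single_smul, map_smul]
    rfl
  have h2 : a • (⟨ε k, Submodule.mem_span_singleton_self _⟩ : (Submodule.span H {ε k} :
      Submodule H H)) = b • ⟨ε k, Submodule.mem_span_singleton_self _⟩ := Subtype.ext h
  rw [h1, h1, h2]

end EndSums

/-! ### The matrix entries of the algebra of clustered diagrams -/

section Entries

variable {R : Type*} [CommRing R] [IsDomain R] {κ : ℝ} {m n : ℕ} {q : R} {σ : Scale κ m}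

theorem card_block (μ : Comp n m) (j : Fin n) :
    (Finset.univ.filter fun t => (μ.coord t).1 = j).card = μ.1 j := by
  rw [← Fintype.card_fin (μ.1 j), ← Finset.card_univ]
  symm
  refine Finset.card_bij (fun i _ => μ.coord.symm ⟨j, i⟩) (fun i _ => ?_) (fun i _ i' _ e => ?_)
    (fun t ht => ?_)
  · simp
  · simpa using μ.coord.symm.injective e
  · rw [Finset.mem_filter] at ht
    obtain ⟨-, rfl⟩ := ht
    exact ⟨_, Finset.mem_univ _, μ.coord.symm_apply_apply t⟩

theorem block_le_of_pos (σ : Scale κ m) (μ ν : Comp n m) {t : Fin m}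
    (h : clusterPos σ μ t = clusterPos σ ν t) : (μ.coord t).1 ≤ (ν.coord t).1 := by
  by_contra hlt
  obtain ⟨_, h2, _⟩ := σ.offset_lt μ t
  obtain ⟨h3, _, h5⟩ := σ.offset_lt ν t
  have h6 : (((ν.coord t).1 : ℕ) : ℝ) + 1 ≤ ((μ.coord t).1 : ℕ) := by
    exact_mod_cast not_le.1 hlt
  have h7 : |κ| < σ.s := by
    have := mul_nonneg (Nat.cast_nonneg (α := ℝ) m) σ.pos.le
    linarith [σ.large]
  have h8 := mul_le_mul_of_nonneg_right h6 ((abs_nonneg κ).trans h7.le)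
  unfold clusterPos at h
  linarith

theorem cluster_injective (σ : Scale κ m) : Function.Injective (cluster σ (n := n)) := by
  intro μ ν h
  have h1 (t : Fin m) : (μ.coord t).1 = (ν.coord t).1 := by
    have h2 : clusterPos σ μ t = clusterPos σ ν t := congrFun (congrArg Config.pos h) t
    exact le_antisymm (block_le_of_pos σ μ ν h2) (block_le_of_pos σ ν μ h2.symm)
  refine Subtype.ext (funext fun j => ?_)
  rw [← card_block μ j, ← card_block ν j]
  simp only [h1]

theorem cluster_mem (σ : Scale κ m) (μ : Comp n m) : cluster σ μ ∈ clusters n σ := ⟨μ, rfl⟩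

variable (q) in
/-- The operator by which a diagram maps the summand of `ν` to the summand of `μ`. -/
abbrev ent (σ : Scale κ m) (μ ν : Comp n m) :
    Diag R κ m q →ₗ[R] (Laurent R m →ₗ[R] Laurent R m) :=
  act q (cluster σ ν) (cluster σ μ)

variable (R q n) in
/-- The sum of the vertical diagrams at the clustered configurations. -/
def clusterUnit (σ : Scale κ m) : Diag R κ m q := ∑ μ : Comp n m, idem R q (cluster σ μ)

theorem clusterUnit_mul_idem (σ : Scale κ m) (μ : Comp n m) :
    clusterUnit R n q σ * idem R q (cluster σ μ) = idem R q (cluster σ μ) := by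
  rw [clusterUnit, Finset.sum_mul, Finset.sum_eq_single μ]
  · exact idem_mul_idem q _
  · exact fun ν _ h => idem_mul_idem_of_ne q fun e => h (cluster_injective σ e)
  · simp

theorem idem_mul_clusterUnit (σ : Scale κ m) (μ : Comp n m) :
    idem R q (cluster σ μ) * clusterUnit R n q σ = idem R q (cluster σ μ) := by
  rw [clusterUnit, Finset.mul_sum, Finset.sum_eq_single μ]
  · exact idem_mul_idem q _
  · exact fun ν _ h => idem_mul_idem_of_ne q fun e => h (cluster_injective σ e).symm
  · simp

theorem clusterUnit_mul {u : Diag R κ m q} (hu : u ∈ waha R q (clusters n σ)) :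
    clusterUnit R n q σ * u = u ∧ u * clusterUnit R n q σ = u := by
  induction hu using NonUnitalAlgebra.adjoin_induction with
  | mem u hu =>
    obtain ⟨_, ⟨μ, rfl⟩, _, ⟨ν, rfl⟩, v, rfl⟩ := hu
    constructor
    · rw [← mul_assoc, ← mul_assoc, clusterUnit_mul_idem]
    · rw [mul_assoc, idem_mul_clusterUnit]
  | add u v _ _ h1 h2 => rw [mul_add, add_mul, h1.1, h1.2, h2.1, h2.2]; exact ⟨rfl, rfl⟩
  | zero => simp
  | mul u v _ _ h1 h2 => rw [← mul_assoc, h1.1, mul_assoc, h2.2]; exact ⟨rfl, rfl⟩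
  | smul c u _ h => rw [mul_smul_comm, smul_mul_assoc, h.1, h.2]; exact ⟨rfl, rfl⟩

theorem ent_mul {u v : Diag R κ m q} (hv : v ∈ waha R q (clusters n σ)) (μ ν : Comp n m) :
    ent q σ μ ν (u * v) = ∑ l : Comp n m, ent q σ μ l u ∘ₗ ent q σ l ν v := by
  conv_lhs => rw [← (clusterUnit_mul hv).1, clusterUnit, Finset.sum_mul, Finset.mul_sum]
  rw [map_sum]
  exact Finset.sum_congr rfl fun l _ => act_mul _ _ _ u v

theorem eq_of_ent (hκ : κ ≠ 0) (hq : IsUnit q) {u v : Diag R κ m q}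
    (hu : u ∈ waha R q (clusters n σ)) (hv : v ∈ waha R q (clusters n σ))
    (h : ∀ μ ν : Comp n m, ent q σ μ ν u = ent q σ μ ν v) : u = v := by
  rw [← sub_eq_zero]
  have hw := sub_mem hu hv
  rw [← (clusterUnit_mul hw).2, ← (clusterUnit_mul hw).1, clusterUnit, Finset.sum_mul,
    Finset.sum_mul]
  refine Finset.sum_eq_zero fun μ _ => ?_
  rw [Finset.mul_sum]
  refine Finset.sum_eq_zero fun ν _ => eq_zero_of_act hκ hq ?_
  rw [map_sub]
  exact sub_eq_zero.2 (h μ ν)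

/-- The entries of a diagram between two given configurations. -/
theorem ent_idem_mul_idem (σ : Scale κ m) (μ ν μ' ν' : Comp n m) (u : Diag R κ m q) :
    ent q σ μ' ν' (idem R q (cluster σ μ) * u * idem R q (cluster σ ν)) =
      if μ' = μ ∧ ν' = ν then ent q σ μ ν u else 0 := by
  split_ifs with h
  · obtain ⟨rfl, rfl⟩ := h
    rw [act_mul_idem, act_idem_mul]
  · rw [not_and_or] at h
    rw [← act_idem_mul, ← act_mul_idem]
    rcases h with h | h
    · rw [← mul_assoc, ← mul_assoc, idem_mul_idem_of_ne q fun e => h (cluster_injective σ e),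
        zero_mul, zero_mul, zero_mul, map_zero]
    · rw [mul_assoc, mul_assoc, mul_assoc,
        idem_mul_idem_of_ne q fun e => h (cluster_injective σ e).symm,
        mul_zero, mul_zero, mul_zero, map_zero]

variable (q) in
/-- The element `u` acts on the summand of `x` by the operator `S`, without leaving it. -/
def ActsBy (x : Config κ m) (u : Diag R κ m q) (S : Laurent R m →ₗ[R] Laurent R m) : Prop :=
  ∀ F, polyAction R κ m q u (Finsupp.single x F) = Finsupp.single x (S F)

theorem ActsBy.act {x : Config κ m} {u : Diag R κ m q} {S : Laurent R m →ₗ[R] Laurent R m}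
    (h : ActsBy q x u S) : act q x x u = S := LinearMap.ext fun F => by
  rw [act_apply, h, Finsupp.single_eq_same]

theorem actsBy_one (x : Config κ m) : ActsBy q x (1 : Diag R κ m q) LinearMap.id := fun F => by
  rw [map_one]
  rfl

theorem ActsBy.mul {x : Config κ m} {u v : Diag R κ m q} {S T : Laurent R m →ₗ[R] Laurent R m}
    (hu : ActsBy q x u S) (hv : ActsBy q x v T) : ActsBy q x (u * v) (S ∘ₗ T) := fun F => by
  rw [map_mul, Module.End.mul_apply, hv, hu, LinearMap.comp_apply]

theorem actsBy_slice {g : Slice κ m} (h : g.top = g.bot) :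
    ActsBy q g.bot (g.toDiag R q) (g.op q) := fun F => by
  rw [polyAction_slice, block, h]
  simp

theorem actsBy_sq_pow (x : Config κ m) (t : Fin m) (k : ℕ) :
    ActsBy q x ((Slice.sq x t).toDiag R q ^ k) (mulOp (Y R t ^ k)) := by
  induction k with
  | zero =>
    rw [pow_zero, pow_zero]
    have e : mulOp (1 : Laurent R m) = LinearMap.id := by ext; simp
    rw [e]
    exact actsBy_one x
  | succ k ih =>
    have h1 : ActsBy q x ((Slice.sq x t).toDiag R q) (mulOp (Y R t)) :=
      actsBy_slice (g := Slice.sq x t) rfl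
    have h2 := ih.mul h1
    rw [← pow_succ] at h2
    have e : mulOp (Y R t ^ (k + 1)) = mulOp (Y R t ^ k) ∘ₗ mulOp (Y R t) := by
      ext; simp [pow_succ, mul_assoc]
    rwa [e]

theorem actsBy_staircase (σ : Scale κ m) (μ : Comp n m) :
    ActsBy q (cluster σ μ) (staircase σ R q μ) (mulOp (stair R μ)) := by
  have key (l : List (Fin m)) (c : Fin m → ℕ) :
      ActsBy q (cluster σ μ) (l.map fun t => (Slice.sq (cluster σ μ) t).toDiag R q ^ c t).prod
        (mulOp (l.map fun t => Y R t ^ c t).prod) := by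
    induction l with
    | nil =>
      have e : mulOp ([].map fun t => Y R t ^ c t).prod = LinearMap.id := by ext; simp
      rw [e]
      exact actsBy_one _
    | cons t l ih =>
      have h := (actsBy_sq_pow (q := q) (cluster σ μ) t (c t)).mul ih
      rw [List.map_cons, List.prod_cons, List.map_cons, List.prod_cons]
      convert h using 1
      ext; simp [mul_assoc]
  have h := key (List.finRange m) (code μ.longest)
  rw [staircase, List.ofFn_eq_map]
  have e : stair R μ = ((List.finRange m).map fun t => Y R t ^ code μ.longest t).prod := by
    rw [stair, monom, ← List.ofFn_eq_map, List.prod_ofFn]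
  rw [e]
  convert h using 5
  rw [code_longest]

theorem actsBy_crossAt (σ : Scale κ m) {μ : Comp n m} {w : Equiv.Perm (Fin m)} (hw : w ∈ μ.young) :
    ActsBy q (cluster σ μ) ((redWord w).map (crossAt R q (cluster σ μ))).prod (demW R w) := by
  have key (l : List (Adj m)) (hl : ∀ a ∈ l, μ.Inner a) :
      ActsBy q (cluster σ μ) (l.map (crossAt R q (cluster σ μ))).prod
        (l.map fun a => (demazure R a : Module.End R (Laurent R m))).prod := by
    induction l with
    | nil => exact actsBy_one _
    | cons a l ih =>
      rw [List.map_cons, List.prod_cons, List.map_cons, List.prod_cons]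
      have hc := isCross_cluster σ (hl a List.mem_cons_self)
      have h1 : ActsBy q (cluster σ μ) (crossAt R q (cluster σ μ) a) (demazure R a) := by
        rw [crossAt, dif_pos hc]
        exact actsBy_slice (g := Slice.cross a _ _ hc) rfl
      exact h1.mul (ih fun b hb => hl b (List.mem_cons_of_mem _ hb))
  exact key _ (Comp.inner_of_mem_redWord hw)

theorem ent_nilIdem (σ : Scale κ m) (l μ ν : Comp n m) :
    ent q σ μ ν (nilIdem σ R q l).1 = if μ = l ∧ ν = l then nilOp R l else 0 := by
  rw [nilIdem, ent_idem_mul_idem]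
  congr 1
  exact ((actsBy_staircase σ l).mul (actsBy_crossAt σ l.longest_mem)).act

theorem ent_nilIdemSum (σ : Scale κ m) (μ ν : Comp n m) :
    ent q σ μ ν (nilIdemSum n σ R q).1 = if μ = ν then nilOp R μ else 0 := by
  rw [nilIdemSum, AddSubmonoidClass.coe_finsetSum, map_sum]
  simp only [ent_nilIdem]
  split_ifs with h
  · subst h
    rw [Finset.sum_eq_single μ]
    · simp
    · intro l _ hl
      rw [if_neg fun e => hl e.1.symm]
    · simp
  · refine Finset.sum_eq_zero fun l _ => ?_
    rw [if_neg]
    rintro ⟨rfl, rfl⟩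
    exact h rfl

theorem ent_nilIdemSum_mul {u : Diag R κ m q} (hu : u ∈ waha R q (clusters n σ)) (μ ν : Comp n m) :
    ent q σ μ ν ((nilIdemSum n σ R q).1 * u) = nilOp R μ ∘ₗ ent q σ μ ν u := by
  rw [ent_mul hu, Finset.sum_eq_single μ]
  · rw [ent_nilIdemSum, if_pos rfl]
  · intro l _ hl
    rw [ent_nilIdemSum, if_neg hl.symm, LinearMap.zero_comp]
  · simp

theorem ent_mul_nilIdemSum (u : Diag R κ m q) (μ ν : Comp n m) :
    ent q σ μ ν (u * (nilIdemSum n σ R q).1) = ent q σ μ ν u ∘ₗ nilOp R ν := by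
  rw [ent_mul (nilIdemSum n σ R q).2, Finset.sum_eq_single ν]
  · rw [ent_nilIdemSum, if_pos rfl]
  · intro l _ hl
    rw [ent_nilIdemSum, if_neg hl, LinearMap.comp_zero]
  · simp

/-- The nilHecke elements are idempotent because the Demazure operator of the longest element maps
the staircase monomial to `1` and is linear over invariants; diagrams act faithfully. -/
theorem isIdempotentElem_nilIdemSum (hκ : κ ≠ 0) (hq : IsUnit q) (σ : Scale κ m) :
    IsIdempotentElem (nilIdemSum n σ R q) := by
  refine Subtype.ext (eq_of_ent hκ hq (nilIdemSum n σ R q * nilIdemSum n σ R q).2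
    (nilIdemSum n σ R q).2 fun μ ν => ?_)
  have := ent_nilIdemSum_mul (nilIdemSum n σ R q).2 μ ν
  rw [ent_nilIdemSum] at this
  refine this.trans ?_
  rw [ent_nilIdemSum]
  split_ifs with h
  · exact nilOp_comp_nilOp μ
  · exact LinearMap.comp_zero _

theorem ent_truncation {u : waha R q (clusters n σ)}
    (hu : u ∈ truncation R (nilIdemSum n σ R q)) (μ ν : Comp n m) :
    nilOp R μ ∘ₗ ent q σ μ ν u.1 = ent q σ μ ν u.1 ∧ ent q σ μ ν u.1 ∘ₗ nilOp R ν = ent q σ μ ν u.1 := by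
  obtain ⟨v, rfl⟩ := hu
  have : ent q σ μ ν (nilIdemSum n σ R q * v * nilIdemSum n σ R q).1 =
      (nilOp R μ ∘ₗ ent q σ μ ν v.1) ∘ₗ nilOp R ν :=
    (ent_mul_nilIdemSum _ μ ν).trans (by rw [← ent_nilIdemSum_mul v.2]; rfl)
  rw [this]
  constructor
  · rw [← LinearMap.comp_assoc, ← LinearMap.comp_assoc, nilOp_comp_nilOp]
  · rw [LinearMap.comp_assoc, nilOp_comp_nilOp]

/-- Every matrix of operators of diagrams gives an element of the truncated algebra. -/
theorem exists_truncation (σ : Scale κ m) {A : Comp n m → Comp n m → Laurent R m →ₗ[R] Laurent R m}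
    (hA : ∀ μ ν, A μ ν ∈ Ops q (cluster σ ν) (cluster σ μ)) :
    ∃ u : truncation R (nilIdemSum n σ R q), ∀ μ ν,
      ent q σ μ ν u.1.1 = nilOp R μ ∘ₗ A μ ν ∘ₗ nilOp R ν := by
  choose g hg using hA
  let v : waha R q (clusters n σ) := ∑ μ : Comp n m, ∑ ν : Comp n m,
    ⟨idem R q (cluster σ μ) * g μ ν * idem R q (cluster σ ν),
      idem_mul_mem R q (cluster_mem σ μ) (cluster_mem σ ν) _⟩
  refine ⟨⟨nilIdemSum n σ R q * v * nilIdemSum n σ R q, v, rfl⟩, fun μ ν => ?_⟩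
  have h1 : ent q σ μ ν v.1 = A μ ν := by
    simp only [v, AddSubmonoidClass.coe_finsetSum, map_sum, ent_idem_mul_idem]
    rw [Finset.sum_eq_single μ, Finset.sum_eq_single ν]
    · simpa using hg μ ν
    · intro l _ hl
      rw [if_neg fun e => hl e.2.symm]
    · simp
    · intro l _ hl
      exact Finset.sum_eq_zero fun l' _ => by rw [if_neg fun e => hl e.1.symm]
    · simp
  refine (ent_mul_nilIdemSum _ μ ν).trans ?_
  rw [← LinearMap.comp_assoc]
  congr 1
  rw [← h1]
  exact ent_nilIdemSum_mul v.2 μ ν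

end Entries

/-! ### The isomorphism with the affine Schur algebra -/

section Isomorphism

variable {R : Type*} [CommRing R] [IsDomain R] {κ : ℝ} {m n : ℕ} {q : R}

/-- An element of the truncated algebra with the entries `u_{μν}` is mapped to the endomorphism
whose entries act by `ε_μ u_{μν}`. -/
theorem exists_truncation_equiv (hκ : κ ≠ 0) (hq : IsUnit q) (σ : Scale κ m) {γ : R}
    (hγ : γ * eig₁ κ q = -1) {ε : Comp n m → Hecke R m q} (hε : ∀ μ, ε μ = gammaSym q γ μ) :
    ∃ Φ : truncation R (nilIdemSum n σ R q) →ₙₐ[R] EndSum ε, Function.Bijective Φ ∧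
      ∀ u μ ν, hrep κ m q ((Φ u).entry μ ν) = hrep κ m q (ε μ) ∘ₗ ent q σ μ ν u.1.1 := by
  obtain rfl : ε = gammaSym q γ := funext hε
  have hinj := hrep_injective (κ := κ) (m := m) hq
  have hex (u : truncation R (nilIdemSum n σ R q)) : ∃ φ : EndSum (gammaSym q γ (n := n) (m := m)),
      ∀ μ ν, hrep κ m q (φ.entry μ ν) = hrep κ m q (gammaSym q γ μ) ∘ₗ ent q σ μ ν u.1.1 := by
    choose g hg using fun μ ν => exists_hecke_of_ops hγ hκ hq σ ⟨u.1.1, rfl⟩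
      (ent_truncation u.2 μ ν).2
    obtain ⟨φ, hφ⟩ := EndSum.exists_entry (ε := gammaSym q γ (n := n) (m := m))
      (M := fun μ ν => g μ ν * gammaSym q γ ν) (fun μ ν => ⟨_, rfl⟩) fun μ ν a ha => by
        refine hinj ?_
        rw [map_mul, hg, map_zero]
        have := congrArg (hrep κ m q) ha
        rw [map_mul, map_zero] at this
        change (hrep κ m q a ∘ₗ hrep κ m q (gammaSym q γ μ)) ∘ₗ _ = 0
        rw [show hrep κ m q a ∘ₗ hrep κ m q (gammaSym q γ μ) = 0 from this, LinearMap.zero_comp]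
    exact ⟨φ, fun μ ν => by rw [hφ, hg]⟩
  choose Φ hΦ using hex
  have huniq {φ ψ : EndSum (gammaSym q γ (n := n) (m := m))}
      (h : ∀ μ ν, hrep κ m q (φ.entry μ ν) = hrep κ m q (ψ.entry μ ν)) : φ = ψ :=
    EndSum.ext_entry fun μ ν => hinj (h μ ν)
  refine ⟨
    { toFun := Φ
      map_smul' := fun c u => huniq fun μ ν => ?_
      map_zero' := huniq fun μ ν => ?_
      map_add' := fun u v => huniq fun μ ν => ?_
      map_mul' := fun u v => huniq fun μ ν => ?_ }, ⟨fun u v h => ?_, fun φ => ?_⟩, hΦ⟩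
  · rw [hΦ, MonoidHom.id_apply, EndSum.entry_smul, map_smul, hΦ]
    have : ent q σ μ ν (c • u).1.1 = c • ent q σ μ ν u.1.1 := map_smul _ _ _
    rw [this, LinearMap.comp_smul]
  · rw [hΦ, EndSum.entry_zero, map_zero]
    have : ent q σ μ ν (0 : truncation R (nilIdemSum n σ R q)).1.1 = 0 := map_zero _
    rw [this, LinearMap.comp_zero]
  · rw [hΦ, EndSum.entry_add, map_add, hΦ, hΦ]
    have : ent q σ μ ν (u + v).1.1 = ent q σ μ ν u.1.1 + ent q σ μ ν v.1.1 := map_add _ _ _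
    rw [this, LinearMap.comp_add]
  · choose g hg using fun l => (Φ u).entry_mem μ l
    have h1 : ent q σ μ ν (u * v).1.1 = _ := ent_mul v.1.2 μ ν
    have h2 (l : Comp n m) := congrArg (hrep κ m q) (hg l)
    rw [hΦ, h1, EndSum.entry_mul _ _ hg, map_sum]
    refine LinearMap.ext fun F => ?_
    simp only [LinearMap.comp_apply, LinearMap.sum_apply, map_sum]
    refine Finset.sum_congr rfl fun l _ => ?_
    rw [map_mul, hΦ]
    have h3 := DFunLike.congr_fun ((h2 l).trans (hΦ u μ l)) (ent q σ l ν v.1.1 F)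
    rw [map_mul] at h3
    exact h3.symm
  · refine Subtype.ext (Subtype.ext (eq_of_ent hκ hq u.1.2 v.1.2 fun μ ν => ?_))
    have h1 : hrep κ m q (gammaSym q γ μ) ∘ₗ ent q σ μ ν u.1.1 =
        hrep κ m q (gammaSym q γ μ) ∘ₗ ent q σ μ ν v.1.1 := by
      rw [← hΦ, ← hΦ]
      exact congrArg (fun φ => hrep κ m q (EndSum.entry φ μ ν)) h
    rw [← (ent_truncation u.2 μ ν).1, ← (ent_truncation v.2 μ ν).1]
    refine LinearMap.ext fun F => ?_
    have h2 := DFunLike.congr_fun h1 F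
    rw [LinearMap.comp_apply, LinearMap.comp_apply] at h2 ⊢
    exact nilOp_eq_of_hrep_gammaSym_eq hγ hκ hq σ h2
  · choose g hg using fun μ ν => φ.entry_mem μ ν
    have hT (μ ν : Comp n m) (a : Adj m) (ha : μ.Inner a) :
        heckeT R q a * (g μ ν * gammaSym q γ ν) = eig₂ κ q • (g μ ν * gammaSym q γ ν) := by
      rw [hg, ← one_mul (φ.entry μ ν), ← smul_mul_assoc, one_mul]
      refine φ.mul_entry_eq ?_ ν
      rw [hecke_T_mul_gammaSym eig_add eig_mul hγ ha, smul_mul_assoc, one_mul]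
    choose A hA hA' using fun μ ν => exists_ops_of_hecke hγ hκ hq σ (hT μ ν)
    obtain ⟨u, hu⟩ := exists_truncation σ hA
    refine ⟨u, huniq fun μ ν => ?_⟩
    refine (hΦ u μ ν).trans ?_
    rw [hu, hA', hg]

end Isomorphism

/-! ### The polynomial representation of the affine Hecke algebra -/

section PolynomialRepresentation

variable {R : Type*} [CommRing R] [IsDomain R] {κ : ℝ} {m n : ℕ} {q : R}

variable (R q m) in
/-- The map `F ↦ F(X) 𝟙` from Laurent polynomials. -/
def toHeckePoly : Laurent R m →ₗ[R] HeckePoly R m q where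
  toFun F := Submodule.Quotient.mk (heckeL q F)
  map_add' F G := by rw [map_add]; rfl
  map_smul' c F := by rw [map_smul]; rfl

theorem toHeckePoly_apply (F : Laurent R m) :
    toHeckePoly R m q F = heckeL q F • (Submodule.Quotient.mk 1 : HeckePoly R m q) := by
  rw [← Submodule.Quotient.mk_smul, smul_eq_mul, mul_one]
  rfl

theorem heckeT_smul_one (a : Adj m) :
    heckeT R q a • (Submodule.Quotient.mk 1 : HeckePoly R m q) = -Submodule.Quotient.mk 1 := by
  rw [← Submodule.Quotient.mk_smul, ← Submodule.Quotient.mk_neg, Submodule.Quotient.eq, smul_eq_mul,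
    mul_one, sub_neg_eq_add]
  exact Submodule.subset_span ⟨a, rfl⟩

theorem heckeTw_smul_one (w : Equiv.Perm (Fin m)) : ∃ c : R,
    heckeTw R q w • (Submodule.Quotient.mk 1 : HeckePoly R m q) = c • Submodule.Quotient.mk 1 := by
  rw [heckeTw]
  induction redWord w with
  | nil =>
    refine ⟨1, ?_⟩
    rw [List.map_nil, List.prod_nil, one_smul]
    exact (one_smul R (Submodule.Quotient.mk 1 : HeckePoly R m q)).symm
  | cons a l ih =>
    obtain ⟨c, hc⟩ := ih
    refine ⟨-c, ?_⟩
    rw [List.map_cons, List.prod_cons, mul_smul, hc, smul_comm, heckeT_smul_one]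
    exact (smul_neg c (Submodule.Quotient.mk 1 : HeckePoly R m q)).trans
      (neg_smul c (Submodule.Quotient.mk 1 : HeckePoly R m q)).symm

/-- For `κ < 0` the relations of the generator hold for the constant `1`. -/
theorem hrep_one_of_mem_span (hκ : κ < 0) {h : Hecke R m q}
    (hh : h ∈ Submodule.span (Hecke R m q) (Set.range fun a : Adj m => heckeT R q a + 1)) :
    hrep κ m q h 1 = 0 := by
  induction hh using Submodule.span_induction with
  | mem _ h =>
    obtain ⟨a, rfl⟩ := h
    have e : hrep κ m q (heckeT R q a + 1) = hrep κ m q (heckeT R q a) + 1 := by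
      rw [map_add, map_one (hrep κ m q)]
    change hrep κ m q (heckeT R q a + 1) 1 = 0
    rw [e, heckeRep_T, LinearMap.add_apply, opT_one, eig₁, if_pos hκ, Module.End.one_apply]
    simp
  | zero => rw [map_zero, LinearMap.zero_apply]
  | add x y _ _ h1 h2 => rw [map_add, LinearMap.add_apply, h1, h2, add_zero]
  | smul a x _ h => rw [smul_eq_mul, map_mul, Module.End.mul_apply, h, map_zero]

/-- Both sides are of the form `F(X) 𝟙`, and `F` is recovered by acting on the constant `1` in the
polynomial representation, where `T_r` acts on it by `-1`. -/
theorem mk_eq_toHeckePoly (hκ : κ < 0) (hq : IsUnit q) (h : Hecke R m q) :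
    (Submodule.Quotient.mk h : HeckePoly R m q) = toHeckePoly R m q (hrep κ m q h 1) := by
  have h1 : ∃ F, (Submodule.Quotient.mk h : HeckePoly R m q) = toHeckePoly R m q F := by
    obtain ⟨p, rfl⟩ := hecke_spanning hq h
    choose c hc using heckeTw_smul_one (R := R) (q := q) (m := m)
    refine ⟨∑ w, c w • p w, ?_⟩
    rw [map_sum, ← mul_one (∑ w, _), ← smul_eq_mul, Submodule.Quotient.mk_smul, Finset.sum_smul]
    refine Finset.sum_congr rfl fun w _ => ?_
    rw [mul_smul, hc, map_smul, toHeckePoly_apply, smul_comm]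
  obtain ⟨F, hF⟩ := h1
  rw [hF]
  have h2 := hrep_one_of_mem_span hκ ((Submodule.Quotient.eq _).1 hF)
  rw [map_sub, LinearMap.sub_apply, heckeRep_L, LinearMap.mulLeft_apply, mul_one] at h2
  rw [sub_eq_zero.1 h2]

/-- The polynomial representation is identified with the Laurent polynomials. -/
theorem toHeckePoly_hrep (hκ : κ < 0) (hq : IsUnit q) (h : Hecke R m q) (F : Laurent R m) :
    toHeckePoly R m q (hrep κ m q h F) = h • toHeckePoly R m q F := by
  have e : h • toHeckePoly R m q F = Submodule.Quotient.mk (h * heckeL q F) := rfl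
  rw [e, mk_eq_toHeckePoly hκ hq, map_mul, Module.End.mul_apply, heckeRep_L, LinearMap.mulLeft_apply,
    mul_one]

theorem toHeckePoly_injective (hκ : κ < 0) : Function.Injective (toHeckePoly R m q) := by
  rw [injective_iff_map_eq_zero]
  intro F hF
  have h1 : heckeL q F ∈ Submodule.span (Hecke R m q)
      (Set.range fun a : Adj m => heckeT R q a + 1) := (Submodule.Quotient.mk_eq_zero _).1 hF
  have h2 := hrep_one_of_mem_span hκ h1
  rwa [heckeRep_L, LinearMap.mulLeft_apply, mul_one] at h2

theorem toHeckePoly_surjective (hκ : κ < 0) (hq : IsUnit q) :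
    Function.Surjective (toHeckePoly R m q) := fun p => by
  obtain ⟨h, rfl⟩ := Submodule.Quotient.mk_surjective _ p
  exact ⟨_, (mk_eq_toHeckePoly hκ hq h).symm⟩

/-- The action of an element of the algebra of clustered diagrams in terms of its entries. -/
theorem polyAction_cluster {σ : Scale κ m} (u : Diag R κ m q) {v : PolyRep R κ m}
    (hv : v ∈ polyOn R (clusters n σ)) (μ : Comp n m) :
    polyAction R κ m q u v (cluster σ μ) = ∑ ν, ent q σ μ ν u (v (cluster σ ν)) := by
  have h1 : v = ∑ ν : Comp n m, Finsupp.single (cluster σ ν) (v (cluster σ ν)) := by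
    ext x
    rw [Finsupp.finsetSum_apply]
    by_cases hx : x ∈ clusters n σ
    · obtain ⟨l, rfl⟩ := hx
      rw [Finset.sum_eq_single l]
      · simp
      · intro l' _ h
        rw [Finsupp.single_eq_of_ne]
        exact fun e => h (cluster_injective σ e).symm
      · simp
    · have h2 : v x = 0 := by
        by_contra h
        exact hx (hv (Finsupp.mem_support_iff.2 h))
      rw [h2, Finset.sum_eq_zero fun l _ => ?_]
      rw [Finsupp.single_eq_of_ne]
      rintro rfl
      exact hx ⟨l, rfl⟩
  conv_lhs => rw [h1]
  rw [map_sum, Finsupp.finsetSum_apply]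
  rfl

theorem polyTrunc_apply {σ : Scale κ m} (v : polyTrunc (nilIdemSum n σ R q)) (μ : Comp n m) :
    nilOp R μ (v.1 (cluster σ μ)) = v.1 (cluster σ μ) := by
  obtain ⟨_, v, hv, rfl⟩ := v
  have : polyAction R κ m q (nilIdemSum n σ R q).1 v (cluster σ μ) = nilOp R μ (v (cluster σ μ)) := by
    rw [polyAction_cluster _ hv, Finset.sum_eq_single μ]
    · rw [ent_nilIdemSum, if_pos rfl]
    · intro l _ hl
      rw [ent_nilIdemSum, if_neg hl.symm, LinearMap.zero_apply]
    · simp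
  dsimp only
  rw [this, ← LinearMap.comp_apply, nilOp_comp_nilOp]

theorem polyTrunc_le {σ : Scale κ m} (v : polyTrunc (nilIdemSum n σ R q)) :
    v.1 ∈ polyOn R (clusters n σ) := by
  obtain ⟨_, v, hv, rfl⟩ := v
  exact waha_maps (nilIdemSum n σ R q).2 v

theorem exists_polyTrunc (σ : Scale κ m) (F : Comp n m → Laurent R m) :
    ∃ v : polyTrunc (nilIdemSum n σ R q), ∀ μ, v.1 (cluster σ μ) = nilOp R μ (F μ) := by
  let v : PolyRep R κ m := ∑ ν : Comp n m, Finsupp.single (cluster σ ν) (F ν)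
  have hv : v ∈ polyOn R (clusters n σ) :=
    sum_mem fun ν _ => Finsupp.single_mem_supported R _ (cluster_mem σ ν)
  have h1 (μ : Comp n m) : v (cluster σ μ) = F μ := by
    rw [Finsupp.finsetSum_apply, Finset.sum_eq_single μ]
    · simp
    · intro l' _ h
      rw [Finsupp.single_eq_of_ne]
      exact fun e => h (cluster_injective σ e).symm
    · simp
  refine ⟨⟨_, v, hv, rfl⟩, fun μ => ?_⟩
  dsimp only
  rw [polyAction_cluster _ hv, Finset.sum_eq_single μ]
  · rw [ent_nilIdemSum, if_pos rfl, h1]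
  · intro l _ hl
    rw [ent_nilIdemSum, if_neg hl.symm, LinearMap.zero_apply]
  · simp

/-- A vector with the components `v_μ` is mapped to the vector with the components `ε_μ v_μ`. -/
theorem exists_polyTrunc_equiv (hκ : κ < 0) (hq : IsUnit q) (σ : Scale κ m)
    (hε : ∀ μ : Comp n m, symmetrizer R q μ = gammaSym q 1 μ) :
    ∃ Ψ : polyTrunc (nilIdemSum n σ R q) ≃ₗ[R] SchurPoly R m q n, ∀ v μ,
      (Ψ v μ : HeckePoly R m q) = symmetrizer R q μ • toHeckePoly R m q (v.1 (cluster σ μ)) := by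
  have hγ : (1 : R) * eig₁ κ q = -1 := by rw [one_mul, eig₁, if_pos hκ]
  let f : polyTrunc (nilIdemSum n σ R q) →ₗ[R] SchurPoly R m q n :=
    { toFun := fun v μ => ⟨symmetrizer R q μ • toHeckePoly R m q (v.1 (cluster σ μ)), _, rfl⟩
      map_add' := fun v w => funext fun μ => Subtype.ext (by
        change symmetrizer R q μ • toHeckePoly R m q (v.1 (cluster σ μ) + w.1 (cluster σ μ)) = _
        rw [map_add, smul_add]
        rfl)
      map_smul' := fun c v => funext fun μ => Subtype.ext (by
        change symmetrizer R q μ • toHeckePoly R m q (c • v.1 (cluster σ μ)) = _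
        rw [map_smul, smul_comm]
        rfl) }
  have hf (v) (μ : Comp n m) : (f v μ : HeckePoly R m q) =
      toHeckePoly R m q (hrep κ m q (gammaSym q 1 μ) (v.1 (cluster σ μ))) := by
    rw [toHeckePoly_hrep hκ hq, ← hε]
    rfl
  refine ⟨LinearEquiv.ofBijective f ⟨fun v w h => ?_, fun w => ?_⟩, fun v μ => rfl⟩
  · refine Subtype.ext (Finsupp.ext fun x => ?_)
    by_cases hx : x ∈ clusters n σ
    · obtain ⟨μ, rfl⟩ := hx
      rw [← polyTrunc_apply v, ← polyTrunc_apply w]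
      refine nilOp_eq_of_hrep_gammaSym_eq hγ hκ.ne hq σ (toHeckePoly_injective (q := q) hκ ?_)
      rw [← hf, ← hf, h]
    · have h2 (v : polyTrunc (nilIdemSum n σ R q)) : v.1 x = 0 := by
        by_contra h
        exact hx (polyTrunc_le v (Finsupp.mem_support_iff.2 h))
      rw [h2, h2]
  · choose p hp using fun μ => (w μ).2
    choose F hF using fun μ => toHeckePoly_surjective hκ hq (p μ)
    obtain ⟨v, hv⟩ := exists_polyTrunc (q := q) σ F
    refine ⟨v, funext fun μ => Subtype.ext ?_⟩
    have e := DFunLike.congr_fun (hrep_gammaSym_comp_nilOp hγ hκ.ne hq σ μ) (F μ)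
    rw [LinearMap.comp_apply] at e
    rw [hf, hv, e, toHeckePoly_hrep hκ hq, hF, ← hp μ, ← hε]
    rfl

theorem symmetrizer_eq (μ : Comp n m) : symmetrizer R q μ = gammaSym q 1 μ := by
  simp only [symmetrizer, gammaSym, one_pow, one_smul]

/-- The truncated algebra is the affine Schur algebra, compatibly with the polynomial
representations. -/
theorem exists_schur_equiv (hκ : κ < 0) (hq : IsUnit q) (σ : Scale κ m) :
    ∃ Φ : truncation R (nilIdemSum n σ R q) →ₙₐ[R] Schur R m q n, Function.Bijective Φ ∧
      ∃ Ψ : polyTrunc (nilIdemSum n σ R q) ≃ₗ[R] SchurPoly R m q n,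
        ∀ u v, IsSchurAction (Φ u) (Ψ v) (Ψ (truncAct u v)) := by
  have hγ : (1 : R) * eig₁ κ q = -1 := by rw [one_mul, eig₁, if_pos hκ]
  obtain ⟨Φ, hΦ, hΦ'⟩ := exists_truncation_equiv (n := n) hκ.ne hq σ hγ symmetrizer_eq
  obtain ⟨Ψ, hΨ⟩ := exists_polyTrunc_equiv (n := n) hκ hq σ symmetrizer_eq
  refine ⟨Φ, hΦ, Ψ, fun u v p hp μ => ?_⟩
  choose F hF using fun μ => toHeckePoly_surjective hκ hq (p μ)
  have h1 (ν : Comp n m) : nilOp R ν (v.1 (cluster σ ν)) = nilOp R ν (F ν) := by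
    refine nilOp_eq_of_hrep_gammaSym_eq hγ hκ.ne hq σ (toHeckePoly_injective (q := q) hκ ?_)
    rw [toHeckePoly_hrep hκ hq, toHeckePoly_hrep hκ hq, ← symmetrizer_eq, hF, ← hΨ, hp]
  have h2 (ν : Comp n m) : ent q σ μ ν u.1.1 (v.1 (cluster σ ν)) = ent q σ μ ν u.1.1 (F ν) := by
    rw [← (ent_truncation u.2 μ ν).2, LinearMap.comp_apply, h1, LinearMap.comp_apply]
  have h3 : (truncAct u v).1 (cluster σ μ) = ∑ ν, ent q σ μ ν u.1.1 (F ν) := by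
    refine (polyAction_cluster u.1.1 (polyTrunc_le v) μ).trans ?_
    exact Finset.sum_congr rfl fun ν _ => h2 ν
  rw [hΨ, h3, ← toHeckePoly_hrep hκ hq, map_sum, map_sum]
  refine Finset.sum_congr rfl fun ν _ => ?_
  rw [← hF, ← toHeckePoly_hrep hκ hq, hΦ', LinearMap.comp_apply]

end PolynomialRepresentation

end WAHA

end

theorem mainTheorem6 {𝕜 : Type*} [Field 𝕜] (q : 𝕜) (hq0 : q ≠ 0) (hq1 : q ≠ 1)
    (d : 𝕜⟦X⟧) (hd : PowerSeries.constantCoeff d = 1)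
    (Q : 𝕜⟦X⟧) (hQ : Q = PowerSeries.C q * d)
    (n m : ℕ) (κ : ℝ) (σ : WAHA.Scale κ m) :
    IsIdempotentElem (WAHA.nilIdemSum n σ 𝕜⟦X⟧ Q) ∧
    (κ < 0 →
      ∃ Φ : WAHA.truncation 𝕜⟦X⟧ (WAHA.nilIdemSum n σ 𝕜⟦X⟧ Q) →ₙₐ[𝕜⟦X⟧]
          WAHA.Schur 𝕜⟦X⟧ m Q n,
        Function.Bijective Φ ∧
        ∃ Ψ : WAHA.polyTrunc (WAHA.nilIdemSum n σ 𝕜⟦X⟧ Q) ≃ₗ[𝕜⟦X⟧]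
            WAHA.SchurPoly 𝕜⟦X⟧ m Q n,
          ∀ u v, WAHA.IsSchurAction (Φ u) (Ψ v) (Ψ (WAHA.truncAct u v))) ∧
    (0 < κ →
      ∃ Φ : WAHA.truncation 𝕜⟦X⟧ (WAHA.nilIdemSum n σ 𝕜⟦X⟧ Q) →ₙₐ[𝕜⟦X⟧]
          WAHA.SignedSchur 𝕜⟦X⟧ m Q n,
        Function.Bijective Φ) := by
  have hQu : IsUnit Q := by
    rw [PowerSeries.isUnit_iff_constantCoeff, hQ, map_mul, hd, PowerSeries.constantCoeff_C, mul_one]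
    exact hq0.isUnit
  have hκ : κ ≠ 0 := by
    rintro rfl
    have h1 := σ.small
    rw [abs_zero] at h1
    exact absurd h1 (mul_nonneg (Nat.cast_nonneg m) σ.pos.le).not_gt
  refine ⟨WAHA.isIdempotentElem_nilIdemSum hκ hQu σ, fun h => WAHA.exists_schur_equiv h hQu σ,
    fun h => ?_⟩
  have hγ : -Ring.inverse Q * WAHA.eig₁ κ Q = -1 := by
    rw [WAHA.eig₁, if_neg h.not_gt, neg_mul, Ring.inverse_mul_cancel Q hQu]
  obtain ⟨Φ, hΦ, -⟩ := WAHA.exists_truncation_equiv (n := n) hκ hQu σ hγ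
    (ε := WAHA.antisymmetrizer 𝕜⟦X⟧ Q) fun μ => rfl
  exact ⟨Φ, hΦ⟩
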